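/- **Notation.** Let $q_-\in\mathbb R\setminus\{0\}$, $q_0=|q_-|$, and for $z\in\mathbb C\setminus\{0\}$ put $k(z)=\frac12(z-q_0^2/z)$, $\lambda(z)=\frac12(z+q_0^2/z)$, $\theta(x,t;z)=\lambda(z)\,[x+(4k(z)^2-2q_0^2)t]$, $D_\pm=\{z\neq0:\pm\mathrm{Im}\,\lambda(z)>0\}$, $\Sigma=(\mathbb R\setminus\{0\})\cup\{|z|=q_0\}$, $\Sigma^0=\Sigma\setminus\{\pm iq_0\}$, $\sigma_3=\mathrm{diag}(1,-1)$. For real $q_+$ with $|q_+|=q_0$ consider real classical solutions $q(x,t)$ of the focusing mKdV equation $q_t+6q^2q_x+q_{xxx}=0$ on $\mathbb R^2$ such that, for every $t$, $q(x,t)\to q_\pm$ as $x\to\pm\infty$ and $(1+|x|)(q-q_\pm)\in L^1(\mathbb R^\pm)$. Let $Q=\begin{pmatrix}0&q\\-q&0\end{pmatrix}$. The Lax pair is $\Phi_x=X\Phi$, $\Phi_t=T\Phi$ with $X=ik\sigma_3+Q$ and $T=4k^2X-2ik\sigma_3(Q_x-Q^2)+2Q^3-Q_{xx}$. The Jost solutions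 $\Phi_\pm(x,t;z)$ of $q$ are the simultaneous solutions of both equations with $\Phi_\pm e^{-i\theta\sigma_3}\to\begin{pmatrix}1&iq_\pm/z\\ iq_\pm/z&1\end{pmatrix}$ as $x\to\pm\infty$, for $z\in\Sigma$; the columns $\Phi_{+1},\Phi_{-2}$ are taken, with the same equations and column normalizations, on $D_+\cup\Sigma$, and $\Phi_{-1},\Phi_{+2}$ on $D_-\cup\Sigma$. The scattering matrix $S=(s_{ij})$ is defined by $\Phi_+=\Phi_-S$ on $\Sigma^0$; $s_{11}=\det(\Phi_{+1},\Phi_{-2})/(1+q_0^2/z^2)$ extends to $D_+$ and $s_{22}=\det(\Phi_{-1},\Phi_{+2})/(1+q_0^2/z^2)$ to $D_-$. There are no spectral singularities if $s_{11},s_{22}\ne0$ on $\Sigma^0$; then $\rho=s_{21}/s_{11}$ and $\tilde\rho=s_{12}/s_{22}$. Let $N_1,N_2\ge0$, let $z_1,\dots,z_{N_1}$ be distinct with $\mathrm{Re}\,z_n>0$, $\mathrm{Im}\,z_n>0$, $|z_n|>q_0$, and let $w_1,\dots,w_{N_2}\in(q_0,\infty)$ be distinct. Let $\eta_1,\dots,\eta_{4N_1+2N_2}$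 be the points $z_n,\,-z_n^*,\,-q_0^2/z_n^*,\,q_0^2/z_n$ $(n\le N_1)$ and $iw_m,\,-iq_0^2/w_m$ $(m\le N_2)$, let $\hat\eta_j=-q_0^2/\eta_j$, and let $Z$ be the set of all $\eta_j$ and $\hat\eta_j$. We say that $q$ is a *reflectionless potential with discrete data* $(z_n),(w_m),A[\cdot]$ if its Jost solutions exist, it has no spectral singularities, $\rho=\tilde\rho=0$ on $\Sigma^0$, the zeros of $s_{11}$ in $\{z\in D_+:\mathrm{Re}\,z>0,\mathrm{Im}\,z>0\}$ are exactly the $z_n$ and those in $i(q_0,\infty)$ exactly the $iw_m$, all of these zeros are simple, and $A[\cdot]$ are its residue constants: for each zero $z_0\in D_+$ of $s_{11}$, $A[z_0]=b[z_0]/s_{11}'(z_0)$ with a constant $b[z_0]$ such that $\Phi_{+1}(x,t;z_0)=b[z_0]\Phi_{-2}(x,t;z_0)$ for all $x,t$, and for each zero $z_0\in D_-$ of $s_{22}$, $A[z_0]=b[z_0]/s_{22}'(z_0)$ with $\Phi_{+2}(x,t;z_0)=b[z_0]\Phi_{-1}(x,t;z_0)$ for all $x,t$. Put $$\alpha_n=A[\hat\eta_n]e^{2i\theta(x,t;\hat\eta_n)},\qquad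 \beta_k=-\frac{iq_-}{\eta_k},\qquad G=(g_{kn}),\quad g_{kn}=\frac{\alpha_n}{\eta_k-\hat\eta_n}-\frac{iq_-}{\eta_k}\delta_{kn}.$$ **Theorem.** 1. If $q$ is a reflectionless potential with discrete data $(z_n),(w_m),A[\cdot]$ (and boundary values $q_\pm$, $|q_+|=q_0$), then $q_+=q_-$; for all $\zeta\in Z$ one has $A[\zeta]\ne0$ and $$A[\zeta]=-A[\zeta^*]^*=-A[-\zeta^*]^*=\frac{\zeta^2}{q_0^2}A\!\left[-\frac{q_0^2}{\zeta}\right];\qquad(*)$$ and for all $x,t\in\mathbb R$, $\det G\neq0$ and $$q(x,t)=q_-+i\,\frac{\det\begin{pmatrix}G&\beta\\ \alpha^T&0\end{pmatrix}}{\det G}.\qquad(**)$$ 2. Conversely, the constants $A[z_n]\in\mathbb C\setminus\{0\}$ and $A[iw_m]\in i\mathbb R\setminus\{0\}$ are free parameters: for every choice of them there are non-zero constants $A[\zeta]$, $\zeta\in Z$, with these values that satisfy $(*)$, such that $\det G\ne0$ for all $x,t\in\mathbb R$ and the function $q$ given by $(**)$ is real and is a reflectionless potential with discrete data $(z_n),(w_m),A[\cdot]$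 and $q_+=q_-$. These are the general $N_1$-breather–$N_2$-soliton solutions of the focusing mKdV equation with non-zero boundary conditions. -/

import Mathlib

open Complex Filter Topology MeasureTheory
open scoped Matrix ComplexConjugate

namespace MKdV

noncomputable section

/-! ### The uniformization variable -/

/-- The spectral parameter `k(z) = (z - q₀²/z)/2`. -/
def kk (q₀ : ℝ) (z : ℂ) : ℂ := (z - (q₀ : ℂ) ^ 2 / z) / 2

/-- `λ(z) = (z + q₀²/z)/2`. -/
def lam (q₀ : ℝ) (z : ℂ) : ℂ := (z + (q₀ : ℂ) ^ 2 / z) / 2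

/-- The phase `θ(x,t;z) = λ(z) [x + (4 k(z)² - 2 q₀²) t]`. -/
def theta (q₀ x t : ℝ) (z : ℂ) : ℂ :=
  lam q₀ z * ((x : ℂ) + (4 * kk q₀ z ^ 2 - 2 * (q₀ : ℂ) ^ 2) * (t : ℂ))

/-- `D₊ = {Im λ > 0}`. -/
def DPlus (q₀ : ℝ) : Set ℂ := {z | z ≠ 0 ∧ 0 < (lam q₀ z).im}

/-- `D₋ = {Im λ < 0}`. -/
def DMinus (q₀ : ℝ) : Set ℂ := {z | z ≠ 0 ∧ (lam q₀ z).im < 0}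

/-- The continuous spectrum `Σ = (ℝ \ {0}) ∪ {|z| = q₀}`. -/
def contSpec (q₀ : ℝ) : Set ℂ := {z | z ≠ 0 ∧ (z.im = 0 ∨ ‖z‖ = q₀)}

/-- `Σ⁰ = Σ \ {i q₀, -i q₀}`. -/
def contSpec₀ (q₀ : ℝ) : Set ℂ := contSpec q₀ \ {I * (q₀ : ℂ), -(I * (q₀ : ℂ))}

/-! ### The focusing mKdV equation with non-zero boundary conditions -/

/-- Classical real solutions `q(x,t)` of `q_t + 6 q² q_x + q_xxx = 0`. -/
def IsFocusingSolution (q : ℝ → ℝ → ℝ) : Prop :=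
  (∀ t, ContDiff ℝ 3 (fun x => q x t)) ∧
  (∀ x, Differentiable ℝ (fun t => q x t)) ∧
  ∀ x t, deriv (fun t' => q x t') t + 6 * q x t ^ 2 * deriv (fun x' => q x' t) x
    + iteratedDeriv 3 (fun x' => q x' t) x = 0

/-- For every time `q(x,t) → q_±` as `x → ±∞`, and `(1 + |x|) (q - q_±) ∈ L¹(ℝ^±)`. -/
def HasBoundaryValues (q : ℝ → ℝ → ℝ) (qm qp : ℝ) : Prop :=
  ∀ t, Tendsto (fun x => q x t) atBot (𝓝 qm) ∧ Tendsto (fun x => q x t) atTop (𝓝 qp) ∧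
    IntegrableOn (fun x => (1 + |x|) * (q x t - qm)) (Set.Iic 0) ∧
    IntegrableOn (fun x => (1 + |x|) * (q x t - qp)) (Set.Ici 0)

/-! ### Lax pair, Jost solutions and scattering data -/

/-- The Pauli matrix `σ₃`. -/
def sigma3 : Matrix (Fin 2) (Fin 2) ℂ := !![1, 0; 0, -1]

/-- The matrix `[[0, r], [-r, 0]]`; with `r = q, q_x, q_xx` this is `Q, Q_x, Q_xx`. -/
def potMat (r : ℝ) : Matrix (Fin 2) (Fin 2) ℂ := !![0, (r : ℂ); -(r : ℂ), 0]

/-- `X = i k σ₃ + Q`. -/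
def laxX (q₀ : ℝ) (q : ℝ → ℝ → ℝ) (x t : ℝ) (z : ℂ) : Matrix (Fin 2) (Fin 2) ℂ :=
  (I * kk q₀ z) • sigma3 + potMat (q x t)

/-- `T = 4 k² X - 2 i k σ₃ (Q_x - Q²) + 2 Q³ - Q_xx`. -/
def laxT (q₀ : ℝ) (q : ℝ → ℝ → ℝ) (x t : ℝ) (z : ℂ) : Matrix (Fin 2) (Fin 2) ℂ :=
  (4 * kk q₀ z ^ 2) • laxX q₀ q x t z
    - (2 * I * kk q₀ z) •
        (sigma3 * (potMat (deriv (fun x' => q x' t) x) - potMat (q x t) ^ 2))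
    + (2 : ℂ) • potMat (q x t) ^ 3 - potMat (iteratedDeriv 2 (fun x' => q x' t) x)

/-- The vector function `φ(x,t)` solves both parts `φ_x = X φ`, `φ_t = T φ` of the Lax pair. -/
def SolvesLax (q₀ : ℝ) (q : ℝ → ℝ → ℝ) (z : ℂ) (φ : ℝ → ℝ → Fin 2 → ℂ) : Prop :=
  ∀ x t, HasDerivAt (fun x' => φ x' t) (laxX q₀ q x t z *ᵥ φ x t) x ∧
    HasDerivAt (fun t' => φ x t') (laxT q₀ q x t z *ᵥ φ x t) t

/-- `E_±(z) = I + (i q_± / z) σ₁`, with `r = q_±`. -/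
def bgMat (r : ℝ) (z : ℂ) : Matrix (Fin 2) (Fin 2) ℂ :=
  !![1, I * (r : ℂ) / z; I * (r : ℂ) / z, 1]

/-- `Φ₋, Φ₊` are the Jost solutions of `q`: simultaneous solutions of the Lax pair with
`Φ_± e^{-iθσ₃} → E_±` as `x → ±∞`.  The columns `Φ₊₁, Φ₋₂` are taken on `{Im λ ≥ 0} = D₊ ∪ Σ`
and the columns `Φ₋₁, Φ₊₂` on `{Im λ ≤ 0} = D₋ ∪ Σ`; there each of them is determined by its
differential equation and its normalization, so that off `Σ` it is the analytic extension of
the corresponding column from `Σ`.  (On `Σ` the phase `θ` is real, all four columns occur,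
and the normalization says `Φ_± = E_± e^{iθσ₃} + o(1)`.) -/
def IsJost (q₀ : ℝ) (q : ℝ → ℝ → ℝ) (qm qp : ℝ)
    (Φm Φp : ℝ → ℝ → ℂ → Matrix (Fin 2) (Fin 2) ℂ) : Prop :=
  (∀ z : ℂ, z ≠ 0 → 0 ≤ (lam q₀ z).im →
    SolvesLax q₀ q z (fun x t i => Φp x t z i 0) ∧
    SolvesLax q₀ q z (fun x t i => Φm x t z i 1) ∧
    ∀ t (i : Fin 2),
      Tendsto (fun x => Φp x t z i 0 * exp (-(I * theta q₀ x t z))) atTop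
        (𝓝 (bgMat qp z i 0)) ∧
      Tendsto (fun x => Φm x t z i 1 * exp (I * theta q₀ x t z)) atBot
        (𝓝 (bgMat qm z i 1))) ∧
  (∀ z : ℂ, z ≠ 0 → (lam q₀ z).im ≤ 0 →
    SolvesLax q₀ q z (fun x t i => Φm x t z i 0) ∧
    SolvesLax q₀ q z (fun x t i => Φp x t z i 1) ∧
    ∀ t (i : Fin 2),
      Tendsto (fun x => Φm x t z i 0 * exp (-(I * theta q₀ x t z))) atBot
        (𝓝 (bgMat qm z i 0)) ∧
      Tendsto (fun x => Φp x t z i 1 * exp (I * theta q₀ x t z)) atTop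
        (𝓝 (bgMat qp z i 1)))

/-- `γ_f(z) = det E_±(z) = 1 + q₀²/z²`. -/
def gammaF (q₀ : ℝ) (z : ℂ) : ℂ := 1 + (q₀ : ℂ) ^ 2 / z ^ 2

/-- The Wronskian of column `i` of `A` and column `j` of `B`. -/
def wr (A : Matrix (Fin 2) (Fin 2) ℂ) (i : Fin 2) (B : Matrix (Fin 2) (Fin 2) ℂ) (j : Fin 2) :
    ℂ := A 0 i * B 1 j - A 1 i * B 0 j

/-! The entries of the scattering matrix `S` in `Φ₊ = Φ₋ S`, by Cramer's rule with
`det Φ₋ = γ_f`.  `X` and `T` are traceless, so the Wronskians do not depend on `(x,t)` and may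
be evaluated at `(0,0)`.  These expressions also give the extensions of `s₁₁` to `D₊` and of
`s₂₂` to `D₋`. -/

section coefficients

variable (q₀ : ℝ) (Φm Φp : ℝ → ℝ → ℂ → Matrix (Fin 2) (Fin 2) ℂ)

def s11 (z : ℂ) : ℂ := wr (Φp 0 0 z) 0 (Φm 0 0 z) 1 / gammaF q₀ z

def s22 (z : ℂ) : ℂ := wr (Φm 0 0 z) 0 (Φp 0 0 z) 1 / gammaF q₀ z

def s12 (z : ℂ) : ℂ := wr (Φp 0 0 z) 1 (Φm 0 0 z) 1 / gammaF q₀ z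

def s21 (z : ℂ) : ℂ := wr (Φm 0 0 z) 0 (Φp 0 0 z) 0 / gammaF q₀ z

/-- The reflection coefficient `ρ`. -/
def refl (z : ℂ) : ℂ := s21 q₀ Φm Φp z / s11 q₀ Φm Φp z

/-- The reflection coefficient `ρ̃`. -/
def reflT (z : ℂ) : ℂ := s12 q₀ Φm Φp z / s22 q₀ Φm Φp z

/-- The four coefficients are the entries of the matrix `S` with `Φ₊ = Φ₋ S`. -/
theorem scattering_spec (z : ℂ) (hγ : gammaF q₀ z ≠ 0) (hdet : (Φm 0 0 z).det = gammaF q₀ z) :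
    Φp 0 0 z = Φm 0 0 z *
      !![s11 q₀ Φm Φp z, s12 q₀ Φm Φp z; s21 q₀ Φm Φp z, s22 q₀ Φm Φp z] := by
  rw [Matrix.det_fin_two] at hdet
  ext i j
  fin_cases i <;> fin_cases j <;>
    simp [Matrix.mul_apply, s11, s12, s21, s22, wr] <;> field_simp <;> rw [← hdet] <;> ring

/-- `A[z₀]` for the points `z₀` of the discrete spectrum: `A[z₀] = b[z₀] / s₁₁'(z₀)` with
`Φ₊₁ = b[z₀] Φ₋₂` for zeros `z₀ ∈ D₊` of `s₁₁`, and `A[z₀] = b[z₀] / s₂₂'(z₀)` with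
`Φ₊₂ = b[z₀] Φ₋₁` for zeros `z₀ ∈ D₋` of `s₂₂`. -/
def IsResidueConstant (A : ℂ → ℂ) : Prop :=
  (∀ z ∈ DPlus q₀, s11 q₀ Φm Φp z = 0 →
    ∃ b : ℂ, (∀ x t i, Φp x t z i 0 = b * Φm x t z i 1) ∧
      A z = b / deriv (s11 q₀ Φm Φp) z) ∧
  (∀ z ∈ DMinus q₀, s22 q₀ Φm Φp z = 0 →
    ∃ b : ℂ, (∀ x t i, Φp x t z i 1 = b * Φm x t z i 0) ∧
      A z = b / deriv (s22 q₀ Φm Φp) z)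

end coefficients

/-- `q` is a solution of the focusing mKdV equation with boundary values `q_∓ = qm, qp` which is
a reflectionless potential (`ρ = ρ̃ = 0`, no spectral singularities), for which `s₁₁` has the
zeros `z_n` in the open first quadrant part of `D₊` and the zeros `i w_m` in `i (q₀, ∞)`, all of
them simple, and no other zeros there, and whose residue constants are `A[·]`. -/
def IsReflectionlessPotential (q₀ qm qp : ℝ) {N₁ N₂ : ℕ} (z : Fin N₁ → ℂ) (w : Fin N₂ → ℝ)
    (A : ℂ → ℂ) (q : ℝ → ℝ → ℝ) : Prop :=
  IsFocusingSolution q ∧ HasBoundaryValues q qm qp ∧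
  ∃ Φm Φp : ℝ → ℝ → ℂ → Matrix (Fin 2) (Fin 2) ℂ,
    IsJost q₀ q qm qp Φm Φp ∧
    (∀ ζ ∈ contSpec₀ q₀, s11 q₀ Φm Φp ζ ≠ 0 ∧ s22 q₀ Φm Φp ζ ≠ 0) ∧
    (∀ ζ ∈ contSpec₀ q₀, refl q₀ Φm Φp ζ = 0 ∧ reflT q₀ Φm Φp ζ = 0) ∧
    {ζ : ℂ | ζ ∈ DPlus q₀ ∧ 0 < ζ.re ∧ 0 < ζ.im ∧ s11 q₀ Φm Φp ζ = 0} = Set.range z ∧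
    {v : ℝ | q₀ < v ∧ s11 q₀ Φm Φp (I * (v : ℂ)) = 0} = Set.range w ∧
    (∀ n, deriv (s11 q₀ Φm Φp) (z n) ≠ 0) ∧
    (∀ m, deriv (s11 q₀ Φm Φp) (I * (w m : ℂ)) ≠ 0) ∧
    IsResidueConstant q₀ Φm Φp A

/-! ### The determinant formula -/

/-- Labels of the `4 N₁ + 2 N₂` points `η_n`. -/
abbrev PoleIdx (N₁ N₂ : ℕ) : Type := (Fin 4 × Fin N₁) ⊕ (Fin 2 × Fin N₂)

section formula

variable (q₀ qm : ℝ) {N₁ N₂ : ℕ} (z : Fin N₁ → ℂ) (w : Fin N₂ → ℝ) (A : ℂ → ℂ)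

/-- The points `η`: `z_n, -z_n*, -q₀²/z_n*, q₀²/z_n` and `i w_m, -i q₀²/w_m`. -/
def eta : PoleIdx N₁ N₂ → ℂ
  | Sum.inl (a, n) =>
      ![z n, -conj (z n), -((q₀ : ℂ) ^ 2 / conj (z n)), (q₀ : ℂ) ^ 2 / z n] a
  | Sum.inr (a, m) => ![I * (w m : ℂ), -(I * (q₀ : ℂ) ^ 2 / (w m : ℂ))] a

/-- `η̂ = -q₀²/η`. -/
def etaHat (j : PoleIdx N₁ N₂) : ℂ := -((q₀ : ℂ) ^ 2 / eta q₀ z w j)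

/-- The discrete spectrum `Z`: all points `η` and `η̂`, that is, the points
`±z_n, ±z_n*, ±q₀²/z_n, ±q₀²/z_n*, ±i w_m, ±i q₀²/w_m`. -/
def discSpec : Set ℂ := Set.range (eta q₀ z w) ∪ Set.range (etaHat q₀ z w)

/-- `A[·]` has no zeros on `Z`, and `A[ζ] = -A[ζ*]* = -A[-ζ*]* = (ζ²/q₀²) A[-q₀²/ζ]` for all
`ζ ∈ Z`. -/
def IsAdmissible : Prop :=
  ∀ ζ ∈ discSpec q₀ z w, A ζ ≠ 0 ∧ A ζ = -conj (A (conj ζ)) ∧ A ζ = -conj (A (-conj ζ)) ∧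
    A ζ = ζ ^ 2 / (q₀ : ℂ) ^ 2 * A (-((q₀ : ℂ) ^ 2 / ζ))

/-- `α_n = A[η̂_n] e^{2iθ(x,t;η̂_n)}`. -/
def alphaVec (x t : ℝ) (n : PoleIdx N₁ N₂) : ℂ :=
  A (etaHat q₀ z w n) * exp (2 * I * theta q₀ x t (etaHat q₀ z w n))

/-- `β_k = -i q₋/η_k`. -/
def betaVec (k : PoleIdx N₁ N₂) : ℂ := -(I * (qm : ℂ) / eta q₀ z w k)

/-- `g_{kn} = α_n / (η_k - η̂_n) - (i q₋/η_k) δ_{kn}`. -/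
def gMat (x t : ℝ) : Matrix (PoleIdx N₁ N₂) (PoleIdx N₁ N₂) ℂ :=
  Matrix.of fun k n =>
    alphaVec q₀ z w A x t n / (eta q₀ z w k - etaHat q₀ z w n)
      - if k = n then I * (qm : ℂ) / eta q₀ z w k else 0

/-- The bordered matrix `[[G, β], [αᵀ, 0]]`. -/
def borderedMat (x t : ℝ) : Matrix (PoleIdx N₁ N₂ ⊕ Unit) (PoleIdx N₁ N₂ ⊕ Unit) ℂ :=
  Matrix.fromBlocks (gMat q₀ qm z w A x t) (Matrix.of fun k _ => betaVec q₀ qm z w k)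
    (Matrix.of fun _ n => alphaVec q₀ z w A x t n) 0

end formula

end

end MKdV

/-! Both halves of the theorem rest on one rational interpolation problem. After removal of the
phase, the first entry of the second column of `Φ₋` is, for a reflectionless potential, `f(z) =
iq₋/z + Σ c_n/(z - η̂_n)` with the residue conditions `c_n = κ_n f(η_n)`, where `κ_n = α_n
η_n/(iq₋)`. The homogeneous problem, without the term `iq₋/z`, has only the zero solution
(`PoleSys.eq_zero_of_residue`): if `g(z) = (iq₋/z) f(-q₀²/z)`, the symmetries of `κ` cancel all
residues of `f(z) f(z*)* + g(z) g(z*)*`, so this function vanishes by Liouville's theorem, while on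
the real axis it is `|f|² + |g|²`. Hence the linear system for the values `f(η_n)` is solvable for
all real `x, t`. Its matrix is `G` up to sign and a diagonal factor (`gMat_eq`), so `det G ≠ 0`, and
a Schur complement identifies the determinant formula with `q₋ - i Σ c_n` (`determinant_formula`).

Existence. The solution `f` and its partner `g(z) = -(iq₋/z) f(q₀²/z)` satisfy the Lax pair because
the error in each equation is again a solution of the homogeneous interpolation problem
(`RatData.dx_c_eq`, `RatData.defRes_eq_zero`); equality of mixed derivatives then gives mKdV
(`RatData.mkdv`). As `x → -∞` all `κ_n` tend to `0`. As `x → ∞` they tend to infinity, the system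
degenerates to a Cauchy system, and the limit of `(f, g)` has its zeros at the `η_n` and its poles
at the `η̂_n`. Multiplication by the Blaschke product `Π (z - η̂_n)/(z - η_n)` therefore turns the
column of `Φ₋` into that of `Φ₊`: `s₂₂` is this product, the two columns are proportional, and both
reflection coefficients vanish. The value `1` of the product at `z = 0` gives `q₊ = q₋`.

Uniqueness. For an arbitrary reflectionless potential the Jost columns solve a Volterra equation
(`JostLeft.volterra`). Its Picard iteration gives uniqueness, continuity up to `Σ` and holomorphy in
`D₊`; one integration by parts gives the limit at `z = ∞` (`JostLeft.tendsto_cobounded`). Uniqueness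
of the columns yields all symmetries, hence `(*)`. Vanishing reflection says that the column of `Φ₋`
on `D₊` and the column of `Φ₊` divided by `s₂₂` on `D₋` have equal boundary values on `Σ⁰`. Morera's
theorem in the coordinate `λ`, which straightens `Σ`, makes the glued function holomorphic across
`Σ` except at `±q₀`, where `λ' = 0`, and at `±iq₀`, where `1 + q₀²/z²` vanishes and nothing is known
about `s₁₁`. The former are removable by continuity. At the latter the Wronskian factors through an
analytic function (`wronskian_factor`), so the glued function is meromorphic, and its boundedness
from one side excludes a pole. Liouville's theorem gives the partial fractions above
(`RHData.fst_eq`); uniqueness of the interpolation identifies the first entry with the constructed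
`f`, and comparison of the `x`-derivatives as `z → ∞` identifies the potentials
(`eq_q_of_reflectionless`). -/

open Bornology

set_option linter.unusedSectionVars false

namespace MKdV

/-! ### Complex analysis -/

/-- Liouville's theorem for a function with finitely many removable singularities. -/
theorem eq_of_removable_of_tendsto (S : Finset ℂ) : ∀ (F : ℂ → ℂ) (l : ℂ),
    DifferentiableOn ℂ F (↑S : Set ℂ)ᶜ →
    (∀ s ∈ S, Tendsto (fun z => (z - s) * F z) (𝓝[≠] s) (𝓝 0)) →
    Tendsto F (cocompact ℂ) (𝓝 l) → ∀ z ∉ S, F z = l := by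
  classical
  induction S using Finset.induction_on with
  | empty =>
    intro F l hd _ hl z _
    have : Differentiable ℂ F := by simpa [differentiableOn_univ] using hd
    exact this.apply_eq_of_tendsto_cocompact z hl
  | insert a S ha ih =>
    intro F l hd hs hl z hz
    set F' := Function.update F a (limUnder (𝓝[≠] a) F) with hF'
    have hne : ∀ w, w ≠ a → F' w = F w := fun w hw => Function.update_of_ne hw _ _
    have hd' : DifferentiableOn ℂ F' (↑S : Set ℂ)ᶜ := by
      have ho : (fun z => F z - F a) =o[𝓝[≠] a] fun z => (z - a)⁻¹ := by
        have h1 : F =o[𝓝[≠] a] fun z => (z - a)⁻¹ := by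
          rw [Asymptotics.isLittleO_iff_tendsto']
          · simpa [div_eq_mul_inv, mul_comm] using hs a (Finset.mem_insert_self _ _)
          · filter_upwards [self_mem_nhdsWithin] with w hw h0
            exact absurd (inv_eq_zero.mp h0) (sub_ne_zero.mpr hw)
        refine h1.sub ?_
        rw [Asymptotics.isLittleO_iff_tendsto']
        · have : Tendsto (fun z : ℂ => F a * (z - a)) (𝓝[≠] a) (𝓝 (F a * (a - a))) :=
            Tendsto.mono_left (Continuous.tendsto (by fun_prop) _) nhdsWithin_le_nhds
          simpa [div_eq_mul_inv] using this
        · filter_upwards [self_mem_nhdsWithin] with w hw h0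
          exact absurd (inv_eq_zero.mp h0) (sub_ne_zero.mpr hw)
      have hmem : (↑(insert a S) : Set ℂ)ᶜ ∈ 𝓝[≠] a := by
        have h2 : (↑S : Set ℂ)ᶜ ∈ 𝓝 a :=
          S.finite_toSet.isClosed.isOpen_compl.mem_nhds (by simpa using ha)
        filter_upwards [self_mem_nhdsWithin, nhdsWithin_le_nhds h2] with w h3 h4
        simp only [Finset.coe_insert, Set.mem_compl_iff, Set.mem_insert_iff, not_or]
        exact ⟨h3, h4⟩
      refine (Complex.differentiableOn_update_limUnder_insert_of_isLittleO hmem hd ho).mono ?_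
      intro w hw
      by_cases hwa : w = a
      · exact Or.inl hwa
      · exact Or.inr (by simpa [hwa] using hw)
    have hza : z ≠ a := fun h => hz (h ▸ Finset.mem_insert_self _ _)
    have hzS : z ∉ S := fun h => hz (Finset.mem_insert_of_mem h)
    rw [← hne z hza]
    refine ih F' l hd' ?_ ?_ z hzS
    · intro s hsS
      have hsa : s ≠ a := fun h => ha (h ▸ hsS)
      refine (hs s (Finset.mem_insert_of_mem hsS)).congr' ?_
      filter_upwards [nhdsWithin_le_nhds (isOpen_ne.mem_nhds hsa)] with w hw
      rw [hne w hw]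
    · refine hl.congr' ?_
      have : ({a} : Set ℂ)ᶜ ∈ cocompact ℂ := isCompact_singleton.compl_mem_cocompact
      filter_upwards [this] with w hw
      rw [hne w hw]

/-- A continuous function that is holomorphic off the real axis is holomorphic. -/
theorem differentiableOn_of_continuousOn_off_real {U : Set ℂ} (hU : IsOpen U) {F : ℂ → ℂ}
    (hc : ContinuousOn F U) (hd : ∀ z ∈ U, z.im ≠ 0 → DifferentiableAt ℂ F z) :
    DifferentiableOn ℂ F U := by
  rw [← Complex.isConservativeOn_and_continuousOn_iff_isDifferentiableOn hU]
  refine ⟨?_, hc⟩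
  -- Morera's theorem. Cauchy's theorem needs holomorphy only inside the rectangle and continuity on
  -- its closure, so a side on the real axis is harmless.
  have key : ∀ z w : ℂ, Rectangle z w ⊆ U → (0 ∉ Set.Ioo (min z.im w.im) (max z.im w.im)) →
      wedgeIntegral z w F + wedgeIntegral w z F = 0 := by
    intro z w hzw h0
    rw [wedgeIntegral_add_wedgeIntegral_eq]
    refine integral_boundary_rect_eq_zero_of_continuousOn_of_differentiableOn F z w
      (hc.mono hzw) ?_
    intro p hp
    refine (hd p (hzw ?_) ?_).differentiableWithinAt
    · exact ⟨Set.Ioo_subset_Icc_self hp.1, Set.Ioo_subset_Icc_self hp.2⟩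
    · intro h; exact h0 (by simpa [h] using hp.2)
  intro z w hzw
  rw [← add_eq_zero_iff_eq_neg]
  -- A rectangle that crosses the axis is cut along it: the integrals over the common side cancel
  -- and those over the vertical sides add up.
  by_cases h0 : 0 ∈ Set.Ioo (min z.im w.im) (max z.im w.im)
  · have h0' : (0 : ℝ) ∈ Set.uIcc z.im w.im := Set.Ioo_subset_Icc_self h0
    have hs1 : Rectangle z (w.re : ℂ) ⊆ Rectangle z w := by
      intro p hp
      simp only [Rectangle, mem_reProdIm, ofReal_re, ofReal_im] at hp ⊢
      exact ⟨hp.1, Set.uIcc_subset_uIcc Set.left_mem_uIcc h0' hp.2⟩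
    have hs2 : Rectangle (z.re : ℂ) w ⊆ Rectangle z w := by
      intro p hp
      simp only [Rectangle, mem_reProdIm, ofReal_re, ofReal_im] at hp ⊢
      exact ⟨hp.1, Set.uIcc_subset_uIcc h0' Set.right_mem_uIcc hp.2⟩
    have h1 := key z w.re (hs1.trans hzw) (by
      simp only [ofReal_im, Set.mem_Ioo, not_and_or, not_lt]
      rcases le_total z.im 0 with h | h
      · right; simp [h]
      · left; simp [h])
    have h2 := key z.re w (hs2.trans hzw) (by
      simp only [ofReal_im, Set.mem_Ioo, not_and_or, not_lt]
      rcases le_total w.im 0 with h | h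
      · right; simp [h]
      · left; simp [h])
    rw [wedgeIntegral_add_wedgeIntegral_eq] at h1 h2 ⊢
    have hint : ∀ x : ℝ, x ∈ Set.uIcc z.re w.re → ∀ a b : ℝ, a ∈ Set.uIcc z.im w.im →
        b ∈ Set.uIcc z.im w.im →
        IntervalIntegrable (fun y : ℝ => F (x + y * I)) volume a b := by
      intro x hx a b ha hb
      refine ContinuousOn.intervalIntegrable ?_
      refine hc.comp (by fun_prop) ?_
      intro y hy
      refine hzw ?_
      simp only [Rectangle, mem_reProdIm]
      refine ⟨by simpa using hx, ?_⟩
      have := Set.uIcc_subset_uIcc ha hb hy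
      simpa using this
    have e1 := intervalIntegral.integral_add_adjacent_intervals
      (hint w.re Set.right_mem_uIcc z.im 0 Set.left_mem_uIcc h0')
      (hint w.re Set.right_mem_uIcc 0 w.im h0' Set.right_mem_uIcc)
    have e2 := intervalIntegral.integral_add_adjacent_intervals
      (hint z.re Set.left_mem_uIcc z.im 0 Set.left_mem_uIcc h0')
      (hint z.re Set.left_mem_uIcc 0 w.im h0' Set.right_mem_uIcc)
    rw [← e1, ← e2]
    simp only [ofReal_re, ofReal_im, smul_eq_mul, ofReal_zero, zero_mul, add_zero] at h1 h2 ⊢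
    linear_combination h1 + h2
  · exact key z w hzw h0

theorem hasStrictDerivAt_lam (q₀ : ℝ) {z : ℂ} (hz : z ≠ 0) :
    HasStrictDerivAt (lam q₀) ((1 - (q₀ : ℂ) ^ 2 / z ^ 2) / 2) z := by
  have h := ((hasStrictDerivAt_id z).add ((hasStrictDerivAt_inv hz).const_mul ((q₀ : ℂ) ^ 2))).div_const 2
  have e : lam q₀ = fun z => (id z + (q₀ : ℂ) ^ 2 * z⁻¹) / 2 := by
    funext w; simp [lam, div_eq_mul_inv]
  rw [e]
  refine h.congr_deriv ?_
  rw [mul_neg, ← sub_eq_add_neg, div_eq_mul_inv ((q₀ : ℂ) ^ 2)]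

theorem contDiffAt_lam (q₀ : ℝ) {z : ℂ} (hz : z ≠ 0) : ContDiffAt ℂ 1 (lam q₀) z := by
  unfold lam
  exact ((contDiffAt_id.add (contDiffAt_const.div contDiffAt_id hz))).div_const 2

/-- A function that is continuous near a point of `Σ \ {± q₀}` and holomorphic off `Σ` is
holomorphic at this point. -/
theorem differentiableAt_of_continuousAt_off_contSpec {q₀ : ℝ} {F : ℂ → ℂ} {z₀ : ℂ}
    (hz : z₀ ≠ 0) (hz2 : z₀ ^ 2 ≠ (q₀ : ℂ) ^ 2)
    (hc : ∀ᶠ z in 𝓝 z₀, ContinuousAt F z)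
    (hd : ∀ᶠ z in 𝓝 z₀, (lam q₀ z).im ≠ 0 → DifferentiableAt ℂ F z) :
    DifferentiableAt ℂ F z₀ := by
  -- The derivative of `λ` at `z₀` is non-zero off `±q₀`. So `λ` is a local coordinate, and it maps
  -- `Σ = {Im λ = 0}` into the real axis; the previous theorem applies to `F` composed with the
  -- local inverse `g`.
  set a : ℂ := (1 - (q₀ : ℂ) ^ 2 / z₀ ^ 2) / 2 with ha
  have ha0 : a ≠ 0 := by
    intro h
    apply hz2
    have : z₀ ^ 2 ≠ 0 := pow_ne_zero _ hz
    rw [ha] at h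
    field_simp at h
    linear_combination h
  have hs := hasStrictDerivAt_lam q₀ hz
  rw [← ha] at hs
  set f' : ℂ ≃L[ℂ] ℂ := ContinuousLinearEquiv.unitsEquivAut ℂ (Units.mk0 a ha0) with hf'
  have hfd : HasStrictFDerivAt (lam q₀) (f' : ℂ →L[ℂ] ℂ) z₀ :=
    hs.hasStrictFDerivAt_equiv ha0
  set g := hfd.localInverse (lam q₀) f' z₀ with hg
  have hgl : ∀ᶠ x in 𝓝 z₀, g (lam q₀ x) = x := hfd.eventually_left_inverse
  have hgr : ∀ᶠ y in 𝓝 (lam q₀ z₀), lam q₀ (g y) = y := hfd.eventually_right_inverse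
  have hg0 : g (lam q₀ z₀) = z₀ := hgl.self_of_nhds
  have hgcd : ContDiffAt ℂ 1 g (lam q₀ z₀) :=
    (contDiffAt_lam q₀ hz).to_localInverse hfd.hasFDerivAt one_ne_zero
  have hgd : ∀ᶠ y in 𝓝 (lam q₀ z₀), DifferentiableAt ℂ g y := by
    filter_upwards [hgcd.eventually (by simp)] with y hy
    exact hy.differentiableAt one_ne_zero
  have hgt : Tendsto g (𝓝 (lam q₀ z₀)) (𝓝 z₀) := by
    have := hgcd.continuousAt.tendsto
    rwa [hg0] at this
  have hev : ∀ᶠ y in 𝓝 (lam q₀ z₀), DifferentiableAt ℂ g y ∧ lam q₀ (g y) = y ∧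
      ContinuousAt F (g y) ∧ ((lam q₀ (g y)).im ≠ 0 → DifferentiableAt ℂ F (g y)) :=
    hgd.and (hgr.and ((hgt.eventually hc).and (hgt.eventually hd)))
  obtain ⟨ε, hε, hball⟩ := Metric.eventually_nhds_iff_ball.mp hev
  have hFg : DifferentiableOn ℂ (F ∘ g) (Metric.ball (lam q₀ z₀) ε) := by
    refine differentiableOn_of_continuousOn_off_real Metric.isOpen_ball ?_ ?_
    · intro y hy
      obtain ⟨h1, h2, h3, h4⟩ := hball y hy
      exact (h3.comp h1.continuousAt).continuousWithinAt
    · intro y hy him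
      obtain ⟨h1, h2, h3, h4⟩ := hball y hy
      exact (h4 (by rwa [h2])).comp y h1
  have h1 : DifferentiableAt ℂ (F ∘ g) (lam q₀ z₀) :=
    hFg.differentiableAt (Metric.ball_mem_nhds _ hε)
  have h2 : DifferentiableAt ℂ ((F ∘ g) ∘ lam q₀) z₀ :=
    h1.comp z₀ hs.hasDerivAt.differentiableAt
  refine h2.congr_of_eventuallyEq ?_
  filter_upwards [hgl] with x hx
  simp [hx]

/-- A parametric integral of holomorphic functions with an integrable bound is holomorphic. -/
theorem differentiableOn_integral_of_dominated {E : Type*} [NormedAddCommGroup E]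
    [NormedSpace ℂ E] [CompleteSpace E] {D : Set ℂ} (hD : IsOpen D) {μ : Measure ℝ}
    {F : ℂ → ℝ → E} {bound : ℝ → ℝ} (hm : ∀ z ∈ D, AEStronglyMeasurable (F z) μ)
    (hb : ∀ z ∈ D, ∀ y, ‖F z y‖ ≤ bound y) (hbi : Integrable bound μ)
    (hd : ∀ y, DifferentiableOn ℂ (fun z => F z y) D) :
    DifferentiableOn ℂ (fun z => ∫ y, F z y ∂μ) D := by
  intro z₀ hz₀
  obtain ⟨ε, hε, hball⟩ := Metric.isOpen_iff.mp hD z₀ hz₀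
  have hε2 : 0 < ε / 2 := by positivity
  have hsub : ∀ z ∈ Metric.ball z₀ (ε / 2), Metric.closedBall z (ε / 4) ⊆ D := by
    intro z hz w hw
    apply hball
    rw [Metric.mem_ball] at hz ⊢
    rw [Metric.mem_closedBall] at hw
    linarith [dist_triangle w z z₀]
  have hder : ∀ z ∈ Metric.ball z₀ (ε / 2), ∀ y,
      HasDerivAt (fun z => F z y) (deriv (fun z => F z y) z) z := by
    intro z hz y
    have : z ∈ D := hsub z hz (Metric.mem_closedBall_self (by linarith))
    exact ((hd y).differentiableAt (hD.mem_nhds this)).hasDerivAt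
  -- Cauchy's estimate on discs of radius `ε/4` bounds the derivative by the bound for `F` itself.
  have hbd : ∀ z ∈ Metric.ball z₀ (ε / 2), ∀ y,
      ‖deriv (fun z => F z y) z‖ ≤ bound y / (ε / 4) := by
    intro z hz y
    have hε4 : 0 < ε / 4 := by positivity
    refine Complex.norm_deriv_le_of_forall_mem_sphere_norm_le hε4 ?_ ?_
    · refine ((hd y).mono ?_).diffContOnCl
      rw [closure_ball _ hε4.ne']
      exact hsub z hz
    · intro w hw
      exact hb w (hsub z hz (Metric.sphere_subset_closedBall hw)) y
  -- The derivative is a pointwise limit of difference quotients along the sequence `s n → 0`, hence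
  -- measurable.
  have hmeas : AEStronglyMeasurable (fun y => deriv (fun z => F z y) z₀) μ := by
    set s : ℕ → ℂ := fun n => ((ε / 4 / ((n : ℝ) + 1) : ℝ) : ℂ) with hs
    have hspos : ∀ n : ℕ, 0 < ε / 4 / ((n : ℝ) + 1) := fun n =>
      div_pos (by linarith) (by positivity)
    have hs0 : Tendsto s atTop (𝓝[≠] 0) := by
      refine tendsto_nhdsWithin_iff.mpr ⟨?_, ?_⟩
      · have h1 : Tendsto (fun n : ℕ => ε / 4 / ((n : ℝ) + 1)) atTop (𝓝 0) := by
          have := (tendsto_one_div_add_atTop_nhds_zero_nat (𝕜 := ℝ)).const_mul (ε / 4)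
          simpa [div_eq_mul_inv] using this
        have := (Complex.continuous_ofReal.tendsto 0).comp h1
        simpa [hs, Function.comp_def] using this
      · filter_upwards with n
        simp only [hs, Set.mem_compl_iff, Set.mem_singleton_iff, ofReal_eq_zero]
        exact (hspos n).ne'
    refine aestronglyMeasurable_of_tendsto_ae (u := atTop)
      (f := fun n y => (s n)⁻¹ • (F (z₀ + s n) y - F z₀ y)) ?_ ?_
    · intro n
      refine ((hm (z₀ + s n) ?_).sub (hm z₀ hz₀)).const_smul (s n)⁻¹
      refine hsub z₀ (Metric.mem_ball_self hε2) ?_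
      simp only [Metric.mem_closedBall, dist_self_add_left, hs, norm_real, Real.norm_eq_abs,
        abs_of_pos (hspos n)]
      refine div_le_self (by positivity) ?_
      have : (0 : ℝ) ≤ n := Nat.cast_nonneg n
      linarith
    · filter_upwards with y
      have := hder z₀ (Metric.mem_ball_self hε2) y
      exact this.tendsto_slope_zero.comp hs0
  have := hasDerivAt_integral_of_dominated_loc_of_deriv_le (μ := μ) (F := F)
    (F' := fun z y => deriv (fun z => F z y) z) (x₀ := z₀) (bound := fun y => bound y / (ε / 4))
    (Metric.ball_mem_nhds z₀ hε2)
    (by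
      filter_upwards [hD.mem_nhds hz₀] with z hz using hm z hz)
    (hbi.mono' (hm z₀ hz₀) (ae_of_all _ (hb z₀ hz₀))) hmeas
    (ae_of_all _ fun y z hz => hbd z hz y) (hbi.div_const _)
    (ae_of_all _ fun y z hz => hder z hz y)
  exact this.2.differentiableAt.differentiableWithinAt

end MKdV

namespace MKdV

/-! ### Real analysis on a left half-line -/

theorem exists_norm_le_of_tendsto_atBot {E : Type*} [NormedAddCommGroup E] {f : ℝ → E} {l : E}
    (hc : Continuous f) (hl : Tendsto f atBot (𝓝 l)) (x : ℝ) :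
    ∃ C, 0 ≤ C ∧ ∀ y ≤ x, ‖f y‖ ≤ C := by
  have h1 : ∀ᶠ y in atBot, ‖f y‖ < ‖l‖ + 1 :=
    hl.norm.eventually (gt_mem_nhds (lt_add_one _))
  obtain ⟨a, ha⟩ := eventually_atBot.mp h1
  obtain ⟨C, hC⟩ := (isCompact_Icc (a := a) (b := x)).exists_bound_of_continuousOn hc.continuousOn
  refine ⟨max (‖l‖ + 1) C, le_max_of_le_left (by positivity), fun y hy => ?_⟩
  rcases le_total y a with h | h
  · exact (ha y h).le.trans (le_max_left _ _)
  · exact (hC y ⟨h, hy⟩).trans (le_max_right _ _)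

section halfline

variable {w : ℝ → ℝ}

theorem hasDerivAt_integral_Iic {E : Type*} [NormedAddCommGroup E] [NormedSpace ℝ E]
    [CompleteSpace E] {w : ℝ → E} (hc : Continuous w)
    (hi : ∀ x, IntegrableOn w (Set.Iic x)) (x : ℝ) :
    HasDerivAt (fun x => ∫ y in Set.Iic x, w y) (w x) x := by
  have h : (fun x => ∫ y in Set.Iic x, w y) =
      fun x' => (∫ y in Set.Iic x, w y) + ∫ y in x..x', w y := by
    funext x'
    rw [← intervalIntegral.integral_Iic_sub_Iic (hi x) (hi x')]
    abel
  rw [h]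
  exact ((intervalIntegral.integral_hasDerivAt_right (hc.intervalIntegrable _ _)
    (hc.stronglyMeasurableAtFilter _ _) hc.continuousAt).const_add _)

theorem tendsto_integral_Iic_atBot {E : Type*} [NormedAddCommGroup E] [NormedSpace ℝ E]
    [CompleteSpace E] {w : ℝ → E} (hi : ∀ x, IntegrableOn w (Set.Iic x)) :
    Tendsto (fun x => ∫ y in Set.Iic x, w y) atBot (𝓝 0) := by
  have h : (fun x => ∫ y in Set.Iic x, w y) =
      fun x' => (∫ y in Set.Iic (0 : ℝ), w y) - ∫ y in x'..0, w y := by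
    funext x'
    rw [← intervalIntegral.integral_Iic_sub_Iic (hi x') (hi 0)]
    abel
  rw [h]
  have := (intervalIntegral_tendsto_integral_Iic (0 : ℝ) (hi 0) tendsto_id)
  simpa using (tendsto_const_nhds (x := ∫ y in Set.Iic (0 : ℝ), w y)).sub this

theorem integral_Iic_mono_of_nonneg (h0 : ∀ y, 0 ≤ w y) (hi : ∀ x, IntegrableOn w (Set.Iic x)) :
    Monotone (fun x => ∫ y in Set.Iic x, w y) := fun _ x' h =>
  setIntegral_mono_set (hi x') (ae_of_all _ h0) (ae_of_all _ (Set.Iic_subset_Iic.mpr h))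

/-- `∫_{-∞}^x w Wⁿ = Wⁿ⁺¹/(n+1)` for the primitive `W` of `w` that vanishes at `-∞`. -/
theorem integral_Iic_mul_pow (hc : Continuous w) (h0 : ∀ y, 0 ≤ w y)
    (hi : ∀ x, IntegrableOn w (Set.Iic x)) (n : ℕ) (x : ℝ) :
    IntegrableOn (fun y => w y * (∫ t in Set.Iic y, w t) ^ n) (Set.Iic x) ∧
    ∫ y in Set.Iic x, w y * (∫ t in Set.Iic y, w t) ^ n =
      (∫ t in Set.Iic x, w t) ^ (n + 1) / (n + 1) := by
  set W := fun x => ∫ y in Set.Iic x, w y with hW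
  have hd : ∀ x, HasDerivAt W (w x) x := hasDerivAt_integral_Iic hc hi
  have hWc : Continuous W := continuous_iff_continuousAt.mpr fun x => (hd x).continuousAt
  have hmono : Monotone W := integral_Iic_mono_of_nonneg h0 hi
  have hW0 : ∀ x, 0 ≤ W x := fun _ => integral_nonneg h0
  have hint : IntegrableOn (fun y => w y * W y ^ n) (Set.Iic x) := by
    refine Integrable.mono' ((hi x).mul_const (W x ^ n))
      (hc.mul (hWc.pow n)).aestronglyMeasurable ?_
    filter_upwards [ae_restrict_mem measurableSet_Iic] with y hy
    rw [Real.norm_eq_abs, abs_of_nonneg (mul_nonneg (h0 y) (pow_nonneg (hW0 y) n))]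
    exact mul_le_mul_of_nonneg_left (pow_le_pow_left₀ (hW0 y) (hmono hy) n) (h0 y)
  refine ⟨hint, ?_⟩
  have hd2 : ∀ y, HasDerivAt (fun y => W y ^ (n + 1) / (n + 1)) (w y * W y ^ n) y := by
    intro y
    have := ((hd y).fun_pow (n + 1)).div_const ((n : ℝ) + 1)
    refine this.congr_deriv ?_
    have : (n : ℝ) + 1 ≠ 0 := by positivity
    push_cast
    field_simp
  have ht : Tendsto (fun y => W y ^ (n + 1) / (n + 1)) atBot (𝓝 0) := by
    have := ((tendsto_integral_Iic_atBot hi).pow (n + 1)).div_const ((n : ℝ) + 1)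
    simpa using this
  have := integral_Iic_of_hasDerivAt_of_tendsto (hd2 x).continuousAt.continuousWithinAt
    (fun y _ => hd2 y) hint ht
  simpa using this

/-- Grönwall's inequality on a left half-line. -/
theorem le_mul_exp_of_le_add_integral_Iic (hc : Continuous w) (h0 : ∀ y, 0 ≤ w y)
    (hi : ∀ x, IntegrableOn w (Set.Iic x)) {a : ℝ → ℝ} (ha : Continuous a) {B x₀ : ℝ}
    (hai : ∀ x, IntegrableOn (fun y => w y * a y) (Set.Iic x))
    (hle : ∀ x ≤ x₀, a x ≤ B + ∫ y in Set.Iic x, w y * a y) (x : ℝ) (hx : x ≤ x₀) :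
    a x ≤ B * Real.exp (∫ y in Set.Iic x, w y) := by
  set W := fun x => ∫ y in Set.Iic x, w y with hW
  set A := fun x => ∫ y in Set.Iic x, w y * a y with hA
  have hd : ∀ x, HasDerivAt W (w x) x := hasDerivAt_integral_Iic hc hi
  have hdA : ∀ x, HasDerivAt A (w x * a x) x := hasDerivAt_integral_Iic (hc.mul ha) hai
  -- The usual integrating factor. `g` is antitone, and its value at `-∞` is `B`, which replaces an
  -- initial value.
  set g := fun x => (B + A x) * Real.exp (-W x) with hg
  have hdg : ∀ x, HasDerivAt g (w x * (a x - (B + A x)) * Real.exp (-W x)) x := by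
    intro x
    refine (((hdA x).const_add B).mul (hd x).fun_neg.exp).congr_deriv ?_
    ring
  have hanti : AntitoneOn g (Set.Iic x₀) := by
    refine antitoneOn_of_deriv_nonpos (convex_Iic x₀)
      (fun y _ => (hdg y).continuousAt.continuousWithinAt)
      (fun y _ => (hdg y).differentiableAt.differentiableWithinAt) ?_
    intro y hy
    rw [interior_Iic] at hy
    rw [(hdg y).deriv]
    refine mul_nonpos_of_nonpos_of_nonneg ?_ (Real.exp_pos _).le
    exact mul_nonpos_of_nonneg_of_nonpos (h0 y) (sub_nonpos.mpr (hle y hy.le))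
  have ht : Tendsto g atBot (𝓝 B) := by
    have h1 := (tendsto_integral_Iic_atBot hai).const_add B
    have h2 := (Real.continuous_exp.tendsto _).comp (tendsto_integral_Iic_atBot hi).neg
    have := h1.mul h2
    simpa [hg] using this
  have hgB : g x ≤ B := by
    refine ge_of_tendsto ht ?_
    filter_upwards [eventually_le_atBot x] with y hy
    exact hanti (hy.trans hx) hx hy
  have h3 : B + A x ≤ B * Real.exp (W x) := by
    have := mul_le_mul_of_nonneg_right hgB (Real.exp_pos (W x)).le
    rwa [hg, mul_assoc, ← Real.exp_add, neg_add_cancel, Real.exp_zero, mul_one] at this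
  exact (hle x hx).trans h3

end halfline

/-! ### The propagator of the constant background -/

noncomputable section

/-- `(e^w - 1)/w`, extended by continuity. -/
def expSlope : ℂ → ℂ := dslope exp 0

theorem differentiable_expSlope : Differentiable ℂ expSlope := by
  rw [← differentiableOn_univ]
  exact (Complex.differentiableOn_dslope univ_mem).mpr differentiable_exp.differentiableOn

theorem mul_expSlope (w : ℂ) : w * expSlope w = exp w - 1 := by
  have := sub_smul_dslope exp 0 w
  simpa [expSlope] using this

/-- Mean value inequality on the convex left half-plane, where the derivative of `exp` has norm at
most `1`. -/
theorem norm_exp_sub_one_le_of_re_nonpos {w : ℂ} (hw : w.re ≤ 0) : ‖exp w - 1‖ ≤ ‖w‖ := by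
  have hconv : Convex ℝ {w : ℂ | w.re ≤ 0} := convex_halfSpace_re_le 0
  have := hconv.norm_image_sub_le_of_norm_hasDerivWithin_le (f := exp) (f' := exp) (C := 1)
    (x := 0) (y := w) (fun x _ => (Complex.hasDerivAt_exp x).hasDerivWithinAt)
    (fun x hx => by
      rw [Complex.norm_exp]
      exact Real.exp_le_one_iff.mpr hx) (by simp) hw
  simpa using this

theorem norm_expSlope_le {w : ℂ} (hw : w.re ≤ 0) : ‖expSlope w‖ ≤ 1 := by
  by_cases h : w = 0
  · simp [h, expSlope, dslope_same]
  · have h1 := norm_exp_sub_one_le_of_re_nonpos hw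
    rw [← mul_expSlope, norm_mul] at h1
    have : 0 < ‖w‖ := norm_pos_iff.mpr h
    nlinarith

/-- The function `z (e^{2iλs} - 1)/(2λ)`, extended by continuity. -/
def kap (q₀ : ℝ) (z : ℂ) (s : ℝ) : ℂ := I * z * s * expSlope (2 * I * lam q₀ z * s)

theorem two_lam_mul_kap (q₀ : ℝ) (z : ℂ) (s : ℝ) :
    2 * lam q₀ z * kap q₀ z s = z * (exp (2 * I * lam q₀ z * s) - 1) := by
  rw [← mul_expSlope, kap]; ring

theorem kap_zero (q₀ : ℝ) (z : ℂ) : kap q₀ z 0 = 0 := by simp [kap]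

theorem re_phase_nonpos {q₀ : ℝ} {z : ℂ} (hz : 0 ≤ (lam q₀ z).im) {s : ℝ} (hs : 0 ≤ s) :
    (2 * I * lam q₀ z * s).re ≤ 0 := by
  have : (2 * I * lam q₀ z * s).re = -(2 * ((lam q₀ z).im * s)) := by
    simp [mul_re, mul_im]; ring
  rw [this]
  have := mul_nonneg hz hs
  linarith

theorem norm_exp_phase_le {q₀ : ℝ} {z : ℂ} (hz : 0 ≤ (lam q₀ z).im) {s : ℝ} (hs : 0 ≤ s) :
    ‖exp (2 * I * lam q₀ z * s)‖ ≤ 1 := by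
  rw [Complex.norm_exp]
  exact Real.exp_le_one_iff.mpr (re_phase_nonpos hz hs)

/-- This bound survives where `λ` vanishes, that is at `±iq₀`, at the price of linear growth in `s`.
This growth is what the weight `1 + |x|` in the integrability assumption has to pay for. -/
theorem norm_kap_le {q₀ : ℝ} {z : ℂ} (hz : 0 ≤ (lam q₀ z).im) {s : ℝ} (hs : 0 ≤ s) :
    ‖kap q₀ z s‖ ≤ ‖z‖ * s := by
  have h := norm_expSlope_le (re_phase_nonpos hz hs)
  rw [kap, norm_mul, norm_mul, norm_mul, norm_I, one_mul, norm_real, Real.norm_eq_abs,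
    abs_of_nonneg hs]
  exact mul_le_of_le_one_right (by positivity) h

/-- Complement of `norm_kap_le` for large `z`: there `λ` is comparable to `z`, and `kap` is bounded
uniformly in `z` and `s`. -/
theorem norm_lam_mul_kap_le {q₀ : ℝ} {z : ℂ} (hz : 0 ≤ (lam q₀ z).im) {s : ℝ} (hs : 0 ≤ s) :
    ‖lam q₀ z‖ * ‖kap q₀ z s‖ ≤ ‖z‖ := by
  have h := congrArg norm (two_lam_mul_kap q₀ z s)
  rw [norm_mul, norm_mul, norm_mul, Complex.norm_ofNat] at h
  have h2 : ‖exp (2 * I * lam q₀ z * s) - 1‖ ≤ 1 + 1 :=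
    (norm_sub_le _ _).trans (by simpa using norm_exp_phase_le hz hs)
  have := mul_le_mul_of_nonneg_left h2 (norm_nonneg z)
  linarith

theorem hasDerivAt_kap (q₀ : ℝ) (z : ℂ) (s : ℝ) :
    HasDerivAt (kap q₀ z) (I * z * exp (2 * I * lam q₀ z * s)) s := by
  set a := 2 * I * lam q₀ z with ha
  -- Differentiating `w * expSlope w = exp w - 1` avoids a separate treatment of `w = 0`.
  have hE : ∀ w, expSlope w + w * deriv expSlope w = exp w := by
    intro w
    have h1 : HasDerivAt (fun w => w * expSlope w) (1 * expSlope w + w * deriv expSlope w) w :=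
      (hasDerivAt_id w).mul (differentiable_expSlope w).hasDerivAt
    have h2 : HasDerivAt (fun w => w * expSlope w) (exp w) w := by
      rw [show (fun w => w * expSlope w) = fun w => exp w - 1 from funext mul_expSlope]
      exact (Complex.hasDerivAt_exp w).sub_const 1
    simpa using h1.unique h2
  have h1 : HasDerivAt (fun s : ℂ => I * z * s * expSlope (a * s))
      (I * z * exp (a * s)) (s : ℂ) := by
    have h2 : HasDerivAt (fun s : ℂ => a * s) a (s : ℂ) := by
      simpa using (hasDerivAt_id (s : ℂ)).const_mul a
    have h3 := (((hasDerivAt_id (s : ℂ)).const_mul (I * z))).mul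
      ((differentiable_expSlope (a * s)).hasDerivAt.comp (s : ℂ) h2)
    refine h3.congr_deriv ?_
    rw [← hE (a * s)]
    simp only [id, Function.comp]
    ring
  exact h1.comp_ofReal

/-! ### The Jost function of the left half-line -/

/-- `m = (m₁, m₂)` is the second column of `Φ₋ e^{-iλxσ₃}` for the potential `u → r`, for all
`z ≠ 0` with `Im λ ≥ 0`. -/
structure JostLeft (q₀ r : ℝ) (u : ℝ → ℝ) (m : ℂ → ℝ → ℂ × ℂ) : Prop where
  pos : 0 < q₀
  sq : r ^ 2 = q₀ ^ 2
  smooth : ContDiff ℝ 1 u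
  integrable : IntegrableOn (fun x => (1 + |x|) * (u x - r)) (Set.Iic 0)
  deriv1 : ∀ z : ℂ, z ≠ 0 → 0 ≤ (lam q₀ z).im → ∀ x,
    HasDerivAt (fun x => (m z x).1) (I * z * (m z x).1 + u x * (m z x).2) x
  deriv2 : ∀ z : ℂ, z ≠ 0 → 0 ≤ (lam q₀ z).im → ∀ x,
    HasDerivAt (fun x => (m z x).2) (-u x * (m z x).1 + I * ((q₀ : ℂ) ^ 2 / z) * (m z x).2) x
  lim : ∀ z : ℂ, z ≠ 0 → 0 ≤ (lam q₀ z).im → Tendsto (m z) atBot (𝓝 (I * r / z, 1))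

/-- The closed region `D₊ ∪ Σ`. -/
def closedPlus (q₀ : ℝ) : Set ℂ := {z | z ≠ 0 ∧ 0 ≤ (lam q₀ z).im}

/-- The kernel of the Volterra equation for the Jost function. -/
def volK (q₀ r : ℝ) (z : ℂ) (s : ℝ) (v : ℂ × ℂ) : ℂ × ℂ :=
  (v.2 + kap q₀ z s * (v.2 + I * r / z * v.1),
    -v.1 + kap q₀ z s * (I * r / z) * (v.2 + I * r / z * v.1))

theorem norm_volK_le (q₀ r : ℝ) (z : ℂ) (s : ℝ) (v : ℂ × ℂ) :
    ‖volK q₀ r z s v‖ ≤ (1 + ‖kap q₀ z s‖ * (1 + ‖I * r / z‖) ^ 2) * ‖v‖ := by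
  set κ := kap q₀ z s
  set ρ := I * r / z
  have h1 : ‖v.1‖ ≤ ‖v‖ := norm_fst_le v
  have h2 : ‖v.2‖ ≤ ‖v‖ := norm_snd_le v
  have h3 : ‖v.2 + ρ * v.1‖ ≤ (1 + ‖ρ‖) * ‖v‖ := by
    refine (norm_add_le _ _).trans ?_
    rw [norm_mul]
    nlinarith [norm_nonneg ρ, mul_le_mul_of_nonneg_left h1 (norm_nonneg ρ)]
  have hk := norm_nonneg κ
  have hr := norm_nonneg ρ
  have hv := norm_nonneg v
  have h4 : ‖κ‖ * ‖v.2 + ρ * v.1‖ ≤ ‖κ‖ * ((1 + ‖ρ‖) * ‖v‖) := mul_le_mul_of_nonneg_left h3 hk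
  rw [Prod.norm_def]
  refine max_le ?_ ?_
  · refine (norm_add_le _ _).trans ?_
    rw [norm_mul]
    have : ‖κ‖ * ((1 + ‖ρ‖) * ‖v‖) ≤ ‖κ‖ * (1 + ‖ρ‖) ^ 2 * ‖v‖ := by
      have : 0 ≤ ‖κ‖ * ‖v‖ * (1 + ‖ρ‖) * ‖ρ‖ := by positivity
      nlinarith
    linarith
  · refine (norm_add_le _ _).trans ?_
    rw [norm_mul, norm_mul, norm_neg]
    have h5 : ‖κ‖ * ‖ρ‖ * ‖v.2 + ρ * v.1‖ ≤ ‖κ‖ * ‖ρ‖ * ((1 + ‖ρ‖) * ‖v‖) :=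
      mul_le_mul_of_nonneg_left h3 (by positivity)
    have : ‖κ‖ * ‖ρ‖ * ((1 + ‖ρ‖) * ‖v‖) ≤ ‖κ‖ * (1 + ‖ρ‖) ^ 2 * ‖v‖ := by
      have : 0 ≤ ‖κ‖ * ‖v‖ * (1 + ‖ρ‖) := by positivity
      nlinarith
    linarith

/-- Here `|q₀²/z| ≤ |z|/4`, and `(1 - 1/4)/2 = 3/8`. -/
theorem le_norm_lam {q₀ : ℝ} (hq : 0 < q₀) {z : ℂ} (h : 2 * q₀ ≤ ‖z‖) :
    (3 / 8) * ‖z‖ ≤ ‖lam q₀ z‖ := by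
  have hz0 : 0 < ‖z‖ := by linarith
  rw [lam, norm_div, Complex.norm_ofNat]
  have h3 : ‖z‖ - ‖(q₀ : ℂ) ^ 2 / z‖ ≤ ‖z + (q₀ : ℂ) ^ 2 / z‖ := by
    have := norm_sub_norm_le z (-((q₀ : ℂ) ^ 2 / z))
    simpa using this
  have h4 : ‖(q₀ : ℂ) ^ 2 / z‖ ≤ ‖z‖ / 4 := by
    rw [norm_div, norm_pow, norm_real, Real.norm_eq_abs, abs_of_pos hq, div_le_iff₀ hz0]
    nlinarith
  linarith

/-- The Volterra kernel grows at most linearly, uniformly for `z` away from `0`. -/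
theorem exists_norm_volK_le {q₀ : ℝ} (hq : 0 < q₀) (r : ℝ) {δ : ℝ} (hδ : 0 < δ) :
    ∃ C, 0 ≤ C ∧ ∀ z ∈ closedPlus q₀, δ ≤ ‖z‖ → ‖((I * r / z, 1) : ℂ × ℂ)‖ ≤ C ∧
      ∀ s : ℝ, 0 ≤ s → ∀ v, ‖volK q₀ r z s v‖ ≤ C * (1 + s) * ‖v‖ := by
  set b := |r| / δ with hb
  have hb0 : 0 ≤ b := by positivity
  refine ⟨1 + b + (2 * q₀ + 3) * (1 + b) ^ 2, by positivity, fun z hz hzδ => ?_⟩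
  have hz0 : 0 < ‖z‖ := hδ.trans_le hzδ
  have hρ : ‖I * r / z‖ ≤ b := by
    rw [norm_div, norm_mul, norm_I, one_mul, norm_real, Real.norm_eq_abs]
    exact div_le_div_of_nonneg_left (abs_nonneg _) hδ hzδ
  have hbig : 0 ≤ (2 * q₀ + 3) * (1 + b) ^ 2 := by positivity
  refine ⟨?_, fun s hs v => ?_⟩
  · rw [Prod.norm_def]
    refine max_le ?_ ?_
    · linarith
    · simp only [norm_one]; linarith
  -- Below `|z| = 2q₀` the linear bound is used, above it the bound `8/3 ≤ 3` that follows from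
  -- `le_norm_lam`.
  · have hκ : ‖kap q₀ z s‖ ≤ (2 * q₀ + 3) * (1 + s) := by
      rcases le_total ‖z‖ (2 * q₀) with h | h
      · refine (norm_kap_le hz.2 hs).trans ?_
        nlinarith
      · have h1 := norm_lam_mul_kap_le hz.2 hs
        have h2 := le_norm_lam hq h
        have h5 : ‖kap q₀ z s‖ ≤ 3 := by
          have h6 := mul_le_mul_of_nonneg_right h2 (norm_nonneg (kap q₀ z s))
          by_contra hcon
          push Not at hcon
          have h7 := mul_lt_mul_of_pos_left hcon hz0
          nlinarith
        nlinarith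
    refine (norm_volK_le q₀ r z s v).trans ?_
    refine mul_le_mul_of_nonneg_right ?_ (norm_nonneg v)
    have h1 : (1 + ‖I * r / z‖) ^ 2 ≤ (1 + b) ^ 2 := by
      have := norm_nonneg (I * r / z)
      gcongr
    have h2 : ‖kap q₀ z s‖ * (1 + ‖I * r / z‖) ^ 2 ≤ (2 * q₀ + 3) * (1 + s) * (1 + b) ^ 2 :=
      mul_le_mul hκ h1 (by positivity) (by positivity)
    nlinarith

theorem continuous_volK (q₀ r : ℝ) : ContinuousOn
    (fun p : ℂ × ℝ × (ℂ × ℂ) => volK q₀ r p.1 p.2.1 p.2.2) {p | p.1 ≠ 0} := by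
  have hE := differentiable_expSlope.continuous
  have hlam : ContinuousOn (fun p : ℂ × ℝ × (ℂ × ℂ) => lam q₀ p.1) {p | p.1 ≠ 0} := by
    unfold lam
    exact (continuousOn_fst.add (continuousOn_const.div continuousOn_fst fun p hp => hp)).div_const 2
  have hκ : ContinuousOn (fun p : ℂ × ℝ × (ℂ × ℂ) => kap q₀ p.1 p.2.1) {p | p.1 ≠ 0} := by
    unfold kap
    refine ContinuousOn.mul (by fun_prop) (hE.comp_continuousOn ?_)
    exact (continuousOn_const.mul hlam).mul (by fun_prop)
  have hρ : ContinuousOn (fun p : ℂ × ℝ × (ℂ × ℂ) => I * r / p.1) {p | p.1 ≠ 0} :=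
    continuousOn_const.div continuousOn_fst fun p hp => hp
  have h1 : ContinuousOn (fun p : ℂ × ℝ × (ℂ × ℂ) => p.2.2.1) {p | p.1 ≠ 0} := by fun_prop
  have h2 : ContinuousOn (fun p : ℂ × ℝ × (ℂ × ℂ) => p.2.2.2) {p | p.1 ≠ 0} := by fun_prop
  unfold volK
  exact (h2.add (hκ.mul (h2.add (hρ.mul h1)))).prodMk
    (h1.neg.add ((hκ.mul hρ).mul (h2.add (hρ.mul h1))))

theorem differentiableOn_volK (q₀ r : ℝ) (s : ℝ) {f : ℂ → ℂ × ℂ} {D : Set ℂ}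
    (hD : ∀ z ∈ D, z ≠ 0) (hf : DifferentiableOn ℂ f D) :
    DifferentiableOn ℂ (fun z => volK q₀ r z s (f z)) D := by
  have hid : DifferentiableOn ℂ (fun z : ℂ => z) D := differentiableOn_id
  have hlam : DifferentiableOn ℂ (lam q₀) D := by
    unfold lam
    exact (hid.add ((differentiableOn_const _).div hid hD)).div_const 2
  have hκ : DifferentiableOn ℂ (fun z => kap q₀ z s) D := by
    unfold kap
    refine DifferentiableOn.mul (by fun_prop) ?_
    exact differentiable_expSlope.comp_differentiableOn
      (((differentiableOn_const _).mul hlam).mul_const _)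
  have hρ : DifferentiableOn ℂ (fun z => I * r / z) D := (differentiableOn_const _).div hid hD
  have h1 : DifferentiableOn ℂ (fun z => (f z).1) D := hf.fst
  have h2 : DifferentiableOn ℂ (fun z => (f z).2) D := hf.snd
  unfold volK
  exact (h2.add (hκ.mul (h2.add (hρ.mul h1)))).prodMk
    (h1.neg.add ((hκ.mul hρ).mul (h2.add (hρ.mul h1))))

/-! ### Volterra integrals and their integrable majorant. -/

/-- The Volterra integral. -/
def volInt (q₀ r : ℝ) (u : ℝ → ℝ) (z : ℂ) (f : ℝ → ℂ × ℂ) (x : ℝ) : ℂ × ℂ :=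
  ∫ y in Set.Iic x, (u y - r) • volK q₀ r z (x - y) (f y)

/-- The integrable weight that dominates the Volterra integrals with `x ≤ x₀`. -/
def volW (r : ℝ) (u : ℝ → ℝ) (C x₀ : ℝ) (y : ℝ) : ℝ :=
  C * (1 + |x₀|) * ((1 + |y|) * |u y - r|)

theorem volW_nonneg {r : ℝ} {u : ℝ → ℝ} {C x₀ : ℝ} (hC : 0 ≤ C) (y : ℝ) :
    0 ≤ volW r u C x₀ y := by unfold volW; positivity

theorem continuous_volW {r : ℝ} {u : ℝ → ℝ} (hu : Continuous u) (C x₀ : ℝ) :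
    Continuous (volW r u C x₀) := by unfold volW; fun_prop

theorem integrableOn_weight {r : ℝ} {u : ℝ → ℝ} (hu : Continuous u)
    (hi : IntegrableOn (fun x => (1 + |x|) * (u x - r)) (Set.Iic 0)) (x : ℝ) :
    IntegrableOn (fun y => (1 + |y|) * |u y - r|) (Set.Iic x) := by
  have h1 : IntegrableOn (fun y => (1 + |y|) * |u y - r|) (Set.Iic 0) := by
    refine hi.norm.congr (ae_of_all _ fun y => ?_)
    simp only [norm_mul, Real.norm_eq_abs, abs_of_nonneg (show (0 : ℝ) ≤ 1 + |y| by positivity)]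
  have h2 : IntegrableOn (fun y => (1 + |y|) * |u y - r|) (Set.Icc 0 x) :=
    (by fun_prop : Continuous fun y => (1 + |y|) * |u y - r|).continuousOn.integrableOn_Icc
  refine (h1.union h2).mono_set fun y hy => ?_
  rcases le_total y 0 with h | h
  · exact Or.inl h
  · exact Or.inr ⟨h, hy⟩

theorem integrableOn_volW {r : ℝ} {u : ℝ → ℝ} (hu : Continuous u)
    (hi : IntegrableOn (fun x => (1 + |x|) * (u x - r)) (Set.Iic 0)) (C x₀ x : ℝ) :
    IntegrableOn (volW r u C x₀) (Set.Iic x) :=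
  (integrableOn_weight hu hi x).const_mul _

theorem norm_smul_volK_le {q₀ r : ℝ} {u : ℝ → ℝ} {z : ℂ} {C x₀ x y : ℝ} (hC : 0 ≤ C)
    (hK : ∀ s : ℝ, 0 ≤ s → ∀ v, ‖volK q₀ r z s v‖ ≤ C * (1 + s) * ‖v‖)
    (hx : x ≤ x₀) (hy : y ≤ x) (v : ℂ × ℂ) :
    ‖(u y - r) • volK q₀ r z (x - y) v‖ ≤ volW r u C x₀ y * ‖v‖ := by
  rw [norm_smul, Real.norm_eq_abs]
  -- The linear growth of the kernel in `x - y` is absorbed by the weight `1 + |y|`, uniformly for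
  -- `x ≤ x₀`.
  have h1 : 1 + (x - y) ≤ (1 + |x₀|) * (1 + |y|) := by
    have a1 := le_abs_self x₀
    have a2 := neg_abs_le y
    have a3 := mul_nonneg (abs_nonneg x₀) (abs_nonneg y)
    nlinarith
  calc |u y - r| * ‖volK q₀ r z (x - y) v‖
      ≤ |u y - r| * (C * ((1 + |x₀|) * (1 + |y|)) * ‖v‖) := by
        refine mul_le_mul_of_nonneg_left ((hK _ (by linarith) v).trans ?_) (abs_nonneg _)
        gcongr
    _ = volW r u C x₀ y * ‖v‖ := by unfold volW; ring

variable {q₀ r : ℝ} {u : ℝ → ℝ} {m : ℂ → ℝ → ℂ × ℂ}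

theorem continuousOn_volK_comp {X : Type*} [TopologicalSpace X] {S : Set X} {a : X → ℂ}
    {b : X → ℝ} {c : X → ℂ × ℂ} (q₀ r : ℝ) (ha : ContinuousOn a S) (hb : ContinuousOn b S)
    (hc : ContinuousOn c S) (h0 : ∀ p ∈ S, a p ≠ 0) :
    ContinuousOn (fun p => volK q₀ r (a p) (b p) (c p)) S :=
  (continuous_volK q₀ r).comp (ha.prodMk (hb.prodMk hc)) fun p hp => h0 p hp

theorem aestronglyMeasurable_volK (hu : Continuous u) {z : ℂ} (hz : z ≠ 0) {x : ℝ}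
    {f : ℝ → ℂ × ℂ} (hf : ContinuousOn f (Set.Iic x)) :
    AEStronglyMeasurable (fun y => (u y - r) • volK q₀ r z (x - y) (f y))
      (volume.restrict (Set.Iic x)) := by
  refine ContinuousOn.aestronglyMeasurable ?_ measurableSet_Iic
  exact (by fun_prop : ContinuousOn (fun y => u y - r) (Set.Iic x)).smul
    (continuousOn_volK_comp q₀ r continuousOn_const (by fun_prop) hf fun _ _ => hz)

theorem integrableOn_volK (hu : Continuous u)
    (hi : IntegrableOn (fun x => (1 + |x|) * (u x - r)) (Set.Iic 0)) {z : ℂ} (hz : z ≠ 0)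
    {C x : ℝ} (hC : 0 ≤ C) (hK : ∀ s : ℝ, 0 ≤ s → ∀ v, ‖volK q₀ r z s v‖ ≤ C * (1 + s) * ‖v‖)
    {f : ℝ → ℂ × ℂ} (hf : ContinuousOn f (Set.Iic x)) {B : ℝ} (hB : ∀ y ≤ x, ‖f y‖ ≤ B) :
    IntegrableOn (fun y => (u y - r) • volK q₀ r z (x - y) (f y)) (Set.Iic x) := by
  refine Integrable.mono' ((integrableOn_volW hu hi C x x).mul_const B)
    (aestronglyMeasurable_volK hu hz hf) ?_
  filter_upwards [ae_restrict_mem measurableSet_Iic] with y hy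
  exact (norm_smul_volK_le hC hK le_rfl hy _).trans
    (mul_le_mul_of_nonneg_left (hB y hy) (volW_nonneg hC y))

/-! ### The Volterra equation of the Jost function. -/

namespace JostLeft

theorem continuous (hm : JostLeft q₀ r u m) {z : ℂ} (hz : z ∈ closedPlus q₀) :
    Continuous (m z) := by
  rw [continuous_iff_continuousAt]
  intro x
  exact (hm.deriv1 z hz.1 hz.2 x).continuousAt.prodMk (hm.deriv2 z hz.1 hz.2 x).continuousAt

theorem integrableOn_abs (hm : JostLeft q₀ r u m) (x : ℝ) :
    IntegrableOn (fun y => |u y - r|) (Set.Iic x) := by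
  have hu := hm.smooth.continuous
  refine Integrable.mono' (integrableOn_weight hu hm.integrable x)
    (by fun_prop : Continuous fun y => |u y - r|).aestronglyMeasurable (ae_of_all _ fun y => ?_)
  rw [Real.norm_eq_abs, abs_abs]
  nlinarith [abs_nonneg y, abs_nonneg (u y - r), mul_nonneg (abs_nonneg y) (abs_nonneg (u y - r))]

theorem bounded (hm : JostLeft q₀ r u m) {z : ℂ} (hz : z ∈ closedPlus q₀) (x : ℝ) :
    ∃ C, 0 ≤ C ∧ ∀ y ≤ x, ‖m z y‖ ≤ C :=
  exists_norm_le_of_tendsto_atBot (hm.continuous hz) (hm.lim z hz.1 hz.2) x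

theorem two_lam (hm : JostLeft q₀ r u m) (z : ℂ) : 2 * lam q₀ z = z + (r : ℂ) ^ 2 / z := by
  have : (r : ℂ) ^ 2 = (q₀ : ℂ) ^ 2 := by exact_mod_cast hm.sq
  rw [this, lam]; ring

/-- The growing component of the Jost function. -/
theorem hasDerivAt_grow (hm : JostLeft q₀ r u m) {z : ℂ} (hz : z ∈ closedPlus q₀) (x : ℝ) :
    HasDerivAt (fun x => (m z x).1 - I * r / z * (m z x).2)
      (2 * I * lam q₀ z * ((m z x).1 - I * r / z * (m z x).2) +
        ((u x - r : ℝ) : ℂ) * ((m z x).2 + I * r / z * (m z x).1)) x := by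
  refine ((hm.deriv1 z hz.1 hz.2 x).sub ((hm.deriv2 z hz.1 hz.2 x).const_mul
    (I * r / z))).congr_deriv ?_
  have h2 := hm.two_lam z
  have h3 : (q₀ : ℂ) ^ 2 = (r : ℂ) ^ 2 := by exact_mod_cast hm.sq.symm
  have hz1 : z * z⁻¹ = 1 := mul_inv_cancel₀ hz.1
  rw [h3, show 2 * I * lam q₀ z = I * (2 * lam q₀ z) by ring, h2]
  simp only [div_eq_mul_inv]
  push_cast
  linear_combination (r * (m z x).2 * z * z⁻¹) * I_sq - r * (m z x).2 * hz1

theorem tendsto_grow (hm : JostLeft q₀ r u m) {z : ℂ} (hz : z ∈ closedPlus q₀) :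
    Tendsto (fun x => (m z x).1 - I * r / z * (m z x).2) atBot (𝓝 0) := by
  have h := hm.lim z hz.1 hz.2
  have h1 := (continuous_fst.tendsto _).comp h
  have h2 := (continuous_snd.tendsto _).comp h
  simpa using h1.sub (h2.const_mul (I * r / z))

/-- Variation of constants from `-∞`, where the growing component vanishes: it equals `∫
e^{2iλ(x-y)} (u - r) p dy`, with `p` the combination in `hB`, and the exponential has norm at most
`1` for `y ≤ x`. -/
theorem norm_grow_le (hm : JostLeft q₀ r u m) {z : ℂ} (hz : z ∈ closedPlus q₀) {x B : ℝ}
    (hB : ∀ y ≤ x, ‖(m z y).2 + I * r / z * (m z y).1‖ ≤ B) :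
    ‖(m z x).1 - I * r / z * (m z x).2‖ ≤ B * ∫ y in Set.Iic x, |u y - r| := by
  set h := fun x => (m z x).1 - I * r / z * (m z x).2 with hh
  set p := fun x => (m z x).2 + I * r / z * (m z x).1 with hp
  have hu := hm.smooth.continuous
  have hmc := hm.continuous hz
  have hd : ∀ y, HasDerivAt (fun y : ℝ => exp (2 * I * lam q₀ z * ((x - y : ℝ) : ℂ)) * h y)
      (exp (2 * I * lam q₀ z * ((x - y : ℝ) : ℂ)) * (((u y - r : ℝ) : ℂ) * p y)) y := by
    intro y
    have e1 : HasDerivAt (fun y : ℝ => ((x - y : ℝ) : ℂ)) (-1) y := by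
      have := ((hasDerivAt_id y).const_sub x).ofReal_comp
      simpa using this
    refine (((e1.const_mul (2 * I * lam q₀ z)).cexp).mul (hm.hasDerivAt_grow hz y)).congr_deriv ?_
    ring
  have hwi := hm.integrableOn_abs
  have hnorm : ∀ y ≤ x, ‖exp (2 * I * lam q₀ z * ((x - y : ℝ) : ℂ)) *
      (((u y - r : ℝ) : ℂ) * p y)‖ ≤ B * |u y - r| := by
    intro y hy
    rw [norm_mul, norm_mul, norm_real, Real.norm_eq_abs]
    have h1 := norm_exp_phase_le hz.2 (sub_nonneg.mpr hy)
    have h2 := mul_le_mul_of_nonneg_left (hB y hy) (abs_nonneg (u y - r))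
    calc _ ≤ 1 * (|u y - r| * ‖p y‖) := mul_le_mul_of_nonneg_right h1 (by positivity)
      _ ≤ _ := by linarith
  have hpc : Continuous p := by fun_prop
  have hint : IntegrableOn (fun y => exp (2 * I * lam q₀ z * ((x - y : ℝ) : ℂ)) *
      (((u y - r : ℝ) : ℂ) * p y)) (Set.Iic x) := by
    refine Integrable.mono' ((hwi x).const_mul B) ?_ ?_
    · exact (by fun_prop : Continuous fun y => exp (2 * I * lam q₀ z * ((x - y : ℝ) : ℂ)) *
        (((u y - r : ℝ) : ℂ) * p y)).aestronglyMeasurable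
    · filter_upwards [ae_restrict_mem measurableSet_Iic] with y hy using hnorm y hy
  have ht : Tendsto (fun y : ℝ => exp (2 * I * lam q₀ z * ((x - y : ℝ) : ℂ)) * h y) atBot
      (𝓝 0) := by
    refine squeeze_zero_norm' ?_ (by simpa using (hm.tendsto_grow hz).norm)
    filter_upwards [eventually_le_atBot x] with y hy
    rw [norm_mul]
    exact mul_le_of_le_one_left (norm_nonneg _) (norm_exp_phase_le hz.2 (sub_nonneg.mpr hy))
  have hI := integral_Iic_of_hasDerivAt_of_tendsto (hd x).continuousAt.continuousWithinAt
    (fun y _ => hd y) hint ht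
  simp only [sub_self, ofReal_zero, mul_zero, exp_zero, one_mul, sub_zero] at hI
  change ‖h x‖ ≤ _
  rw [← hI, ← integral_const_mul]
  refine norm_integral_le_of_norm_le ((hwi x).const_mul B) ?_
  filter_upwards [ae_restrict_mem measurableSet_Iic] with y hy using hnorm y hy

/-- The Volterra equation for the Jost function. -/
theorem volterra (hm : JostLeft q₀ r u m) {z : ℂ} (hz : z ∈ closedPlus q₀) (x : ℝ) :
    m z x = (I * r / z, 1) + volInt q₀ r u z (m z) x := by
  obtain ⟨B, hB0, hB⟩ := hm.bounded hz x
  have hu := hm.smooth.continuous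
  have hmc := hm.continuous hz
  obtain ⟨C, hC0, hC⟩ := exists_norm_volK_le hm.pos r (norm_pos_iff.mpr hz.1)
  have hK := (hC z hz le_rfl).2
  set ρ := I * r / z with hρ
  set h := fun x => (m z x).1 - ρ * (m z x).2 with hh
  have hz1 : z * z⁻¹ = 1 := mul_inv_cancel₀ hz.1
  have h2 := hm.two_lam z
  have h3 : (q₀ : ℂ) ^ 2 = (r : ℂ) ^ 2 := by exact_mod_cast hm.sq.symm
  have hκ : ∀ y : ℝ, HasDerivAt (fun y : ℝ => kap q₀ z (x - y))
      (-(I * z + 2 * I * lam q₀ z * kap q₀ z (x - y))) y := by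
    intro y
    have := (hasDerivAt_kap q₀ z (x - y)).scomp y ((hasDerivAt_id y).const_sub x)
    refine this.congr_deriv ?_
    have e := two_lam_mul_kap q₀ z (x - y)
    simp only [neg_smul, one_smul]
    linear_combination I * e
  -- The background matrix has the eigenvalues `0` and `2iλ`, because `r² = q₀²`, and its image is
  -- spanned by `(1, ρ)`. The pair below is its propagator over `x - y` applied to `m(y)`: it equals
  -- `m(x)` at `y = x`, and only the perturbation `u - r` contributes to its `y`-derivative.
  have hd : ∀ y, HasDerivAt (fun y => ((m z y).1 + kap q₀ z (x - y) * h y,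
      (m z y).2 + kap q₀ z (x - y) * ρ * h y))
      ((u y - r) • volK q₀ r z (x - y) (m z y)) y := by
    intro y
    have a1 := (hm.deriv1 z hz.1 hz.2 y).add ((hκ y).mul (hm.hasDerivAt_grow hz y))
    have a2 := (hm.deriv2 z hz.1 hz.2 y).add (((hκ y).mul_const ρ).mul (hm.hasDerivAt_grow hz y))
    refine (a1.prodMk a2).congr_deriv ?_
    simp only [volK, Prod.smul_mk, real_smul, Prod.mk.injEq, ← hρ, h3]
    have hzρ : z * ρ = I * r := by rw [hρ, div_eq_mul_inv]; linear_combination I * r * hz1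
    have hq : (r : ℂ) ^ 2 / z = - I * r * ρ := by
      rw [hρ, div_eq_mul_inv, div_eq_mul_inv]; linear_combination r ^ 2 * z⁻¹ * I_sq
    rw [hq]
    push_cast
    constructor
    · linear_combination I * (m z y).2 * hzρ + r * (m z y).2 * I_sq
    · linear_combination (-I * (m z y).1 + I * ρ * (m z y).2) * hzρ + 
        (-r * (m z y).1) * I_sq
  have hint := integrableOn_volK hu hm.integrable hz.1 hC0 hK hmc.continuousOn hB
  have hwt := tendsto_integral_Iic_atBot (integrableOn_weight hu hm.integrable)
  -- `kap` may grow like `x - y`, but `h(y)` is at most a constant times the integral of `|u - r|`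
  -- over `(-∞, y]`. Since `x - y ≤ (1 + |x|)(1 + |t|)` for `t ≤ y ≤ 0`, the product is bounded by a
  -- tail of the weighted integral.
  have hκh : Tendsto (fun y => kap q₀ z (x - y) * h y) atBot (𝓝 0) := by
    have hwi := hm.integrableOn_abs
    have hp : ∀ y ≤ x, ‖(m z y).2 + ρ * (m z y).1‖ ≤ (1 + ‖ρ‖) * B := by
      intro y hy
      have b1 := (norm_fst_le (m z y)).trans (hB y hy)
      have b2 := (norm_snd_le (m z y)).trans (hB y hy)
      refine (norm_add_le _ _).trans ?_
      rw [norm_mul]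
      nlinarith [mul_le_mul_of_nonneg_left b1 (norm_nonneg ρ)]
    have hlim := hwt.const_mul (‖z‖ * ((1 + ‖ρ‖) * B) * (1 + |x|))
    rw [mul_zero] at hlim
    refine squeeze_zero_norm' ?_ hlim
    filter_upwards [eventually_le_atBot x, eventually_le_atBot 0] with y hy hy0
    rw [norm_mul]
    have c1 := norm_kap_le hz.2 (sub_nonneg.mpr hy)
    have c2 := hm.norm_grow_le hz (x := y) fun t ht => hp t (ht.trans hy)
    have c3 : (x - y) * ∫ t in Set.Iic y, |u t - r| ≤
        (1 + |x|) * ∫ t in Set.Iic y, (1 + |t|) * |u t - r| := by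
      rw [← integral_const_mul, ← integral_const_mul]
      refine setIntegral_mono_on ((hwi y).const_mul _)
        ((integrableOn_weight hu hm.integrable y).const_mul _) measurableSet_Iic fun t ht => ?_
      rw [← mul_assoc]
      refine mul_le_mul_of_nonneg_right ?_ (abs_nonneg _)
      have d1 := le_abs_self x
      have d2 : -t ≤ |t| := neg_le_abs t
      have d3 := mul_nonneg (abs_nonneg x) (abs_nonneg t)
      have d4 : t ≤ y := ht
      nlinarith
    calc ‖kap q₀ z (x - y)‖ * ‖h y‖
        ≤ (‖z‖ * (x - y)) * ((1 + ‖ρ‖) * B * ∫ t in Set.Iic y, |u t - r|) :=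
          mul_le_mul c1 c2 (norm_nonneg _)
            (mul_nonneg (norm_nonneg z) (sub_nonneg.mpr hy))
      _ = ‖z‖ * ((1 + ‖ρ‖) * B) * ((x - y) * ∫ t in Set.Iic y, |u t - r|) := by ring
      _ ≤ ‖z‖ * ((1 + ‖ρ‖) * B) * ((1 + |x|) * ∫ t in Set.Iic y, (1 + |t|) * |u t - r|) :=
          mul_le_mul_of_nonneg_left c3 (by positivity)
      _ = _ := by ring
  have ht : Tendsto (fun y => ((m z y).1 + kap q₀ z (x - y) * h y,
      (m z y).2 + kap q₀ z (x - y) * ρ * h y)) atBot (𝓝 (ρ, 1)) := by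
    have hl := hm.lim z hz.1 hz.2
    have l1 := ((continuous_fst.tendsto _).comp hl).add hκh
    have l2 := ((continuous_snd.tendsto _).comp hl).add (hκh.const_mul ρ)
    have := l1.prodMk_nhds l2
    simp only [mul_zero, add_zero] at this
    refine this.congr fun y => ?_
    simp only [Function.comp]
    congr 1
    ring
  have hI := integral_Iic_of_hasDerivAt_of_tendsto (hd x).continuousAt.continuousWithinAt
    (fun y _ => hd y) hint ht
  rw [volInt, hI]
  simp [kap_zero]

end JostLeft

/-! ### Picard iteration and regularity in the spectral parameter. -/

variable {q₀ r : ℝ} {u : ℝ → ℝ} {m : ℂ → ℝ → ℂ × ℂ}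

/-- The Picard iterates of the Volterra equation. -/
def volIter (q₀ r : ℝ) (u : ℝ → ℝ) : ℕ → ℂ → ℝ → ℂ × ℂ
  | 0 => fun _ _ => 0
  | n + 1 => fun z x => (I * r / z, 1) + volInt q₀ r u z (volIter q₀ r u n z) x

/-- Regularity in `(z, x)` of the Picard iterates, for `z ∈ V` and `x ≤ x₀`. -/
structure VolRegular (q₀ : ℝ) (V : Set ℂ) (x₀ : ℝ) (f : ℂ → ℝ → ℂ × ℂ) : Prop where
  continuousOn : ContinuousOn (fun p : ℂ × ℝ => f p.1 p.2) (V ×ˢ Set.Iic x₀)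
  differentiableOn : ∀ x ≤ x₀,
    DifferentiableOn ℂ (fun z => f z x) (interior V ∩ {z | 0 < (lam q₀ z).im})
  bounded : ∃ B, 0 ≤ B ∧ ∀ z ∈ V, ∀ x ≤ x₀, ‖f z x‖ ≤ B

theorem isOpen_interior_inter_plus (q₀ : ℝ) {V : Set ℂ} (hV : ∀ z ∈ V, z ≠ 0) :
    IsOpen (interior V ∩ {z | 0 < (lam q₀ z).im}) := by
  have : ContinuousOn (fun z => (lam q₀ z).im) (interior V) := by
    have h0 : ∀ z ∈ interior V, z ≠ 0 := fun z hz => hV z (interior_subset hz)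
    unfold lam
    exact continuous_im.comp_continuousOn
      ((continuousOn_id.add (continuousOn_const.div continuousOn_id h0)).div_const 2)
  exact this.isOpen_inter_preimage isOpen_interior isOpen_Ioi

theorem VolRegular.slice {V : Set ℂ} {x₀ : ℝ} {f : ℂ → ℝ → ℂ × ℂ} (hf : VolRegular q₀ V x₀ f)
    {z : ℂ} (hz : z ∈ V) {x : ℝ} (hx : x ≤ x₀) : ContinuousOn (f z) (Set.Iic x) :=
  hf.continuousOn.comp (f := fun y : ℝ => (z, y)) (by fun_prop)
    fun _ hy => ⟨hz, le_trans hy hx⟩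

/-- One Picard step preserves regularity. The moving upper limit is traded for an indicator on the
fixed half-line up to `x₀`, so that one majorant `w * B` serves for dominated convergence and for
holomorphy under the integral. -/
theorem VolRegular.volInt (hu : Continuous u)
    (hi : IntegrableOn (fun x => (1 + |x|) * (u x - r)) (Set.Iic 0)) {V : Set ℂ} {x₀ C : ℝ}
    (hV : ∀ z ∈ V, z ≠ 0) (hC : 0 ≤ C) (hE : ∀ z ∈ V, ‖((I * r / z, 1) : ℂ × ℂ)‖ ≤ C)
    (hK : ∀ z ∈ V, ∀ s : ℝ, 0 ≤ s → ∀ v, ‖volK q₀ r z s v‖ ≤ C * (1 + s) * ‖v‖)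
    {f : ℂ → ℝ → ℂ × ℂ} (hf : VolRegular q₀ V x₀ f) :
    VolRegular q₀ V x₀ (fun z x => (I * r / z, 1) + volInt q₀ r u z (f z) x) := by
  obtain ⟨B, hB0, hB⟩ := hf.bounded
  set w := volW r u C x₀ with hw
  have hw0 : ∀ y, 0 ≤ w y := volW_nonneg hC
  have hwi : ∀ x, IntegrableOn w (Set.Iic x) := integrableOn_volW hu hi C x₀
  have hnorm : ∀ z ∈ V, ∀ x ≤ x₀, ∀ y ≤ x, ‖(u y - r) • volK q₀ r z (x - y) (f z y)‖ ≤ w y * B :=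
    fun z hz x hx y hy => (norm_smul_volK_le hC (hK z hz) hx hy _).trans
      (mul_le_mul_of_nonneg_left (hB z hz y (hy.trans hx)) (hw0 y))
  set G : ℂ × ℝ → ℝ → ℂ × ℂ := fun p => Set.indicator (Set.Iic p.2)
    (fun y => (u y - r) • volK q₀ r p.1 (p.2 - y) (f p.1 y)) with hG
  have hGint : ∀ p ∈ V ×ˢ Set.Iic x₀, ∫ y in Set.Iic x₀, G p y = MKdV.volInt q₀ r u p.1 (f p.1) p.2 := by
    intro p hp
    rw [hG, setIntegral_indicator measurableSet_Iic, Set.Iic_inter_Iic, min_eq_right hp.2]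
    rfl
  have hGn : ∀ p ∈ V ×ˢ Set.Iic x₀, ∀ y, ‖G p y‖ ≤ w y * B := by
    intro p hp y
    by_cases hy : y ≤ p.2
    · rw [hG]
      simp only [Set.indicator_of_mem (Set.mem_Iic.mpr hy)]
      exact hnorm p.1 hp.1 p.2 hp.2 y hy
    · rw [hG]
      simp only [Set.indicator_of_notMem (fun h => hy (Set.mem_Iic.mp h)), norm_zero]
      exact mul_nonneg (hw0 y) hB0
  have hGm : ∀ p ∈ V ×ˢ Set.Iic x₀, AEStronglyMeasurable (G p) (volume.restrict (Set.Iic x₀)) := by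
    intro p hp
    refine (aestronglyMeasurable_indicator_iff measurableSet_Iic).mpr ?_
    rw [Measure.restrict_restrict measurableSet_Iic, Set.Iic_inter_Iic, min_eq_left hp.2]
    exact aestronglyMeasurable_volK hu (hV _ hp.1) (hf.slice hp.1 hp.2)
  have hEc : ContinuousOn (fun p : ℂ × ℝ => ((I * r / p.1, 1) : ℂ × ℂ)) (V ×ˢ Set.Iic x₀) :=
    (continuousOn_const.div continuousOn_fst fun p hp => hV _ hp.1).prodMk continuousOn_const
  refine ⟨?_, ?_, ?_⟩
  · refine hEc.add ?_
    refine ContinuousOn.congr (f := fun p => ∫ y in Set.Iic x₀, G p y) ?_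
      fun p hp => (hGint p hp).symm
    intro p₀ hp₀
    refine continuousWithinAt_of_dominated (bound := fun y => w y * B) ?_ ?_
      ((hwi x₀).mul_const B) ?_
    · filter_upwards [self_mem_nhdsWithin] with p hp using hGm p hp
    · filter_upwards [self_mem_nhdsWithin] with p hp
      exact ae_of_all _ (hGn p hp)
    -- The indicator is discontinuous in `p` at `p₀` only for `y = p₀.2`, a null set.
    · have hne : ∀ᵐ y ∂(volume.restrict (Set.Iic x₀)), y ≠ p₀.2 :=
        ae_restrict_of_ae (Measure.ae_ne volume p₀.2)
      filter_upwards [hne, ae_restrict_mem measurableSet_Iic] with y hy hyx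
      rcases lt_or_gt_of_ne hy with hlt | hgt
      · have hev : ∀ᶠ p in 𝓝[V ×ˢ Set.Iic x₀] p₀,
            G p y = (u y - r) • volK q₀ r p.1 (p.2 - y) (f p.1 y) := by
          have : ∀ᶠ p in 𝓝 p₀, y < p.2 := continuous_snd.continuousAt.eventually (lt_mem_nhds hlt)
          filter_upwards [nhdsWithin_le_nhds this] with p hp
          simp only [hG, Set.indicator_of_mem (Set.mem_Iic.mpr hp.le)]
        refine ContinuousWithinAt.congr_of_eventuallyEq ?_ hev (by
          simp only [hG, Set.indicator_of_mem (Set.mem_Iic.mpr hlt.le)])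
        suffices h : ContinuousWithinAt (fun p : ℂ × ℝ => volK q₀ r p.1 (p.2 - y) (f p.1 y))
            (V ×ˢ Set.Iic x₀) p₀ from h.const_smul (u y - r)
        refine continuousOn_volK_comp (S := V ×ˢ Set.Iic x₀) (a := fun p : ℂ × ℝ => p.1)
          (b := fun p => p.2 - y) (c := fun p => f p.1 y) q₀ r continuousOn_fst (by fun_prop) ?_
          (fun p hp => hV _ hp.1) p₀ hp₀
        exact hf.continuousOn.comp (f := fun p : ℂ × ℝ => (p.1, y)) (by fun_prop)
          fun p hp => ⟨hp.1, hyx⟩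
      · have hev : ∀ᶠ p in 𝓝[V ×ˢ Set.Iic x₀] p₀, G p y = 0 := by
          have : ∀ᶠ p in 𝓝 p₀, p.2 < y := continuous_snd.continuousAt.eventually (gt_mem_nhds hgt)
          filter_upwards [nhdsWithin_le_nhds this] with p hp
          simp only [hG, Set.indicator_of_notMem (fun h => not_le.mpr hp (Set.mem_Iic.mp h))]
        refine ContinuousWithinAt.congr_of_eventuallyEq continuousWithinAt_const hev (by
          simp only [hG, Set.indicator_of_notMem (fun h => not_le.mpr hgt (Set.mem_Iic.mp h))])
  · intro x hx
    set D := interior V ∩ {z | 0 < (lam q₀ z).im}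
    have hDV : ∀ z ∈ D, z ∈ V := fun z hz => interior_subset hz.1
    have hD0 : ∀ z ∈ D, z ≠ 0 := fun z hz => hV z (hDV z hz)
    refine DifferentiableOn.add (((differentiableOn_const _).div differentiableOn_id hD0).prodMk
      (differentiableOn_const _)) ?_
    refine DifferentiableOn.congr (f := fun z => ∫ y in Set.Iic x₀, G (z, x) y) ?_
      fun z hz => (hGint (z, x) ⟨hDV z hz, hx⟩).symm
    refine differentiableOn_integral_of_dominated (isOpen_interior_inter_plus q₀ hV)
      (bound := fun y => w y * B) (fun z hz => hGm (z, x) ⟨hDV z hz, hx⟩)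
      (fun z hz => hGn (z, x) ⟨hDV z hz, hx⟩) ((hwi x₀).mul_const B) ?_
    intro y
    by_cases hy : y ≤ x
    · simp only [hG, Set.indicator_of_mem (Set.mem_Iic.mpr hy)]
      exact (differentiableOn_volK q₀ r (x - y) hD0
        (hf.differentiableOn y (hy.trans hx))).const_smul (u y - r)
    · simp only [hG, Set.indicator_of_notMem (fun h => hy (Set.mem_Iic.mp h))]
      exact differentiableOn_const _
  · refine ⟨C + ∫ y in Set.Iic x₀, w y * B, by
      have : 0 ≤ ∫ y in Set.Iic x₀, w y * B := integral_nonneg fun y => mul_nonneg (hw0 y) hB0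
      linarith, fun z hz x hx => ?_⟩
    refine (norm_add_le _ _).trans (add_le_add (hE z hz) ?_)
    rw [← hGint (z, x) ⟨hz, hx⟩]
    exact norm_integral_le_of_norm_le ((hwi x₀).mul_const B)
      (ae_of_all _ (hGn (z, x) ⟨hz, hx⟩))

theorem volRegular_volIter (hu : Continuous u)
    (hi : IntegrableOn (fun x => (1 + |x|) * (u x - r)) (Set.Iic 0)) {V : Set ℂ} {x₀ C : ℝ}
    (hV : ∀ z ∈ V, z ≠ 0) (hC : 0 ≤ C) (hE : ∀ z ∈ V, ‖((I * r / z, 1) : ℂ × ℂ)‖ ≤ C)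
    (hK : ∀ z ∈ V, ∀ s : ℝ, 0 ≤ s → ∀ v, ‖volK q₀ r z s v‖ ≤ C * (1 + s) * ‖v‖) (n : ℕ) :
    VolRegular q₀ V x₀ (volIter q₀ r u n) := by
  induction n with
  | zero => exact ⟨continuousOn_const, fun _ _ => differentiableOn_const _,
      ⟨0, le_rfl, fun _ _ _ _ => by simp [volIter]⟩⟩
  | succ n ih => exact ih.volInt hu hi hV hC hE hK

namespace JostLeft

/-- A bound for the Jost function, uniform for `z` away from `0`. -/
theorem norm_le (hm : JostLeft q₀ r u m) {C x₀ : ℝ} (hC : 0 ≤ C) {z : ℂ}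
    (hz : z ∈ closedPlus q₀) (hE : ‖((I * r / z, 1) : ℂ × ℂ)‖ ≤ C)
    (hK : ∀ s : ℝ, 0 ≤ s → ∀ v, ‖volK q₀ r z s v‖ ≤ C * (1 + s) * ‖v‖) {x : ℝ} (hx : x ≤ x₀) :
    ‖m z x‖ ≤ C * Real.exp (∫ y in Set.Iic x₀, volW r u C x₀ y) := by
  have hu := hm.smooth.continuous
  have hmc := hm.continuous hz
  have hw0 : ∀ y, 0 ≤ volW r u C x₀ y := volW_nonneg hC
  have hwi := integrableOn_volW hu hm.integrable C x₀
  have hai : ∀ x, IntegrableOn (fun y => volW r u C x₀ y * ‖m z y‖) (Set.Iic x) := by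
    intro x
    obtain ⟨B, _, hB⟩ := hm.bounded hz x
    refine Integrable.mono' ((hwi x).mul_const B)
      (((continuous_volW hu C x₀).mul hmc.norm).aestronglyMeasurable) ?_
    filter_upwards [ae_restrict_mem measurableSet_Iic] with y hy
    rw [Real.norm_eq_abs, abs_of_nonneg (mul_nonneg (hw0 y) (norm_nonneg _))]
    exact mul_le_mul_of_nonneg_left (hB y hy) (hw0 y)
  have h := le_mul_exp_of_le_add_integral_Iic (continuous_volW hu C x₀) hw0 hwi hmc.norm
    (B := C) (x₀ := x₀) hai (fun x hx => by
      rw [hm.volterra hz x]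
      refine (norm_add_le _ _).trans (add_le_add hE ?_)
      refine norm_integral_le_of_norm_le (hai x) ?_
      filter_upwards [ae_restrict_mem measurableSet_Iic] with y hy
      exact norm_smul_volK_le hC hK hx hy _) x hx
  exact h.trans (mul_le_mul_of_nonneg_left
    (Real.exp_le_exp.mpr (integral_Iic_mono_of_nonneg hw0 hwi hx)) hC)

/-- Each step integrates the previous error once more against the weight `w`, and
`integral_Iic_mul_pow` turns the iterated integrals into powers over factorials, uniformly for `z`
in `V`. -/
theorem norm_sub_volIter_le (hm : JostLeft q₀ r u m) {C x₀ : ℝ} (hC : 0 ≤ C) {V : Set ℂ}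
    (hV : V ⊆ closedPlus q₀) (hE : ∀ z ∈ V, ‖((I * r / z, 1) : ℂ × ℂ)‖ ≤ C)
    (hK : ∀ z ∈ V, ∀ s : ℝ, 0 ≤ s → ∀ v, ‖volK q₀ r z s v‖ ≤ C * (1 + s) * ‖v‖) (n : ℕ) :
    ∀ z ∈ V, ∀ x ≤ x₀, ‖m z x - volIter q₀ r u n z x‖ ≤
      C * Real.exp (∫ y in Set.Iic x₀, volW r u C x₀ y) *
        ((∫ y in Set.Iic x, volW r u C x₀ y) ^ n / n.factorial) := by
  have hu := hm.smooth.continuous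
  have hw0 : ∀ y, 0 ≤ volW r u C x₀ y := volW_nonneg hC
  have hwi := integrableOn_volW hu hm.integrable C x₀
  set B := C * Real.exp (∫ y in Set.Iic x₀, volW r u C x₀ y) with hB
  induction n with
  | zero =>
    intro z hz x hx
    simpa [volIter] using hm.norm_le hC (hV hz) (hE z hz) (hK z hz) hx
  | succ n ih =>
    intro z hz x hx
    have hz0 := (hV hz).1
    have hreg := volRegular_volIter (x₀ := x₀) hu hm.integrable (fun z hz => (hV hz).1) hC hE hK n
    obtain ⟨B₁, _, hB₁⟩ := hreg.bounded
    obtain ⟨B₂, _, hB₂⟩ := hm.bounded (hV hz) x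
    have i1 := integrableOn_volK hu hm.integrable hz0 hC (hK z hz)
      (hm.continuous (hV hz)).continuousOn hB₂
    have i2 := integrableOn_volK hu hm.integrable hz0 hC (hK z hz) (hreg.slice hz hx)
      (fun y hy => hB₁ z hz y (hy.trans hx))
    rw [hm.volterra (hV hz) x, volIter, add_sub_add_left_eq_sub, MKdV.volInt, MKdV.volInt,
      ← integral_sub i1 i2]
    obtain ⟨i3, e3⟩ := integral_Iic_mul_pow (continuous_volW hu C x₀) hw0 hwi n x
    have e4 : ∫ y in Set.Iic x, B / n.factorial *
        (volW r u C x₀ y * (∫ t in Set.Iic y, volW r u C x₀ t) ^ n) =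
        B * ((∫ y in Set.Iic x, volW r u C x₀ y) ^ (n + 1) / (n + 1).factorial) := by
      rw [integral_const_mul, e3, Nat.factorial_succ]
      push_cast
      field_simp
    rw [← e4]
    refine norm_integral_le_of_norm_le (i3.const_mul _) ?_
    filter_upwards [ae_restrict_mem measurableSet_Iic] with y hy
    have hlin : volK q₀ r z (x - y) (m z y) - volK q₀ r z (x - y) (volIter q₀ r u n z y) =
        volK q₀ r z (x - y) (m z y - volIter q₀ r u n z y) := by
      simp only [volK, Prod.mk_sub_mk, Prod.fst_sub, Prod.snd_sub, Prod.mk.injEq]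
      constructor <;> ring
    rw [← smul_sub, hlin]
    refine (norm_smul_volK_le hC (hK z hz) hx hy _).trans ?_
    calc _ ≤ volW r u C x₀ y * (B * ((∫ y in Set.Iic y, volW r u C x₀ y) ^ n / n.factorial)) :=
          mul_le_mul_of_nonneg_left (ih z hz y (le_trans hy hx)) (hw0 y)
      _ = _ := by ring

/-- Uniform limits inherit continuity up to `Σ` and holomorphy in `D₊` from the iterates. As the
iterates involve only the potential, the same convergence also proves that the Jost function is
unique. -/
theorem tendstoUniformlyOn_volIter (hm : JostLeft q₀ r u m) {δ : ℝ} (hδ : 0 < δ) (x : ℝ) :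
    TendstoUniformlyOn (fun n z => volIter q₀ r u n z x) (fun z => m z x) atTop
      (closedPlus q₀ ∩ {z | δ ≤ ‖z‖}) := by
  obtain ⟨C, hC0, hC⟩ := exists_norm_volK_le hm.pos r hδ
  have h := fun n => hm.norm_sub_volIter_le (x₀ := x) hC0 (V := closedPlus q₀ ∩ {z | δ ≤ ‖z‖})
    Set.inter_subset_left (fun z hz => (hC z hz.1 hz.2).1) (fun z hz => (hC z hz.1 hz.2).2) n
  rw [Metric.tendstoUniformlyOn_iff]
  intro ε hε
  set B := C * Real.exp (∫ y in Set.Iic x, volW r u C x y)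
  have ht := (FloorSemiring.tendsto_pow_div_factorial_atTop
    (∫ y in Set.Iic x, volW r u C x y)).const_mul B
  rw [mul_zero] at ht
  filter_upwards [ht.eventually (gt_mem_nhds hε)] with n hn z hz
  rw [dist_eq_norm]
  exact (h n z hz x le_rfl).trans_lt hn

theorem mem_nhdsWithin_away (q₀ : ℝ) {z : ℂ} (hz : z ≠ 0) :
    closedPlus q₀ ∩ {w | ‖z‖ / 2 ≤ ‖w‖} ∈ 𝓝[closedPlus q₀] z := by
  refine inter_mem self_mem_nhdsWithin (nhdsWithin_le_nhds ?_)
  have : ∀ᶠ w in 𝓝 z, ‖z‖ / 2 < ‖w‖ :=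
    continuous_norm.continuousAt.eventually (lt_mem_nhds (half_lt_self (norm_pos_iff.mpr hz)))
  filter_upwards [this] with w hw using hw.le

/-- The Jost function is continuous in the spectral parameter up to the continuous spectrum. -/
theorem continuousOn_spectral (hm : JostLeft q₀ r u m) (x : ℝ) :
    ContinuousOn (fun z => m z x) (closedPlus q₀) := by
  intro z hz
  have hδ : 0 < ‖z‖ / 2 := half_pos (norm_pos_iff.mpr hz.1)
  obtain ⟨C, hC0, hC⟩ := exists_norm_volK_le hm.pos r hδ
  have hu := hm.smooth.continuous
  have hreg := fun n => volRegular_volIter (x₀ := x) (q₀ := q₀) (V := closedPlus q₀ ∩ {w | ‖z‖ / 2 ≤ ‖w‖})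
    hu hm.integrable (fun z hz => hz.1.1) hC0 (fun z hz => (hC z hz.1 hz.2).1)
    (fun z hz => (hC z hz.1 hz.2).2) n
  have hc : ContinuousOn (fun z => m z x) (closedPlus q₀ ∩ {w | ‖z‖ / 2 ≤ ‖w‖}) := by
    refine (hm.tendstoUniformlyOn_volIter hδ x).continuousOn (Frequently.of_forall fun n => ?_)
    exact (hreg n).continuousOn.comp (f := fun z : ℂ => (z, x)) (by fun_prop)
      fun p hp => ⟨hp, Set.mem_Iic.mpr le_rfl⟩
  refine (hc z ⟨hz, ?_⟩).mono_of_mem_nhdsWithin (mem_nhdsWithin_away q₀ hz.1)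
  have : 0 < ‖z‖ := norm_pos_iff.mpr hz.1
  exact (half_lt_self this).le

theorem _root_.MKdV.isOpen_DPlus (q₀ : ℝ) : IsOpen (DPlus q₀) := by
  have : ContinuousOn (fun z => (lam q₀ z).im) {z : ℂ | z ≠ 0} := by
    unfold lam
    exact continuous_im.comp_continuousOn
      ((continuousOn_id.add (continuousOn_const.div continuousOn_id fun _ h => h)).div_const 2)
  exact this.isOpen_inter_preimage isOpen_ne isOpen_Ioi

/-- The Jost function is holomorphic in `D₊`. -/
theorem differentiableOn_spectral (hm : JostLeft q₀ r u m) (x : ℝ) :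
    DifferentiableOn ℂ (fun z => m z x) (DPlus q₀) := by
  intro z hz
  have hδ : 0 < ‖z‖ / 2 := half_pos (norm_pos_iff.mpr hz.1)
  obtain ⟨C, hC0, hC⟩ := exists_norm_volK_le hm.pos r hδ
  have hu := hm.smooth.continuous
  set V := closedPlus q₀ ∩ {w | ‖z‖ / 2 ≤ ‖w‖} with hVdef
  have hreg := fun n => volRegular_volIter (x₀ := x) (q₀ := q₀) (V := V)
    hu hm.integrable (fun z hz => hz.1.1) hC0 (fun z hz => (hC z hz.1 hz.2).1)
    (fun z hz => (hC z hz.1 hz.2).2) n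
  have hsub : interior V ∩ {z | 0 < (lam q₀ z).im} ⊆ V := fun w hw => interior_subset hw.1
  have hopen := isOpen_interior_inter_plus q₀ (V := V) fun w hw => hw.1.1
  have hd := ((hm.tendstoUniformlyOn_volIter hδ x).mono hsub).tendstoLocallyUniformlyOn.differentiableOn
    (Eventually.of_forall fun n => (hreg n).differentiableOn x le_rfl) hopen
  refine (hd.differentiableAt (hopen.mem_nhds ⟨?_, hz.2⟩)).differentiableWithinAt
  rw [mem_interior_iff_mem_nhds]
  have h1 := mem_nhdsWithin_away q₀ hz.1
  have h2 : closedPlus q₀ ∈ 𝓝 z :=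
    mem_of_superset ((isOpen_DPlus q₀).mem_nhds hz) fun w hw => ⟨hw.1, hw.2.le⟩
  rwa [nhdsWithin_eq_nhds.mpr h2] at h1

end JostLeft

/-! ### The Jost function as `z → ∞`. -/

variable {q₀ r : ℝ} {u : ℝ → ℝ} {m : ℂ → ℝ → ℂ × ℂ}

namespace JostLeft

theorem bounded_away (hm : JostLeft q₀ r u m) (x : ℝ) :
    ∃ B, 0 ≤ B ∧ ∀ z ∈ closedPlus q₀, 1 ≤ ‖z‖ → ∀ y ≤ x, ‖m z y‖ ≤ B := by
  obtain ⟨C, hC0, hC⟩ := exists_norm_volK_le hm.pos r one_pos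
  exact ⟨C * Real.exp (∫ y in Set.Iic x, volW r u C x y), by positivity,
    fun z hz hz1 y hy => hm.norm_le hC0 hz (hC z hz hz1).1 (hC z hz hz1).2 hy⟩

/-- The growing component vanishes as `z → ∞`, uniformly on left half-lines. -/
theorem eventually_norm_grow_le (hm : JostLeft q₀ r u m) (x : ℝ) {ε : ℝ} (hε : 0 < ε) :
    ∀ᶠ z in cobounded ℂ ⊓ 𝓟 (closedPlus q₀), ∀ y ≤ x,
      ‖(m z y).1 - I * r / z * (m z y).2‖ ≤ ε := by
  obtain ⟨B, hB0, hB⟩ := hm.bounded_away x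
  set P := (1 + |r|) * B with hP
  have hρ : ∀ z : ℂ, 1 ≤ ‖z‖ → ‖I * r / z‖ ≤ |r| := by
    intro z hz
    rw [norm_div, norm_mul, norm_I, one_mul, norm_real, Real.norm_eq_abs]
    exact div_le_self (abs_nonneg _) hz
  have hp : ∀ z ∈ closedPlus q₀, 1 ≤ ‖z‖ → ∀ y ≤ x,
      ‖(m z y).2 + I * r / z * (m z y).1‖ ≤ P := by
    intro z hz hz1 y hy
    have b1 := (norm_fst_le (m z y)).trans (hB z hz hz1 y hy)
    have b2 := (norm_snd_le (m z y)).trans (hB z hz hz1 y hy)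
    refine (norm_add_le _ _).trans ?_
    rw [norm_mul]
    have := mul_le_mul (hρ z hz1) b1 (norm_nonneg _) (abs_nonneg r)
    linarith
  have htail : Tendsto (fun a => P * ∫ y in Set.Iic a, |u y - r|) atBot (𝓝 0) := by
    simpa using (tendsto_integral_Iic_atBot hm.integrableOn_abs).const_mul P
  -- To the left of `a` the smallness comes from integrability of `u - r`, uniformly in `z`; on the
  -- compact rest `[a, x]` it comes from oscillation or decay of the exponential.
  obtain ⟨a, hax, hat⟩ : ∃ a, a ≤ x ∧ P * ∫ y in Set.Iic a, |u y - r| < ε / 2 := by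
    have := (eventually_le_atBot x).and (htail.eventually (gt_mem_nhds (half_pos hε)))
    exact this.exists
  have hu := hm.smooth.continuous
  have hu' : Continuous (deriv u) := hm.smooth.continuous_deriv le_rfl
  obtain ⟨U, hU⟩ := (isCompact_Icc (a := a) (b := x)).exists_bound_of_continuousOn hu.continuousOn
  obtain ⟨U', hU'⟩ :=
    (isCompact_Icc (a := a) (b := x)).exists_bound_of_continuousOn hu'.continuousOn
  have hU0 : 0 ≤ U := (norm_nonneg _).trans (hU a ⟨le_rfl, hax⟩)
  have hU0' : 0 ≤ U' := (norm_nonneg _).trans (hU' a ⟨le_rfl, hax⟩)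
  have hP0 : 0 ≤ P := by positivity
  set M₁ := (U + |r|) * P with hM₁
  set M₂ := U' * P + (U + |r|) * ((U + q₀ ^ 2 + |r| + |r| * U) * B) with hM₂
  have hM₁0 : 0 ≤ M₁ := by positivity
  have hM₂0 : 0 ≤ M₂ := by positivity
  -- Two boundary terms and one integral over a length of at most `x - a`, each still to be divided
  -- by `‖c‖ = 2‖λ‖ ≥ (3/4)‖z‖`.
  set K := 2 * M₁ + M₂ * (x - a) with hK
  have hK0 : 0 ≤ K := add_nonneg (by positivity) (mul_nonneg hM₂0 (sub_nonneg.mpr hax))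
  have hbig : ∀ᶠ z in cobounded ℂ, max (max 1 (2 * q₀)) (4 * (K + 1) / ε) ≤ ‖z‖ :=
    tendsto_norm_cobounded_atTop.eventually (eventually_ge_atTop _)
  rw [eventually_inf_principal]
  filter_upwards [hbig] with z hzb hz
  have hz1 : 1 ≤ ‖z‖ := (le_max_left _ _).trans ((le_max_left _ _).trans hzb)
  have hz2 : 2 * q₀ ≤ ‖z‖ := (le_max_right _ _).trans ((le_max_left _ _).trans hzb)
  have hz3 : 4 * (K + 1) / ε ≤ ‖z‖ := (le_max_right _ _).trans hzb
  have hz0 : 0 < ‖z‖ := by linarith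
  have hlam := le_norm_lam hm.pos hz2
  have hlam0 : 0 < ‖lam q₀ z‖ := by linarith
  have hlamne : lam q₀ z ≠ 0 := norm_pos_iff.mp hlam0
  set ρ := I * r / z with hρdef
  set h := fun x => (m z x).1 - ρ * (m z x).2 with hh
  set p := fun x => (m z x).2 + ρ * (m z x).1 with hpdef
  have hleft : ∀ y ≤ a, ‖h y‖ ≤ ε / 2 := by
    intro y hy
    refine (hm.norm_grow_le hz fun t ht => hp z hz hz1 t (ht.trans (hy.trans hax))).trans ?_
    refine le_trans ?_ hat.le
    exact mul_le_mul_of_nonneg_left (integral_Iic_mono_of_nonneg (fun _ => abs_nonneg _)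
      hm.integrableOn_abs hy) hP0
  intro y hy
  rcases le_total y a with hya | hya
  · exact (hleft y hya).trans (by linarith)
  set c := 2 * I * lam q₀ z with hc
  have hcn : ‖c‖ = 2 * ‖lam q₀ z‖ := by simp [hc]
  have hc0 : c ≠ 0 := by
    intro h0; rw [h0, norm_zero] at hcn; linarith
  have hcpos : 0 < ‖c‖ := norm_pos_iff.mpr hc0
  set p' := fun s => -u s * (m z s).1 + I * ((q₀ : ℂ) ^ 2 / z) * (m z s).2 +
    ρ * (I * z * (m z s).1 + u s * (m z s).2) with hp'
  have hpd : ∀ s, HasDerivAt p (p' s) s := fun s =>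
    (hm.deriv2 z hz.1 hz.2 s).add ((hm.deriv1 z hz.1 hz.2 s).const_mul ρ)
  have hud : ∀ s, HasDerivAt (fun s => ((u s - r : ℝ) : ℂ)) ((deriv u s : ℝ) : ℂ) s := fun s =>
    (((hm.smooth.differentiable one_ne_zero) s).hasDerivAt.sub_const r).ofReal_comp
  -- Integration by parts: the correction `(u - r) p / c` cancels the source term of `h`, and what
  -- remains carries a factor `1/c`. This is where differentiability of the potential is needed.
  have hHd : ∀ s, HasDerivAt
      (fun s : ℝ => exp (c * ((y - s : ℝ) : ℂ)) * (h s + ((u s - r : ℝ) : ℂ) * p s / c))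
      (exp (c * ((y - s : ℝ) : ℂ)) * ((((deriv u s : ℝ) : ℂ) * p s + ((u s - r : ℝ) : ℂ) * p' s) / c))
      s := by
    intro s
    have e1 : HasDerivAt (fun s : ℝ => ((y - s : ℝ) : ℂ)) (-1) s := by
      have := ((hasDerivAt_id s).const_sub y).ofReal_comp
      simpa using this
    refine (((e1.const_mul c).cexp).mul ((hm.hasDerivAt_grow hz s).add
      (((hud s).mul (hpd s)).div_const c))).congr_deriv ?_
    simp only [← hρdef, hpdef, Pi.add_apply, Pi.mul_apply]
    field_simp
    ring
  have hp'n : ∀ s ∈ Set.Icc a x, ‖p' s‖ ≤ (U + q₀ ^ 2 + |r| + |r| * U) * B := by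
    intro s hs
    have b1 := (norm_fst_le (m z s)).trans (hB z hz hz1 s hs.2)
    have b2 := (norm_snd_le (m z s)).trans (hB z hz hz1 s hs.2)
    have b3 : ‖(u s : ℂ)‖ ≤ U := by rw [norm_real]; exact hU s hs
    -- Since `ρ z = ir`, the factor `z` in the derivative of the first component disappears, so `p'`
    -- stays bounded as `z → ∞`.
    have e : p' s = -u s * (m z s).1 + I * ((q₀ : ℂ) ^ 2 / z) * (m z s).2 +
        (-r * (m z s).1 + ρ * u s * (m z s).2) := by
      have : ρ * z = I * r := by rw [hρdef]; field_simp [hz.1]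
      simp only [hp']
      linear_combination (I * (m z s).1) * this + r * (m z s).1 * I_sq
    have b4 : ‖(q₀ : ℂ) ^ 2 / z‖ ≤ q₀ ^ 2 := by
      rw [norm_div, norm_pow, norm_real, Real.norm_eq_abs, sq_abs]
      exact div_le_self (sq_nonneg _) hz1
    have b5 := hρ z hz1
    rw [e]
    refine (norm_add_le _ _).trans ((add_le_add (norm_add_le _ _) (norm_add_le _ _)).trans ?_)
    simp only [norm_mul, norm_neg, norm_I, one_mul, norm_real (r := r), Real.norm_eq_abs]
    have d1 := mul_le_mul b3 b1 (norm_nonneg _) hU0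
    have d2 := mul_le_mul b4 b2 (norm_nonneg _) (sq_nonneg q₀)
    have d3 := mul_le_mul_of_nonneg_left b1 (abs_nonneg r)
    have d4 := mul_le_mul (mul_le_mul b5 b3 (norm_nonneg _) (abs_nonneg r)) b2 (norm_nonneg _)
      (by positivity)
    linarith
  have hΔn : ∀ s ∈ Set.Icc a x, ‖((u s - r : ℝ) : ℂ)‖ ≤ U + |r| := by
    intro s hs
    rw [norm_real]
    exact (norm_sub_le _ _).trans (add_le_add (hU s hs) le_rfl)
  have hΔp : ∀ s ∈ Set.Icc a x, ‖((u s - r : ℝ) : ℂ) * p s / c‖ ≤ M₁ / ‖c‖ := by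
    intro s hs
    rw [norm_div, norm_mul]
    refine div_le_div_of_nonneg_right ?_ hcpos.le
    exact mul_le_mul (hΔn s hs) (hp z hz hz1 s hs.2) (norm_nonneg _) (by positivity)
  have hexp : ∀ s ≤ y, ‖exp (c * ((y - s : ℝ) : ℂ))‖ ≤ 1 := fun s hs =>
    norm_exp_phase_le hz.2 (sub_nonneg.mpr hs)
  have hmv := (convex_Icc a y).norm_image_sub_le_of_norm_hasDerivWithin_le (C := M₂ / ‖c‖)
    (fun s _ => (hHd s).hasDerivWithinAt) (fun s hs => by
      have hs' : s ∈ Set.Icc a x := ⟨hs.1, hs.2.trans hy⟩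
      rw [norm_mul, norm_div]
      refine (mul_le_of_le_one_left (by positivity) (hexp s hs.2)).trans ?_
      refine div_le_div_of_nonneg_right ((norm_add_le _ _).trans ?_) hcpos.le
      rw [norm_mul, norm_mul, norm_real]
      exact add_le_add (mul_le_mul (hU' s hs') (hp z hz hz1 s hs'.2) (norm_nonneg _) hU0')
        (mul_le_mul (hΔn s hs') (hp'n s hs') (norm_nonneg _) (by positivity)))
    (Set.left_mem_Icc.mpr hya) (Set.right_mem_Icc.mpr hya)
  simp only [sub_self, ofReal_zero, mul_zero, exp_zero, one_mul] at hmv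
  have hy' : y ∈ Set.Icc a x := ⟨hya, hy⟩
  have ha' : a ∈ Set.Icc a x := ⟨le_rfl, hax⟩
  set T := exp (c * ((y - a : ℝ) : ℂ)) * (h a + ((u a - r : ℝ) : ℂ) * p a / c) with hT
  have hTn : ‖T‖ ≤ ε / 2 + M₁ / ‖c‖ := by
    rw [hT, norm_mul]
    refine (mul_le_of_le_one_left (norm_nonneg _) (hexp a hya)).trans ?_
    exact (norm_add_le _ _).trans (add_le_add (hleft a le_rfl) (hΔp a ha'))
  have hfin : ‖h y‖ ≤ M₂ / ‖c‖ * ‖y - a‖ + (ε / 2 + M₁ / ‖c‖) + M₁ / ‖c‖ := by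
    have e : h y = ((h y + ((u y - r : ℝ) : ℂ) * p y / c - T) + T) -
        ((u y - r : ℝ) : ℂ) * p y / c := by ring
    rw [e]
    exact (norm_sub_le _ _).trans (add_le_add ((norm_add_le _ _).trans (add_le_add hmv hTn))
      (hΔp y hy'))
  refine hfin.trans ?_
  have hya' : ‖y - a‖ ≤ x - a := by
    rw [Real.norm_eq_abs, abs_of_nonneg (by linarith)]; linarith
  have hKc : K / ‖c‖ ≤ ε / 2 := by
    rw [div_le_iff₀ hcpos, hcn]
    have h4 : 4 * (K + 1) ≤ ‖z‖ * ε := (div_le_iff₀ hε).mp hz3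
    nlinarith
  have : M₂ / ‖c‖ * ‖y - a‖ ≤ M₂ * (x - a) / ‖c‖ := by
    rw [div_mul_eq_mul_div]
    exact div_le_div_of_nonneg_right (mul_le_mul_of_nonneg_left hya' hM₂0) hcpos.le
  have e5 : K / ‖c‖ = M₁ / ‖c‖ + M₁ / ‖c‖ + M₂ * (x - a) / ‖c‖ := by rw [hK]; ring
  linarith

/-- The Jost function tends to `(0, 1)` as `z → ∞` in the closed region `D₊ ∪ Σ`. -/
theorem tendsto_cobounded (hm : JostLeft q₀ r u m) (x : ℝ) :
    Tendsto (fun z => m z x) (cobounded ℂ ⊓ 𝓟 (closedPlus q₀)) (𝓝 (0, 1)) := by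
  obtain ⟨B, hB0, hB⟩ := hm.bounded_away x
  set N := ∫ y in Set.Iic x, |u y - r| with hN
  have hN0 : 0 ≤ N := integral_nonneg fun _ => abs_nonneg _
  rw [Metric.tendsto_nhds]
  intro ε hε
  -- The final bounds are `2η` for the first component and `2ηN + η` for the second, both below `ε`.
  set η := ε / (2 * N + 3) with hη
  have hη0 : 0 < η := by positivity
  have hηε : η * (2 * N + 3) = ε := by rw [hη]; field_simp
  have hρ0 : Tendsto (fun z : ℂ => I * r / z) (cobounded ℂ) (𝓝 0) := by
    simpa [div_eq_mul_inv] using (tendsto_inv₀_cobounded (α := ℂ)).const_mul (I * (r : ℂ))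
  have hρ1 : ∀ᶠ z in cobounded ℂ, ‖I * r / z‖ < min 1 (η / (2 * (B + 1))) := by
    have := hρ0.norm
    rw [norm_zero] at this
    exact this.eventually (gt_mem_nhds (by positivity))
  have hz1 : ∀ᶠ z in cobounded ℂ, (1 : ℝ) ≤ ‖z‖ :=
    tendsto_norm_cobounded_atTop.eventually (eventually_ge_atTop _)
  filter_upwards [hm.eventually_norm_grow_le x hη0, inf_le_left (a := cobounded ℂ) hρ1,
    inf_le_left (a := cobounded ℂ) hz1, inf_le_right (a := cobounded ℂ) (mem_principal_self _)]
    with z hgrow hρ hz1 hz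
  set ρ := I * r / z with hρdef
  have hρB : ‖ρ‖ * (2 * (B + 1)) ≤ η :=
    ((lt_div_iff₀ (by positivity)).mp (hρ.trans_le (min_le_right _ _))).le
  have hρ1 : ‖ρ‖ ≤ 1 := hρ.le.trans (min_le_left _ _)
  have hρn := norm_nonneg ρ
  have b1 : ∀ y ≤ x, ‖(m z y).1‖ ≤ B := fun y hy => (norm_fst_le _).trans (hB z hz hz1 y hy)
  have b2 : ∀ y ≤ x, ‖(m z y).2‖ ≤ B := fun y hy => (norm_snd_le _).trans (hB z hz hz1 y hy)
  have hm1 : ‖(m z x).1‖ ≤ 2 * η := by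
    have e : (m z x).1 = ((m z x).1 - ρ * (m z x).2) + ρ * (m z x).2 := by ring
    rw [e]
    refine (norm_add_le _ _).trans ?_
    rw [norm_mul]
    have := mul_le_mul_of_nonneg_left (b2 x le_rfl) hρn
    have := hgrow x le_rfl
    nlinarith
  -- The combination `m₂ - ρ m₁` is conserved by the constant background, so no exponential appears.
  -- Its derivative is controlled by `m₁ + ρ m₂`, which is the growing component plus `2ρ m₂`, hence
  -- small.
  have hd : ∀ y, HasDerivAt (fun y => (m z y).2 - ρ * (m z y).1)
      (-((u y - r : ℝ) : ℂ) * ((m z y).1 + ρ * (m z y).2)) y := by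
    intro y
    refine ((hm.deriv2 z hz.1 hz.2 y).sub ((hm.deriv1 z hz.1 hz.2 y).const_mul ρ)).congr_deriv ?_
    have hzρ : ρ * z = I * r := by rw [hρdef]; field_simp [hz.1]
    have h3 : (q₀ : ℂ) ^ 2 = (r : ℂ) ^ 2 := by exact_mod_cast hm.sq.symm
    have hq : (r : ℂ) ^ 2 / z = - I * r * ρ := by
      rw [hρdef, div_eq_mul_inv, div_eq_mul_inv]; linear_combination r ^ 2 * z⁻¹ * I_sq
    rw [h3, hq]
    push_cast
    linear_combination (-I * (m z y).1) * hzρ - r * ((m z y).1 + ρ * (m z y).2) * I_sq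
  have hbd : ∀ y ≤ x, ‖-((u y - r : ℝ) : ℂ) * ((m z y).1 + ρ * (m z y).2)‖ ≤
      2 * η * |u y - r| := by
    intro y hy
    have e : (m z y).1 + ρ * (m z y).2 = ((m z y).1 - ρ * (m z y).2) + 2 * (ρ * (m z y).2) := by
      ring
    rw [norm_mul, norm_neg, norm_real, Real.norm_eq_abs, e, mul_comm]
    refine mul_le_mul_of_nonneg_right ((norm_add_le _ _).trans ?_) (abs_nonneg _)
    rw [norm_mul, norm_mul, Complex.norm_ofNat]
    have := mul_le_mul_of_nonneg_left (b2 y hy) hρn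
    have := hgrow y hy
    nlinarith
  have hmc := hm.continuous hz
  have hu := hm.smooth.continuous
  have hint : IntegrableOn (fun y => -((u y - r : ℝ) : ℂ) * ((m z y).1 + ρ * (m z y).2))
      (Set.Iic x) := by
    refine Integrable.mono' ((hm.integrableOn_abs x).const_mul (2 * η))
      (by fun_prop : Continuous _).aestronglyMeasurable ?_
    filter_upwards [ae_restrict_mem measurableSet_Iic] with y hy using hbd y hy
  have ht : Tendsto (fun y => (m z y).2 - ρ * (m z y).1) atBot (𝓝 (1 - ρ * ρ)) := by
    have hl := hm.lim z hz.1 hz.2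
    exact ((continuous_snd.tendsto _).comp hl).sub
      (((continuous_fst.tendsto _).comp hl).const_mul ρ)
  have hI := integral_Iic_of_hasDerivAt_of_tendsto (hd x).continuousAt.continuousWithinAt
    (fun y _ => hd y) hint ht
  have hIn : ‖((m z x).2 - ρ * (m z x).1) - (1 - ρ * ρ)‖ ≤ 2 * η * N := by
    rw [← hI, hN, ← integral_const_mul]
    refine norm_integral_le_of_norm_le ((hm.integrableOn_abs x).const_mul (2 * η)) ?_
    filter_upwards [ae_restrict_mem measurableSet_Iic] with y hy using hbd y hy
  have hm2 : ‖(m z x).2 - 1‖ ≤ 2 * η * N + η := by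
    have e : (m z x).2 - 1 = (((m z x).2 - ρ * (m z x).1) - (1 - ρ * ρ)) +
        (ρ * (m z x).1 - ρ * ρ) := by ring
    rw [e]
    refine (norm_add_le _ _).trans (add_le_add hIn ((norm_sub_le _ _).trans ?_))
    rw [norm_mul, norm_mul]
    have := mul_le_mul_of_nonneg_left (b1 x le_rfl) hρn
    have := mul_le_mul_of_nonneg_left hρ1 hρn
    nlinarith
  rw [dist_eq_norm, Prod.norm_def]
  refine max_lt ?_ ?_
  · simp only [Prod.fst_sub, sub_zero]
    refine hm1.trans_lt ?_
    nlinarith [mul_nonneg hη0.le hN0]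
  · simp only [Prod.snd_sub]
    refine hm2.trans_lt ?_
    nlinarith [mul_nonneg hη0.le hN0]

end JostLeft

/-! ### The rational interpolation problem -/

theorem lam_neg_div {q₀ : ℝ} (hq : q₀ ≠ 0) {z : ℂ} (hz : z ≠ 0) :
    lam q₀ (-((q₀ : ℂ) ^ 2 / z)) = -lam q₀ z := by
  have : (q₀ : ℂ) ≠ 0 := by exact_mod_cast hq
  unfold lam; field_simp; ring

theorem kk_neg_div {q₀ : ℝ} (hq : q₀ ≠ 0) {z : ℂ} (hz : z ≠ 0) :
    kk q₀ (-((q₀ : ℂ) ^ 2 / z)) = kk q₀ z := by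
  have : (q₀ : ℂ) ≠ 0 := by exact_mod_cast hq
  unfold kk; field_simp; ring

theorem lam_conj (q₀ : ℝ) (z : ℂ) : lam q₀ (conj z) = conj (lam q₀ z) := by
  simp [lam, Complex.conj_ofNat]

theorem kk_conj (q₀ : ℝ) (z : ℂ) : kk q₀ (conj z) = conj (kk q₀ z) := by
  simp [kk, Complex.conj_ofNat]

theorem lam_neg (q₀ : ℝ) (z : ℂ) : lam q₀ (-z) = -lam q₀ z := by
  simp only [lam, div_neg]; ring

theorem kk_neg (q₀ : ℝ) (z : ℂ) : kk q₀ (-z) = -kk q₀ z := by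
  simp only [kk, div_neg]; ring

theorem neg_div_ne_zero {q₀ : ℝ} (hq : q₀ ≠ 0) {z : ℂ} (hz : z ≠ 0) :
    -((q₀ : ℂ) ^ 2 / z) ≠ 0 := by
  have : (q₀ : ℂ) ≠ 0 := by exact_mod_cast hq
  exact neg_ne_zero.mpr (div_ne_zero (pow_ne_zero 2 this) hz)

theorem neg_div_mem_DMinus {q₀ : ℝ} (hq : q₀ ≠ 0) {z : ℂ} (hz : z ∈ DPlus q₀) :
    -((q₀ : ℂ) ^ 2 / z) ∈ DMinus q₀ :=
  ⟨neg_div_ne_zero hq hz.1, by rw [lam_neg_div hq hz.1, neg_im]; linarith [hz.2]⟩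

variable {ι : Type*}

/-- A Cauchy matrix with distinct nodes is nonsingular. -/
theorem eq_zero_of_cauchy [Fintype ι] [DecidableEq ι] {p s c : ι → ℂ} (hp : Function.Injective p)
    (hs : Function.Injective s) (hps : ∀ k n, p k ≠ s n)
    (h : ∀ k, ∑ n, c n / (p k - s n) = 0) : c = 0 := by
  classical
  -- The numerator of `Σ c_n/(x - s_n)`: its degree is below the number of its roots `p k`, so it
  -- vanishes, and its value at `s n` isolates `c n`.
  set P : Polynomial ℂ := ∑ n, Polynomial.C (c n) *
    ∏ j ∈ Finset.univ.erase n, (Polynomial.X - Polynomial.C (s j)) with hP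
  have heval : ∀ x, P.eval x = ∑ n, c n * ∏ j ∈ Finset.univ.erase n, (x - s j) := by
    intro x
    simp [hP, Polynomial.eval_finsetSum, Polynomial.eval_prod]
  have hdeg : P.degree < Fintype.card ι := by
    refine lt_of_le_of_lt (Polynomial.degree_sum_le _ _) ?_
    rw [Finset.sup_lt_iff (by exact_mod_cast WithBot.bot_lt_coe _)]
    intro n _
    refine lt_of_le_of_lt (Polynomial.degree_mul_le _ _) ?_
    have h1 : (∏ j ∈ Finset.univ.erase n, (Polynomial.X - Polynomial.C (s j))).degree =
        ((Finset.univ.erase n).card : WithBot ℕ) := by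
      rw [Polynomial.degree_prod]
      simp
    have h2 : (Finset.univ.erase n).card < Fintype.card ι :=
      Finset.card_lt_univ_of_notMem (Finset.notMem_erase n _)
    rw [h1]
    calc (Polynomial.C (c n)).degree + ((Finset.univ.erase n).card : WithBot ℕ)
        ≤ 0 + ((Finset.univ.erase n).card : WithBot ℕ) := by
          gcongr; exact Polynomial.degree_C_le
      _ < _ := by rw [zero_add]; exact_mod_cast h2
  have hroot : ∀ k, P.eval (p k) = 0 := by
    intro k
    rw [heval]
    have hprod : ∏ j, (p k - s j) ≠ 0 :=
      Finset.prod_ne_zero_iff.mpr fun j _ => sub_ne_zero.mpr (hps k j)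
    have : ∑ n, c n * ∏ j ∈ Finset.univ.erase n, (p k - s j) =
        (∏ j, (p k - s j)) * ∑ n, c n / (p k - s n) := by
      rw [Finset.mul_sum]
      refine Finset.sum_congr rfl fun n _ => ?_
      rw [← Finset.mul_prod_erase Finset.univ (fun j => p k - s j) (Finset.mem_univ n)]
      have := sub_ne_zero.mpr (hps k n)
      field_simp
    rw [this, h k, mul_zero]
  have hP0 : P = 0 := by
    refine Polynomial.eq_zero_of_degree_lt_of_eval_finset_eq_zero (Finset.univ.image p) ?_ ?_
    · rwa [Finset.card_image_of_injective _ hp, Finset.card_univ]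
    · intro x hx
      obtain ⟨k, _, rfl⟩ := Finset.mem_image.mp hx
      exact hroot k
  funext n
  have h3 := heval (s n)
  rw [hP0, Polynomial.eval_zero, Finset.sum_eq_single n] at h3
  · have : ∏ j ∈ Finset.univ.erase n, (s n - s j) ≠ 0 := by
      refine Finset.prod_ne_zero_iff.mpr fun j hj => sub_ne_zero.mpr fun h => ?_
      exact (Finset.mem_erase.mp hj).1 (hs h).symm
    exact (mul_eq_zero.mp h3.symm).resolve_right this
  · intro b _ hb
    rw [Finset.prod_eq_zero (i := n) (Finset.mem_erase.mpr ⟨hb.symm, Finset.mem_univ _⟩) (sub_self _),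
      mul_zero]
  · simp

/-- A system of poles `η` in `D₊` that is symmetric under `η ↦ -η*` and `η ↦ q₀²/η`. -/
structure PoleSys (q₀ r : ℝ) (η : ι → ℂ) (σ τ : ι → ι) : Prop where
  pos : 0 < q₀
  sq : r ^ 2 = q₀ ^ 2
  inj : Function.Injective η
  mem : ∀ k, η k ∈ DPlus q₀
  eta_conj : ∀ k, η (σ k) = -conj (η k)
  eta_inv : ∀ k, η (τ k) = (q₀ : ℂ) ^ 2 / η k

/-- Symmetric coefficients in the residue conditions. -/
structure SymmCoeff (σ τ : ι → ι) (κ : ι → ℂ) : Prop where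
  ne_zero : ∀ k, κ k ≠ 0
  coef_conj : ∀ k, conj (κ k) = -κ (σ k)
  coef_inv : ∀ k, κ (τ k) = κ k

/-- The point `η̂ = -q₀²/η`. -/
def hat (q₀ : ℝ) (z : ℂ) : ℂ := -((q₀ : ℂ) ^ 2 / z)

/-- `Σ c_n / (z - η̂_n)`. -/
def pfrac [Fintype ι] (q₀ : ℝ) (η c : ι → ℂ) (z : ℂ) : ℂ := ∑ n, c n / (z - hat q₀ (η n))

namespace PoleSys

variable {q₀ r : ℝ} {η : ι → ℂ} {σ τ : ι → ι}

theorem ne_zero (h : PoleSys q₀ r η σ τ) (k : ι) : η k ≠ 0 := (h.mem k).1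

theorem q_ne (h : PoleSys q₀ r η σ τ) : (q₀ : ℂ) ≠ 0 := by exact_mod_cast h.pos.ne'

theorem sqC (h : PoleSys q₀ r η σ τ) : (r : ℂ) ^ 2 = (q₀ : ℂ) ^ 2 := by exact_mod_cast h.sq

theorem r_ne (h : PoleSys q₀ r η σ τ) : (r : ℂ) ≠ 0 := by
  intro h0
  have := h.sqC
  rw [h0] at this
  exact pow_ne_zero 2 h.q_ne (by simpa using this.symm)

theorem hat_mem (h : PoleSys q₀ r η σ τ) (k : ι) : hat q₀ (η k) ∈ DMinus q₀ :=
  neg_div_mem_DMinus h.pos.ne' (h.mem k)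

theorem hat_ne_zero (h : PoleSys q₀ r η σ τ) (k : ι) : hat q₀ (η k) ≠ 0 := (h.hat_mem k).1

theorem hat_hat (h : PoleSys q₀ r η σ τ) {z : ℂ} (hz : z ≠ 0) : hat q₀ (hat q₀ z) = z := by
  have := h.q_ne
  unfold hat; field_simp

theorem hat_inj (h : PoleSys q₀ r η σ τ) : Function.Injective fun k => hat q₀ (η k) := by
  intro a b hab
  apply h.inj
  have := congrArg (hat q₀) hab
  simpa only [h.hat_hat (h.ne_zero a), h.hat_hat (h.ne_zero b)] using this

theorem ne_hat (h : PoleSys q₀ r η σ τ) (k n : ι) : η k ≠ hat q₀ (η n) := by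
  intro he
  have h1 := (h.mem k).2
  have h2 := (h.hat_mem n).2
  rw [he] at h1
  exact lt_asymm h1 h2

theorem ne_hat_of_nonneg (h : PoleSys q₀ r η σ τ) {z : ℂ} (hz : 0 ≤ (lam q₀ z).im) (n : ι) :
    z ≠ hat q₀ (η n) := by
  intro he
  have h2 := (h.hat_mem n).2
  rw [← he] at h2
  linarith

theorem ne_of_nonpos (h : PoleSys q₀ r η σ τ) {z : ℂ} (hz : (lam q₀ z).im ≤ 0) (n : ι) :
    z ≠ η n := by
  intro he
  have h2 := (h.mem n).2
  rw [← he] at h2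
  linarith

theorem inv_inv (h : PoleSys q₀ r η σ τ) (k : ι) : τ (τ k) = k := by
  apply h.inj
  rw [h.eta_inv, h.eta_inv]
  have := h.ne_zero k
  have := h.q_ne
  field_simp

theorem conj_conj (h : PoleSys q₀ r η σ τ) (k : ι) : σ (σ k) = k := by
  apply h.inj
  rw [h.eta_conj, h.eta_conj]; simp

theorem conj_inv (h : PoleSys q₀ r η σ τ) (k : ι) : σ (τ k) = τ (σ k) := by
  apply h.inj
  rw [h.eta_conj, h.eta_inv, h.eta_inv, h.eta_conj]; simp [div_neg]

theorem hat_inv (h : PoleSys q₀ r η σ τ) (k : ι) : hat q₀ (η (τ k)) = -η k := by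
  rw [h.eta_inv, hat]
  have := h.ne_zero k
  have := h.q_ne
  field_simp

theorem hat_conj (h : PoleSys q₀ r η σ τ) (k : ι) : hat q₀ (η (σ k)) = -conj (hat q₀ (η k)) := by
  rw [h.eta_conj]; simp [hat, div_neg]

/-- Complex conjugation exchanges the points `η̂` with the points `η`; the permutation of labels is
`τσ`. -/
theorem conj_hat (h : PoleSys q₀ r η σ τ) (k : ι) : conj (hat q₀ (η k)) = η (τ (σ k)) := by
  rw [h.eta_inv, h.eta_conj]; simp [hat, div_neg]

theorem conj_eta (h : PoleSys q₀ r η σ τ) (k : ι) : starRingEnd ℂ (η k) = hat q₀ (η (τ (σ k))) := by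
  rw [h.hat_inv, h.eta_conj]; simp

variable [Fintype ι]

/-- `(ir/z) f(-q₀²/z)` in partial fractions. -/
theorem mul_pfrac_hat (h : PoleSys q₀ r η σ τ) (c : ι → ℂ) {z : ℂ} (hz : z ≠ 0)
    (hzn : ∀ n, z ≠ η n) :
    I * r / z * pfrac q₀ η c (hat q₀ z) =
      ∑ n, (I * r * η n / (q₀ : ℂ) ^ 2 * c n) / (z - η n) := by
  rw [pfrac, Finset.mul_sum]
  refine Finset.sum_congr rfl fun n _ => ?_
  have h1 := h.ne_zero n
  have h2 := h.q_ne
  have h3 : z - η n ≠ 0 := sub_ne_zero.mpr (hzn n)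
  have h4 : hat q₀ z - hat q₀ (η n) = (q₀ : ℂ) ^ 2 * (z - η n) / (z * η n) := by
    unfold hat; field_simp; ring
  rw [h4]; field_simp

theorem differentiableOn_pfrac (q₀ : ℝ) (η c : ι → ℂ) {S : Set ℂ}
    (hS : ∀ z ∈ S, ∀ n, z ≠ hat q₀ (η n)) : DifferentiableOn ℂ (pfrac q₀ η c) S := by
  unfold pfrac
  refine DifferentiableOn.fun_sum fun n _ => ?_
  exact (differentiableOn_const _).div (differentiableOn_id.sub (differentiableOn_const _))
    fun z hz => sub_ne_zero.mpr (hS z hz n)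

end PoleSys

theorem tendsto_cobounded_div_sub (c s : ℂ) : Tendsto (fun z => c / (z - s)) (cobounded ℂ) (𝓝 0) := by
  have : Tendsto (fun z : ℂ => z - s) (cobounded ℂ) (cobounded ℂ) := by
    simp [sub_eq_add_neg]
  simpa [div_eq_mul_inv] using (tendsto_inv₀_cobounded.comp this).const_mul c

theorem tendsto_cobounded_sum_div_sub [Fintype ι] (c s : ι → ℂ) :
    Tendsto (fun z => ∑ n, c n / (z - s n)) (cobounded ℂ) (𝓝 0) := by
  simpa using tendsto_finsetSum Finset.univ fun n _ => tendsto_cobounded_div_sub (c n) (s n)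

/-- The residue of a sum of simple fractions. -/
theorem tendsto_sub_mul_sum_div_sub [Fintype ι] (c s : ι → ℂ) (hs : Function.Injective s) (k : ι) :
    Tendsto (fun z => (z - s k) * ∑ n, c n / (z - s n)) (𝓝[≠] (s k)) (𝓝 (c k)) := by
  classical
  have h1 : Tendsto (fun z => c k + (z - s k) * ∑ n ∈ Finset.univ.erase k, c n / (z - s n))
      (𝓝[≠] (s k)) (𝓝 (c k + (s k - s k) * ∑ n ∈ Finset.univ.erase k, c n / (s k - s n))) := by
    refine Tendsto.mono_left ?_ nhdsWithin_le_nhds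
    refine tendsto_const_nhds.add ((tendsto_id.sub_const _).mul (tendsto_finsetSum _ fun n hn => ?_))
    refine tendsto_const_nhds.div (tendsto_id.sub_const _) (sub_ne_zero.mpr fun h => ?_)
    exact (Finset.mem_erase.mp hn).1 (hs h).symm
  rw [sub_self, zero_mul, add_zero] at h1
  refine h1.congr' ?_
  filter_upwards [self_mem_nhdsWithin] with z hz
  rw [← Finset.add_sum_erase Finset.univ (fun n => c n / (z - s n)) (Finset.mem_univ k)]
  have : z - s k ≠ 0 := sub_ne_zero.mpr hz
  field_simp

namespace PoleSys

variable {q₀ r : ℝ} {η : ι → ℂ} {σ τ : ι → ι} [Fintype ι]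

theorem tendsto_mul_pfrac (h : PoleSys q₀ r η σ τ) (c : ι → ℂ) (k : ι) :
    Tendsto (fun z => (z - hat q₀ (η k)) * pfrac q₀ η c z) (𝓝[≠] (hat q₀ (η k))) (𝓝 (c k)) :=
  tendsto_sub_mul_sum_div_sub c (fun n => hat q₀ (η n)) h.hat_inj k

theorem continuousAt_pfrac (c : ι → ℂ) {z : ℂ} (hz : ∀ n, z ≠ hat q₀ (η n)) :
    ContinuousAt (pfrac q₀ η c) z := by
  unfold pfrac
  refine tendsto_finsetSum _ fun n _ => ?_
  exact continuousAt_const.div (continuousAt_id.sub continuousAt_const) (sub_ne_zero.mpr (hz n))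

/-- Uniqueness for the interpolation problem: a sum of simple fractions with residues
`κ_n f(η_n)` at `η̂_n` vanishes. -/
theorem eq_zero_of_residue [DecidableEq ι] (h : PoleSys q₀ r η σ τ) {κ : ι → ℂ}
    (hκ : SymmCoeff σ τ κ) {c : ι → ℂ} (hc : ∀ k, c k = κ k * pfrac q₀ η c (η k)) : c = 0 := by
  classical
  set f := pfrac q₀ η c with hf
  set b : ι → ℂ := fun n => I * r * η n / (q₀ : ℂ) ^ 2 * c n with hb
  set g : ℂ → ℂ := fun z => ∑ n, b n / (z - η n) with hg
  set F : ℂ → ℂ := fun z => f z * starRingEnd ℂ (f (conj z)) + g z * starRingEnd ℂ (g (conj z)) with hF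
  have hq := h.q_ne
  have hgk : ∀ k, g (hat q₀ (η k)) = I * r / hat q₀ (η k) * f (η k) := by
    intro k
    rw [hg]
    simp only
    rw [← h.mul_pfrac_hat c (h.hat_ne_zero k) fun n => (h.ne_hat n k).symm, h.hat_hat (h.ne_zero k)]
  set S : Finset ℂ := Finset.univ.image η ∪ Finset.univ.image (fun n => hat q₀ (η n)) with hS
  have hS1 : ∀ z ∉ S, ∀ n, z ≠ η n := fun z hz n hn =>
    hz (Finset.mem_union_left _ (Finset.mem_image.mpr ⟨n, Finset.mem_univ _, hn.symm⟩))
  have hS2 : ∀ z ∉ S, ∀ n, z ≠ hat q₀ (η n) := fun z hz n hn =>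
    hz (Finset.mem_union_right _ (Finset.mem_image.mpr ⟨n, Finset.mem_univ _, hn.symm⟩))
  have hfc : ∀ z, conj (f (conj z)) = ∑ n, conj (c n) / (z - η (τ (σ n))) := by
    intro z
    simp only [hf, pfrac, map_sum, map_div₀, map_sub, starRingEnd_self_apply, h.conj_hat]
  have hgc : ∀ z, conj (g (conj z)) = ∑ n, conj (b n) / (z - hat q₀ (η (τ (σ n)))) := by
    intro z
    simp only [hg, map_sum, map_div₀, map_sub, starRingEnd_self_apply, h.conj_eta]
  have hμi : Function.Injective fun n => τ (σ n) := by
    intro a b hab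
    have := congrArg (fun n => σ (τ n)) hab
    simpa [h.inv_inv, h.conj_conj] using this
  have hsymm : ∀ z, F (conj z) = conj (F z) := by
    intro z
    simp only [hF, map_add, map_mul, starRingEnd_self_apply]
    ring
  have hres1 : ∀ k, Tendsto (fun z => (z - η k) * F z) (𝓝[≠] (η k)) (𝓝 0) := by
    intro k
    set j := τ (σ k) with hj
    have hjk : τ (σ j) = k := by rw [hj, h.conj_inv, h.inv_inv, h.conj_conj]
    have e1 : Tendsto (fun z => (z - η k) * conj (f (conj z))) (𝓝[≠] (η k)) (𝓝 (conj (c j))) := by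
      have := tendsto_sub_mul_sum_div_sub (fun n => conj (c n)) (fun n => η (τ (σ n)))
        (h.inj.comp hμi) j
      simp only [hjk] at this
      exact this.congr fun z => by rw [hfc]
    have e2 : Tendsto (fun z => (z - η k) * g z) (𝓝[≠] (η k)) (𝓝 (b k)) :=
      tendsto_sub_mul_sum_div_sub b η h.inj k
    have e3 : Tendsto f (𝓝[≠] (η k)) (𝓝 (f (η k))) :=
      (continuousAt_pfrac c fun n => h.ne_hat k n).tendsto.mono_left nhdsWithin_le_nhds
    have e4 : Tendsto (fun z => conj (g (conj z))) (𝓝[≠] (η k)) (𝓝 (conj (g (conj (η k))))) := by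
      refine Tendsto.mono_left ?_ nhdsWithin_le_nhds
      simp only [hgc]
      refine tendsto_finsetSum _ fun n _ => ?_
      exact tendsto_const_nhds.div (tendsto_id.sub_const _) (sub_ne_zero.mpr (h.ne_hat k _))
    have e5 := (e3.mul e1).add (e2.mul e4)
    -- At `η_k` the residue of `f(z*)*` is `-κ_k f(η_j)*` by the symmetries of `κ`, while `g` has
    -- residue `b_k` and `g(η̂_j)` is a multiple of `f(η_j)`. The two contributions cancel because
    -- `r² = q₀²`.
    have e6 : f (η k) * conj (c j) + b k * conj (g (conj (η k))) = 0 := by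
      rw [h.conj_eta, ← hj, hgk j, hb, hc j]
      simp only [hc k, map_mul, map_div₀, conj_I, conj_ofReal, h.conj_hat, hjk, hκ.coef_conj]
      rw [show κ (σ j) = κ k by rw [← hκ.coef_inv (σ j), hjk]]
      have := h.ne_zero k
      have hI : I * I = -1 := I_mul_I
      have hr := h.sqC
      have h1 : I * (r : ℂ) * η k / (q₀ : ℂ) ^ 2 * (κ k * f (η k)) *
          (-I * r / η k * conj (f (η j))) =
          (r : ℂ) ^ 2 / (q₀ : ℂ) ^ 2 * (κ k * f (η k) * conj (f (η j))) * (-(I * I)) := by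
        field_simp
      rw [h1, hr, hI, div_self (pow_ne_zero 2 hq)]
      ring
    rw [e6] at e5
    refine e5.congr fun z => ?_
    rw [hF]; ring
  have hres2 : ∀ k, Tendsto (fun z => (z - hat q₀ (η k)) * F z) (𝓝[≠] (hat q₀ (η k))) (𝓝 0) := by
    intro k
    have hcj : Tendsto (fun z : ℂ => conj z) (𝓝[≠] (hat q₀ (η k))) (𝓝[≠] (η (τ (σ k)))) := by
      refine tendsto_nhdsWithin_iff.mpr ⟨?_, ?_⟩
      · rw [← h.conj_hat]
        exact (Complex.continuous_conj.tendsto _).mono_left nhdsWithin_le_nhds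
      · filter_upwards [self_mem_nhdsWithin] with z hz hz'
        apply hz
        have : conj z = η (τ (σ k)) := hz'
        rw [← h.conj_hat] at this
        exact (starRingEnd ℂ).injective this
    have := (Complex.continuous_conj.tendsto _).comp ((hres1 (τ (σ k))).comp hcj)
    rw [map_zero] at this
    refine this.congr fun z => ?_
    simp only [Function.comp, hsymm, map_mul, map_sub, starRingEnd_self_apply, ← h.conj_hat]
  have hF0 : ∀ z ∉ S, F z = 0 := by
    refine eq_of_removable_of_tendsto S F 0 ?_ ?_ ?_
    · have hd1 : DifferentiableOn ℂ f (↑S : Set ℂ)ᶜ :=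
        differentiableOn_pfrac q₀ η c fun z hz => hS2 z hz
      have hd2 : DifferentiableOn ℂ g (↑S : Set ℂ)ᶜ := by
        refine DifferentiableOn.fun_sum fun n _ => ?_
        exact (differentiableOn_const _).div (differentiableOn_id.sub (differentiableOn_const _))
          fun z hz => sub_ne_zero.mpr (hS1 z hz n)
      have hd3 : DifferentiableOn ℂ (fun z => conj (f (conj z))) (↑S : Set ℂ)ᶜ := by
        simp only [hfc]
        refine DifferentiableOn.fun_sum fun n _ => ?_
        exact (differentiableOn_const _).div (differentiableOn_id.sub (differentiableOn_const _))
          fun z hz => sub_ne_zero.mpr (hS1 z hz _)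
      have hd4 : DifferentiableOn ℂ (fun z => conj (g (conj z))) (↑S : Set ℂ)ᶜ := by
        simp only [hgc]
        refine DifferentiableOn.fun_sum fun n _ => ?_
        exact (differentiableOn_const _).div (differentiableOn_id.sub (differentiableOn_const _))
          fun z hz => sub_ne_zero.mpr (hS2 z hz _)
      exact (hd1.mul hd3).add (hd2.mul hd4)
    · intro s hs
      rcases Finset.mem_union.mp hs with h1 | h1
      · obtain ⟨k, _, rfl⟩ := Finset.mem_image.mp h1
        exact hres1 k
      · obtain ⟨k, _, rfl⟩ := Finset.mem_image.mp h1
        exact hres2 k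
    · rw [← Metric.cobounded_eq_cocompact]
      have t1 : Tendsto f (cobounded ℂ) (𝓝 0) := tendsto_cobounded_sum_div_sub _ _
      have t2 : Tendsto g (cobounded ℂ) (𝓝 0) := tendsto_cobounded_sum_div_sub _ _
      have t3 : Tendsto (fun z => conj (f (conj z))) (cobounded ℂ) (𝓝 0) := by
        simp only [hfc]; exact tendsto_cobounded_sum_div_sub _ _
      have t4 : Tendsto (fun z => conj (g (conj z))) (cobounded ℂ) (𝓝 0) := by
        simp only [hgc]; exact tendsto_cobounded_sum_div_sub _ _
      simpa using (t1.mul t3).add (t2.mul t4)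
  have him : ∀ x : ℝ, (lam q₀ (x : ℂ)).im = 0 := by
    intro x
    have : lam q₀ (x : ℂ) = ((x + q₀ ^ 2 / x) / 2 : ℝ) := by simp [lam]
    rw [this, ofReal_im]
  have hreal : ∀ x : ℝ, (x : ℂ) ∉ S := by
    intro x hx
    have hx' := him x
    rcases Finset.mem_union.mp hx with h1 | h1
    · obtain ⟨k, _, hk⟩ := Finset.mem_image.mp h1
      rw [← hk] at hx'
      exact (h.mem k).2.ne' hx'
    · obtain ⟨k, _, hk⟩ := Finset.mem_image.mp h1
      rw [← hk] at hx'
      exact (h.hat_mem k).2.ne hx'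
  have hf0 : ∀ x : ℝ, f x = 0 := by
    intro x
    have h1 := hF0 x (hreal x)
    simp only [hF, conj_ofReal, mul_conj] at h1
    have h2 : normSq (f x) + normSq (g x) = 0 := by exact_mod_cast h1
    have h3 := normSq_nonneg (f x)
    have h4 := normSq_nonneg (g x)
    exact normSq_eq_zero.mp (by linarith)
  -- Any distinct real sample points will do, since no pole is real; the integers `0, 1, 2, …` are
  -- taken.
  set e : ι → ℝ := fun k => (Fintype.equivFin ι k : ℕ) with he
  refine eq_zero_of_cauchy (p := fun k => (e k : ℂ)) (s := fun n => hat q₀ (η n)) ?_ h.hat_inj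
    (fun k n => hS2 _ (hreal _) n) fun k => hf0 _
  intro a b hab
  have : ((Fintype.equivFin ι a : ℕ) : ℝ) = (Fintype.equivFin ι b : ℕ) := by
    simpa [he] using hab
  exact (Fintype.equivFin ι).injective (Fin.ext (by exact_mod_cast this))

end PoleSys

/-! ### The linear system for the values at the poles -/

section system

variable {ι : Type*} [Fintype ι] [DecidableEq ι] {q₀ r : ℝ} {η : ι → ℂ} {σ τ : ι → ι}

/-- The matrix of the system `v_k - Σ κ_n v_n / (η_k - η̂_n) = ir/η_k`. -/
def sysMat (q₀ : ℝ) (η κ : ι → ℂ) : Matrix ι ι ℂ :=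
  Matrix.of fun k n => (if k = n then 1 else 0) - κ n / (η k - hat q₀ (η n))

theorem sysMat_mulVec (q₀ : ℝ) (η κ v : ι → ℂ) (k : ι) :
    (sysMat q₀ η κ *ᵥ v) k = v k - pfrac q₀ η (fun n => κ n * v n) (η k) := by
  simp only [sysMat, Matrix.mulVec, dotProduct, Matrix.of_apply, sub_mul, ite_mul, one_mul,
    zero_mul, Finset.sum_sub_distrib, Finset.sum_ite_eq, Finset.mem_univ, if_true, pfrac]
  congr 1
  exact Finset.sum_congr rfl fun n _ => by ring

/-- A kernel vector `v` makes `κ v` a solution of the homogeneous interpolation problem, and no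
`κ_k` vanishes. -/
theorem det_sysMat_ne_zero (h : PoleSys q₀ r η σ τ) {κ : ι → ℂ} (hκ : SymmCoeff σ τ κ) :
    (sysMat q₀ η κ).det ≠ 0 := by
  intro hdet
  obtain ⟨v, hv0, hv⟩ := Matrix.exists_mulVec_eq_zero_iff.mpr hdet
  have hk : ∀ k, v k = pfrac q₀ η (fun n => κ n * v n) (η k) := by
    intro k
    have := congrFun hv k
    rw [sysMat_mulVec] at this
    exact sub_eq_zero.mp this
  have hc := h.eq_zero_of_residue hκ (c := fun n => κ n * v n) fun k => by rw [← hk k]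
  apply hv0
  funext k
  exact (mul_eq_zero.mp (congrFun hc k)).resolve_left (hκ.ne_zero k)

/-- The values `v_k` of the solution at the poles `η_k`. -/
def poleVal (q₀ r : ℝ) (η κ : ι → ℂ) : ι → ℂ := (sysMat q₀ η κ)⁻¹ *ᵥ fun k => I * r / η k

theorem poleVal_spec (h : PoleSys q₀ r η σ τ) {κ : ι → ℂ} (hκ : SymmCoeff σ τ κ) (k : ι) :
    poleVal q₀ r η κ k =
      I * r / η k + pfrac q₀ η (fun n => κ n * poleVal q₀ r η κ n) (η k) := by
  have hu : IsUnit (sysMat q₀ η κ).det := (det_sysMat_ne_zero h hκ).isUnit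
  have h1 : sysMat q₀ η κ *ᵥ poleVal q₀ r η κ = fun k => I * r / η k := by
    rw [poleVal, Matrix.mulVec_mulVec, Matrix.mul_nonsing_inv _ hu, Matrix.one_mulVec]
  have h2 := congrFun h1 k
  rw [sysMat_mulVec] at h2
  linear_combination h2

end system

/-! ### The poles of the theorem -/

/-- The permutation of the labels that corresponds to `η ↦ -η*`. -/
def sigIdx {N₁ N₂ : ℕ} : PoleIdx N₁ N₂ → PoleIdx N₁ N₂
  | Sum.inl (a, n) => Sum.inl (![1, 0, 3, 2] a, n)
  | Sum.inr p => Sum.inr p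

/-- The permutation of the labels that corresponds to `η ↦ q₀²/η`. -/
def tauIdx {N₁ N₂ : ℕ} : PoleIdx N₁ N₂ → PoleIdx N₁ N₂
  | Sum.inl (a, n) => Sum.inl (![3, 2, 1, 0] a, n)
  | Sum.inr (a, m) => Sum.inr (![1, 0] a, m)

section poles

variable {q₀ qm : ℝ} {N₁ N₂ : ℕ} {z : Fin N₁ → ℂ} {w : Fin N₂ → ℝ}

theorem im_lam_pos {q₀ : ℝ} (hq : 0 < q₀) {z : ℂ} (hz : 0 < z.im) (hn : q₀ < ‖z‖) :
    0 < (lam q₀ z).im := by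
  have h1 : (lam q₀ z).im = (z.im - q₀ ^ 2 * (z.im / normSq z)) / 2 := by
    rw [lam, ← ofReal_pow, div_eq_mul_inv (_ : ℂ) z]
    have h2 : ∀ x : ℂ, (x / 2).im = x.im / 2 := fun x => by
      rw [show (2 : ℂ) = ((2 : ℝ) : ℂ) by norm_num, div_ofReal_im]
    rw [h2, add_im, im_ofReal_mul, inv_im]
    ring
  have h3 : q₀ ^ 2 < normSq z := by
    rw [normSq_eq_norm_sq]
    gcongr
  have h4 : 0 < normSq z := by nlinarith [sq_nonneg q₀]
  have h5 : q₀ ^ 2 * (z.im / normSq z) < z.im := by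
    rw [← mul_div_assoc, div_lt_iff₀ h4]
    nlinarith
  rw [h1]; linarith

theorem re_sq_div {q₀ : ℝ} (z : ℂ) : ((q₀ : ℂ) ^ 2 / z).re = q₀ ^ 2 / normSq z * z.re := by
  rw [← ofReal_pow, div_eq_mul_inv, re_ofReal_mul, inv_re]; ring

theorem im_sq_div {q₀ : ℝ} (z : ℂ) : ((q₀ : ℂ) ^ 2 / z).im = -(q₀ ^ 2 / normSq z * z.im) := by
  rw [← ofReal_pow, div_eq_mul_inv, im_ofReal_mul, inv_im]; ring

theorem eta_conj_eq (q₀ : ℝ) (z : Fin N₁ → ℂ) (w : Fin N₂ → ℝ) (k : PoleIdx N₁ N₂) :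
    eta q₀ z w (sigIdx k) = -conj (eta q₀ z w k) := by
  rcases k with ⟨a, n⟩ | ⟨a, m⟩
  · fin_cases a <;> simp [sigIdx, eta]
  · fin_cases a <;> simp [sigIdx, eta, neg_div]

theorem eta_inv_eq (hq : q₀ ≠ 0) (hz : ∀ n, z n ≠ 0) (hw : ∀ m, w m ≠ 0) (k : PoleIdx N₁ N₂) :
    eta q₀ z w (tauIdx k) = (q₀ : ℂ) ^ 2 / eta q₀ z w k := by
  have hq' : (q₀ : ℂ) ≠ 0 := by exact_mod_cast hq
  rcases k with ⟨a, n⟩ | ⟨a, m⟩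
  · have h1 := hz n
    have h2 : conj (z n) ≠ 0 := (map_ne_zero _).mpr h1
    fin_cases a <;> simp [tauIdx, eta, div_neg] <;> field_simp
  · have h1 : (w m : ℂ) ≠ 0 := by exact_mod_cast hw m
    fin_cases a
    · simp only [tauIdx, eta]
      simp only [Fin.zero_eta, Matrix.cons_val_zero, Matrix.cons_val_one]
      rw [div_mul_eq_div_div, div_I]; ring
    · simp only [tauIdx, eta]
      simp only [Fin.mk_one, Matrix.cons_val_zero, Matrix.cons_val_one]
      field_simp
      linear_combination I_sq

/-- The signs of real and imaginary parts of the poles distinguish the families. -/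
theorem eta_signs (hq : 0 < q₀) (hzre : ∀ n, 0 < (z n).re) (hzim : ∀ n, 0 < (z n).im)
    (hw : ∀ m, 0 < w m) :
    (∀ n : Fin N₁, 0 < (eta q₀ z w (Sum.inl (0, n))).re ∧ 0 < (eta q₀ z w (Sum.inl (0, n))).im) ∧
    (∀ n : Fin N₁, (eta q₀ z w (Sum.inl (1, n))).re < 0 ∧ 0 < (eta q₀ z w (Sum.inl (1, n))).im) ∧
    (∀ n : Fin N₁, (eta q₀ z w (Sum.inl (2, n))).re < 0 ∧ (eta q₀ z w (Sum.inl (2, n))).im < 0) ∧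
    (∀ n : Fin N₁, 0 < (eta q₀ z w (Sum.inl (3, n))).re ∧ (eta q₀ z w (Sum.inl (3, n))).im < 0) ∧
    (∀ m : Fin N₂, (eta q₀ z w (Sum.inr (0, m))).re = 0 ∧ 0 < (eta q₀ z w (Sum.inr (0, m))).im) ∧
    (∀ m : Fin N₂, (eta q₀ z w (Sum.inr (1, m))).re = 0 ∧
      (eta q₀ z w (Sum.inr (1, m))).im < 0) := by
  have hns : ∀ n, 0 < q₀ ^ 2 / normSq (z n) := fun n => by
    have : z n ≠ 0 := fun h => by simpa [h] using hzre n
    have := normSq_pos.mpr this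
    positivity
  have e0 : ∀ n, eta q₀ z w (Sum.inl (0, n)) = z n := fun n => rfl
  have e1 : ∀ n, eta q₀ z w (Sum.inl (1, n)) = -conj (z n) := fun n => rfl
  have e2 : ∀ n, eta q₀ z w (Sum.inl (2, n)) = -((q₀ : ℂ) ^ 2 / conj (z n)) := fun n => rfl
  have e3 : ∀ n, eta q₀ z w (Sum.inl (3, n)) = (q₀ : ℂ) ^ 2 / z n := fun n => rfl
  have e4 : ∀ m, eta q₀ z w (Sum.inr (0, m)) = I * (w m : ℂ) := fun n => rfl
  have e5 : ∀ m, eta q₀ z w (Sum.inr (1, m)) = I * ((-(q₀ ^ 2 / w m) : ℝ) : ℂ) := fun n => by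
    change -(I * (q₀ : ℂ) ^ 2 / (w n : ℂ)) = _
    push_cast; ring
  refine ⟨fun n => ?_, fun n => ?_, fun n => ?_, fun n => ?_, fun m => ?_, fun m => ?_⟩
  · rw [e0]; exact ⟨hzre n, hzim n⟩
  · rw [e1]; simp [hzre n, hzim n]
  · rw [e2, neg_re, neg_im, re_sq_div, im_sq_div, normSq_conj, conj_re, conj_im]
    have := mul_pos (hns n) (hzre n)
    have := mul_pos (hns n) (hzim n)
    constructor <;> linarith
  · rw [e3, re_sq_div, im_sq_div]
    have := mul_pos (hns n) (hzre n)
    have := mul_pos (hns n) (hzim n)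
    constructor <;> linarith
  · rw [e4]; simp [hw m]
  · rw [e5]
    have : 0 < q₀ ^ 2 / w m := div_pos (by positivity) (hw m)
    simp only [mul_re, mul_im, I_re, I_im, ofReal_re, ofReal_im]
    constructor <;> linarith

/-- The six families lie in different quadrants or on opposite imaginary half-axes (`eta_signs`), so
a coincidence can only occur inside one family. -/
theorem eta_injective (hq : 0 < q₀) (hz : Function.Injective z) (hw : Function.Injective w)
    (hzre : ∀ n, 0 < (z n).re) (hzim : ∀ n, 0 < (z n).im) (hwp : ∀ m, 0 < w m) :
    Function.Injective (eta q₀ z w) := by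
  obtain ⟨s0, s1, s2, s3, s4, s5⟩ := eta_signs hq hzre hzim hwp
  have hq' : (q₀ : ℂ) ^ 2 ≠ 0 := by
    have : (q₀ : ℂ) ≠ 0 := by exact_mod_cast hq.ne'
    exact pow_ne_zero 2 this
  have hcanc : ∀ {a b c : ℂ}, a ≠ 0 → a / b = a / c → b = c := fun ha h => by
    rw [div_eq_mul_inv, div_eq_mul_inv] at h
    exact inv_injective (mul_left_cancel₀ ha h)
  have hinj : ∀ (a : Fin 4) (n n' : Fin N₁),
      eta q₀ z w (Sum.inl (a, n)) = eta q₀ z w (Sum.inl (a, n')) → n = n' := by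
    intro a n n' h
    apply hz
    fin_cases a
    · exact h
    · exact (starRingEnd ℂ).injective (neg_injective h)
    · exact (starRingEnd ℂ).injective (hcanc hq' (neg_injective h))
    · exact hcanc hq' h
  have hinj' : ∀ (a : Fin 2) (n n' : Fin N₂),
      eta q₀ z w (Sum.inr (a, n)) = eta q₀ z w (Sum.inr (a, n')) → n = n' := by
    intro a n n' h
    apply hw
    fin_cases a
    · exact_mod_cast mul_left_cancel₀ I_ne_zero h
    · have := hcanc (mul_ne_zero I_ne_zero hq') (neg_injective h)
      exact_mod_cast this
  rintro (⟨a, n⟩ | ⟨a, n⟩) (⟨b, n'⟩ | ⟨b, n'⟩) h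
  · have : a = b := by
      have hre := congrArg re h
      have him := congrArg im h
      have t0 := s0 n; have t1 := s1 n; have t2 := s2 n; have t3 := s3 n
      have t0' := s0 n'; have t1' := s1 n'; have t2' := s2 n'; have t3' := s3 n'
      fin_cases a <;> fin_cases b <;> first | rfl | (exfalso; simp only [Fin.zero_eta, Fin.mk_one, Fin.reduceFinMk] at hre him; linarith)
    subst this
    rw [hinj a n n' h]
  · exfalso
    have hre := congrArg re h
    have t0 := s0 n; have t1 := s1 n; have t2 := s2 n; have t3 := s3 n
    have t4 := s4 n'; have t5 := s5 n'
    fin_cases a <;> fin_cases b <;>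
      (simp only [Fin.zero_eta, Fin.mk_one, Fin.reduceFinMk] at hre; linarith)
  · exfalso
    have hre := congrArg re h
    have t0 := s0 n'; have t1 := s1 n'; have t2 := s2 n'; have t3 := s3 n'
    have t4 := s4 n; have t5 := s5 n
    fin_cases a <;> fin_cases b <;>
      (simp only [Fin.zero_eta, Fin.mk_one, Fin.reduceFinMk] at hre; linarith)
  · have : a = b := by
      have him := congrArg im h
      have t4 := s4 n; have t5 := s5 n
      have t4' := s4 n'; have t5' := s5 n'
      fin_cases a <;> fin_cases b <;> first | rfl | (exfalso; simp only [Fin.zero_eta, Fin.mk_one] at him; linarith)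
    subst this
    rw [hinj' a n n' h]

/-- Membership in `D₊` has to be checked only for `z_n` and `iw_m`: `λ(-z*) = -λ(z)*` and `λ(q₀²/z)
= λ(z)` carry it along the symmetry orbits. -/
theorem poleSys_eta (hq : 0 < q₀) (hqm : |qm| = q₀) (hz : Function.Injective z)
    (hw : Function.Injective w) (hzre : ∀ n, 0 < (z n).re) (hzim : ∀ n, 0 < (z n).im)
    (hznorm : ∀ n, q₀ < ‖z n‖) (hwq : ∀ m, q₀ < w m) :
    PoleSys q₀ qm (eta q₀ z w) sigIdx tauIdx := by
  have hwp : ∀ m, 0 < w m := fun m => hq.trans (hwq m)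
  have hz0 : ∀ n, z n ≠ 0 := fun n h => by simpa [h] using hzre n
  have hsq : qm ^ 2 = q₀ ^ 2 := by rw [← hqm, sq_abs]
  have hinv := eta_inv_eq (z := z) (w := w) hq.ne' hz0 fun m => (hwp m).ne'
  have hconj := eta_conj_eq q₀ z w
  have hzmem : ∀ n, eta q₀ z w (Sum.inl (0, n)) ∈ DPlus q₀ := fun n =>
    ⟨hz0 n, im_lam_pos hq (hzim n) (hznorm n)⟩
  have hwmem : ∀ m, eta q₀ z w (Sum.inr (0, m)) ∈ DPlus q₀ := fun m => by
    have h1 : I * (w m : ℂ) ≠ 0 := mul_ne_zero I_ne_zero (by exact_mod_cast (hwp m).ne')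
    change I * (w m : ℂ) ∈ DPlus q₀
    exact ⟨h1, im_lam_pos hq (by simp [hwp m]) (by simpa [abs_of_pos (hwp m)] using hwq m)⟩
  have hmc : ∀ k, eta q₀ z w k ∈ DPlus q₀ → eta q₀ z w (sigIdx k) ∈ DPlus q₀ := by
    intro k hk
    rw [hconj]
    refine ⟨neg_ne_zero.mpr ((map_ne_zero _).mpr hk.1), ?_⟩
    rw [lam_neg, lam_conj]
    simpa using hk.2
  have hmi : ∀ k, eta q₀ z w k ∈ DPlus q₀ → eta q₀ z w (tauIdx k) ∈ DPlus q₀ := by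
    intro k hk
    have hq' : (q₀ : ℂ) ≠ 0 := by exact_mod_cast hq.ne'
    rw [hinv]
    refine ⟨div_ne_zero (pow_ne_zero 2 hq') hk.1, ?_⟩
    have := lam_neg_div hq.ne' hk.1
    rw [lam_neg, neg_inj] at this
    rw [this]; exact hk.2
  refine ⟨hq, hsq, eta_injective hq hz hw hzre hzim hwp, ?_, hconj, hinv⟩
  rintro (⟨a, n⟩ | ⟨a, n⟩)
  · fin_cases a
    · exact hzmem n
    · exact hmc _ (hzmem n)
    · exact hmi _ (hmc _ (hzmem n))
    · exact hmi _ (hzmem n)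
  · fin_cases a
    · exact hwmem n
    · exact hmi _ (hwmem n)

end poles

/-! ### Symmetries of the coefficients -/

theorem theta_hat {q₀ : ℝ} (hq : q₀ ≠ 0) (x t : ℝ) {z : ℂ} (hz : z ≠ 0) :
    theta q₀ x t (hat q₀ z) = -theta q₀ x t z := by
  simp only [theta, hat, lam_neg_div hq hz, kk_neg_div hq hz]; ring

theorem theta_neg (q₀ x t : ℝ) (z : ℂ) : theta q₀ x t (-z) = -theta q₀ x t z := by
  simp only [theta, lam_neg, kk_neg]; ring

theorem theta_conj (q₀ x t : ℝ) (z : ℂ) : theta q₀ x t (conj z) = conj (theta q₀ x t z) := by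
  simp [theta, lam_conj, kk_conj, Complex.conj_ofNat]

section coefficients

variable {q₀ qm : ℝ} {N₁ N₂ : ℕ} {z : Fin N₁ → ℂ} {w : Fin N₂ → ℝ} {A : ℂ → ℂ}

/-- The coefficient `κ_n = α_n η_n / (i q₋)` of the residue condition at `η̂_n`. -/
def resCoef (q₀ qm : ℝ) (z : Fin N₁ → ℂ) (w : Fin N₂ → ℝ) (A : ℂ → ℂ) (x t : ℝ)
    (n : PoleIdx N₁ N₂) : ℂ := alphaVec q₀ z w A x t n * eta q₀ z w n / (I * qm)

/-- This is `(*)` rewritten for `κ`. The phases agree with it because `θ(-z*) = -θ(z)*` and because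
`η̂` and `-η` have the same phase. -/
theorem symmCoeff_resCoef (h : PoleSys q₀ qm (eta q₀ z w) sigIdx tauIdx)
    (hA : IsAdmissible q₀ z w A) (x t : ℝ) :
    SymmCoeff sigIdx tauIdx (resCoef q₀ qm z w A x t) := by
  have hr : I * (qm : ℂ) ≠ 0 := mul_ne_zero I_ne_zero h.r_ne
  have hZ1 : ∀ n, eta q₀ z w n ∈ discSpec q₀ z w := fun n => Or.inl ⟨n, rfl⟩
  have hZ2 : ∀ n, hat q₀ (eta q₀ z w n) ∈ discSpec q₀ z w := fun n => Or.inr ⟨n, rfl⟩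
  refine ⟨fun n => ?_, fun n => ?_, fun n => ?_⟩
  · exact div_ne_zero (mul_ne_zero (mul_ne_zero (hA _ (hZ2 n)).1 (exp_ne_zero _)) (h.ne_zero n)) hr
  · have h1 := (hA _ (hZ2 (sigIdx n))).2.2.1
    rw [h.hat_conj, map_neg, starRingEnd_self_apply, neg_neg] at h1
    have h2 : conj (exp (2 * I * theta q₀ x t (hat q₀ (eta q₀ z w n)))) =
        exp (2 * I * theta q₀ x t (hat q₀ (eta q₀ z w (sigIdx n)))) := by
      rw [h.hat_conj, theta_neg, theta_conj, ← exp_conj]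
      simp [Complex.conj_ofNat]
    have h3 : conj (eta q₀ z w n) = -eta q₀ z w (sigIdx n) := by rw [h.eta_conj]; simp
    change conj (A (hat q₀ (eta q₀ z w n)) * _ * _ / _) =
      -(A (hat q₀ (eta q₀ z w (sigIdx n))) * _ * _ / _)
    rw [map_div₀, map_mul, map_mul, map_mul, conj_I, conj_ofReal]
    rw [show etaHat q₀ z w n = hat q₀ (eta q₀ z w n) from rfl, h2, h3,
      show etaHat q₀ z w (sigIdx n) = hat q₀ (eta q₀ z w (sigIdx n)) from rfl]
    rw [show conj (A (hat q₀ (eta q₀ z w n))) = -A (hat q₀ (eta q₀ z w (sigIdx n))) by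
      rw [h.hat_conj, h1, neg_neg]]
    field_simp
  · have h1 := (hA _ (hZ2 (tauIdx (sigIdx n)))).2.1
    have h2 := (hA _ (hZ2 (tauIdx (sigIdx n)))).2.2.1
    rw [← h.conj_eta, starRingEnd_self_apply] at h1 h2
    -- The first two symmetries together say that `A` is even.
    have h3 : A (-eta q₀ z w n) = A (eta q₀ z w n) := by
      have := h1.symm.trans h2
      exact ((starRingEnd ℂ).injective (neg_injective this)).symm
    have h4 := (hA _ (hZ1 n)).2.2.2
    have h5 : theta q₀ x t (hat q₀ (eta q₀ z w (tauIdx n))) =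
        theta q₀ x t (hat q₀ (eta q₀ z w n)) := by
      rw [h.hat_inv, theta_neg, theta_hat h.pos.ne' x t (h.ne_zero n)]
    change A (hat q₀ (eta q₀ z w (tauIdx n))) * exp (2 * I * theta q₀ x t
        (hat q₀ (eta q₀ z w (tauIdx n)))) * eta q₀ z w (tauIdx n) / _ =
      A (hat q₀ (eta q₀ z w n)) * exp (2 * I * theta q₀ x t (hat q₀ (eta q₀ z w n))) *
        eta q₀ z w n / _
    rw [h5, h.hat_inv, h3, h4, h.eta_inv]
    have := h.ne_zero n
    have := h.q_ne
    simp only [hat]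
    field_simp

/-- Rescaling the unknowns by `iq₋/η_n` turns the system of the interpolation problem into `-G`;
thus non-vanishing of `det G` is the uniqueness of the interpolation. -/
theorem gMat_eq (h : PoleSys q₀ qm (eta q₀ z w) sigIdx tauIdx) (x t : ℝ) :
    gMat q₀ qm z w A x t = -(sysMat q₀ (eta q₀ z w) (resCoef q₀ qm z w A x t) *
      Matrix.diagonal fun n => I * (qm : ℂ) / eta q₀ z w n) := by
  ext k n
  have hr : I * (qm : ℂ) ≠ 0 := mul_ne_zero I_ne_zero h.r_ne
  have hn := h.ne_zero n
  rw [Matrix.neg_apply, Matrix.mul_diagonal]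
  simp only [gMat, sysMat, Matrix.of_apply, resCoef]
  have e : alphaVec q₀ z w A x t n * eta q₀ z w n / (I * qm) /
      (eta q₀ z w k - hat q₀ (eta q₀ z w n)) * (I * qm / eta q₀ z w n) =
      alphaVec q₀ z w A x t n / (eta q₀ z w k - hat q₀ (eta q₀ z w n)) := by
    have : eta q₀ z w k - hat q₀ (eta q₀ z w n) ≠ 0 := sub_ne_zero.mpr (h.ne_hat k n)
    have hI := I_ne_zero
    have hq := h.r_ne
    field_simp
  rw [sub_mul, e, show etaHat q₀ z w n = hat q₀ (eta q₀ z w n) from rfl]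
  split_ifs with hkn
  · subst hkn; ring
  · ring

theorem det_gMat_ne_zero (h : PoleSys q₀ qm (eta q₀ z w) sigIdx tauIdx)
    (hA : IsAdmissible q₀ z w A) (x t : ℝ) : (gMat q₀ qm z w A x t).det ≠ 0 := by
  rw [gMat_eq h, Matrix.det_neg, Matrix.det_mul, Matrix.det_diagonal]
  refine mul_ne_zero (pow_ne_zero _ (neg_ne_zero.mpr one_ne_zero)) (mul_ne_zero
    (det_sysMat_ne_zero h (symmCoeff_resCoef h hA x t)) (Finset.prod_ne_zero_iff.mpr fun n _ => ?_))
  exact div_ne_zero (mul_ne_zero I_ne_zero h.r_ne) (h.ne_zero n)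

/-- The determinant formula in terms of the solution of the linear system. -/
theorem determinant_formula (h : PoleSys q₀ qm (eta q₀ z w) sigIdx tauIdx)
    (hA : IsAdmissible q₀ z w A) (x t : ℝ) {v : PoleIdx N₁ N₂ → ℂ}
    (hv : ∀ k, v k = I * qm / eta q₀ z w k +
      pfrac q₀ (eta q₀ z w) (fun n => resCoef q₀ qm z w A x t n * v n) (eta q₀ z w k)) :
    (qm : ℂ) + (borderedMat q₀ qm z w A x t).det / (gMat q₀ qm z w A x t).det * I =
      qm - I * ∑ n, resCoef q₀ qm z w A x t n * v n := by
  have hG := det_gMat_ne_zero h hA x t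
  -- The rescaled unknowns solve `G y = β`, so the Schur complement of `G` in the bordered matrix is
  -- `-α · y`.
  set y : PoleIdx N₁ N₂ → ℂ := fun n => eta q₀ z w n / (I * qm) * v n with hy
  have hr := h.r_ne
  have hI := I_ne_zero
  have hGy : gMat q₀ qm z w A x t *ᵥ y = betaVec q₀ qm z w := by
    funext k
    rw [gMat_eq h, Matrix.neg_mulVec, ← Matrix.mulVec_mulVec]
    have e : (Matrix.diagonal fun n => I * (qm : ℂ) / eta q₀ z w n) *ᵥ y = v := by
      funext n
      have := h.ne_zero n
      rw [Matrix.mulVec_diagonal, hy]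
      field_simp
    rw [e, Pi.neg_apply, sysMat_mulVec, betaVec]
    linear_combination -hv k
  have hunit : IsUnit (gMat q₀ qm z w A x t).det := hG.isUnit
  let _ := (gMat q₀ qm z w A x t).invertibleOfIsUnitDet hunit
  have hdet : (borderedMat q₀ qm z w A x t).det =
      (gMat q₀ qm z w A x t).det * -∑ n, alphaVec q₀ z w A x t n * y n := by
    rw [borderedMat, Matrix.det_fromBlocks₁₁]
    congr 1
    rw [Matrix.det_unique, zero_sub, Matrix.neg_apply, Matrix.mul_assoc]
    congr 1
    have e : ⅟(gMat q₀ qm z w A x t) * (Matrix.of fun k (_ : Unit) => betaVec q₀ qm z w k) =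
        Matrix.of fun k (_ : Unit) => y k := by
      rw [← hGy]
      ext k j
      have := congrFun (show ⅟(gMat q₀ qm z w A x t) *ᵥ (gMat q₀ qm z w A x t *ᵥ y) = y by
        rw [Matrix.mulVec_mulVec, invOf_mul_self, Matrix.one_mulVec]) k
      simpa [Matrix.mul_apply, Matrix.mulVec, dotProduct] using this
    rw [e, Matrix.mul_apply]
    rfl
  rw [hdet, mul_div_cancel_left₀ _ hG]
  have e : ∑ n, alphaVec q₀ z w A x t n * y n = ∑ n, resCoef q₀ qm z w A x t n * v n :=
    Finset.sum_congr rfl fun n _ => by simp only [hy, resCoef]; ring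
  rw [e]; ring

end coefficients

/-! ### Partial derivatives of smooth functions of two variables -/

/-- Joint smoothness of a function of `(x,t)`. -/
def Smooth₂ (F : ℝ → ℝ → ℂ) : Prop := ContDiff ℝ (⊤ : ℕ∞) fun p : ℝ × ℝ => F p.1 p.2

/-- `∂F/∂x`. -/
def dx (F : ℝ → ℝ → ℂ) (x t : ℝ) : ℂ := deriv (fun x' => F x' t) x

/-- `∂F/∂t`. -/
def dt (F : ℝ → ℝ → ℂ) (x t : ℝ) : ℂ := deriv (fun t' => F x t') t

namespace Smooth₂

variable {F G : ℝ → ℝ → ℂ}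

theorem hasDerivAt_fst_fderiv (hF : Smooth₂ F) (x t : ℝ) : HasDerivAt (fun x' => F x' t)
    (fderiv ℝ (fun p : ℝ × ℝ => F p.1 p.2) (x, t) (1, 0)) x := by
  have h1 : HasFDerivAt (fun p : ℝ × ℝ => F p.1 p.2) _ (x, t) :=
    (hF.differentiable (by simp)).differentiableAt.hasFDerivAt
  exact h1.comp_hasDerivAt (f := fun x' : ℝ => (x', t)) x
    ((hasDerivAt_id x).prodMk (hasDerivAt_const x t))

theorem hasDerivAt_snd_fderiv (hF : Smooth₂ F) (x t : ℝ) : HasDerivAt (fun t' => F x t')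
    (fderiv ℝ (fun p : ℝ × ℝ => F p.1 p.2) (x, t) (0, 1)) t := by
  have h1 : HasFDerivAt (fun p : ℝ × ℝ => F p.1 p.2) _ (x, t) :=
    (hF.differentiable (by simp)).differentiableAt.hasFDerivAt
  exact h1.comp_hasDerivAt (f := fun t' : ℝ => (x, t')) t
    ((hasDerivAt_const t x).prodMk (hasDerivAt_id t))

theorem dx_eq (hF : Smooth₂ F) (x t : ℝ) :
    dx F x t = fderiv ℝ (fun p : ℝ × ℝ => F p.1 p.2) (x, t) (1, 0) :=
  (hF.hasDerivAt_fst_fderiv x t).deriv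

theorem dt_eq (hF : Smooth₂ F) (x t : ℝ) :
    dt F x t = fderiv ℝ (fun p : ℝ × ℝ => F p.1 p.2) (x, t) (0, 1) :=
  (hF.hasDerivAt_snd_fderiv x t).deriv

theorem hasDerivAt_dx (hF : Smooth₂ F) (x t : ℝ) : HasDerivAt (fun x' => F x' t) (dx F x t) x :=
  (hF.hasDerivAt_fst_fderiv x t).differentiableAt.hasDerivAt

theorem hasDerivAt_dt (hF : Smooth₂ F) (x t : ℝ) : HasDerivAt (fun t' => F x t') (dt F x t) t :=
  (hF.hasDerivAt_snd_fderiv x t).differentiableAt.hasDerivAt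

theorem smooth_dx (hF : Smooth₂ F) : Smooth₂ (dx F) := by
  have h1 : ContDiff ℝ (⊤ : ℕ∞) (fderiv ℝ (fun p : ℝ × ℝ => F p.1 p.2)) :=
    ContDiff.fderiv_right hF (by simp)
  have h2 := h1.clm_apply (contDiff_const (c := ((1 : ℝ), (0 : ℝ))))
  have e : (fun p : ℝ × ℝ => dx F p.1 p.2) = _ := funext fun p => hF.dx_eq p.1 p.2
  exact (congrArg (ContDiff ℝ (⊤ : ℕ∞)) e).mpr h2

theorem smooth_dt (hF : Smooth₂ F) : Smooth₂ (dt F) := by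
  have h1 : ContDiff ℝ (⊤ : ℕ∞) (fderiv ℝ (fun p : ℝ × ℝ => F p.1 p.2)) :=
    ContDiff.fderiv_right hF (by simp)
  have h2 := h1.clm_apply (contDiff_const (c := ((0 : ℝ), (1 : ℝ))))
  have e : (fun p : ℝ × ℝ => dt F p.1 p.2) = _ := funext fun p => hF.dt_eq p.1 p.2
  exact (congrArg (ContDiff ℝ (⊤ : ℕ∞)) e).mpr h2

theorem mixed (hF : Smooth₂ F) (x t : ℝ) : dt (dx F) x t = dx (dt F) x t := by
  rw [hF.smooth_dx.dt_eq, hF.smooth_dt.dx_eq]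
  have h1 : ContDiff ℝ (⊤ : ℕ∞) (fderiv ℝ (fun p : ℝ × ℝ => F p.1 p.2)) :=
    ContDiff.fderiv_right hF (by simp)
  have h1' : DifferentiableAt ℝ (fderiv ℝ (fun p : ℝ × ℝ => F p.1 p.2)) (x, t) :=
    (h1.differentiable (by simp)).differentiableAt
  have e1 : (fun p : ℝ × ℝ => dx F p.1 p.2) =
      fun p => fderiv ℝ (fun p : ℝ × ℝ => F p.1 p.2) p (1, 0) :=
    funext fun p => hF.dx_eq p.1 p.2
  have e2 : (fun p : ℝ × ℝ => dt F p.1 p.2) =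
      fun p => fderiv ℝ (fun p : ℝ × ℝ => F p.1 p.2) p (0, 1) :=
    funext fun p => hF.dt_eq p.1 p.2
  have hs : IsSymmSndFDerivAt ℝ (fun p : ℝ × ℝ => F p.1 p.2) (x, t) :=
    (ContDiff.contDiffAt hF).isSymmSndFDerivAt
      (by simpa using (by exact_mod_cast le_top : ((2 : ℕ∞) : WithTop ℕ∞) ≤ ((⊤ : ℕ∞) : WithTop ℕ∞)))
  rw [e1, e2, fderiv_clm_apply h1' (differentiableAt_const _),
    fderiv_clm_apply h1' (differentiableAt_const _)]
  simpa using hs.eq (0, 1) (1, 0)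

theorem const (c : ℂ) : Smooth₂ fun _ _ => c := contDiff_const

theorem add (hF : Smooth₂ F) (hG : Smooth₂ G) : Smooth₂ fun x t => F x t + G x t :=
  ContDiff.add hF hG

theorem sub (hF : Smooth₂ F) (hG : Smooth₂ G) : Smooth₂ fun x t => F x t - G x t :=
  ContDiff.sub hF hG

theorem mul (hF : Smooth₂ F) (hG : Smooth₂ G) : Smooth₂ fun x t => F x t * G x t :=
  ContDiff.mul hF hG

theorem sum {ι : Type*} (s : Finset ι) {F : ι → ℝ → ℝ → ℂ} (hF : ∀ n, Smooth₂ (F n)) :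
    Smooth₂ fun x t => ∑ n ∈ s, F n x t :=
  ContDiff.sum fun n _ => hF n

theorem prod {ι : Type*} (s : Finset ι) {F : ι → ℝ → ℝ → ℂ} (hF : ∀ n, Smooth₂ (F n)) :
    Smooth₂ fun x t => ∏ n ∈ s, F n x t :=
  contDiff_prod fun n _ => hF n

theorem inv (hF : Smooth₂ F) (h0 : ∀ x t, F x t ≠ 0) : Smooth₂ fun x t => (F x t)⁻¹ :=
  ContDiff.inv hF fun p => h0 p.1 p.2

theorem det {ι : Type*} [Fintype ι] [DecidableEq ι] {M : ℝ → ℝ → Matrix ι ι ℂ}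
    (hM : ∀ i j, Smooth₂ fun x t => M x t i j) : Smooth₂ fun x t => (M x t).det := by
  simp only [Matrix.det_apply']
  exact sum _ fun s => (const _).mul (prod _ fun i => hM _ _)

/-- Cramer's rule: every entry of the inverse is a quotient of determinants, that is of polynomials
in the entries. -/
theorem inv_mulVec {ι : Type*} [Fintype ι] [DecidableEq ι] {M : ℝ → ℝ → Matrix ι ι ℂ}
    (hM : ∀ i j, Smooth₂ fun x t => M x t i j) (h0 : ∀ x t, (M x t).det ≠ 0) (b : ι → ℂ) (k : ι) :
    Smooth₂ fun x t => ((M x t)⁻¹ *ᵥ b) k := by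
  have e : ∀ x t, ((M x t)⁻¹ *ᵥ b) k =
      ∑ n, ((M x t).det)⁻¹ * ((M x t).updateRow n (Pi.single k 1)).det * b n := by
    intro x t
    simp only [Matrix.inv_def, Matrix.mulVec, dotProduct, Matrix.smul_apply, smul_eq_mul,
      Ring.inverse_eq_inv', Matrix.adjugate_apply]
  simp only [e]
  refine sum _ fun n => (((det hM).inv h0).mul (det fun i j => ?_)).mul (const _)
  simp only [Matrix.updateRow_apply]
  split_ifs
  · exact const _
  · exact hM i j

end Smooth₂

theorem hasDerivAt_theta_fst (q₀ x t : ℝ) (z : ℂ) :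
    HasDerivAt (fun x' : ℝ => theta q₀ x' t z) (lam q₀ z) x := by
  have h := ((hasDerivAt_id x).ofReal_comp.add_const
    ((4 * kk q₀ z ^ 2 - 2 * (q₀ : ℂ) ^ 2) * (t : ℂ))).const_mul (lam q₀ z)
  simpa [theta] using h

/-- `∂θ/∂t`. -/
def thetaT (q₀ : ℝ) (z : ℂ) : ℂ := lam q₀ z * (4 * kk q₀ z ^ 2 - 2 * (q₀ : ℂ) ^ 2)

theorem hasDerivAt_theta_snd (q₀ x t : ℝ) (z : ℂ) :
    HasDerivAt (fun t' : ℝ => theta q₀ x t' z) (thetaT q₀ z) t := by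
  have h := (((hasDerivAt_id t).ofReal_comp.const_mul
    (4 * kk q₀ z ^ 2 - 2 * (q₀ : ℂ) ^ 2)).const_add (x : ℂ)).const_mul (lam q₀ z)
  simpa [theta, thetaT] using h

theorem smooth_exp_theta (q₀ : ℝ) (z c : ℂ) : Smooth₂ fun x t => exp (c * theta q₀ x t z) := by
  have h1 : ContDiff ℝ (⊤ : ℕ∞) fun p : ℝ × ℝ => ((p.1 : ℝ) : ℂ) :=
    ofRealCLM.contDiff.comp contDiff_fst
  have h2 : ContDiff ℝ (⊤ : ℕ∞) fun p : ℝ × ℝ => ((p.2 : ℝ) : ℂ) :=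
    ofRealCLM.contDiff.comp contDiff_snd
  exact (contDiff_const.mul (contDiff_const.mul (h1.add (contDiff_const.mul h2)))).cexp

/-! ### Rational solutions of the Lax pair -/

/-- Poles and coefficients of a reflectionless solution. -/
structure RatData (ι : Type*) where
  /-- the modulus of the boundary value -/
  q₀ : ℝ
  /-- the boundary value -/
  r : ℝ
  /-- the poles -/
  η : ι → ℂ
  /-- `η ↦ -η*` on labels -/
  σ : ι → ι
  /-- `η ↦ q₀²/η` on labels -/
  τ : ι → ι
  /-- the coefficients at `x = t = 0` -/
  κ₀ : ι → ℂ
  sys : PoleSys q₀ r η σ τ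
  symm : SymmCoeff σ τ κ₀

namespace RatData

variable {ι : Type*} (D : RatData ι)

/-- The points `η̂_n`. -/
def η' (n : ι) : ℂ := hat D.q₀ (D.η n)

/-- The coefficients at `(x,t)`. -/
def κ (x t : ℝ) (n : ι) : ℂ := D.κ₀ n * exp (2 * I * theta D.q₀ x t (D.η' n))

theorem η'_ne_zero (n : ι) : D.η' n ≠ 0 := D.sys.hat_ne_zero n

theorem η'_inv (n : ι) : D.η' (D.τ n) = -D.η n := D.sys.hat_inv n

/-- The exponentials respect both symmetries for real `x, t`, so the interpolation problem stays
uniquely solvable for all of them. -/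
theorem symmCoeff (x t : ℝ) : SymmCoeff D.σ D.τ (D.κ x t) := by
  refine ⟨fun n => mul_ne_zero (D.symm.ne_zero n) (exp_ne_zero _), fun n => ?_, fun n => ?_⟩
  · rw [κ, κ, map_mul, D.symm.coef_conj, ← exp_conj, η', η', D.sys.hat_conj, theta_neg, theta_conj]
    simp [Complex.conj_ofNat]
  · rw [κ, κ, D.symm.coef_inv, η'_inv, theta_neg, η',
      theta_hat D.sys.pos.ne' x t (D.sys.ne_zero n)]

theorem smooth_κ (n : ι) : Smooth₂ fun x t => D.κ x t n :=
  (Smooth₂.const _).mul (smooth_exp_theta _ _ _)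

/-- The rate is `2iλ(η̂) = i(η̂ - η)`, because `q₀²/η̂ = -η`. In this form it exchanges
multiplication by `η` at the node and by `η̂` at the pole. -/
theorem dx_κ (x t : ℝ) (n : ι) :
    HasDerivAt (fun x' => D.κ x' t n) (I * (D.η' n - D.η n) * D.κ x t n) x := by
  have h := (((hasDerivAt_theta_fst D.q₀ x t (D.η' n)).const_mul (2 * I)).cexp).const_mul (D.κ₀ n)
  refine h.congr_deriv ?_
  have h1 := D.sys.ne_zero n
  have h2 := D.sys.q_ne
  rw [κ, lam]
  have : (D.q₀ : ℂ) ^ 2 / D.η' n = -D.η n := by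
    rw [η', hat]; field_simp
  rw [this]; ring

theorem dt_κ (x t : ℝ) (n : ι) :
    HasDerivAt (fun t' => D.κ x t' n) (2 * I * thetaT D.q₀ (D.η' n) * D.κ x t n) t := by
  have h := (((hasDerivAt_theta_snd D.q₀ x t (D.η' n)).const_mul (2 * I)).cexp).const_mul (D.κ₀ n)
  refine h.congr_deriv ?_
  rw [κ]; ring

variable [Fintype ι] [DecidableEq ι]

/-- The values at the poles. -/
def v (x t : ℝ) (n : ι) : ℂ := poleVal D.q₀ D.r D.η (D.κ x t) n

/-- The residues of the first component. -/
def c (n : ι) (x t : ℝ) : ℂ := D.κ x t n * D.v x t n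

/-- The residues of the second component. -/
def d (n : ι) (x t : ℝ) : ℂ := -(I * D.r / D.η n) * D.c (D.τ n) x t

/-- The first component. -/
def f (z : ℂ) (x t : ℝ) : ℂ := I * D.r / z + pfrac D.q₀ D.η (fun n => D.c n x t) z

/-- The second component. -/
def g (z : ℂ) (x t : ℝ) : ℂ := 1 + pfrac D.q₀ D.η (fun n => D.d n x t) z

/-- The potential. -/
def qc (x t : ℝ) : ℂ := D.r - I * ∑ n, D.c n x t

theorem v_spec (x t : ℝ) (k : ι) : D.v x t k = D.f (D.η k) x t :=
  poleVal_spec D.sys (D.symmCoeff x t) k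

theorem smooth_v (n : ι) : Smooth₂ fun x t => D.v x t n := by
  refine Smooth₂.inv_mulVec (fun i j => ?_) (fun x t => det_sysMat_ne_zero D.sys (D.symmCoeff x t)) _ _
  simp only [sysMat, Matrix.of_apply, div_eq_mul_inv]
  exact (Smooth₂.const _).sub ((D.smooth_κ j).mul (Smooth₂.const _))

theorem smooth_c (n : ι) : Smooth₂ (D.c n) := (D.smooth_κ n).mul (D.smooth_v n)

theorem smooth_d (n : ι) : Smooth₂ (D.d n) := (Smooth₂.const _).mul (D.smooth_c _)

theorem smooth_f (z : ℂ) : Smooth₂ (D.f z) := by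
  change Smooth₂ fun x t => I * D.r / z + ∑ n, D.c n x t / (z - hat D.q₀ (D.η n))
  simp only [div_eq_mul_inv]
  exact (Smooth₂.const _).add (Smooth₂.sum _ fun n => (D.smooth_c n).mul (Smooth₂.const _))

theorem smooth_g (z : ℂ) : Smooth₂ (D.g z) := by
  change Smooth₂ fun x t => 1 + ∑ n, D.d n x t / (z - hat D.q₀ (D.η n))
  simp only [div_eq_mul_inv]
  exact (Smooth₂.const _).add (Smooth₂.sum _ fun n => (D.smooth_d n).mul (Smooth₂.const _))

theorem smooth_qc : Smooth₂ D.qc :=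
  (Smooth₂.const _).sub ((Smooth₂.const _).mul (Smooth₂.sum _ D.smooth_c))

theorem dx_f (z : ℂ) (x t : ℝ) : dx (D.f z) x t = pfrac D.q₀ D.η (fun n => dx (D.c n) x t) z := by
  have h := (HasDerivAt.fun_sum fun n (_ : n ∈ Finset.univ) =>
    (((D.smooth_c n).hasDerivAt_dx x t).div_const (z - hat D.q₀ (D.η n)))).const_add (I * D.r / z)
  exact h.deriv

theorem dt_f (z : ℂ) (x t : ℝ) : dt (D.f z) x t = pfrac D.q₀ D.η (fun n => dt (D.c n) x t) z := by
  have h := (HasDerivAt.fun_sum fun n (_ : n ∈ Finset.univ) =>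
    (((D.smooth_c n).hasDerivAt_dt x t).div_const (z - hat D.q₀ (D.η n)))).const_add (I * D.r / z)
  exact h.deriv

theorem dx_dx_f (z : ℂ) (x t : ℝ) :
    dx (dx (D.f z)) x t = pfrac D.q₀ D.η (fun n => dx (dx (D.c n)) x t) z := by
  have h := HasDerivAt.fun_sum fun n (_ : n ∈ Finset.univ) =>
    (((D.smooth_c n).smooth_dx.hasDerivAt_dx x t).div_const (z - hat D.q₀ (D.η n)))
  have e : dx (D.f z) = fun x t => pfrac D.q₀ D.η (fun n => dx (D.c n) x t) z := by
    funext x t; exact D.dx_f z x t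
  rw [e]; exact h.deriv

theorem dx_g (z : ℂ) (x t : ℝ) : dx (D.g z) x t = pfrac D.q₀ D.η (fun n => dx (D.d n) x t) z := by
  have h := (HasDerivAt.fun_sum fun n (_ : n ∈ Finset.univ) =>
    (((D.smooth_d n).hasDerivAt_dx x t).div_const (z - hat D.q₀ (D.η n)))).const_add 1
  exact h.deriv

theorem dt_g (z : ℂ) (x t : ℝ) : dt (D.g z) x t = pfrac D.q₀ D.η (fun n => dt (D.d n) x t) z := by
  have h := (HasDerivAt.fun_sum fun n (_ : n ∈ Finset.univ) =>
    (((D.smooth_d n).hasDerivAt_dt x t).div_const (z - hat D.q₀ (D.η n)))).const_add 1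
  exact h.deriv

theorem dx_qc (x t : ℝ) : dx D.qc x t = -(I * ∑ n, dx (D.c n) x t) := by
  have h := ((HasDerivAt.fun_sum fun n (_ : n ∈ Finset.univ) =>
    ((D.smooth_c n).hasDerivAt_dx x t)).const_mul I).const_sub (D.r : ℂ)
  exact h.deriv

theorem dx_dx_qc (x t : ℝ) : dx (dx D.qc) x t = -(I * ∑ n, dx (dx (D.c n)) x t) := by
  have h := ((HasDerivAt.fun_sum fun n (_ : n ∈ Finset.univ) =>
    ((D.smooth_c n).smooth_dx.hasDerivAt_dx x t)).const_mul I).fun_neg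
  have e : dx D.qc = fun x t => -(I * ∑ n, dx (D.c n) x t) := by
    funext x t; exact D.dx_qc x t
  rw [e]; exact h.deriv

theorem dx_c (x t : ℝ) (n : ι) : dx (D.c n) x t =
    I * (D.η' n - D.η n) * D.c n x t + D.κ x t n * dx (D.f (D.η n)) x t := by
  have h := (D.dx_κ x t n).mul ((D.smooth_v n).hasDerivAt_dx x t)
  have e : dx (fun x t => D.v x t n) x t = dx (D.f (D.η n)) x t := by
    simp only [dx, D.v_spec]
  rw [e] at h
  refine h.deriv.trans ?_
  rw [c]; ring

theorem dt_c (x t : ℝ) (n : ι) : dt (D.c n) x t =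
    2 * I * thetaT D.q₀ (D.η' n) * D.c n x t + D.κ x t n * dt (D.f (D.η n)) x t := by
  have h := (D.dt_κ x t n).mul ((D.smooth_v n).hasDerivAt_dt x t)
  have e : dt (fun x t => D.v x t n) x t = dt (D.f (D.η n)) x t := by
    simp only [dt, D.v_spec]
  rw [e] at h
  refine h.deriv.trans ?_
  rw [c]; ring

/-- The symmetry `z ↦ q₀²/z` of the solution. -/
theorem g_eq {z : ℂ} (hz : z ≠ 0) (hzn : ∀ n, z ≠ D.η' n) (x t : ℝ) :
    D.g z x t = -(I * D.r / z) * D.f ((D.q₀ : ℂ) ^ 2 / z) x t := by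
  have hq := D.sys.q_ne
  have hr := D.sys.sqC
  have e : pfrac D.q₀ D.η (fun n => D.d n x t) z =
      ∑ n, D.d (D.τ n) x t / (z - hat D.q₀ (D.η (D.τ n))) :=
    Equiv.sum_comp (Function.Involutive.toPerm D.τ D.sys.inv_inv)
      (fun n => D.d n x t / (z - hat D.q₀ (D.η n))) |>.symm
  rw [g, f, e, pfrac, mul_add, Finset.mul_sum]
  congr 1
  · field_simp
    rw [← hr, I_sq]
    ring
  · refine Finset.sum_congr rfl fun n _ => ?_
    have h1 := D.sys.ne_zero n
    have h2 : z + D.η n ≠ 0 := by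
      have := sub_ne_zero.mpr (hzn (D.τ n))
      rwa [D.η'_inv, sub_neg_eq_add] at this
    have h3 : z - hat D.q₀ (D.η (D.τ n)) = z + D.η n := by rw [D.sys.hat_inv]; ring
    have h4 : (D.q₀ : ℂ) ^ 2 / z - hat D.q₀ (D.η n) = (D.q₀ : ℂ) ^ 2 * (z + D.η n) / (z * D.η n) := by
      unfold hat; field_simp; ring
    rw [h3, h4, d, D.sys.inv_inv, D.sys.eta_inv]
    field_simp

theorem f_eq {z : ℂ} (hz : z ≠ 0) (hzn : ∀ n, z ≠ -D.η n) (x t : ℝ) :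
    D.f z x t = I * D.r / z * D.g ((D.q₀ : ℂ) ^ 2 / z) x t := by
  have hq := D.sys.q_ne
  have hr := D.sys.sqC
  have h1 : (D.q₀ : ℂ) ^ 2 / z ≠ 0 := div_ne_zero (pow_ne_zero 2 hq) hz
  rw [D.g_eq h1 (fun n hn => hzn n ?_)]
  · rw [div_div_cancel₀ (pow_ne_zero 2 hq)]
    have : I * (D.r : ℂ) / z * (-(I * D.r / ((D.q₀ : ℂ) ^ 2 / z)) * D.f z x t) =
        -(I ^ 2) * ((D.r : ℂ) ^ 2 / (D.q₀ : ℂ) ^ 2) * D.f z x t := by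
      field_simp
    rw [this, hr, I_sq, div_self (pow_ne_zero 2 hq)]; ring
  · have h2 := D.sys.ne_zero n
    rw [η', hat] at hn
    field_simp at hn
    rw [hn]; ring

/-- By the symmetry `z ↦ q₀²/z` and `κ ∘ τ = κ`, the second component obeys the same residue
conditions as the first. Hence linear combinations of both may be fed into the uniqueness lemma. -/
theorem d_eq (x t : ℝ) (n : ι) : D.d n x t = D.κ x t n * D.g (D.η n) x t := by
  rw [D.g_eq (D.sys.ne_zero n) fun m => D.sys.ne_hat n m, ← D.sys.eta_inv, ← D.v_spec, d, c,
    (D.symmCoeff x t).coef_inv]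
  ring

/-- Multiplication by `z` splits off the sum of the residues; this constant is what produces the
potential `qc`. -/
theorem mul_pfrac (a : ι → ℂ) {z : ℂ} (hzn : ∀ n, z ≠ D.η' n) :
    z * pfrac D.q₀ D.η a z = ∑ n, a n + pfrac D.q₀ D.η (fun n => D.η' n * a n) z := by
  rw [pfrac, pfrac, Finset.mul_sum, ← Finset.sum_add_distrib]
  refine Finset.sum_congr rfl fun n _ => ?_
  have : z - hat D.q₀ (D.η n) ≠ 0 := sub_ne_zero.mpr (hzn n)
  rw [η']
  field_simp
  ring

end RatData

namespace RatData

variable {ι : Type*} (D : RatData ι) [Fintype ι] [DecidableEq ι]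

/-! #### The spatial equation -/

/-- The differences of both sides are the residues of `f_x - izf - qg`. The choice of `qc` cancels
its constant at infinity, so it is a pure sum of simple fractions, and by `dx_κ` and `d_eq` it
satisfies the homogeneous residue conditions. Uniqueness of the interpolation makes it zero. -/
theorem dx_c_eq (x t : ℝ) (n : ι) :
    dx (D.c n) x t = I * D.η' n * D.c n x t + D.qc x t * D.d n x t := by
  have h0 := D.sys.eq_zero_of_residue (D.symmCoeff x t)
    (c := fun n => dx (D.c n) x t - I * D.η' n * D.c n x t - D.qc x t * D.d n x t) ?_
  · have := congrFun h0 n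
    simp only [Pi.zero_apply] at this
    linear_combination this
  intro k
  have hk := D.sys.ne_zero k
  have hne : ∀ n, D.η k ≠ D.η' n := fun n => D.sys.ne_hat k n
  have e : pfrac D.q₀ D.η
      (fun n => dx (D.c n) x t - I * D.η' n * D.c n x t - D.qc x t * D.d n x t) (D.η k) =
      dx (D.f (D.η k)) x t - I * D.η k * D.f (D.η k) x t - D.qc x t * D.g (D.η k) x t := by
    have h1 := D.mul_pfrac (fun n => D.c n x t) hne
    have h2 : pfrac D.q₀ D.η
        (fun n => dx (D.c n) x t - I * D.η' n * D.c n x t - D.qc x t * D.d n x t) (D.η k) =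
        pfrac D.q₀ D.η (fun n => dx (D.c n) x t) (D.η k) -
        I * pfrac D.q₀ D.η (fun n => D.η' n * D.c n x t) (D.η k) -
        D.qc x t * pfrac D.q₀ D.η (fun n => D.d n x t) (D.η k) := by
      simp only [pfrac, Finset.mul_sum, ← Finset.sum_sub_distrib]
      exact Finset.sum_congr rfl fun n _ => by ring
    rw [h2, D.dx_f, f, g]
    have h3 : I * D.η k * (I * D.r / D.η k) = -D.r := by
      field_simp; rw [I_sq]; ring
    have h4 : D.qc x t = D.r - I * ∑ n, D.c n x t := rfl
    linear_combination I * h1 + h3 + h4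
  rw [e, D.dx_c, D.d_eq, c, D.v_spec]
  ring

theorem dx_f_eq {z : ℂ} (hz : z ≠ 0) (hzn : ∀ n, z ≠ D.η' n) (x t : ℝ) :
    dx (D.f z) x t = I * z * D.f z x t + D.qc x t * D.g z x t := by
  have h1 := D.mul_pfrac (fun n => D.c n x t) hzn
  have h2 : pfrac D.q₀ D.η (fun n => dx (D.c n) x t) z =
      I * pfrac D.q₀ D.η (fun n => D.η' n * D.c n x t) z +
      D.qc x t * pfrac D.q₀ D.η (fun n => D.d n x t) z := by
    simp only [D.dx_c_eq, pfrac, Finset.mul_sum, ← Finset.sum_add_distrib]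
    exact Finset.sum_congr rfl fun n _ => by ring
  rw [D.dx_f, h2, f, g]
  have h3 : I * z * (I * D.r / z) = -D.r := by
    field_simp; rw [I_sq]; ring
  have h4 : D.qc x t = D.r - I * ∑ n, D.c n x t := rfl
  linear_combination -I * h1 - h3 - h4

theorem coef_d_sq (x t : ℝ) (n : ι) :
    I * D.r / D.η n * D.d (D.τ n) x t = D.c n x t := by
  have h1 := D.sys.ne_zero n
  have h2 := D.sys.q_ne
  have hr := D.sys.sqC
  rw [d, D.sys.inv_inv, D.sys.eta_inv]
  have : I * (D.r : ℂ) / D.η n * (-(I * D.r / ((D.q₀ : ℂ) ^ 2 / D.η n)) * D.c n x t) =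
      -(I ^ 2) * ((D.r : ℂ) ^ 2 / (D.q₀ : ℂ) ^ 2) * D.c n x t := by
    field_simp
  rw [this, hr, I_sq, div_self (pow_ne_zero 2 h2)]; ring

theorem sq_div_η' (n : ι) : (D.q₀ : ℂ) ^ 2 / D.η' n = -D.η n := by
  have h1 := D.sys.ne_zero n
  have h2 := D.sys.q_ne
  rw [η', hat]; field_simp

theorem dx_d_eq (x t : ℝ) (n : ι) :
    dx (D.d n) x t = -(D.qc x t * D.c n x t) + I * ((D.q₀ : ℂ) ^ 2 / D.η' n) * D.d n x t := by
  have h := ((D.smooth_c (D.τ n)).hasDerivAt_dx x t).const_mul (-(I * D.r / D.η n))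
  have e : dx (D.d n) x t = -(I * D.r / D.η n) * dx (D.c (D.τ n)) x t := h.deriv
  rw [e, D.dx_c_eq, D.η'_inv, D.sq_div_η', ← D.coef_d_sq x t n]
  have hd : D.d n x t = -(I * D.r / D.η n) * D.c (D.τ n) x t := rfl
  linear_combination I * D.η n * hd

theorem dx_g_eq {z : ℂ} (hz : z ≠ 0) (hzn : ∀ n, z ≠ D.η' n) (x t : ℝ) :
    dx (D.g z) x t = -(D.qc x t * D.f z x t) + I * ((D.q₀ : ℂ) ^ 2 / z) * D.g z x t := by
  have hq := D.sys.q_ne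
  have hz' : (D.q₀ : ℂ) ^ 2 / z ≠ 0 := div_ne_zero (pow_ne_zero 2 hq) hz
  have hzm : ∀ n, z ≠ -D.η n := fun n => by rw [← D.η'_inv]; exact hzn _
  have hzn' : ∀ n, (D.q₀ : ℂ) ^ 2 / z ≠ D.η' n := fun n hn => by
    apply hzm n
    have h2 := D.sys.ne_zero n
    rw [η', hat] at hn
    field_simp at hn
    rw [hn]; ring
  have h := ((D.smooth_f ((D.q₀ : ℂ) ^ 2 / z)).hasDerivAt_dx x t).const_mul (-(I * D.r / z))
  have e : dx (D.g z) x t = -(I * D.r / z) * dx (D.f ((D.q₀ : ℂ) ^ 2 / z)) x t := by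
    rw [← h.deriv]
    simp only [dx, D.g_eq hz hzn]
  rw [e, D.dx_f_eq hz' hzn', D.f_eq hz hzm, D.g_eq hz hzn]
  ring

/-! #### The temporal equation -/

/-- The upper left entry of `T`. -/
def T11 (z : ℂ) (x t : ℝ) : ℂ := 4 * I * kk D.q₀ z ^ 3 - 2 * I * kk D.q₀ z * D.qc x t ^ 2

/-- The upper right entry of `T`. -/
def T12 (z : ℂ) (x t : ℝ) : ℂ := 4 * kk D.q₀ z ^ 2 * D.qc x t - 2 * I * kk D.q₀ z * dx D.qc x t
  - 2 * D.qc x t ^ 3 - dx (dx D.qc) x t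

/-- The lower left entry of `T`. -/
def T21 (z : ℂ) (x t : ℝ) : ℂ := -(4 * kk D.q₀ z ^ 2 * D.qc x t) - 2 * I * kk D.q₀ z * dx D.qc x t
  + 2 * D.qc x t ^ 3 + dx (dx D.qc) x t

theorem dx_dx_f_eq {z : ℂ} (hz : z ≠ 0) (hzn : ∀ n, z ≠ D.η' n) (x t : ℝ) :
    dx (dx (D.f z)) x t = I * z * dx (D.f z) x t +
      (dx D.qc x t * D.g z x t + D.qc x t * dx (D.g z) x t) := by
  have h := (((D.smooth_f z).hasDerivAt_dx x t).const_mul (I * z)).add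
    ((D.smooth_qc.hasDerivAt_dx x t).mul ((D.smooth_g z).hasDerivAt_dx x t))
  have e : dx (D.f z) = fun x t => I * z * D.f z x t + D.qc x t * D.g z x t := by
    funext x t; exact D.dx_f_eq hz hzn x t
  rw [← h.deriv]
  conv_lhs => rw [e]
  rfl

/-- The `x`-equation is used to trade the powers of `k` in `T` for `x`-derivatives. On the right
every factor `k` or `λ` meets a quantity of order `1/z`, so each term has a limit at infinity. -/
theorem rowOne_eq {z : ℂ} (hz : z ≠ 0) (hzn : ∀ n, z ≠ D.η' n) (x t : ℝ) :
    (D.T11 z x t + I * thetaT D.q₀ z) * D.f z x t + D.T12 z x t * D.g z x t =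
      -(2 * I * (kk D.q₀ z * dx (dx (D.f z)) x t)) - 4 * I * D.qc x t ^ 2 * (kk D.q₀ z * D.f z x t)
      - 2 * (kk D.q₀ z * ((D.q₀ : ℂ) ^ 2 / z)) * (dx (D.f z) x t + D.qc x t * D.g z x t)
      - 2 * I * (D.q₀ : ℂ) ^ 2 * (lam D.q₀ z * D.f z x t)
      - (2 * D.qc x t ^ 3 + dx (dx D.qc) x t) * D.g z x t := by
  rw [D.dx_dx_f_eq hz hzn, D.dx_g_eq hz hzn, D.dx_f_eq hz hzn]
  simp only [T11, T12, thetaT, kk, lam]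
  field_simp
  ring_nf
  simp only [I_sq, show I ^ 3 = -I by rw [pow_succ, I_sq]; ring]
  ring

theorem rowTwo_eq {z : ℂ} (hz : z ≠ 0) (hzn : ∀ n, z ≠ D.η' n) (x t : ℝ) :
    D.T21 z x t * D.f z x t + (-D.T11 z x t + I * thetaT D.q₀ z) * D.g z x t =
      -(2 * (kk D.q₀ z * ((D.q₀ : ℂ) ^ 2 / z)) * dx (D.g z) x t)
      + 2 * I * (D.qc x t * (kk D.q₀ z * dx (D.f z) x t) - dx D.qc x t * (kk D.q₀ z * D.f z x t))
      - 2 * I * ((D.q₀ : ℂ) ^ 4 / z) * D.g z x t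
      + (2 * D.qc x t ^ 3 + dx (dx D.qc) x t) * D.f z x t := by
  rw [D.dx_g_eq hz hzn, D.dx_f_eq hz hzn]
  simp only [T11, T21, thetaT, kk, lam]
  field_simp
  ring_nf
  simp only [I_sq]
  ring

end RatData

theorem eventually_cobounded_ne (s : ℂ) : ∀ᶠ z in cobounded ℂ, z ≠ s := by
  have h : IsBounded ({s} : Set ℂ) := (Set.finite_singleton s).isBounded
  filter_upwards [isBounded_def.mp h] with z hz
  exact hz

section growth

variable {F : ℂ → ℂ} {L : ℂ}

theorem tendsto_zero_of_mul_tendsto (h : Tendsto (fun z => z * F z) (cobounded ℂ) (𝓝 L)) :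
    Tendsto F (cobounded ℂ) (𝓝 0) := by
  have h1 := tendsto_inv₀_cobounded.mul h
  rw [zero_mul] at h1
  refine h1.congr' ?_
  filter_upwards [eventually_cobounded_ne 0] with z hz
  field_simp

theorem tendsto_kk_mul (q₀ : ℝ) (h : Tendsto (fun z => z * F z) (cobounded ℂ) (𝓝 L)) :
    Tendsto (fun z => kk q₀ z * F z) (cobounded ℂ) (𝓝 (L / 2)) := by
  have h1 := (h.sub ((tendsto_inv₀_cobounded.const_mul ((q₀ : ℂ) ^ 2)).mul
    (tendsto_zero_of_mul_tendsto h))).div_const 2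
  rw [mul_zero, sub_zero] at h1
  refine h1.congr fun z => ?_
  rw [kk]; ring

theorem tendsto_lam_mul (q₀ : ℝ) (h : Tendsto (fun z => z * F z) (cobounded ℂ) (𝓝 L)) :
    Tendsto (fun z => lam q₀ z * F z) (cobounded ℂ) (𝓝 (L / 2)) := by
  have h1 := (h.add ((tendsto_inv₀_cobounded.const_mul ((q₀ : ℂ) ^ 2)).mul
    (tendsto_zero_of_mul_tendsto h))).div_const 2
  rw [mul_zero, add_zero] at h1
  refine h1.congr fun z => ?_
  rw [lam]; ring

end growth

theorem tendsto_mul_div_cobounded (c : ℂ) :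
    Tendsto (fun z : ℂ => z * (c / z)) (cobounded ℂ) (𝓝 c) := by
  refine tendsto_const_nhds.congr' ?_
  filter_upwards [eventually_cobounded_ne 0] with z hz
  field_simp

theorem differentiableAt_kk (q₀ : ℝ) {z : ℂ} (hz : z ≠ 0) : DifferentiableAt ℂ (kk q₀) z := by
  unfold kk
  exact (differentiableAt_id.sub ((differentiableAt_const _).div differentiableAt_id hz)).div_const 2

theorem differentiableAt_lam (q₀ : ℝ) {z : ℂ} (hz : z ≠ 0) : DifferentiableAt ℂ (lam q₀) z := by
  unfold lam
  exact (differentiableAt_id.add ((differentiableAt_const _).div differentiableAt_id hz)).div_const 2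

theorem kk_sq_div {q₀ : ℝ} (hq : q₀ ≠ 0) {z : ℂ} (hz : z ≠ 0) :
    kk q₀ ((q₀ : ℂ) ^ 2 / z) = -kk q₀ z := by
  rw [← neg_neg ((q₀ : ℂ) ^ 2 / z), kk_neg, kk_neg_div hq hz]

theorem lam_sq_div {q₀ : ℝ} (hq : q₀ ≠ 0) {z : ℂ} (hz : z ≠ 0) :
    lam q₀ ((q₀ : ℂ) ^ 2 / z) = lam q₀ z := by
  rw [← neg_neg ((q₀ : ℂ) ^ 2 / z), lam_neg, lam_neg_div hq hz, neg_neg]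

/-! ### The defect of the temporal equation and its singularities. -/

namespace RatData

variable {ι : Type*} (D : RatData ι) [Fintype ι] [DecidableEq ι]

theorem tendsto_mul_pfrac_cobounded (a : ι → ℂ) :
    Tendsto (fun z => z * pfrac D.q₀ D.η a z) (cobounded ℂ) (𝓝 (∑ n, a n)) := by
  have h := (tendsto_cobounded_sum_div_sub (fun n => D.η' n * a n)
    (fun n => hat D.q₀ (D.η n))).const_add (∑ n, a n)
  rw [add_zero] at h
  refine h.congr' ?_
  filter_upwards [eventually_all.mpr fun n => eventually_cobounded_ne (D.η' n)] with z hz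
  exact (D.mul_pfrac a hz).symm

theorem I_mul_sum_c (x t : ℝ) : I * D.r + ∑ n, D.c n x t = I * D.qc x t := by
  rw [qc]; linear_combination (∑ n, D.c n x t) * I_sq

theorem tendsto_mul_f (x t : ℝ) :
    Tendsto (fun z => z * D.f z x t) (cobounded ℂ) (𝓝 (I * D.qc x t)) := by
  rw [← D.I_mul_sum_c]
  refine ((tendsto_mul_div_cobounded (I * D.r)).add
    (D.tendsto_mul_pfrac_cobounded fun n => D.c n x t)).congr fun z => ?_
  rw [f]; ring

theorem tendsto_mul_dx_f (x t : ℝ) :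
    Tendsto (fun z => z * dx (D.f z) x t) (cobounded ℂ) (𝓝 (I * dx D.qc x t)) := by
  have : I * dx D.qc x t = ∑ n, dx (D.c n) x t := by
    rw [D.dx_qc]; linear_combination -(∑ n, dx (D.c n) x t) * I_sq
  rw [this]
  simp only [D.dx_f]
  exact D.tendsto_mul_pfrac_cobounded _

theorem tendsto_mul_dx_dx_f (x t : ℝ) :
    Tendsto (fun z => z * dx (dx (D.f z)) x t) (cobounded ℂ) (𝓝 (I * dx (dx D.qc) x t)) := by
  have : I * dx (dx D.qc) x t = ∑ n, dx (dx (D.c n)) x t := by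
    rw [D.dx_dx_qc]; linear_combination -(∑ n, dx (dx (D.c n)) x t) * I_sq
  rw [this]
  simp only [D.dx_dx_f]
  exact D.tendsto_mul_pfrac_cobounded _

theorem tendsto_g (x t : ℝ) : Tendsto (fun z => D.g z x t) (cobounded ℂ) (𝓝 1) := by
  have := (tendsto_cobounded_sum_div_sub (fun n => D.d n x t)
    (fun n => hat D.q₀ (D.η n))).const_add 1
  rwa [add_zero] at this

theorem tendsto_dx_g (x t : ℝ) : Tendsto (fun z => dx (D.g z) x t) (cobounded ℂ) (𝓝 0) := by
  simp only [D.dx_g]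
  exact tendsto_cobounded_sum_div_sub _ _

/-- The defect of the first row of the temporal equation. -/
def defOne (z : ℂ) (x t : ℝ) : ℂ :=
  dt (D.f z) x t - ((D.T11 z x t + I * thetaT D.q₀ z) * D.f z x t + D.T12 z x t * D.g z x t)

/-- The defect of the second row of the temporal equation. -/
def defTwo (z : ℂ) (x t : ℝ) : ℂ :=
  dt (D.g z) x t - (D.T21 z x t * D.f z x t + (-D.T11 z x t + I * thetaT D.q₀ z) * D.g z x t)

/-- The coefficient of `1/z` in `f` and its `x`-derivatives is `i` times the corresponding
derivative of the potential; with these values the limits of the terms of `rowOne_eq` cancel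
exactly. -/
theorem tendsto_defOne (x t : ℝ) : Tendsto (fun z => D.defOne z x t) (cobounded ℂ) (𝓝 0) := by
  have h0 : Tendsto (fun z => dt (D.f z) x t) (cobounded ℂ) (𝓝 0) := by
    simp only [D.dt_f]; exact tendsto_cobounded_sum_div_sub _ _
  have h1 := (tendsto_kk_mul D.q₀ (D.tendsto_mul_dx_dx_f x t)).const_mul (2 * I)
  have h2 := (tendsto_kk_mul D.q₀ (D.tendsto_mul_f x t)).const_mul (4 * I * D.qc x t ^ 2)
  have h3 := ((tendsto_kk_mul D.q₀ (tendsto_mul_div_cobounded ((D.q₀ : ℂ) ^ 2))).const_mul 2).mul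
    ((tendsto_zero_of_mul_tendsto (D.tendsto_mul_dx_f x t)).add ((D.tendsto_g x t).const_mul
      (D.qc x t)))
  have h4 := (tendsto_lam_mul D.q₀ (D.tendsto_mul_f x t)).const_mul (2 * I * (D.q₀ : ℂ) ^ 2)
  have h5 := (D.tendsto_g x t).const_mul (2 * D.qc x t ^ 3 + dx (dx D.qc) x t)
  have h := h0.sub ((((h1.neg.sub h2).sub h3).sub h4).sub h5)
  have e : (0 : ℂ) - (-(2 * I * (I * dx (dx D.qc) x t / 2)) -
      4 * I * D.qc x t ^ 2 * (I * D.qc x t / 2) -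
      2 * ((D.q₀ : ℂ) ^ 2 / 2) * (0 + D.qc x t * 1) -
      2 * I * (D.q₀ : ℂ) ^ 2 * (I * D.qc x t / 2) -
      (2 * D.qc x t ^ 3 + dx (dx D.qc) x t) * 1) = 0 := by
    linear_combination (dx (dx D.qc) x t + 2 * D.qc x t ^ 3 + (D.q₀ : ℂ) ^ 2 * D.qc x t) * I_sq
  rw [e] at h
  refine h.congr' ?_
  filter_upwards [eventually_cobounded_ne 0,
    eventually_all.mpr fun n => eventually_cobounded_ne (D.η' n)] with z hz hzn
  rw [defOne, D.rowOne_eq hz hzn]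

theorem tendsto_defTwo (x t : ℝ) : Tendsto (fun z => D.defTwo z x t) (cobounded ℂ) (𝓝 0) := by
  have h0 : Tendsto (fun z => dt (D.g z) x t) (cobounded ℂ) (𝓝 0) := by
    simp only [D.dt_g]; exact tendsto_cobounded_sum_div_sub _ _
  have h1 := ((tendsto_kk_mul D.q₀ (tendsto_mul_div_cobounded ((D.q₀ : ℂ) ^ 2))).const_mul 2).mul
    (D.tendsto_dx_g x t)
  have h2 := (((tendsto_kk_mul D.q₀ (D.tendsto_mul_dx_f x t)).const_mul (D.qc x t)).sub
    ((tendsto_kk_mul D.q₀ (D.tendsto_mul_f x t)).const_mul (dx D.qc x t))).const_mul (2 * I)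
  have h3 := ((tendsto_cobounded_div_sub ((D.q₀ : ℂ) ^ 4) 0).const_mul (2 * I)).mul (D.tendsto_g x t)
  have h4 := (tendsto_zero_of_mul_tendsto (D.tendsto_mul_f x t)).const_mul
    (2 * D.qc x t ^ 3 + dx (dx D.qc) x t)
  have h := h0.sub (((h1.neg.add h2).sub h3).add h4)
  have e : (0 : ℂ) - (-(2 * ((D.q₀ : ℂ) ^ 2 / 2) * 0) +
      2 * I * (D.qc x t * (I * dx D.qc x t / 2) - dx D.qc x t * (I * D.qc x t / 2)) -
      2 * I * 0 * 1 + (2 * D.qc x t ^ 3 + dx (dx D.qc) x t) * 0) = 0 := by ring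
  rw [e] at h
  refine h.congr' ?_
  filter_upwards [eventually_cobounded_ne 0,
    eventually_all.mpr fun n => eventually_cobounded_ne (D.η' n)] with z hz hzn
  rw [defTwo, D.rowTwo_eq hz hzn, sub_zero]

theorem sq_div_ne {z : ℂ} (hz : z ≠ 0) (hzn : ∀ n, z ≠ D.η' n) (n : ι) :
    (D.q₀ : ℂ) ^ 2 / z ≠ D.η' n := by
  intro hn
  have h1 := D.sys.ne_zero n
  have h2 := D.sys.q_ne
  refine hzn (D.τ n) ?_
  rw [D.η'_inv]
  rw [η', hat] at hn
  field_simp at hn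
  rw [hn]; ring

theorem T11_sq_div {z : ℂ} (hz : z ≠ 0) (x t : ℝ) :
    D.T11 ((D.q₀ : ℂ) ^ 2 / z) x t = -D.T11 z x t := by
  simp only [T11, kk_sq_div D.sys.pos.ne' hz]; ring

theorem T12_sq_div {z : ℂ} (hz : z ≠ 0) (x t : ℝ) :
    D.T12 ((D.q₀ : ℂ) ^ 2 / z) x t = -D.T21 z x t := by
  simp only [T12, T21, kk_sq_div D.sys.pos.ne' hz]; ring

theorem T21_sq_div {z : ℂ} (hz : z ≠ 0) (x t : ℝ) :
    D.T21 ((D.q₀ : ℂ) ^ 2 / z) x t = -D.T12 z x t := by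
  simp only [T12, T21, kk_sq_div D.sys.pos.ne' hz]; ring

theorem thetaT_sq_div {z : ℂ} (hz : z ≠ 0) : thetaT D.q₀ ((D.q₀ : ℂ) ^ 2 / z) = thetaT D.q₀ z := by
  simp only [thetaT, kk_sq_div D.sys.pos.ne' hz, lam_sq_div D.sys.pos.ne' hz]; ring

/-- Symmetry `z ↦ q₀²/z` of the whole system. It carries the decay of the second defect at infinity
to the behaviour of the first at `z = 0`, where `T` is singular. -/
theorem defOne_eq {z : ℂ} (hz : z ≠ 0) (hzn : ∀ n, z ≠ D.η' n) (x t : ℝ) :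
    D.defOne z x t = I * D.r / z * D.defTwo ((D.q₀ : ℂ) ^ 2 / z) x t := by
  have hzm : ∀ n, z ≠ -D.η n := fun n => by rw [← D.η'_inv]; exact hzn _
  have h := ((D.smooth_g ((D.q₀ : ℂ) ^ 2 / z)).hasDerivAt_dt x t).const_mul (I * D.r / z)
  have e : dt (D.f z) x t = I * D.r / z * dt (D.g ((D.q₀ : ℂ) ^ 2 / z)) x t := by
    rw [← h.deriv]
    simp only [dt, D.f_eq hz hzm]
  rw [defOne, defTwo, e, D.T21_sq_div hz, D.T11_sq_div hz, D.thetaT_sq_div hz, D.f_eq hz hzm,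
    D.g_eq hz hzn]
  ring

theorem defTwo_eq {z : ℂ} (hz : z ≠ 0) (hzn : ∀ n, z ≠ D.η' n) (x t : ℝ) :
    D.defTwo z x t = -(I * D.r / z) * D.defOne ((D.q₀ : ℂ) ^ 2 / z) x t := by
  have hzm : ∀ n, z ≠ -D.η n := fun n => by rw [← D.η'_inv]; exact hzn _
  have h := ((D.smooth_f ((D.q₀ : ℂ) ^ 2 / z)).hasDerivAt_dt x t).const_mul (-(I * D.r / z))
  have e : dt (D.g z) x t = -(I * D.r / z) * dt (D.f ((D.q₀ : ℂ) ^ 2 / z)) x t := by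
    rw [← h.deriv]
    simp only [dt, D.g_eq hz hzn]
  rw [defOne, defTwo, e, D.T12_sq_div hz, D.T11_sq_div hz, D.thetaT_sq_div hz, D.f_eq hz hzm,
    D.g_eq hz hzn]
  ring

/-- The residues of the defect. -/
def defRes (n : ι) (x t : ℝ) : ℂ :=
  dt (D.c n) x t - ((D.T11 (D.η' n) x t + I * thetaT D.q₀ (D.η' n)) * D.c n x t +
    D.T12 (D.η' n) x t * D.d n x t)

theorem differentiableAt_T11 {z : ℂ} (hz : z ≠ 0) (x t : ℝ) :
    DifferentiableAt ℂ (fun z => D.T11 z x t + I * thetaT D.q₀ z) z := by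
  have h1 := differentiableAt_kk D.q₀ hz
  have h2 := differentiableAt_lam D.q₀ hz
  unfold T11 thetaT
  fun_prop

theorem differentiableAt_T12 {z : ℂ} (hz : z ≠ 0) (x t : ℝ) :
    DifferentiableAt ℂ (fun z => D.T12 z x t) z := by
  have h1 := differentiableAt_kk D.q₀ hz
  unfold T12
  fun_prop

/-- The defect can be singular only at the `η̂_n`, where its poles are simple, and at `0`, where the
third power of `k` suggests a high order pole. The latter is removable by `defOne_eq` and
`tendsto_defTwo`. Since the defect vanishes at infinity, it is the sum of its principal parts. -/
theorem defOne_eq_pfrac {z : ℂ} (hz : z ≠ 0) (hzn : ∀ n, z ≠ D.η' n) (x t : ℝ) :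
    D.defOne z x t = pfrac D.q₀ D.η (fun n => D.defRes n x t) z := by
  classical
  set S : Finset ℂ := insert 0 (Finset.univ.image D.η') with hS
  have hS0 : ∀ z ∉ S, z ≠ 0 ∧ ∀ n, z ≠ D.η' n := fun z hz =>
    ⟨fun h => hz (h ▸ Finset.mem_insert_self _ _), fun n hn =>
      hz (Finset.mem_insert_of_mem (Finset.mem_image.mpr ⟨n, Finset.mem_univ _, hn.symm⟩))⟩
  have hzS : z ∉ S := by
    intro h
    rcases Finset.mem_insert.mp h with h | h
    · exact hz h
    · obtain ⟨n, _, hn⟩ := Finset.mem_image.mp h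
      exact hzn n hn.symm
  refine sub_eq_zero.mp (eq_of_removable_of_tendsto S
    (fun z => D.defOne z x t - pfrac D.q₀ D.η (fun n => D.defRes n x t) z) 0 ?_ ?_ ?_ z hzS)
  · intro y hy
    obtain ⟨hy0, hyn⟩ := hS0 y hy
    have hp : ∀ a : ι → ℂ, DifferentiableAt ℂ (pfrac D.q₀ D.η a) y := fun a => by
      unfold pfrac
      exact DifferentiableAt.fun_sum fun n _ => (differentiableAt_const _).div
        (differentiableAt_id.sub_const _) (sub_ne_zero.mpr (hyn n))
    have hf : DifferentiableAt ℂ (fun z => D.f z x t) y :=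
      ((differentiableAt_const _).div differentiableAt_id hy0).add (hp _)
    have hg : DifferentiableAt ℂ (fun z => D.g z x t) y := (differentiableAt_const _).add (hp _)
    have hft : DifferentiableAt ℂ (fun z => dt (D.f z) x t) y := by
      simp only [D.dt_f]; exact hp _
    exact ((hft.sub (((D.differentiableAt_T11 hy0 x t).mul hf).add
      ((D.differentiableAt_T12 hy0 x t).mul hg))).sub (hp _)).differentiableWithinAt
  · intro s hs
    rcases Finset.mem_insert.mp hs with rfl | hs
    · have h1 : Tendsto (fun z : ℂ => (D.q₀ : ℂ) ^ 2 / z) (𝓝[≠] 0) (cobounded ℂ) := by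
        have hq := pow_ne_zero 2 D.sys.q_ne
        have e : Tendsto (fun z : ℂ => z / (D.q₀ : ℂ) ^ 2) (𝓝[≠] 0) (𝓝[≠] 0) := by
          refine tendsto_nhdsWithin_iff.mpr ⟨?_, ?_⟩
          · have : Tendsto (fun z : ℂ => z / (D.q₀ : ℂ) ^ 2) (𝓝 0) (𝓝 (0 / (D.q₀ : ℂ) ^ 2)) :=
              tendsto_id.div_const _
            rw [zero_div] at this
            exact this.mono_left nhdsWithin_le_nhds
          · filter_upwards [self_mem_nhdsWithin] with z hz
            exact div_ne_zero hz hq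
        refine (tendsto_inv₀_nhdsNE_zero.comp e).congr fun z => ?_
        simp
      have h2 := ((D.tendsto_defTwo x t).comp h1).const_mul (I * D.r)
      have h3 : Tendsto (fun z => z * pfrac D.q₀ D.η (fun n => D.defRes n x t) z) (𝓝[≠] 0)
          (𝓝 (0 * pfrac D.q₀ D.η (fun n => D.defRes n x t) 0)) := by
        refine Tendsto.mono_left ?_ nhdsWithin_le_nhds
        exact tendsto_id.mul (PoleSys.continuousAt_pfrac _ fun n => (D.η'_ne_zero n).symm)
      have h4 := h2.sub h3
      rw [mul_zero, zero_mul, sub_zero] at h4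
      refine h4.congr' ?_
      have h5 : ∀ᶠ z : ℂ in 𝓝[≠] 0, ∀ n, z ≠ D.η' n := by
        refine eventually_all.mpr fun n => ?_
        exact nhdsWithin_le_nhds (isOpen_ne.mem_nhds (D.η'_ne_zero n).symm)
      filter_upwards [self_mem_nhdsWithin, h5] with y hy hyn
      have hy' : y ≠ 0 := hy
      simp only [Function.comp, sub_zero, D.defOne_eq hy' hyn]
      field_simp
    · obtain ⟨k, _, rfl⟩ := Finset.mem_image.mp hs
      have hk := D.η'_ne_zero k
      have hid : Tendsto (fun z : ℂ => z - D.η' k) (𝓝[≠] (D.η' k)) (𝓝 0) := by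
        have : Tendsto (fun z : ℂ => z - D.η' k) (𝓝 (D.η' k)) (𝓝 (D.η' k - D.η' k)) :=
          tendsto_id.sub_const _
        rw [sub_self] at this
        exact this.mono_left nhdsWithin_le_nhds
      have h1 : Tendsto (fun z => (z - D.η' k) * D.f z x t) (𝓝[≠] (D.η' k)) (𝓝 (D.c k x t)) := by
        have e1 : Tendsto (fun z : ℂ => I * D.r / z) (𝓝[≠] (D.η' k)) (𝓝 (I * D.r / D.η' k)) :=
          (tendsto_const_nhds.div tendsto_id hk).mono_left nhdsWithin_le_nhds
        have := (hid.mul e1).add (D.sys.tendsto_mul_pfrac (fun n => D.c n x t) k)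
        rw [zero_mul, zero_add] at this
        refine this.congr fun z => ?_
        rw [f, η']; ring
      have h2 : Tendsto (fun z => (z - D.η' k) * D.g z x t) (𝓝[≠] (D.η' k)) (𝓝 (D.d k x t)) := by
        have := (hid.mul_const 1).add (D.sys.tendsto_mul_pfrac (fun n => D.d n x t) k)
        rw [zero_mul, zero_add] at this
        refine this.congr fun z => ?_
        rw [g, η']; ring
      have h3 := (D.differentiableAt_T11 hk x t).continuousAt.tendsto.mono_left
        (nhdsWithin_le_nhds (s := {D.η' k}ᶜ))
      have h4 := (D.differentiableAt_T12 hk x t).continuousAt.tendsto.mono_left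
        (nhdsWithin_le_nhds (s := {D.η' k}ᶜ))
      have h5 := ((D.sys.tendsto_mul_pfrac (fun n => dt (D.c n) x t) k).sub
        ((h3.mul h1).add (h4.mul h2))).sub (D.sys.tendsto_mul_pfrac (fun n => D.defRes n x t) k)
      rw [show dt (D.c k) x t - ((D.T11 (D.η' k) x t + I * thetaT D.q₀ (D.η' k)) * D.c k x t +
        D.T12 (D.η' k) x t * D.d k x t) - D.defRes k x t = 0 from sub_self _] at h5
      refine h5.congr fun z => ?_
      rw [defOne, D.dt_f, η']; ring
  · rw [← Metric.cobounded_eq_cocompact]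
    have := (D.tendsto_defOne x t).sub (tendsto_cobounded_sum_div_sub (fun n => D.defRes n x t)
      fun n => hat D.q₀ (D.η n))
    rwa [sub_zero] at this

theorem kk_η' (n : ι) : kk D.q₀ (D.η' n) = kk D.q₀ (D.η n) :=
  kk_neg_div D.sys.pos.ne' (D.sys.ne_zero n)

theorem thetaT_η' (n : ι) : thetaT D.q₀ (D.η' n) = -thetaT D.q₀ (D.η n) := by
  rw [thetaT, D.kk_η', η', hat, lam_neg_div D.sys.pos.ne' (D.sys.ne_zero n), thetaT]; ring

/-- `k` and hence `T` take equal values at `η` and `η̂`, whereas `θ_t` changes sign; the mismatch is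
exactly the logarithmic `t`-derivative of `κ`. So the defect solves the homogeneous interpolation
problem. -/
theorem defRes_eq_zero (n : ι) (x t : ℝ) : D.defRes n x t = 0 := by
  refine congrFun (D.sys.eq_zero_of_residue (D.symmCoeff x t) (c := fun n => D.defRes n x t)
    fun k => ?_) n
  rw [← D.defOne_eq_pfrac (D.sys.ne_zero k) fun n => D.sys.ne_hat k n, defRes, defOne, D.dt_c,
    D.d_eq, c, D.v_spec]
  have h1 : D.T11 (D.η' k) x t = D.T11 (D.η k) x t := by simp only [T11, D.kk_η']
  have h2 : D.T12 (D.η' k) x t = D.T12 (D.η k) x t := by simp only [T12, D.kk_η']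
  rw [h1, h2, D.thetaT_η']
  ring

theorem dt_f_eq {z : ℂ} (hz : z ≠ 0) (hzn : ∀ n, z ≠ D.η' n) (x t : ℝ) : dt (D.f z) x t =
    (D.T11 z x t + I * thetaT D.q₀ z) * D.f z x t + D.T12 z x t * D.g z x t := by
  have := D.defOne_eq_pfrac hz hzn x t
  simp only [D.defRes_eq_zero, pfrac, zero_div, Finset.sum_const_zero] at this
  exact sub_eq_zero.mp this

theorem dt_g_eq {z : ℂ} (hz : z ≠ 0) (hzn : ∀ n, z ≠ D.η' n) (x t : ℝ) : dt (D.g z) x t =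
    D.T21 z x t * D.f z x t + (-D.T11 z x t + I * thetaT D.q₀ z) * D.g z x t := by
  have h := D.defTwo_eq hz hzn x t
  have hz' : (D.q₀ : ℂ) ^ 2 / z ≠ 0 := div_ne_zero (pow_ne_zero 2 D.sys.q_ne) hz
  rw [defOne, D.dt_f_eq hz' (D.sq_div_ne hz hzn), sub_self, mul_zero] at h
  exact sub_eq_zero.mp h

theorem dt_c_eq (n : ι) (x t : ℝ) : dt (D.c n) x t =
    (D.T11 (D.η' n) x t + I * thetaT D.q₀ (D.η' n)) * D.c n x t +
      D.T12 (D.η' n) x t * D.d n x t :=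
  sub_eq_zero.mp (D.defRes_eq_zero n x t)

theorem dt_d_eq (n : ι) (x t : ℝ) : dt (D.d n) x t =
    D.T21 (D.η' n) x t * D.c n x t +
      (-D.T11 (D.η' n) x t + I * thetaT D.q₀ (D.η' n)) * D.d n x t := by
  have h := ((D.smooth_c (D.τ n)).hasDerivAt_dt x t).const_mul (-(I * D.r / D.η n))
  have e : dt (D.d n) x t = -(I * D.r / D.η n) * dt (D.c (D.τ n)) x t := h.deriv
  have hn := D.η'_ne_zero n
  have h0 : D.η' (D.τ n) = (D.q₀ : ℂ) ^ 2 / D.η' n := by rw [D.η'_inv, D.sq_div_η']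
  have hd : D.d n x t = -(I * D.r / D.η n) * D.c (D.τ n) x t := rfl
  rw [e, D.dt_c_eq, h0, D.T11_sq_div hn, D.T12_sq_div hn, D.thetaT_sq_div hn]
  linear_combination D.T21 (D.η' n) x t * D.coef_d_sq x t n -
    (-D.T11 (D.η' n) x t + I * thetaT D.q₀ (D.η' n)) * hd

/-- The zero curvature condition. -/
theorem mkdv (x t : ℝ) :
    dt D.qc x t + 6 * D.qc x t ^ 2 * dx D.qc x t + dx (dx (dx D.qc)) x t = 0 := by
  -- A single spectral value suffices. In `f_xt = f_tx` the terms with `f` drop out after insertion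
  -- of the Lax equations, and mKdV remains multiplied by `g`; hence a point with `g ≠ 0` is chosen.
  have hev : ∀ᶠ z in cobounded ℂ, z ≠ 0 ∧ (∀ n, z ≠ D.η' n) ∧ D.g z x t ≠ 0 := by
    filter_upwards [eventually_cobounded_ne 0, eventually_all.mpr fun n =>
      eventually_cobounded_ne (D.η' n), (D.tendsto_g x t).eventually_ne one_ne_zero] with z h1 h2 h3
    exact ⟨h1, h2, h3⟩
  have : (cobounded ℂ).NeBot := by
    rw [Metric.cobounded_eq_cocompact]; infer_instance
  obtain ⟨z, hz, hzn, hg⟩ := hev.exists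
  have hmix := (D.smooth_f z).mixed x t
  have hfx : dx (D.f z) = fun x t => I * z * D.f z x t + D.qc x t * D.g z x t := by
    funext x t; exact D.dx_f_eq hz hzn x t
  have hft : dt (D.f z) = fun x t =>
      (D.T11 z x t + I * thetaT D.q₀ z) * D.f z x t + D.T12 z x t * D.g z x t := by
    funext x t; exact D.dt_f_eq hz hzn x t
  have hq := D.smooth_qc
  have h1 : dt (dx (D.f z)) x t = I * z * dt (D.f z) x t +
      (dt D.qc x t * D.g z x t + D.qc x t * dt (D.g z) x t) := by
    have h := (((D.smooth_f z).hasDerivAt_dt x t).const_mul (I * z)).add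
      ((hq.hasDerivAt_dt x t).mul ((D.smooth_g z).hasDerivAt_dt x t))
    conv_lhs => rw [hfx]
    exact h.deriv
  have hT11 : HasDerivAt (fun x' => D.T11 z x' t + I * thetaT D.q₀ z)
      (-(4 * I * kk D.q₀ z * D.qc x t * dx D.qc x t)) x := by
    have h := ((((hq.hasDerivAt_dx x t).pow 2).const_mul (2 * I * kk D.q₀ z)).const_sub
      (4 * I * kk D.q₀ z ^ 3)).add_const (I * thetaT D.q₀ z)
    refine h.congr_deriv ?_
    push_cast; ring
  have hT12 : HasDerivAt (fun x' => D.T12 z x' t)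
      (4 * kk D.q₀ z ^ 2 * dx D.qc x t - 2 * I * kk D.q₀ z * dx (dx D.qc) x t
        - 6 * D.qc x t ^ 2 * dx D.qc x t - dx (dx (dx D.qc)) x t) x := by
    have h := ((((hq.hasDerivAt_dx x t).const_mul (4 * kk D.q₀ z ^ 2)).sub
      ((hq.smooth_dx.hasDerivAt_dx x t).const_mul (2 * I * kk D.q₀ z))).sub
      (((hq.hasDerivAt_dx x t).pow 3).const_mul 2)).sub (hq.smooth_dx.smooth_dx.hasDerivAt_dx x t)
    refine h.congr_deriv ?_
    push_cast; ring
  have h2 : dx (dt (D.f z)) x t =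
      (-(4 * I * kk D.q₀ z * D.qc x t * dx D.qc x t) * D.f z x t +
        (D.T11 z x t + I * thetaT D.q₀ z) * dx (D.f z) x t) +
      ((4 * kk D.q₀ z ^ 2 * dx D.qc x t - 2 * I * kk D.q₀ z * dx (dx D.qc) x t
        - 6 * D.qc x t ^ 2 * dx D.qc x t - dx (dx (dx D.qc)) x t) * D.g z x t +
        D.T12 z x t * dx (D.g z) x t) := by
    have h := (hT11.mul ((D.smooth_f z).hasDerivAt_dx x t)).add
      (hT12.mul ((D.smooth_g z).hasDerivAt_dx x t))
    conv_lhs => rw [hft]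
    exact h.deriv
  rw [h1, h2, D.dt_f_eq hz hzn, D.dt_g_eq hz hzn, D.dx_f_eq hz hzn, D.dx_g_eq hz hzn] at hmix
  have hk : I * ((D.q₀ : ℂ) ^ 2 / z) = I * z - 2 * I * kk D.q₀ z := by rw [kk]; ring
  rw [hk] at hmix
  refine (mul_eq_zero.mp ?_).resolve_right hg
  simp only [T11, T12, T21] at hmix
  linear_combination hmix + 4 * kk D.q₀ z ^ 2 * dx D.qc x t * D.g z x t * I_sq

end RatData

/-! ### Behaviour of the rational solutions as `x → ±∞` -/

theorem tendsto_inv_mulVec {X ι : Type*} [Fintype ι] [DecidableEq ι] {l : Filter X}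
    {M : X → Matrix ι ι ℂ} {M₀ : Matrix ι ι ℂ} (hM : ∀ i j, Tendsto (fun x => M x i j) l (𝓝 (M₀ i j)))
    (h0 : M₀.det ≠ 0) (b : ι → ℂ) : Tendsto (fun x => (M x)⁻¹ *ᵥ b) l (𝓝 (M₀⁻¹ *ᵥ b)) := by
  have hM' : Tendsto M l (𝓝 M₀) := tendsto_pi_nhds.mpr fun i => tendsto_pi_nhds.mpr fun j => hM i j
  have h1 : Continuous fun A : Matrix ι ι ℂ => A.det := continuous_id.matrix_det
  have h2 : Continuous fun A : Matrix ι ι ℂ => A.adjugate *ᵥ b :=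
    (continuous_id.matrix_adjugate).matrix_mulVec continuous_const
  have h3 := (((h1.tendsto M₀).comp hM').inv₀ h0).smul ((h2.tendsto M₀).comp hM')
  simpa [Matrix.inv_def, Ring.inverse_eq_inv', Matrix.smul_mulVec] using h3

theorem integrableOn_Ici_of_isBigO_exp {u : ℝ → ℝ} (hu : Continuous u) {b : ℝ} (hb : 0 < b)
    (ho : u =O[atTop] fun x => Real.exp (-b * x)) :
    Tendsto u atTop (𝓝 0) ∧ IntegrableOn (fun x => (1 + |x|) * u x) (Set.Ici 0) := by
  -- Half of the exponential decay absorbs the factor `1 + |x|`.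
  have hb2 : 0 < b / 2 := by positivity
  constructor
  · refine ho.trans_tendsto ?_
    have : Tendsto (fun x : ℝ => b * x) atTop atTop := tendsto_id.const_mul_atTop hb
    refine (Real.tendsto_exp_neg_atTop_nhds_zero.comp this).congr fun x => ?_
    simp
  · rw [integrableOn_Ici_iff_integrableOn_Ioi]
    refine integrable_of_isBigO_exp_neg hb2 (by fun_prop) ?_
    have h1 : (fun x : ℝ => 1 + |x|) =O[atTop] fun x => Real.exp (b / 2 * x) := by
      have h2 : (fun _ : ℝ => (1 : ℝ)) =O[atTop] fun x => Real.exp (b / 2 * x) := by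
        refine Asymptotics.IsBigO.of_bound 1 ?_
        filter_upwards [eventually_ge_atTop 0] with x hx
        rw [norm_one, one_mul, Real.norm_eq_abs, Real.abs_exp]
        exact Real.one_le_exp (by positivity)
      have h3 : (fun x : ℝ => |x|) =O[atTop] fun x => Real.exp (b / 2 * x) := by
        have := isLittleO_pow_exp_pos_mul_atTop 1 hb2
        simpa using this.isBigO.norm_left
      exact h2.add h3
    refine (h1.mul ho).congr_right fun x => ?_
    rw [← Real.exp_add]; congr 1; ring

theorem integrableOn_Iic_of_isBigO_exp {u : ℝ → ℝ} (hu : Continuous u) {b : ℝ} (hb : 0 < b)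
    (ho : u =O[atBot] fun x => Real.exp (b * x)) :
    Tendsto u atBot (𝓝 0) ∧ IntegrableOn (fun x => (1 + |x|) * u x) (Set.Iic 0) := by
  obtain ⟨h1, h2⟩ := integrableOn_Ici_of_isBigO_exp (u := fun x => u (-x)) (by fun_prop) hb
    ((ho.comp_tendsto tendsto_neg_atTop_atBot).congr_right fun x => by simp)
  constructor
  · simpa [Function.comp_def] using h1.comp tendsto_neg_atBot_atTop
  · have h3 : IntegrableOn (fun x => (1 + |-x|) * u (- -x)) (Set.Iic 0) :=
      IntegrableOn.comp_neg_Iic (c := 0) (f := fun x => (1 + |x|) * u (-x)) (by rwa [neg_zero])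
    simpa only [abs_neg, neg_neg] using h3

namespace RatData

variable {ι : Type*} (D : RatData ι) [Fintype ι] [DecidableEq ι]

/-- This is the form in which uniqueness of the interpolation is applied: for the reality of the
potential, and later to recognize the values of a given Jost function at the poles. -/
theorem eq_v {x t : ℝ} {u : ι → ℂ}
    (hu : ∀ k, u k = I * D.r / D.η k + pfrac D.q₀ D.η (fun n => D.κ x t n * u n) (D.η k)) (k : ι) :
    u k = D.v x t k := by
  have h0 := D.sys.eq_zero_of_residue (D.symmCoeff x t)
    (c := fun n => D.κ x t n * (u n - D.v x t n)) fun k => ?_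
  · have := (mul_eq_zero.mp (congrFun h0 k)).resolve_left ((D.symmCoeff x t).ne_zero k)
    exact sub_eq_zero.mp this
  · have h1 := hu k
    have h2 := D.v_spec x t k
    rw [f] at h2
    have e : pfrac D.q₀ D.η (fun n => D.κ x t n * (u n - D.v x t n)) (D.η k) =
        pfrac D.q₀ D.η (fun n => D.κ x t n * u n) (D.η k) -
        pfrac D.q₀ D.η (fun n => D.c n x t) (D.η k) := by
      simp only [pfrac, ← Finset.sum_sub_distrib, c]
      exact Finset.sum_congr rfl fun n _ => by ring
    rw [e, h1, h2]; ring

/-- The conjugated and relabelled values solve the same linear system, by the symmetry of `κ` under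
`η ↦ -η*`. -/
theorem conj_v (x t : ℝ) (k : ι) : conj (D.v x t (D.σ k)) = D.v x t k := by
  refine D.eq_v (u := fun k => conj (D.v x t (D.σ k))) (fun k => ?_) k
  have e : pfrac D.q₀ D.η (fun n => D.κ x t n * conj (D.v x t (D.σ n))) (D.η k) =
      ∑ n, D.κ x t (D.σ n) * conj (D.v x t (D.σ (D.σ n))) / (D.η k - hat D.q₀ (D.η (D.σ n))) :=
    (Equiv.sum_comp (Function.Involutive.toPerm D.σ D.sys.conj_conj)
      fun n => D.κ x t n * conj (D.v x t (D.σ n)) / (D.η k - hat D.q₀ (D.η n))).symm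
  rw [e, D.v_spec, f, map_add, D.sys.eta_conj, pfrac, map_sum]
  congr 1
  · simp
  · refine Finset.sum_congr rfl fun n _ => ?_
    rw [D.sys.conj_conj, c, map_div₀, map_mul, (D.symmCoeff x t).coef_conj, D.sys.hat_conj, map_sub,
      map_neg, Complex.conj_conj]
    rw [show -D.η k - conj (hat D.q₀ (D.η n)) = -(D.η k - -conj (hat D.q₀ (D.η n))) by ring,
      div_neg, neg_mul, neg_div, neg_neg]

theorem conj_c (x t : ℝ) (n : ι) : conj (D.c n x t) = -D.c (D.σ n) x t := by
  have := D.conj_v x t (D.σ n)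
  rw [D.sys.conj_conj] at this
  rw [c, map_mul, (D.symmCoeff x t).coef_conj, this, c]; ring

theorem conj_qc (x t : ℝ) : conj (D.qc x t) = D.qc x t := by
  have e : ∑ n, D.c (D.σ n) x t = ∑ n, D.c n x t :=
    Equiv.sum_comp (Function.Involutive.toPerm D.σ D.sys.conj_conj) fun n => D.c n x t
  simp only [qc, map_sub, map_mul, conj_ofReal, conj_I, map_sum, D.conj_c, Finset.sum_neg_distrib, e]
  ring

/-- The real potential. -/
def q (x t : ℝ) : ℝ := (D.qc x t).re

theorem ofReal_q (x t : ℝ) : (D.q x t : ℂ) = D.qc x t := Complex.conj_eq_iff_re.mp (D.conj_qc x t)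

/-- The decay rates. -/
def rate (n : ι) : ℝ := (lam D.q₀ (D.η n)).im

/-- The rates are positive since `η_n ∈ D₊`: all `κ_n` decay at `-∞` and blow up at `∞`, at every
fixed time. -/
theorem norm_κ (x t : ℝ) (n : ι) :
    ‖D.κ x t n‖ = ‖D.κ 0 t n‖ * Real.exp (2 * D.rate n * x) := by
  have e : D.κ x t n = D.κ 0 t n * exp (2 * I * (lam D.q₀ (D.η' n) * x)) := by
    rw [κ, κ, mul_assoc (D.κ₀ n) (exp _), ← exp_add]
    congr 2
    simp only [theta]; push_cast; ring
  rw [e, norm_mul, norm_exp, η', hat, lam_neg_div D.sys.pos.ne' (D.sys.ne_zero n)]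
  congr 2
  simp [rate]
  ring

theorem exists_rate : ∃ b : ℝ, 0 < b ∧ ∀ n, b ≤ 2 * D.rate n := by
  have h : ∀ᶠ b : ℝ in 𝓝[>] 0, ∀ n, b ≤ 2 * D.rate n := by
    refine eventually_all.mpr fun n => nhdsWithin_le_nhds ?_
    have : 0 < 2 * D.rate n := mul_pos two_pos (D.sys.mem n).2
    exact (eventually_lt_nhds this).mono fun _ => le_of_lt
  obtain ⟨b, h1, h2⟩ := (h.and self_mem_nhdsWithin).exists
  exact ⟨b, h2, h1⟩

theorem isBigO_κ {b : ℝ} (hb : ∀ n, b ≤ 2 * D.rate n) (t : ℝ) (n : ι) :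
    (fun x => D.κ x t n) =O[atBot] fun x => Real.exp (b * x) := by
  refine Asymptotics.IsBigO.of_bound ‖D.κ 0 t n‖ ?_
  filter_upwards [eventually_le_atBot 0] with x hx
  rw [D.norm_κ, Real.norm_eq_abs, Real.abs_exp]
  refine mul_le_mul_of_nonneg_left (Real.exp_le_exp.mpr ?_) (norm_nonneg _)
  exact mul_le_mul_of_nonpos_right (hb n) hx

theorem isBigO_inv_κ {b : ℝ} (hb : ∀ n, b ≤ 2 * D.rate n) (t : ℝ) (n : ι) :
    (fun x => (D.κ x t n)⁻¹) =O[atTop] fun x => Real.exp (-b * x) := by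
  refine Asymptotics.IsBigO.of_bound ‖D.κ 0 t n‖⁻¹ ?_
  filter_upwards [eventually_ge_atTop 0] with x hx
  rw [norm_inv, D.norm_κ, mul_inv, ← Real.exp_neg, Real.norm_eq_abs, Real.abs_exp]
  refine mul_le_mul_of_nonneg_left (Real.exp_le_exp.mpr ?_) (by positivity)
  nlinarith [mul_le_mul_of_nonneg_right (hb n) hx]

theorem tendsto_exp_atBot {b : ℝ} (hb : 0 < b) :
    Tendsto (fun x : ℝ => Real.exp (b * x)) atBot (𝓝 0) :=
  Real.tendsto_exp_atBot.comp (tendsto_id.const_mul_atBot hb)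

theorem tendsto_exp_atTop {b : ℝ} (hb : 0 < b) :
    Tendsto (fun x : ℝ => Real.exp (-b * x)) atTop (𝓝 0) :=
  Real.tendsto_exp_atBot.comp (tendsto_id.const_mul_atTop_of_neg (neg_neg_of_pos hb))

theorem tendsto_v_atBot (t : ℝ) :
    Tendsto (fun x => D.v x t) atBot (𝓝 ((1 : Matrix ι ι ℂ)⁻¹ *ᵥ fun k => I * D.r / D.η k)) := by
  obtain ⟨b, hb0, hb⟩ := D.exists_rate
  refine tendsto_inv_mulVec (M := fun x => sysMat D.q₀ D.η (D.κ x t)) (fun i j => ?_) (by simp) _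
  have h1 : Tendsto (fun x => D.κ x t j) atBot (𝓝 0) :=
    (D.isBigO_κ hb t j).trans_tendsto (tendsto_exp_atBot hb0)
  have h2 := (h1.div_const (D.η i - hat D.q₀ (D.η j))).const_sub (if i = j then (1 : ℂ) else 0)
  rw [zero_div, sub_zero] at h2
  simpa [sysMat, Matrix.one_apply] using h2

theorem isBigO_c {b : ℝ} (hb : ∀ n, b ≤ 2 * D.rate n) (t : ℝ) (n : ι) :
    (fun x => D.c n x t) =O[atBot] fun x => Real.exp (b * x) := by
  have h1 : Tendsto (fun x => D.v x t n) atBot _ := (tendsto_pi_nhds.mp (D.tendsto_v_atBot t)) n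
  exact ((D.isBigO_κ hb t n).mul (h1.isBigO_one ℝ)).congr_right fun x => mul_one _

theorem tendsto_c_atBot (t : ℝ) (n : ι) : Tendsto (fun x => D.c n x t) atBot (𝓝 0) := by
  obtain ⟨b, hb0, hb⟩ := D.exists_rate
  exact (D.isBigO_c hb t n).trans_tendsto (tendsto_exp_atBot hb0)

theorem tendsto_d_atBot (t : ℝ) (n : ι) : Tendsto (fun x => D.d n x t) atBot (𝓝 0) := by
  have := (D.tendsto_c_atBot t (D.τ n)).const_mul (-(I * D.r / D.η n))
  rwa [mul_zero] at this

theorem tendsto_pfrac {X : Type*} {l : Filter X} {a : X → ι → ℂ} {a₀ : ι → ℂ}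
    (h : ∀ n, Tendsto (fun x => a x n) l (𝓝 (a₀ n))) (z : ℂ) :
    Tendsto (fun x => pfrac D.q₀ D.η (a x) z) l (𝓝 (pfrac D.q₀ D.η a₀ z)) :=
  tendsto_finsetSum _ fun n _ => (h n).div_const _

theorem tendsto_f_atBot (t : ℝ) (z : ℂ) :
    Tendsto (fun x => D.f z x t) atBot (𝓝 (I * D.r / z)) := by
  have := (D.tendsto_pfrac (fun n => D.tendsto_c_atBot t n) z).const_add (I * D.r / z)
  simpa [f, pfrac] using this

theorem tendsto_g_atBot (t : ℝ) (z : ℂ) : Tendsto (fun x => D.g z x t) atBot (𝓝 1) := by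
  have := (D.tendsto_pfrac (fun n => D.tendsto_d_atBot t n) z).const_add 1
  simpa [g, pfrac] using this

/-- The Cauchy matrix `-1/(η_k - η̂_n)`. -/
def cauchyMat : Matrix ι ι ℂ := Matrix.of fun k n => -(1 / (D.η k - D.η' n))

theorem det_cauchyMat : D.cauchyMat.det ≠ 0 := by
  intro hdet
  obtain ⟨v, hv0, hv⟩ := Matrix.exists_mulVec_eq_zero_iff.mpr hdet
  refine hv0 (eq_zero_of_cauchy D.sys.inj D.sys.hat_inj D.sys.ne_hat fun k => ?_)
  have h1 := congrFun hv k
  simp only [cauchyMat, Matrix.mulVec, dotProduct, Matrix.of_apply, Pi.zero_apply, neg_mul,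
    Finset.sum_neg_distrib, neg_eq_zero] at h1
  rw [← h1]
  exact Finset.sum_congr rfl fun n _ => by rw [η']; ring

/-- The limits of the residues as `x → ∞`. -/
def cInf : ι → ℂ := D.cauchyMat⁻¹ *ᵥ fun k => I * D.r / D.η k

/-- The limits of the residues as `x → ∞`. -/
def dInf (n : ι) : ℂ := -(I * D.r / D.η n) * D.cInf (D.τ n)

theorem invκ_mul_c (x t : ℝ) (k : ι) : (D.κ x t k)⁻¹ * D.c k x t = D.f (D.η k) x t := by
  rw [c, inv_mul_cancel_left₀ ((D.symmCoeff x t).ne_zero k), D.v_spec]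

theorem invκ_mul_d (x t : ℝ) (k : ι) : (D.κ x t k)⁻¹ * D.d k x t = D.g (D.η k) x t := by
  rw [d_eq, inv_mul_cancel_left₀ ((D.symmCoeff x t).ne_zero k)]

/-- In the unknowns `c_k = κ_k v_k` the system reads `κ_k⁻¹ c_k - Σ c_n/(η_k - η̂_n) = ir/η_k`. As
`x → ∞` the diagonal term disappears and a nonsingular Cauchy system is left. -/
theorem tendsto_c_atTop (t : ℝ) (n : ι) :
    Tendsto (fun x => D.c n x t) atTop (𝓝 (D.cInf n)) := by
  obtain ⟨b, hb0, hb⟩ := D.exists_rate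
  set M : ℝ → Matrix ι ι ℂ := fun x => Matrix.diagonal (fun k => (D.κ x t k)⁻¹) + D.cauchyMat with hM
  have hent : ∀ i j, Tendsto (fun x => M x i j) atTop (𝓝 (D.cauchyMat i j)) := by
    intro i j
    have h1 : Tendsto (fun x => if i = j then (D.κ x t i)⁻¹ else 0) atTop (𝓝 0) := by
      split_ifs
      · exact (D.isBigO_inv_κ hb t i).trans_tendsto (tendsto_exp_atTop hb0)
      · exact tendsto_const_nhds
    have h2 := h1.add_const (D.cauchyMat i j)
    rw [zero_add] at h2
    simpa [hM, Matrix.diagonal_apply] using h2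
  have h3 := tendsto_inv_mulVec hent D.det_cauchyMat fun k => I * D.r / D.η k
  have hdet : ∀ᶠ x in atTop, (M x).det ≠ 0 := by
    have hM' : Tendsto M atTop (𝓝 D.cauchyMat) :=
      tendsto_pi_nhds.mpr fun i => tendsto_pi_nhds.mpr fun j => hent i j
    have h1 : Continuous fun A : Matrix ι ι ℂ => A.det := continuous_id.matrix_det
    exact ((h1.tendsto _).comp hM').eventually_ne D.det_cauchyMat
  refine (tendsto_pi_nhds.mp h3 n).congr' ?_
  filter_upwards [hdet] with x hx
  have h4 : M x *ᵥ (fun k => D.c k x t) = fun k => I * D.r / D.η k := by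
    funext k
    rw [hM]
    simp only [Matrix.add_mulVec, Pi.add_apply, Matrix.mulVec_diagonal, invκ_mul_c]
    simp only [cauchyMat, Matrix.mulVec, dotProduct, Matrix.of_apply, f, pfrac, neg_mul,
      Finset.sum_neg_distrib]
    have : ∑ n, 1 / (D.η k - D.η' n) * D.c n x t = ∑ n, D.c n x t / (D.η k - hat D.q₀ (D.η n)) :=
      Finset.sum_congr rfl fun n _ => by rw [η']; ring
    rw [this]; ring
  rw [← h4, Matrix.mulVec_mulVec, Matrix.nonsing_inv_mul _ hx.isUnit, Matrix.one_mulVec]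

theorem tendsto_d_atTop (t : ℝ) (n : ι) :
    Tendsto (fun x => D.d n x t) atTop (𝓝 (D.dInf n)) :=
  (D.tendsto_c_atTop t (D.τ n)).const_mul _

theorem tendsto_f_atTop (t : ℝ) (z : ℂ) :
    Tendsto (fun x => D.f z x t) atTop (𝓝 (I * D.r / z + pfrac D.q₀ D.η D.cInf z)) :=
  (D.tendsto_pfrac (fun n => D.tendsto_c_atTop t n) z).const_add _

theorem tendsto_g_atTop (t : ℝ) (z : ℂ) :
    Tendsto (fun x => D.g z x t) atTop (𝓝 (1 + pfrac D.q₀ D.η D.dInf z)) :=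
  (D.tendsto_pfrac (fun n => D.tendsto_d_atTop t n) z).const_add _

/-- `f(η_k) = κ_k⁻¹ c_k`, where `c_k` converges and `κ_k⁻¹` tends to `0`. So the limit function has
a zero at each `η_k`. -/
theorem fInf_η (k : ι) : I * D.r / D.η k + pfrac D.q₀ D.η D.cInf (D.η k) = 0 := by
  obtain ⟨b, hb0, hb⟩ := D.exists_rate
  have h1 := ((D.isBigO_inv_κ hb 0 k).trans_tendsto (tendsto_exp_atTop hb0)).mul
    (D.tendsto_c_atTop 0 k)
  simp only [D.invκ_mul_c, zero_mul] at h1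
  exact tendsto_nhds_unique (D.tendsto_f_atTop 0 _) h1

theorem gInf_η (k : ι) : 1 + pfrac D.q₀ D.η D.dInf (D.η k) = 0 := by
  obtain ⟨b, hb0, hb⟩ := D.exists_rate
  have h1 := ((D.isBigO_inv_κ hb 0 k).trans_tendsto (tendsto_exp_atTop hb0)).mul
    (D.tendsto_d_atTop 0 k)
  simp only [D.invκ_mul_d, zero_mul] at h1
  exact tendsto_nhds_unique (D.tendsto_g_atTop 0 _) h1

/-- Subtracting the limiting Cauchy system leaves the right-hand side `-κ_k⁻¹ c_k`, which is
exponentially small. -/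
theorem isBigO_c_sub {b : ℝ} (hb : ∀ n, b ≤ 2 * D.rate n) (t : ℝ) (n : ι) :
    (fun x => D.c n x t - D.cInf n) =O[atTop] fun x => Real.exp (-b * x) := by
  have hu : IsUnit D.cauchyMat.det := D.det_cauchyMat.isUnit
  have h1 : ∀ x, (fun k => D.c k x t - D.cInf k) =
      D.cauchyMat⁻¹ *ᵥ fun k => -((D.κ x t k)⁻¹ * D.c k x t) := by
    intro x
    have : D.cauchyMat *ᵥ (fun k => D.c k x t - D.cInf k) =
        fun k => -((D.κ x t k)⁻¹ * D.c k x t) := by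
      funext k
      have h2 := D.fInf_η k
      rw [D.invκ_mul_c, f]
      simp only [cauchyMat, Matrix.mulVec, dotProduct, Matrix.of_apply, pfrac] at h2 ⊢
      have e : ∑ n, -(1 / (D.η k - D.η' n)) * (D.c n x t - D.cInf n) =
          ∑ n, D.cInf n / (D.η k - hat D.q₀ (D.η n)) - ∑ n, D.c n x t / (D.η k - hat D.q₀ (D.η n)) := by
        rw [← Finset.sum_sub_distrib]
        exact Finset.sum_congr rfl fun n _ => by rw [η']; ring
      rw [e]
      linear_combination h2
    rw [← this, Matrix.mulVec_mulVec, Matrix.nonsing_inv_mul _ hu, Matrix.one_mulVec]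
  have h2 : (fun x => D.c n x t - D.cInf n) = fun x =>
      ∑ k, D.cauchyMat⁻¹ n k * -((D.κ x t k)⁻¹ * D.c k x t) := by
    funext x
    exact congrFun (h1 x) n
  rw [h2]
  refine Asymptotics.IsBigO.fun_sum fun k _ => ?_
  have h3 : (fun x => (D.κ x t k)⁻¹ * D.c k x t) =O[atTop] fun x => Real.exp (-b * x) :=
    ((D.isBigO_inv_κ hb t k).mul ((D.tendsto_c_atTop t k).isBigO_one ℝ)).congr_right
      fun x => mul_one _
  exact h3.neg_left.const_mul_left _

/-! #### The Blaschke product -/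

/-- `Π (z - η̂_n)/(z - η_n)`. -/
def bl (z : ℂ) : ℂ := ∏ n, (z - D.η' n) / (z - D.η n)

/-- `bl z / (z - η̂_k)` -/
def blq (k : ι) (z : ℂ) : ℂ :=
  (∏ n ∈ Finset.univ.erase k, (z - D.η' n) / (z - D.η n)) / (z - D.η k)

theorem bl_eq (k : ι) (z : ℂ) : D.bl z = (z - D.η' k) * D.blq k z := by
  rw [bl, blq, ← Finset.mul_prod_erase Finset.univ _ (Finset.mem_univ k)]; ring

/-- The factors pair off under `τ`, because `η̂_{τn} = -η_n`. There are no fixed labels: `η = q₀²/η`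
would force `η = ±q₀`, which is not in `D₊`. -/
theorem bl_zero : D.bl 0 = 1 := by
  refine Finset.prod_involution (fun n _ => D.τ n) (fun n _ => ?_) (fun n _ _ => ?_)
    (fun _ _ => Finset.mem_univ _) fun n _ => D.sys.inv_inv n
  · have h1 := D.sys.ne_zero n
    have h2 := D.sys.ne_zero (D.τ n)
    have h3 : D.η' n = -D.η (D.τ n) := by
      have := D.η'_inv (D.τ n)
      rwa [D.sys.inv_inv] at this
    rw [D.η'_inv, h3]
    field_simp
    ring
  · intro h
    have h1 := D.sys.eta_inv n
    rw [h] at h1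
    have h2 := D.sys.ne_zero n
    have h3 : (D.η n - D.q₀) * (D.η n + D.q₀) = 0 := by
      field_simp at h1
      linear_combination h1
    have h4 := (D.sys.mem n).2
    have h5 : ∀ y : ℝ, (lam D.q₀ (y : ℂ)).im = 0 := fun y => by
      have : lam D.q₀ (y : ℂ) = ((y + D.q₀ ^ 2 / y) / 2 : ℝ) := by simp [lam]
      rw [this, ofReal_im]
    rcases mul_eq_zero.mp h3 with h | h
    · rw [sub_eq_zero.mp h, h5] at h4
      exact lt_irrefl _ h4
    · rw [eq_neg_of_add_eq_zero_left h, ← ofReal_neg, h5] at h4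
      exact lt_irrefl _ h4

theorem tendsto_bl : Tendsto D.bl (cobounded ℂ) (𝓝 1) := by
  have h : ∀ n, Tendsto (fun z => (z - D.η' n) / (z - D.η n)) (cobounded ℂ) (𝓝 1) := by
    intro n
    have := (tendsto_cobounded_div_sub (D.η n - D.η' n) (D.η n)).const_add 1
    rw [add_zero] at this
    refine this.congr' ?_
    filter_upwards [eventually_cobounded_ne (D.η n)] with z hz
    have := sub_ne_zero.mpr hz
    field_simp
    ring
  have := tendsto_finsetProd Finset.univ fun n _ => h n
  simp only [Finset.prod_const_one] at this
  exact this

theorem differentiableAt_bl {z : ℂ} (hz : ∀ n, z ≠ D.η n) : DifferentiableAt ℂ D.bl z := by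
  unfold bl
  exact DifferentiableAt.fun_finsetProd fun n _ =>
    (differentiableAt_id.sub_const _).div (differentiableAt_id.sub_const _) (sub_ne_zero.mpr (hz n))

theorem continuousAt_blq (k : ι) {z : ℂ} (hz : ∀ n, z ≠ D.η n) : ContinuousAt (D.blq k) z := by
  unfold blq
  refine ContinuousAt.div (tendsto_finsetProd _ fun n _ => ?_) (by fun_prop) (sub_ne_zero.mpr (hz k))
  exact (continuousAt_id.sub continuousAt_const).div (continuousAt_id.sub continuousAt_const)
    (sub_ne_zero.mpr (hz n))

theorem bl_η' (k : ι) : D.bl (D.η' k) = 0 := by rw [D.bl_eq k, sub_self, zero_mul]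

theorem blq_η' (k : ι) : D.blq k (D.η' k) ≠ 0 := by
  refine div_ne_zero (Finset.prod_ne_zero_iff.mpr fun n hn => div_ne_zero ?_ ?_) ?_
  · exact sub_ne_zero.mpr fun h => (Finset.mem_erase.mp hn).1 (D.sys.hat_inj h).symm
  · exact sub_ne_zero.mpr (D.sys.ne_hat n k).symm
  · exact sub_ne_zero.mpr (D.sys.ne_hat k k).symm

theorem bl_ne_zero {z : ℂ} (hz : ∀ n, z ≠ D.η n) (hz' : ∀ n, z ≠ D.η' n) : D.bl z ≠ 0 :=
  Finset.prod_ne_zero_iff.mpr fun n _ => div_ne_zero (sub_ne_zero.mpr (hz' n))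
    (sub_ne_zero.mpr (hz n))

/-- A rational function with poles `η̂` and zeros `η`. -/
theorem bl_mul {L : ℂ} {e : ι → ℂ} (h : ∀ k, L + pfrac D.q₀ D.η e (D.η k) = 0) {z : ℂ}
    (hz : ∀ n, z ≠ D.η n) (hz' : ∀ n, z ≠ D.η' n) : D.bl z * (L + pfrac D.q₀ D.η e z) = L := by
  classical
  set S : Finset ℂ := Finset.univ.image D.η ∪ Finset.univ.image D.η' with hS
  have hmem : ∀ y ∉ S, (∀ n, y ≠ D.η n) ∧ ∀ n, y ≠ D.η' n := fun y hy =>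
    ⟨fun n hn => hy (Finset.mem_union_left _ (Finset.mem_image.mpr ⟨n, Finset.mem_univ _, hn.symm⟩)),
     fun n hn => hy (Finset.mem_union_right _ (Finset.mem_image.mpr ⟨n, Finset.mem_univ _, hn.symm⟩))⟩
  have hzS : z ∉ S := by
    intro hm
    rcases Finset.mem_union.mp hm with h1 | h1
    · obtain ⟨n, _, hn⟩ := Finset.mem_image.mp h1
      exact hz n hn.symm
    · obtain ⟨n, _, hn⟩ := Finset.mem_image.mp h1
      exact hz' n hn.symm
  refine eq_of_removable_of_tendsto S (fun z => D.bl z * (L + pfrac D.q₀ D.η e z)) L ?_ ?_ ?_ z hzS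
  · intro y hy
    obtain ⟨h1, h2⟩ := hmem y hy
    have hp : DifferentiableAt ℂ (pfrac D.q₀ D.η e) y := by
      unfold pfrac
      exact DifferentiableAt.fun_sum fun n _ => (differentiableAt_const _).div
        (differentiableAt_id.sub_const _) (sub_ne_zero.mpr (h2 n))
    exact ((D.differentiableAt_bl h1).mul ((differentiableAt_const _).add hp)).differentiableWithinAt
  · intro s hs
    rcases Finset.mem_union.mp hs with h1 | h1
    · obtain ⟨k, _, rfl⟩ := Finset.mem_image.mp h1
      have t1 : Tendsto (fun z => L + pfrac D.q₀ D.η e z) (𝓝[≠] (D.η k)) (𝓝 0) := by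
        rw [← h k]
        exact ((PoleSys.continuousAt_pfrac e fun n => D.sys.ne_hat k n).tendsto.mono_left
          nhdsWithin_le_nhds).const_add L
      have t2 : Tendsto (fun z => (z - D.η' k) *
          ∏ n ∈ Finset.univ.erase k, (z - D.η' n) / (z - D.η n)) (𝓝[≠] (D.η k))
          (𝓝 ((D.η k - D.η' k) *
            ∏ n ∈ Finset.univ.erase k, (D.η k - D.η' n) / (D.η k - D.η n))) := by
        refine Tendsto.mono_left ?_ nhdsWithin_le_nhds
        refine (tendsto_id.sub_const _).mul (tendsto_finsetProd _ fun n hn => ?_)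
        refine (tendsto_id.sub_const _).div (tendsto_id.sub_const _) (sub_ne_zero.mpr fun h => ?_)
        exact (Finset.mem_erase.mp hn).1 (D.sys.inj h).symm
      have t3 := t2.mul t1
      rw [mul_zero] at t3
      refine t3.congr' ?_
      filter_upwards [self_mem_nhdsWithin] with y hy
      have : y - D.η k ≠ 0 := sub_ne_zero.mpr hy
      rw [D.bl_eq k, blq]
      field_simp
    · obtain ⟨k, _, rfl⟩ := Finset.mem_image.mp h1
      have hk : ∀ n, D.η' k ≠ D.η n := fun n => (D.sys.ne_hat n k).symm
      have t1 : Tendsto D.bl (𝓝[≠] (D.η' k)) (𝓝 0) := by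
        rw [← D.bl_η' k]
        exact (D.differentiableAt_bl hk).continuousAt.tendsto.mono_left nhdsWithin_le_nhds
      have t2 : Tendsto (fun z => (z - D.η' k) * L) (𝓝[≠] (D.η' k)) (𝓝 ((D.η' k - D.η' k) * L)) :=
        (((continuousAt_id.sub continuousAt_const).mul continuousAt_const).tendsto).mono_left
          nhdsWithin_le_nhds
      have t3 := t1.mul (t2.add (D.sys.tendsto_mul_pfrac e k))
      rw [zero_mul] at t3
      refine t3.congr fun y => ?_
      rw [η']; ring
  · rw [← Metric.cobounded_eq_cocompact]
    have := D.tendsto_bl.mul ((tendsto_cobounded_sum_div_sub e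
      fun n => hat D.q₀ (D.η n)).const_add L)
    rwa [add_zero, one_mul] at this

/-- `z` times the limit of `f` is `L + Σ η̂_n c_n/(z - η̂_n)` with `L = ir + Σ c_n`, and it vanishes
at every `η_k`; the Blaschke product turns it into the constant `L`. At `z = 0` the value is `ir`,
and the product is `1` there, so `L = ir`. This is the equality of the two boundary values of the
potential. -/
theorem sum_cInf : ∑ n, D.cInf n = 0 := by
  have h1 : ∀ y, (∀ n, y ≠ D.η' n) → (I * D.r + ∑ n, D.cInf n) +
      pfrac D.q₀ D.η (fun n => D.η' n * D.cInf n) y = I * D.r + y * pfrac D.q₀ D.η D.cInf y :=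
    fun y hy => by rw [D.mul_pfrac _ hy]; ring
  have h2 := D.bl_mul (L := I * D.r + ∑ n, D.cInf n) (e := fun n => D.η' n * D.cInf n)
    (fun k => ?_) (z := 0) (fun n => (D.sys.ne_zero n).symm) fun n => (D.η'_ne_zero n).symm
  · rw [D.bl_zero, h1 _ fun n => (D.η'_ne_zero n).symm] at h2
    linear_combination -h2
  · have hk := D.sys.ne_zero k
    rw [h1 _ fun n => D.sys.ne_hat k n]
    have h3 := D.fInf_η k
    field_simp at h3
    linear_combination h3

theorem bl_mul_fInf {z : ℂ} (hz0 : z ≠ 0) (hz : ∀ n, z ≠ D.η n) (hz' : ∀ n, z ≠ D.η' n) :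
    D.bl z * (I * D.r / z + pfrac D.q₀ D.η D.cInf z) = I * D.r / z := by
  have h1 : ∀ y, (∀ n, y ≠ D.η' n) → I * D.r +
      pfrac D.q₀ D.η (fun n => D.η' n * D.cInf n) y = I * D.r + y * pfrac D.q₀ D.η D.cInf y :=
    fun y hy => by rw [D.mul_pfrac _ hy, D.sum_cInf]; ring
  have h2 := D.bl_mul (L := I * D.r) (e := fun n => D.η' n * D.cInf n) (fun k => ?_) hz hz'
  · rw [h1 _ hz'] at h2
    field_simp
    linear_combination h2
  · have hk := D.sys.ne_zero k
    rw [h1 _ fun n => D.sys.ne_hat k n]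
    have h3 := D.fInf_η k
    field_simp at h3
    linear_combination h3

theorem bl_mul_gInf {z : ℂ} (hz : ∀ n, z ≠ D.η n) (hz' : ∀ n, z ≠ D.η' n) :
    D.bl z * (1 + pfrac D.q₀ D.η D.dInf z) = 1 :=
  D.bl_mul D.gInf_η hz hz'

theorem hasBoundaryValues : HasBoundaryValues D.q D.r D.r := by
  intro t
  obtain ⟨b, hb0, hb⟩ := D.exists_rate
  have hcont : Continuous fun x => D.q x t - D.r := by
    have h1 : Continuous fun x => D.qc x t :=
      continuous_iff_continuousAt.mpr fun x => (D.smooth_qc.hasDerivAt_dx x t).continuousAt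
    exact (Complex.continuous_re.comp h1).sub continuous_const
  have e1 : ∀ x, D.q x t - D.r = (-(I * ∑ n, D.c n x t)).re := fun x => by
    rw [q, qc]; simp
  have e2 : ∀ x, D.q x t - D.r = (-(I * ∑ n, (D.c n x t - D.cInf n))).re := fun x => by
    rw [Finset.sum_sub_distrib, D.sum_cInf, sub_zero, e1]
  have hre : ∀ (F : ℝ → ℂ) (l : Filter ℝ) (B : ℝ → ℝ), F =O[l] B → (fun x => (-(I * F x)).re) =O[l] B :=
    fun F l B h => by
      refine Asymptotics.IsBigO.trans (Asymptotics.IsBigO.of_bound 1 (Eventually.of_forall fun x => ?_)) h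
      rw [one_mul]
      refine (Complex.abs_re_le_norm _).trans ?_
      simp
  have o1 : (fun x => D.q x t - D.r) =O[atBot] fun x => Real.exp (b * x) := by
    simp only [e1]
    exact hre _ _ _ (Asymptotics.IsBigO.fun_sum fun n _ => D.isBigO_c hb t n)
  have o2 : (fun x => D.q x t - D.r) =O[atTop] fun x => Real.exp (-b * x) := by
    simp only [e2]
    exact hre _ _ _ (Asymptotics.IsBigO.fun_sum fun n _ => D.isBigO_c_sub hb t n)
  obtain ⟨a1, a2⟩ := integrableOn_Iic_of_isBigO_exp hcont hb0 o1
  obtain ⟨a3, a4⟩ := integrableOn_Ici_of_isBigO_exp hcont hb0 o2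
  refine ⟨?_, ?_, a2, a4⟩
  · simpa using a1.add_const D.r
  · simpa using a3.add_const D.r

end RatData

/-! ### The Lax pair in components -/

theorem laxX_mulVec (q₀ : ℝ) (q : ℝ → ℝ → ℝ) (x t : ℝ) (z : ℂ) (φ : Fin 2 → ℂ) :
    laxX q₀ q x t z *ᵥ φ =
      ![I * kk q₀ z * φ 0 + q x t * φ 1, -(q x t * φ 0) - I * kk q₀ z * φ 1] := by
  funext i
  fin_cases i
  · simp [laxX, sigma3, potMat, Matrix.mulVec, dotProduct, Fin.sum_univ_two]
  · simp [laxX, sigma3, potMat, Matrix.mulVec, dotProduct, Fin.sum_univ_two]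
    ring

/-- The diagonal entry of `T`. -/
def tDiag (q₀ : ℝ) (q : ℝ → ℝ → ℝ) (x t : ℝ) (z : ℂ) : ℂ :=
  4 * I * kk q₀ z ^ 3 - 2 * I * kk q₀ z * (q x t : ℂ) ^ 2

/-- The upper right entry of `T`. -/
def tUp (q₀ : ℝ) (q : ℝ → ℝ → ℝ) (x t : ℝ) (z : ℂ) : ℂ :=
  4 * kk q₀ z ^ 2 * q x t - 2 * I * kk q₀ z * (deriv (fun x' => q x' t) x : ℝ)
    - 2 * (q x t : ℂ) ^ 3 - (iteratedDeriv 2 (fun x' => q x' t) x : ℝ)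

/-- The lower left entry of `T`. -/
def tLow (q₀ : ℝ) (q : ℝ → ℝ → ℝ) (x t : ℝ) (z : ℂ) : ℂ :=
  -(4 * kk q₀ z ^ 2 * q x t) - 2 * I * kk q₀ z * (deriv (fun x' => q x' t) x : ℝ)
    + 2 * (q x t : ℂ) ^ 3 + (iteratedDeriv 2 (fun x' => q x' t) x : ℝ)

theorem laxT_mulVec (q₀ : ℝ) (q : ℝ → ℝ → ℝ) (x t : ℝ) (z : ℂ) (φ : Fin 2 → ℂ) :
    laxT q₀ q x t z *ᵥ φ =
      ![tDiag q₀ q x t z * φ 0 + tUp q₀ q x t z * φ 1,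
        tLow q₀ q x t z * φ 0 - tDiag q₀ q x t z * φ 1] := by
  have h2 : potMat (q x t) ^ 2 = !![-(q x t : ℂ) ^ 2, 0; 0, -(q x t : ℂ) ^ 2] := by
    rw [pow_two]
    ext i j
    fin_cases i <;> fin_cases j <;> simp [potMat, Matrix.mul_apply, Fin.sum_univ_two] <;> ring
  have h3 : potMat (q x t) ^ 3 = !![0, -(q x t : ℂ) ^ 3; (q x t : ℂ) ^ 3, 0] := by
    rw [pow_succ, h2]
    ext i j
    fin_cases i <;> fin_cases j <;> simp [potMat, Matrix.mul_apply, Fin.sum_univ_two] <;> ring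
  have hT : laxT q₀ q x t z =
      !![tDiag q₀ q x t z, tUp q₀ q x t z; tLow q₀ q x t z, -tDiag q₀ q x t z] := by
    rw [laxT, h2, h3]
    ext i j
    fin_cases i <;> fin_cases j <;>
      simp [laxX, sigma3, potMat, tDiag, tUp, tLow] <;> ring
  rw [hT]
  funext i
  fin_cases i
  · simp [Matrix.mulVec, dotProduct, Fin.sum_univ_two]
  · simp [Matrix.mulVec, dotProduct, Fin.sum_univ_two]
    ring

theorem solvesLax_iff {q₀ : ℝ} {q : ℝ → ℝ → ℝ} {z : ℂ} {φ : ℝ → ℝ → Fin 2 → ℂ} :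
    SolvesLax q₀ q z φ ↔ ∀ x t,
      (HasDerivAt (fun x' => φ x' t 0) (I * kk q₀ z * φ x t 0 + q x t * φ x t 1) x ∧
       HasDerivAt (fun x' => φ x' t 1) (-(q x t * φ x t 0) - I * kk q₀ z * φ x t 1) x) ∧
      (HasDerivAt (fun t' => φ x t' 0)
        (tDiag q₀ q x t z * φ x t 0 + tUp q₀ q x t z * φ x t 1) t ∧
       HasDerivAt (fun t' => φ x t' 1)
        (tLow q₀ q x t z * φ x t 0 - tDiag q₀ q x t z * φ x t 1) t) := by
  simp only [SolvesLax, laxX_mulVec, laxT_mulVec, hasDerivAt_pi, Fin.forall_fin_two,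
    Matrix.cons_val_zero, Matrix.cons_val_one]

/-- The Lax pair sees `z` only through `k`, so the points `z` and `-q₀²/z` share their solutions;
the first columns are obtained from the second in this way. -/
theorem solvesLax_congr_kk {q₀ : ℝ} {q : ℝ → ℝ → ℝ} {z z' : ℂ} {φ : ℝ → ℝ → Fin 2 → ℂ}
    (hk : kk q₀ z = kk q₀ z') (h : SolvesLax q₀ q z φ) : SolvesLax q₀ q z' φ := by
  have h1 := solvesLax_iff.mp h
  refine solvesLax_iff.mpr fun x t => ?_
  have h2 := h1 x t
  simpa only [tDiag, tUp, tLow, hk] using h2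

theorem SolvesLax.const_mul {q₀ : ℝ} {q : ℝ → ℝ → ℝ} {z : ℂ} {φ : ℝ → ℝ → Fin 2 → ℂ}
    (h : SolvesLax q₀ q z φ) (c : ℂ) : SolvesLax q₀ q z fun x t i => c * φ x t i := by
  intro x t
  have h1 := h x t
  have e : (fun x t i => c * φ x t i) = fun x t => c • φ x t := rfl
  rw [e]
  simp only [Matrix.mulVec_smul]
  exact ⟨h1.1.const_smul c, h1.2.const_smul c⟩

/-- Removing the phase from a solution of the Lax pair. -/
theorem solvesLax_of_gauge {q₀ : ℝ} {q : ℝ → ℝ → ℝ} {z : ℂ} {a b : ℝ → ℝ → ℂ}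
    (h1 : ∀ x t, HasDerivAt (fun x' => a x' t) (I * z * a x t + q x t * b x t) x)
    (h2 : ∀ x t, HasDerivAt (fun x' => b x' t)
      (-(q x t * a x t) + I * ((q₀ : ℂ) ^ 2 / z) * b x t) x)
    (h3 : ∀ x t, HasDerivAt (fun t' => a x t')
      ((tDiag q₀ q x t z + I * thetaT q₀ z) * a x t + tUp q₀ q x t z * b x t) t)
    (h4 : ∀ x t, HasDerivAt (fun t' => b x t')
      (tLow q₀ q x t z * a x t + (-tDiag q₀ q x t z + I * thetaT q₀ z) * b x t) t) :
    SolvesLax q₀ q z fun x t i => ![a x t, b x t] i * exp (-(I * theta q₀ x t z)) := by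
  refine solvesLax_iff.mpr fun x t => ?_
  have e1 := ((hasDerivAt_theta_fst q₀ x t z).const_mul I).fun_neg.cexp
  have e2 := ((hasDerivAt_theta_snd q₀ x t z).const_mul I).fun_neg.cexp
  have hl : lam q₀ z = z - kk q₀ z := by rw [lam, kk]; ring
  have hl' : lam q₀ z = (q₀ : ℂ) ^ 2 / z + kk q₀ z := by rw [lam, kk]; ring
  simp only [Matrix.cons_val_zero, Matrix.cons_val_one]
  refine ⟨⟨((h1 x t).mul e1).congr_deriv ?_, ((h2 x t).mul e1).congr_deriv ?_⟩,
    ((h3 x t).mul e2).congr_deriv ?_, ((h4 x t).mul e2).congr_deriv ?_⟩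
  · rw [hl]; ring
  · rw [hl']; ring
  · ring
  · ring

/-! ### The uniformization plane -/

theorem im_lam (q₀ : ℝ) (z : ℂ) : (lam q₀ z).im = z.im * (1 - q₀ ^ 2 / normSq z) / 2 := by
  rw [lam, ← ofReal_pow, div_eq_mul_inv (_ : ℂ) z]
  have h2 : ∀ x : ℂ, (x / 2).im = x.im / 2 := fun x => by
    rw [show (2 : ℂ) = ((2 : ℝ) : ℂ) by norm_num, div_ofReal_im]
  rw [h2, add_im, im_ofReal_mul, inv_im]
  ring

theorem mem_contSpec_iff {q₀ : ℝ} (hq : 0 < q₀) {z : ℂ} :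
    z ∈ contSpec q₀ ↔ z ≠ 0 ∧ (lam q₀ z).im = 0 := by
  refine and_congr_right fun hz => ?_
  have h1 : 0 < normSq z := normSq_pos.mpr hz
  rw [im_lam, div_eq_zero_iff, mul_eq_zero]
  have h2 : 1 - q₀ ^ 2 / normSq z = 0 ↔ ‖z‖ = q₀ := by
    rw [sub_eq_zero, eq_comm, div_eq_one_iff_eq h1.ne', normSq_eq_norm_sq, eq_comm,
      pow_left_inj₀ (norm_nonneg _) hq.le two_ne_zero]
  rw [h2]
  simp

theorem gammaF_ne_zero {q₀ : ℝ} {z : ℂ} (hz : z ≠ 0) (h1 : z ≠ I * q₀) (h2 : z ≠ -(I * q₀)) :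
    gammaF q₀ z ≠ 0 := by
  intro h
  have h3 : (z - I * q₀) * (z + I * q₀) = 0 := by
    rw [gammaF] at h
    field_simp at h
    linear_combination h - (q₀ : ℂ) ^ 2 * I_sq
  rcases mul_eq_zero.mp h3 with h | h
  · exact h1 (sub_eq_zero.mp h)
  · exact h2 (eq_neg_of_add_eq_zero_left h)

theorem im_lam_I {q₀ : ℝ} (hq : 0 < q₀) :
    (lam q₀ (I * q₀)).im = 0 ∧ (lam q₀ (-(I * q₀))).im = 0 := by
  have h : I * (q₀ : ℂ) ∈ contSpec q₀ :=
    ⟨mul_ne_zero I_ne_zero (by exact_mod_cast hq.ne'), Or.inr (by simp [abs_of_pos hq])⟩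
  have h1 := ((mem_contSpec_iff hq).mp h).2
  exact ⟨h1, by rw [lam_neg, neg_im, h1, neg_zero]⟩

theorem gammaF_ne_zero_of_im {q₀ : ℝ} (hq : 0 < q₀) {z : ℂ} (hz : z ≠ 0) (h : (lam q₀ z).im ≠ 0) :
    gammaF q₀ z ≠ 0 :=
  gammaF_ne_zero hz (fun he => h (he ▸ (im_lam_I hq).1)) fun he => h (he ▸ (im_lam_I hq).2)

theorem im_lam_hat {q₀ : ℝ} (hq : q₀ ≠ 0) {z : ℂ} (hz : z ≠ 0) :
    (lam q₀ (hat q₀ z)).im = -(lam q₀ z).im := by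
  rw [hat, lam_neg_div hq hz, neg_im]

theorem isOpen_DMinus (q₀ : ℝ) : IsOpen (DMinus q₀) := by
  have h : DMinus q₀ = (fun z => -z) ⁻¹' DPlus q₀ := by
    ext z
    simp [DMinus, DPlus, lam_neg]
  rw [h]
  exact (isOpen_DPlus q₀).preimage continuous_neg

namespace Smooth₂

theorem contDiff_left {F : ℝ → ℝ → ℂ} (hF : Smooth₂ F) (t : ℝ) :
    ContDiff ℝ (⊤ : ℕ∞) fun x : ℝ => F x t := by
  have h : ContDiff ℝ (⊤ : ℕ∞) fun x : ℝ => (x, t) := contDiff_id.prodMk contDiff_const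
  exact ContDiff.comp (g := fun p : ℝ × ℝ => F p.1 p.2) hF h

theorem ofReal_deriv {F : ℝ → ℝ → ℂ} {u : ℝ → ℝ → ℝ} (hF : Smooth₂ F)
    (hu : ∀ x t, (u x t : ℂ) = F x t) (x t : ℝ) :
    HasDerivAt (fun x' => u x' t) (deriv (fun x' => u x' t) x) x ∧
      ((deriv (fun x' => u x' t) x : ℝ) : ℂ) = dx F x t := by
  have h1 : HasDerivAt (fun x' => u x' t) (dx F x t).re x := by
    have := Complex.reCLM.hasFDerivAt.comp_hasDerivAt x (hF.hasDerivAt_dx x t)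
    refine this.congr_of_eventuallyEq (Eventually.of_forall fun y => ?_)
    simp [← hu]
  have h2 := h1.ofReal_comp
  simp only [hu] at h2
  rw [h1.deriv]
  exact ⟨h1, h2.unique (hF.hasDerivAt_dx x t)⟩

theorem ofReal_deriv_snd {F : ℝ → ℝ → ℂ} {u : ℝ → ℝ → ℝ} (hF : Smooth₂ F)
    (hu : ∀ x t, (u x t : ℂ) = F x t) (x t : ℝ) :
    HasDerivAt (fun t' => u x t') (deriv (fun t' => u x t') t) t ∧
      ((deriv (fun t' => u x t') t : ℝ) : ℂ) = dt F x t := by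
  have h1 : HasDerivAt (fun t' => u x t') (dt F x t).re t := by
    have := Complex.reCLM.hasFDerivAt.comp_hasDerivAt t (hF.hasDerivAt_dt x t)
    refine this.congr_of_eventuallyEq (Eventually.of_forall fun y => ?_)
    simp [← hu]
  have h2 := h1.ofReal_comp
  simp only [hu] at h2
  rw [h1.deriv]
  exact ⟨h1, h2.unique (hF.hasDerivAt_dt x t)⟩

end Smooth₂

/-- The Wronskian of two vectors. -/
def wrv (a b : Fin 2 → ℂ) : ℂ := a 0 * b 1 - a 1 * b 0

/-! ### Jost solutions of the constructed potential. -/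

namespace RatData

variable {ι : Type*} (D : RatData ι) [Fintype ι] [DecidableEq ι]

theorem ofReal_qx (x t : ℝ) : ((deriv (fun x' => D.q x' t) x : ℝ) : ℂ) = dx D.qc x t :=
  (D.smooth_qc.ofReal_deriv D.ofReal_q x t).2

theorem ofReal_qxx (x t : ℝ) : ((iteratedDeriv 2 (fun x' => D.q x' t) x : ℝ) : ℂ) =
    dx (dx D.qc) x t := by
  rw [iteratedDeriv_succ, iteratedDeriv_one]
  exact (D.smooth_qc.smooth_dx.ofReal_deriv (u := fun x t => deriv (fun x' => D.q x' t) x)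
    D.ofReal_qx x t).2

theorem ofReal_qxxx (x t : ℝ) : ((iteratedDeriv 3 (fun x' => D.q x' t) x : ℝ) : ℂ) =
    dx (dx (dx D.qc)) x t := by
  have h := (D.smooth_qc.smooth_dx.smooth_dx.ofReal_deriv
    (u := fun x t => iteratedDeriv 2 (fun x' => D.q x' t) x) D.ofReal_qxx x t).2
  rw [← h, iteratedDeriv_succ]

theorem isFocusingSolution : IsFocusingSolution D.q := by
  refine ⟨fun t => ?_, fun x t => ?_, fun x t => ?_⟩
  · have h2 : ContDiff ℝ (⊤ : ℕ∞) fun x : ℝ => D.q x t :=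
      Complex.reCLM.contDiff.comp (D.smooth_qc.contDiff_left t)
    exact contDiff_infty.mp h2 3
  · exact (D.smooth_qc.ofReal_deriv_snd D.ofReal_q x t).1.differentiableAt
  · have h := D.mkdv x t
    have h1 := (D.smooth_qc.ofReal_deriv_snd D.ofReal_q x t).2
    rw [← h1, ← D.ofReal_qx, ← D.ofReal_qxxx, ← D.ofReal_q] at h
    exact_mod_cast h

theorem tDiag_eq (x t : ℝ) (z : ℂ) : tDiag D.q₀ D.q x t z = D.T11 z x t := by
  rw [tDiag, T11, D.ofReal_q]

theorem tUp_eq (x t : ℝ) (z : ℂ) : tUp D.q₀ D.q x t z = D.T12 z x t := by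
  rw [tUp, T12, D.ofReal_q, D.ofReal_qx, D.ofReal_qxx]

theorem tLow_eq (x t : ℝ) (z : ℂ) : tLow D.q₀ D.q x t z = D.T21 z x t := by
  rw [tLow, T21, D.ofReal_q, D.ofReal_qx, D.ofReal_qxx]

/-- The second column of `Φ₋`. -/
def jostMinus (x t : ℝ) (z : ℂ) (i : Fin 2) : ℂ :=
  ![D.f z x t, D.g z x t] i * exp (-(I * theta D.q₀ x t z))

theorem solvesLax_jostMinus {z : ℂ} (hz : z ≠ 0) (hzn : ∀ n, z ≠ D.η' n) :
    SolvesLax D.q₀ D.q z fun x t i => D.jostMinus x t z i := by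
  refine solvesLax_of_gauge (a := D.f z) (b := D.g z) (fun x t => ?_) (fun x t => ?_) (fun x t => ?_)
    fun x t => ?_
  · rw [D.ofReal_q, ← D.dx_f_eq hz hzn]; exact (D.smooth_f z).hasDerivAt_dx x t
  · rw [D.ofReal_q, ← D.dx_g_eq hz hzn]; exact (D.smooth_g z).hasDerivAt_dx x t
  · rw [D.tDiag_eq, D.tUp_eq, ← D.dt_f_eq hz hzn]; exact (D.smooth_f z).hasDerivAt_dt x t
  · rw [D.tDiag_eq, D.tLow_eq, ← D.dt_g_eq hz hzn]; exact (D.smooth_g z).hasDerivAt_dt x t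

/-- At `η̂_k` the column of `Φ₊` cannot be written as the Blaschke product times that of `Φ₋`, which
has a pole there; it is a multiple of this residue vector instead. -/
theorem solvesLax_residue (k : ι) : SolvesLax D.q₀ D.q (D.η' k) fun x t i =>
    ![D.c k x t, D.d k x t] i * exp (-(I * theta D.q₀ x t (D.η' k))) := by
  refine solvesLax_of_gauge (a := D.c k) (b := D.d k) (fun x t => ?_) (fun x t => ?_) (fun x t => ?_)
    fun x t => ?_
  · rw [D.ofReal_q, ← D.dx_c_eq]; exact (D.smooth_c k).hasDerivAt_dx x t
  · rw [D.ofReal_q, ← neg_mul, neg_mul, ← D.dx_d_eq]; exact (D.smooth_d k).hasDerivAt_dx x t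
  · rw [D.tDiag_eq, D.tUp_eq, ← D.dt_c_eq]; exact (D.smooth_c k).hasDerivAt_dt x t
  · rw [D.tDiag_eq, D.tLow_eq, ← D.dt_d_eq]; exact (D.smooth_d k).hasDerivAt_dt x t

/-- The amplitude of the second column of `Φ₊`. -/
def ampPlus (x t : ℝ) (z : ℂ) : Fin 2 → ℂ :=
  ![D.bl z * (I * D.r / z) + ∑ n, D.c n x t * D.blq n z, D.bl z + ∑ n, D.d n x t * D.blq n z]

/-- The second column of `Φ₊`. -/
def jostPlus (x t : ℝ) (z : ℂ) (i : Fin 2) : ℂ :=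
  D.ampPlus x t z i * exp (-(I * theta D.q₀ x t z))

theorem sum_mul_blq (a : ι → ℂ) {z : ℂ} (hzn : ∀ n, z ≠ D.η' n) :
    ∑ n, a n * D.blq n z = D.bl z * pfrac D.q₀ D.η a z := by
  rw [pfrac, Finset.mul_sum]
  refine Finset.sum_congr rfl fun n _ => ?_
  have := sub_ne_zero.mpr (hzn n)
  rw [η'] at this
  rw [D.bl_eq n, η']
  field_simp

theorem sum_mul_blq_η' (a : ι → ℂ) (k : ι) :
    ∑ n, a n * D.blq n (D.η' k) = D.blq k (D.η' k) * a k := by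
  rw [Finset.sum_eq_single k]
  · ring
  · intro n _ hn
    rw [blq, Finset.prod_eq_zero (i := k) (Finset.mem_erase.mpr ⟨hn.symm, Finset.mem_univ _⟩)
      (by rw [sub_self, zero_div]), zero_div, mul_zero]
  · simp

/-- Proportionality of the two columns is the absence of reflection, and the factor is `s₂₂`. -/
theorem jostPlus_eq {z : ℂ} (hzn : ∀ n, z ≠ D.η' n) (x t : ℝ) (i : Fin 2) :
    D.jostPlus x t z i = D.bl z * D.jostMinus x t z i := by
  rw [jostPlus, jostMinus, ← mul_assoc]
  congr 1
  fin_cases i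
  · simp [ampPlus, D.sum_mul_blq _ hzn, f, mul_add]
  · simp [ampPlus, D.sum_mul_blq _ hzn, g, mul_add]

theorem jostPlus_η' (k : ι) (x t : ℝ) (i : Fin 2) : D.jostPlus x t (D.η' k) i =
    D.blq k (D.η' k) * (![D.c k x t, D.d k x t] i * exp (-(I * theta D.q₀ x t (D.η' k)))) := by
  rw [jostPlus, ← mul_assoc]
  congr 1
  fin_cases i
  · simp [ampPlus, D.bl_η', D.sum_mul_blq_η']
  · simp [ampPlus, D.bl_η', D.sum_mul_blq_η']

theorem solvesLax_jostPlus {z : ℂ} (hz : z ≠ 0) :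
    SolvesLax D.q₀ D.q z fun x t i => D.jostPlus x t z i := by
  by_cases h : ∃ k, z = D.η' k
  · obtain ⟨k, rfl⟩ := h
    simp only [D.jostPlus_η']
    exact (D.solvesLax_residue k).const_mul _
  · push Not at h
    simp only [D.jostPlus_eq h]
    exact (D.solvesLax_jostMinus hz h).const_mul _

theorem tendsto_jostMinus (t : ℝ) (z : ℂ) (i : Fin 2) :
    Tendsto (fun x => D.jostMinus x t z i * exp (I * theta D.q₀ x t z)) atBot
      (𝓝 (![I * D.r / z, 1] i)) := by
  have e : ∀ x, D.jostMinus x t z i * exp (I * theta D.q₀ x t z) = ![D.f z x t, D.g z x t] i := by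
    intro x
    rw [jostMinus, mul_assoc, ← exp_add, neg_add_cancel, exp_zero, mul_one]
  simp only [e]
  fin_cases i
  · exact D.tendsto_f_atBot t z
  · exact D.tendsto_g_atBot t z

/-- The limit of `ampPlus` as `x → ∞`. -/
theorem amp_limit {z : ℂ} (hz : z ≠ 0) (hzn : ∀ n, z ≠ D.η n) :
    D.bl z * (I * D.r / z) + ∑ n, D.cInf n * D.blq n z = I * D.r / z ∧
      D.bl z + ∑ n, D.dInf n * D.blq n z = 1 := by
  have hgen : ∀ y, y ≠ 0 → (∀ n, y ≠ D.η n) → (∀ n, y ≠ D.η' n) →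
      D.bl y * (I * D.r / y) + ∑ n, D.cInf n * D.blq n y = I * D.r / y ∧
      D.bl y + ∑ n, D.dInf n * D.blq n y = 1 := by
    intro y h0 h1 h2
    rw [D.sum_mul_blq _ h2, D.sum_mul_blq _ h2, ← mul_add, D.bl_mul_fInf h0 h1 h2]
    refine ⟨rfl, ?_⟩
    rw [← D.bl_mul_gInf h1 h2]; ring
  -- At the points `η̂_n` the identities follow by continuity from a punctured neighbourhood.
  have hev : ∀ᶠ y in 𝓝[≠] z, y ≠ 0 ∧ (∀ n, y ≠ D.η n) ∧ ∀ n, y ≠ D.η' n := by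
    have h1 : ∀ᶠ y in 𝓝[≠] z, y ≠ 0 := nhdsWithin_le_nhds (isOpen_ne.mem_nhds hz)
    have h2 : ∀ᶠ y in 𝓝[≠] z, ∀ n, y ≠ D.η n :=
      eventually_all.mpr fun n => nhdsWithin_le_nhds (isOpen_ne.mem_nhds (hzn n))
    have h3 : ∀ᶠ y in 𝓝[≠] z, ∀ n, y ≠ D.η' n := by
      refine eventually_all.mpr fun n => ?_
      by_cases h : z = D.η' n
      · rw [← h]; exact self_mem_nhdsWithin
      · exact nhdsWithin_le_nhds (isOpen_ne.mem_nhds h)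
    exact h1.and (h2.and h3)
  have hbl := (D.differentiableAt_bl hzn).continuousAt
  have hc : ContinuousAt (fun y : ℂ => I * D.r / y) z := continuousAt_const.div continuousAt_id hz
  have hs : ∀ a : ι → ℂ, ContinuousAt (fun y => ∑ n, a n * D.blq n y) z := fun a =>
    tendsto_finsetSum _ fun n _ => (D.continuousAt_blq n hzn).const_mul (a n)
  constructor
  · refine tendsto_nhds_unique (l := 𝓝[≠] z) (((hbl.mul hc).add (hs _)).tendsto.mono_left nhdsWithin_le_nhds)
      ((hc.tendsto.mono_left nhdsWithin_le_nhds).congr' ?_)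
    filter_upwards [hev] with y hy
    exact (hgen y hy.1 hy.2.1 hy.2.2).1.symm
  · refine tendsto_nhds_unique (l := 𝓝[≠] z) ((hbl.add (hs _)).tendsto.mono_left nhdsWithin_le_nhds)
      ((tendsto_const_nhds (x := (1 : ℂ)) (f := 𝓝[≠] z)).congr' ?_)
    filter_upwards [hev] with y hy
    exact (hgen y hy.1 hy.2.1 hy.2.2).2.symm

theorem tendsto_jostPlus (t : ℝ) {z : ℂ} (hz : z ≠ 0) (hzn : ∀ n, z ≠ D.η n) (i : Fin 2) :
    Tendsto (fun x => D.jostPlus x t z i * exp (I * theta D.q₀ x t z)) atTop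
      (𝓝 (![I * D.r / z, 1] i)) := by
  have e : ∀ x, D.jostPlus x t z i * exp (I * theta D.q₀ x t z) = D.ampPlus x t z i := by
    intro x
    rw [jostPlus, mul_assoc, ← exp_add, neg_add_cancel, exp_zero, mul_one]
  simp only [e]
  obtain ⟨h1, h2⟩ := D.amp_limit hz hzn
  fin_cases i
  · change Tendsto _ _ (𝓝 (I * D.r / z))
    rw [← h1]
    exact (tendsto_finsetSum _ fun n _ => (D.tendsto_c_atTop t n).mul_const _).const_add _
  · change Tendsto _ _ (𝓝 1)
    rw [← h2]
    exact (tendsto_finsetSum _ fun n _ => (D.tendsto_d_atTop t n).mul_const _).const_add _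

/-- The Jost solutions `Φ₋`. -/
def jostM (x t : ℝ) (z : ℂ) : Matrix (Fin 2) (Fin 2) ℂ :=
  Matrix.of fun i j => ![I * D.r / z * D.jostMinus x t (hat D.q₀ z) i, D.jostMinus x t z i] j

/-- The Jost solutions `Φ₊`. -/
def jostP (x t : ℝ) (z : ℂ) : Matrix (Fin 2) (Fin 2) ℂ :=
  Matrix.of fun i j => ![I * D.r / z * D.jostPlus x t (hat D.q₀ z) i, D.jostPlus x t z i] j

theorem hat_ne {z : ℂ} (hz : z ≠ 0) : hat D.q₀ z ≠ 0 := neg_div_ne_zero D.sys.pos.ne' hz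

theorem hat_mem {z : ℂ} (hz : z ∈ DPlus D.q₀) : hat D.q₀ z ∈ DMinus D.q₀ :=
  neg_div_mem_DMinus D.sys.pos.ne' hz

theorem kk_hat {z : ℂ} (hz : z ≠ 0) : kk D.q₀ (hat D.q₀ z) = kk D.q₀ z :=
  kk_neg_div D.sys.pos.ne' hz

theorem coef_mul {z : ℂ} (hz : z ≠ 0) : I * D.r / z * (I * D.r / hat D.q₀ z) = 1 := by
  have hq := D.sys.q_ne
  have : I * (D.r : ℂ) / z * (I * D.r / hat D.q₀ z) = -(I ^ 2) * ((D.r : ℂ) ^ 2 / (D.q₀ : ℂ) ^ 2) := by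
    unfold hat; field_simp
  rw [this, D.sys.sqC, I_sq, div_self (pow_ne_zero 2 hq)]; ring

theorem bg_hat {z : ℂ} (hz : z ≠ 0) (i : Fin 2) :
    I * D.r / z * ![I * D.r / hat D.q₀ z, 1] i = bgMat D.r z i 0 := by
  fin_cases i
  · simpa [bgMat] using D.coef_mul hz
  · simp [bgMat]

theorem bg_one (z : ℂ) (i : Fin 2) : ![I * D.r / z, 1] i = bgMat D.r z i 1 := by
  fin_cases i <;> simp [bgMat]

/-- The first columns are `ir/z` times the second columns at `-q₀²/z`: the phase `θ` changes sign
there, and `(ir/z)(ir/ẑ) = 1` gives the right normalization. -/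
theorem isJost : IsJost D.q₀ D.q D.r D.r D.jostM D.jostP := by
  constructor
  · intro z hz hl
    have hl' : (lam D.q₀ (hat D.q₀ z)).im ≤ 0 := by
      rw [im_lam_hat D.sys.pos.ne' hz]; linarith
    refine ⟨?_, D.solvesLax_jostMinus hz (D.sys.ne_hat_of_nonneg hl), fun t i => ⟨?_, ?_⟩⟩
    · exact solvesLax_congr_kk (D.kk_hat hz) ((D.solvesLax_jostPlus (D.hat_ne hz)).const_mul _)
    · rw [← D.bg_hat hz]
      refine ((D.tendsto_jostPlus t (D.hat_ne hz) (D.sys.ne_of_nonpos hl') i).const_mul _).congr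
        fun x => ?_
      rw [theta_hat D.sys.pos.ne' x t hz, mul_neg, ← mul_assoc]
      rfl
    · rw [← D.bg_one]
      exact D.tendsto_jostMinus t z i
  · intro z hz hl
    have hl' : 0 ≤ (lam D.q₀ (hat D.q₀ z)).im := by
      rw [im_lam_hat D.sys.pos.ne' hz]; linarith
    refine ⟨?_, D.solvesLax_jostPlus hz, fun t i => ⟨?_, ?_⟩⟩
    · exact solvesLax_congr_kk (D.kk_hat hz)
        ((D.solvesLax_jostMinus (D.hat_ne hz) (D.sys.ne_hat_of_nonneg hl')).const_mul _)
    · rw [← D.bg_hat hz]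
      refine ((D.tendsto_jostMinus t (hat D.q₀ z) i).const_mul _).congr fun x => ?_
      rw [theta_hat D.sys.pos.ne' x t hz, mul_neg, ← mul_assoc]
      rfl
    · rw [← D.bg_one]
      exact D.tendsto_jostPlus t hz (D.sys.ne_of_nonpos hl) i

/-! #### Scattering data -/

theorem hat_eq_η' {z : ℂ} (hz : z ≠ 0) (n : ι) : hat D.q₀ z = D.η' n ↔ z = D.η n := by
  constructor
  · intro h
    rw [← D.sys.hat_hat hz, h, η', D.sys.hat_hat (D.sys.ne_zero n)]
  · rintro rfl; rfl

/-- The two phases are opposite, so the Wronskian of the amplitudes has zero `x`-derivative and may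
be evaluated at `-∞`. -/
theorem wronskian {z : ℂ} (hz : z ≠ 0) (h1 : ∀ n, z ≠ D.η n) (h2 : ∀ n, z ≠ D.η' n) (x t : ℝ) :
    D.f (hat D.q₀ z) x t * D.g z x t - D.g (hat D.q₀ z) x t * D.f z x t =
      I * D.r / hat D.q₀ z - I * D.r / z := by
  have hz' := D.hat_ne hz
  have h1' : ∀ n, hat D.q₀ z ≠ D.η' n := fun n hn => h1 n ((D.hat_eq_η' hz n).mp hn)
  set W : ℝ → ℂ := fun x =>
    D.f (hat D.q₀ z) x t * D.g z x t - D.g (hat D.q₀ z) x t * D.f z x t with hW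
  have hd : ∀ x, HasDerivAt W 0 x := by
    intro x
    have e := (((D.smooth_f (hat D.q₀ z)).hasDerivAt_dx x t).mul ((D.smooth_g z).hasDerivAt_dx x t)).sub
      (((D.smooth_g (hat D.q₀ z)).hasDerivAt_dx x t).mul ((D.smooth_f z).hasDerivAt_dx x t))
    refine e.congr_deriv ?_
    rw [D.dx_f_eq hz h2, D.dx_g_eq hz h2, D.dx_f_eq hz' h1', D.dx_g_eq hz' h1']
    have e2 : (D.q₀ : ℂ) ^ 2 / hat D.q₀ z = -z := by
      have := D.sys.q_ne
      unfold hat; field_simp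
    rw [e2, show hat D.q₀ z = -((D.q₀ : ℂ) ^ 2 / z) from rfl]
    ring
  have hconst : ∀ y, W y = W x := fun y =>
    is_const_of_deriv_eq_zero (fun x => (hd x).differentiableAt) (fun x => (hd x).deriv) y x
  have hlim : Tendsto W atBot (𝓝 (I * D.r / hat D.q₀ z * 1 - 1 * (I * D.r / z))) :=
    ((D.tendsto_f_atBot t _).mul (D.tendsto_g_atBot t z)).sub
      ((D.tendsto_g_atBot t _).mul (D.tendsto_f_atBot t z))
  rw [mul_one, one_mul] at hlim
  refine tendsto_nhds_unique ?_ hlim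
  exact tendsto_const_nhds.congr fun y => (hconst y).symm

theorem wr_jostM {z : ℂ} (hz : z ≠ 0) (h1 : ∀ n, z ≠ D.η n) (h2 : ∀ n, z ≠ D.η' n) (x t : ℝ) :
    wrv (fun i => I * D.r / z * D.jostMinus x t (hat D.q₀ z) i) (D.jostMinus x t z) =
      gammaF D.q₀ z := by
  have h3 := D.wronskian hz h1 h2 x t
  have e : exp (-(I * theta D.q₀ x t (hat D.q₀ z))) * exp (-(I * theta D.q₀ x t z)) = 1 := by
    rw [theta_hat D.sys.pos.ne' x t hz, ← exp_add, mul_neg, neg_neg, add_neg_cancel, exp_zero]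
  have e2 : gammaF D.q₀ z = I * D.r / z * (I * D.r / hat D.q₀ z - I * D.r / z) := by
    rw [mul_sub, D.coef_mul hz, gammaF, ← D.sys.sqC]
    field_simp
    rw [I_sq]; ring
  rw [e2, ← h3, wrv]
  simp only [jostMinus, Matrix.cons_val_zero, Matrix.cons_val_one]
  linear_combination (I * D.r / z * (D.f (hat D.q₀ z) x t * D.g z x t -
    D.g (hat D.q₀ z) x t * D.f z x t)) * e

/-- The ratio of the Jost solutions at the poles. -/
def bCoef (k : ι) : ℂ := D.blq k (D.η' k) * (D.κ₀ k * D.η' k / (I * D.r))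

/-- The residue condition `c_k = κ_k f(η_k)`, together with `d_k = κ_k g(η_k)`, read as
proportionality of Jost columns. The factor `e^{2iθ}` in `κ_k` is the quotient of the two phases, so
the ratio does not depend on `(x,t)`. -/
theorem jostPlus_η'_eq (k : ι) (x t : ℝ) (i : Fin 2) : D.jostPlus x t (D.η' k) i =
    D.bCoef k * (I * D.r / D.η' k * D.jostMinus x t (D.η k) i) := by
  have hr := D.sys.r_ne
  have hk := D.η'_ne_zero k
  have hv : ![D.c k x t, D.d k x t] i = D.κ x t k * ![D.f (D.η k) x t, D.g (D.η k) x t] i := by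
    fin_cases i
    · exact congrArg (D.κ x t k * ·) (D.v_spec x t k)
    · exact D.d_eq x t k
  have he : exp (2 * I * theta D.q₀ x t (D.η' k)) * exp (-(I * theta D.q₀ x t (D.η' k))) =
      exp (-(I * theta D.q₀ x t (D.η k))) := by
    rw [← exp_add, show theta D.q₀ x t (D.η k) = -theta D.q₀ x t (D.η' k) by
      rw [η', theta_hat D.sys.pos.ne' x t (D.sys.ne_zero k), neg_neg]]
    congr 1; ring
  rw [D.jostPlus_η', hv, jostMinus, bCoef, ← he, κ]
  have hI := I_ne_zero
  field_simp

/-- Away from the `η̂_n` the column of `Φ₊` is the product times that of `Φ₋`, whose Wronskian is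
`γ_f`; at an `η̂_k` both sides vanish because the columns are proportional. -/
theorem s22_eq {z : ℂ} (hz : z ≠ 0) (hγ : gammaF D.q₀ z ≠ 0) (h1 : ∀ n, z ≠ D.η n) :
    s22 D.q₀ D.jostM D.jostP z = D.bl z := by
  rw [s22, div_eq_iff hγ]
  change wrv (fun i => I * D.r / z * D.jostMinus 0 0 (hat D.q₀ z) i) (D.jostPlus 0 0 z) = _
  by_cases h : ∃ k, z = D.η' k
  · obtain ⟨k, rfl⟩ := h
    rw [D.bl_η', zero_mul, wrv, D.jostPlus_η'_eq, D.jostPlus_η'_eq, η',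
      D.sys.hat_hat (D.sys.ne_zero k)]
    ring
  · push Not at h
    rw [← D.wr_jostM hz h1 h 0 0, wrv, wrv, D.jostPlus_eq h, D.jostPlus_eq h]
    ring

theorem s11_eq {z : ℂ} (hz : z ≠ 0) :
    s11 D.q₀ D.jostM D.jostP z = s22 D.q₀ D.jostM D.jostP (hat D.q₀ z) := by
  have hz' := D.hat_ne hz
  have hq := D.sys.q_ne
  have hr := D.sys.r_ne
  have hγ : gammaF D.q₀ (hat D.q₀ z) = z ^ 2 / (D.q₀ : ℂ) ^ 2 * gammaF D.q₀ z := by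
    unfold gammaF hat; field_simp; ring
  have e1 : wr (D.jostP 0 0 z) 0 (D.jostM 0 0 z) 1 =
      I * D.r / z * wrv (D.jostPlus 0 0 (hat D.q₀ z)) (D.jostMinus 0 0 z) := by
    change I * D.r / z * D.jostPlus 0 0 (hat D.q₀ z) 0 * D.jostMinus 0 0 z 1 -
      I * D.r / z * D.jostPlus 0 0 (hat D.q₀ z) 1 * D.jostMinus 0 0 z 0 = _
    rw [wrv]; ring
  have e2 : wr (D.jostM 0 0 (hat D.q₀ z)) 0 (D.jostP 0 0 (hat D.q₀ z)) 1 =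
      -(I * D.r / hat D.q₀ z) * wrv (D.jostPlus 0 0 (hat D.q₀ z)) (D.jostMinus 0 0 z) := by
    change I * D.r / hat D.q₀ z * D.jostMinus 0 0 (hat D.q₀ (hat D.q₀ z)) 0 *
        D.jostPlus 0 0 (hat D.q₀ z) 1 -
      I * D.r / hat D.q₀ z * D.jostMinus 0 0 (hat D.q₀ (hat D.q₀ z)) 1 *
        D.jostPlus 0 0 (hat D.q₀ z) 0 = _
    rw [D.sys.hat_hat hz, wrv]; ring
  rw [s11, s22, e1, e2, hγ]
  have e3 : -(I * (D.r : ℂ) / hat D.q₀ z) = z ^ 2 / (D.q₀ : ℂ) ^ 2 * (I * D.r / z) := by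
    unfold hat; field_simp
  rw [e3, mul_assoc, mul_div_mul_left _ _ (div_ne_zero (pow_ne_zero 2 hz) (pow_ne_zero 2 hq))]

theorem s22_eq_of_mem {z : ℂ} (hz : z ∈ DMinus D.q₀) : s22 D.q₀ D.jostM D.jostP z = D.bl z :=
  D.s22_eq hz.1 (gammaF_ne_zero_of_im D.sys.pos hz.1 hz.2.ne) (D.sys.ne_of_nonpos hz.2.le)

theorem s11_eq_of_mem {z : ℂ} (hz : z ∈ DPlus D.q₀) :
    s11 D.q₀ D.jostM D.jostP z = D.bl (hat D.q₀ z) := by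
  rw [D.s11_eq hz.1, D.s22_eq_of_mem (D.hat_mem hz)]

theorem hasDerivAt_bl (k : ι) : HasDerivAt D.bl (D.blq k (D.η' k)) (D.η' k) := by
  have hc := D.continuousAt_blq k (z := D.η' k) fun n => (D.sys.ne_hat n k).symm
  rw [hasDerivAt_iff_tendsto_slope]
  refine (hc.tendsto.mono_left nhdsWithin_le_nhds).congr' ?_
  filter_upwards [self_mem_nhdsWithin] with y hy
  have : y - D.η' k ≠ 0 := sub_ne_zero.mpr hy
  rw [slope_def_field, D.bl_η', sub_zero, D.bl_eq k]
  field_simp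

theorem deriv_s22 (k : ι) : deriv (s22 D.q₀ D.jostM D.jostP) (D.η' k) = D.blq k (D.η' k) := by
  have h : s22 D.q₀ D.jostM D.jostP =ᶠ[𝓝 (D.η' k)] D.bl := by
    filter_upwards [(isOpen_DMinus D.q₀).mem_nhds (D.sys.hat_mem k)] with z hz
    exact D.s22_eq_of_mem hz
  rw [h.deriv_eq, (D.hasDerivAt_bl k).deriv]

theorem deriv_s11 (k : ι) : deriv (s11 D.q₀ D.jostM D.jostP) (D.η k) =
    D.blq k (D.η' k) * ((D.q₀ : ℂ) ^ 2 / D.η k ^ 2) := by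
  have h : s11 D.q₀ D.jostM D.jostP =ᶠ[𝓝 (D.η k)] fun z => D.bl (hat D.q₀ z) := by
    filter_upwards [(isOpen_DPlus D.q₀).mem_nhds (D.sys.mem k)] with z hz
    exact D.s11_eq_of_mem hz
  have hk := D.sys.ne_zero k
  have h1 : HasDerivAt (hat D.q₀) ((D.q₀ : ℂ) ^ 2 / D.η k ^ 2) (D.η k) := by
    have := ((hasDerivAt_inv hk).const_mul ((D.q₀ : ℂ) ^ 2)).fun_neg
    refine (this.congr_of_eventuallyEq (Eventually.of_forall fun z => ?_)).congr_deriv ?_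
    · simp [hat, div_eq_mul_inv]
    · field_simp
  rw [h.deriv_eq]
  exact (HasDerivAt.comp (D.η k) (D.hasDerivAt_bl k) h1).deriv

theorem s22_zero {z : ℂ} (hz : z ∈ DMinus D.q₀) :
    s22 D.q₀ D.jostM D.jostP z = 0 ↔ ∃ k, z = D.η' k := by
  rw [D.s22_eq_of_mem hz]
  constructor
  · intro h
    by_contra h2
    push Not at h2
    exact D.bl_ne_zero (D.sys.ne_of_nonpos hz.2.le) h2 h
  · rintro ⟨k, rfl⟩; exact D.bl_η' k

theorem s11_zero {z : ℂ} (hz : z ∈ DPlus D.q₀) :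
    s11 D.q₀ D.jostM D.jostP z = 0 ↔ ∃ k, z = D.η k := by
  rw [D.s11_eq hz.1, D.s22_zero (D.hat_mem hz)]
  exact exists_congr fun k => D.hat_eq_η' hz.1 k

theorem deriv_s11_ne (k : ι) : deriv (s11 D.q₀ D.jostM D.jostP) (D.η k) ≠ 0 := by
  rw [D.deriv_s11]
  exact mul_ne_zero (D.blq_η' k) (div_ne_zero (pow_ne_zero 2 D.sys.q_ne)
    (pow_ne_zero 2 (D.sys.ne_zero k)))

/-- No pole or zero of the Blaschke product lies on `Σ`, and the Wronskian of proportional columns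
is zero. -/
theorem scattering {z : ℂ} (hz : z ∈ contSpec₀ D.q₀) :
    (s11 D.q₀ D.jostM D.jostP z ≠ 0 ∧ s22 D.q₀ D.jostM D.jostP z ≠ 0) ∧
      refl D.q₀ D.jostM D.jostP z = 0 ∧ reflT D.q₀ D.jostM D.jostP z = 0 := by
  obtain ⟨h0, him⟩ := (mem_contSpec_iff D.sys.pos).mp hz.1
  have hne : z ≠ I * D.q₀ ∧ z ≠ -(I * D.q₀) := by
    have := hz.2
    simpa [not_or] using this
  have hγ := gammaF_ne_zero h0 hne.1 hne.2
  have h1 := D.sys.ne_of_nonpos him.le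
  have h2 : ∀ n, z ≠ D.η' n := D.sys.ne_hat_of_nonneg him.ge
  have h0' := D.hat_ne h0
  have him' : (lam D.q₀ (hat D.q₀ z)).im = 0 := by rw [im_lam_hat D.sys.pos.ne' h0, him, neg_zero]
  have h1' := D.sys.ne_of_nonpos him'.le
  have h2' : ∀ n, hat D.q₀ z ≠ D.η' n := D.sys.ne_hat_of_nonneg him'.ge
  have hγ' : gammaF D.q₀ (hat D.q₀ z) ≠ 0 := by
    have hq := D.sys.q_ne
    have : gammaF D.q₀ (hat D.q₀ z) = z ^ 2 / (D.q₀ : ℂ) ^ 2 * gammaF D.q₀ z := by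
      unfold gammaF hat; field_simp; ring
    rw [this]
    exact mul_ne_zero (div_ne_zero (pow_ne_zero 2 h0) (pow_ne_zero 2 hq)) hγ
  refine ⟨⟨?_, ?_⟩, ?_, ?_⟩
  · rw [D.s11_eq h0, D.s22_eq h0' hγ' h1']; exact D.bl_ne_zero h1' h2'
  · rw [D.s22_eq h0 hγ h1]; exact D.bl_ne_zero h1 h2
  · have : wr (D.jostM 0 0 z) 0 (D.jostP 0 0 z) 0 = 0 := by
      change I * D.r / z * D.jostMinus 0 0 (hat D.q₀ z) 0 *
          (I * D.r / z * D.jostPlus 0 0 (hat D.q₀ z) 1) -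
        I * D.r / z * D.jostMinus 0 0 (hat D.q₀ z) 1 *
          (I * D.r / z * D.jostPlus 0 0 (hat D.q₀ z) 0) = 0
      rw [D.jostPlus_eq h2', D.jostPlus_eq h2']; ring
    rw [refl, s21, this, zero_div, zero_div]
  · have : wr (D.jostP 0 0 z) 1 (D.jostM 0 0 z) 1 = 0 := by
      change D.jostPlus 0 0 z 0 * D.jostMinus 0 0 z 1 -
        D.jostPlus 0 0 z 1 * D.jostMinus 0 0 z 0 = 0
      rw [D.jostPlus_eq h2, D.jostPlus_eq h2]; ring
    rw [reflT, s12, this, zero_div, zero_div]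

/-- The factor `blq` of the proportionality constant equals the derivative of `s₂₂` and cancels in
the quotient. At `η_k` the constant is the same and the derivative gains `q₀²/η_k²` by the chain
rule, in accordance with `h2`. -/
theorem isResidueConstant {A : ℂ → ℂ}
    (h1 : ∀ k, A (D.η' k) = D.κ₀ k * D.η' k / (I * D.r))
    (h2 : ∀ k, A (D.η k) = D.η k ^ 2 / (D.q₀ : ℂ) ^ 2 * A (D.η' k)) :
    IsResidueConstant D.q₀ D.jostM D.jostP A := by
  constructor
  · intro z hz h0
    obtain ⟨k, rfl⟩ := (D.s11_zero hz).mp h0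
    have hk := D.sys.ne_zero k
    refine ⟨D.bCoef k, fun x t i => ?_, ?_⟩
    · change I * D.r / D.η k * D.jostPlus x t (D.η' k) i = D.bCoef k * D.jostMinus x t (D.η k) i
      rw [D.jostPlus_η'_eq]
      have := D.coef_mul hk
      rw [show hat D.q₀ (D.η k) = D.η' k from rfl] at this
      linear_combination D.bCoef k * D.jostMinus x t (D.η k) i * this
    · have hq := D.sys.q_ne
      have hb := D.blq_η' k
      rw [h2, h1, D.deriv_s11, bCoef]
      field_simp
  · intro z hz h0
    obtain ⟨k, rfl⟩ := (D.s22_zero hz).mp h0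
    refine ⟨D.bCoef k, fun x t i => ?_, ?_⟩
    · change D.jostPlus x t (D.η' k) i =
        D.bCoef k * (I * D.r / D.η' k * D.jostMinus x t (hat D.q₀ (D.η' k)) i)
      rw [D.jostPlus_η'_eq]
      rw [η', D.sys.hat_hat (D.sys.ne_zero k)]
    · rw [h1, D.deriv_s22, bCoef, mul_div_cancel_left₀ _ (D.blq_η' k)]

end RatData

/-! ### Existence of reflectionless potentials -/

section existence

variable {q₀ qm : ℝ} {N₁ N₂ : ℕ} {z : Fin N₁ → ℂ} {w : Fin N₂ → ℝ} {A : ℂ → ℂ}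

theorem alphaVec_eq (q₀ : ℝ) (z : Fin N₁ → ℂ) (w : Fin N₂ → ℝ) (A : ℂ → ℂ) (x t : ℝ)
    (n : PoleIdx N₁ N₂) : alphaVec q₀ z w A x t n =
      alphaVec q₀ z w A 0 0 n * exp (2 * I * theta q₀ x t (hat q₀ (eta q₀ z w n))) := by
  have h0 : alphaVec q₀ z w A 0 0 n = A (etaHat q₀ z w n) := by simp [alphaVec, theta]
  rw [h0]; rfl

/-- The rational data of admissible residue constants. -/
def ratData (h : PoleSys q₀ qm (eta q₀ z w) sigIdx tauIdx) (hA : IsAdmissible q₀ z w A) :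
    RatData (PoleIdx N₁ N₂) where
  q₀ := q₀
  r := qm
  η := eta q₀ z w
  σ := sigIdx
  τ := tauIdx
  κ₀ := resCoef q₀ qm z w A 0 0
  sys := h
  symm := symmCoeff_resCoef h hA 0 0

theorem ratData_κ (h : PoleSys q₀ qm (eta q₀ z w) sigIdx tauIdx) (hA : IsAdmissible q₀ z w A)
    (x t : ℝ) : (ratData h hA).κ x t = resCoef q₀ qm z w A x t := by
  funext n
  change resCoef q₀ qm z w A 0 0 n * exp (2 * I * theta q₀ x t (hat q₀ (eta q₀ z w n))) = _
  rw [resCoef, resCoef, alphaVec_eq q₀ z w A x t]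
  ring

theorem determinant_formula_ratData (h : PoleSys q₀ qm (eta q₀ z w) sigIdx tauIdx)
    (hA : IsAdmissible q₀ z w A) (x t : ℝ) :
    ((ratData h hA).q x t : ℂ) = (qm : ℂ) + (borderedMat q₀ qm z w A x t).det /
      (gMat q₀ qm z w A x t).det * I := by
  rw [determinant_formula h hA x t (v := (ratData h hA).v x t), RatData.ofReal_q, RatData.qc]
  · simp only [RatData.c, ratData_κ]; rfl
  · intro k
    have := (ratData h hA).v_spec x t k
    rw [RatData.f] at this
    simp only [RatData.c, ratData_κ] at this
    exact this

theorem eta_mem_first (hq : 0 < q₀) (hzre : ∀ n, 0 < (z n).re) (hzim : ∀ n, 0 < (z n).im)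
    (hw : ∀ m, 0 < w m) {k : PoleIdx N₁ N₂} (hre : 0 < (eta q₀ z w k).re)
    (him : 0 < (eta q₀ z w k).im) : ∃ n, z n = eta q₀ z w k := by
  obtain ⟨s0, s1, s2, s3, s4, s5⟩ := eta_signs (q₀ := q₀) hq hzre hzim hw
  rcases k with ⟨a, n⟩ | ⟨a, m⟩
  · fin_cases a
    · exact ⟨n, rfl⟩
    · exact absurd hre (s1 n).1.not_gt
    · exact absurd hre (s2 n).1.not_gt
    · exact absurd him (s3 n).2.not_gt
  · fin_cases a
    · exact absurd hre (s4 m).1.le.not_gt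
    · exact absurd hre (s5 m).1.le.not_gt

theorem eta_mem_imag (hq : 0 < q₀) (hzre : ∀ n, 0 < (z n).re) (hzim : ∀ n, 0 < (z n).im)
    (hw : ∀ m, 0 < w m) {k : PoleIdx N₁ N₂} (hre : (eta q₀ z w k).re = 0)
    (him : 0 < (eta q₀ z w k).im) : ∃ m, I * (w m : ℂ) = eta q₀ z w k := by
  obtain ⟨s0, s1, s2, s3, s4, s5⟩ := eta_signs (q₀ := q₀) hq hzre hzim hw
  rcases k with ⟨a, n⟩ | ⟨a, m⟩
  · fin_cases a
    · exact absurd hre (s0 n).1.ne'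
    · exact absurd hre (s1 n).1.ne
    · exact absurd hre (s2 n).1.ne
    · exact absurd hre (s3 n).1.ne'
  · fin_cases a
    · exact ⟨m, rfl⟩
    · exact absurd him (s5 m).2.not_gt

theorem isReflectionlessPotential_ratData (h : PoleSys q₀ qm (eta q₀ z w) sigIdx tauIdx)
    (hA : IsAdmissible q₀ z w A) (hzre : ∀ n, 0 < (z n).re) (hzim : ∀ n, 0 < (z n).im)
    (hwq : ∀ m, q₀ < w m) :
    IsReflectionlessPotential q₀ qm qm z w A (ratData h hA).q := by
  set D := ratData h hA with hD
  have hw : ∀ m, 0 < w m := fun m => h.pos.trans (hwq m)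
  refine ⟨D.isFocusingSolution, D.hasBoundaryValues, D.jostM, D.jostP, D.isJost,
    fun ζ hζ => (D.scattering hζ).1, fun ζ hζ => (D.scattering hζ).2, ?_, ?_, ?_, ?_, ?_⟩
  · ext ζ
    constructor
    · rintro ⟨h1, h2, h3, h4⟩
      obtain ⟨k, rfl⟩ := (D.s11_zero h1).mp h4
      exact eta_mem_first h.pos hzre hzim hw h2 h3
    · rintro ⟨n, rfl⟩
      have hm := h.mem (Sum.inl (0, n))
      exact ⟨hm, hzre n, hzim n, (D.s11_zero hm).mpr ⟨Sum.inl (0, n), rfl⟩⟩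
  · ext v
    constructor
    · rintro ⟨h1, h2⟩
      have hv : 0 < v := h.pos.trans h1
      have hm : I * (v : ℂ) ∈ DPlus q₀ :=
        ⟨mul_ne_zero I_ne_zero (by exact_mod_cast hv.ne'),
          im_lam_pos h.pos (by simp [hv]) (by simpa [abs_of_pos hv] using h1)⟩
      obtain ⟨k, hk⟩ := (D.s11_zero hm).mp h2
      have hk' : I * (v : ℂ) = eta q₀ z w k := hk
      obtain ⟨m, hm⟩ := eta_mem_imag (q₀ := q₀) (k := k) h.pos hzre hzim hw (by rw [← hk']; simp)
        (by rw [← hk']; simp [hv])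
      rw [← hk'] at hm
      exact ⟨m, by exact_mod_cast mul_left_cancel₀ I_ne_zero hm⟩
    · rintro ⟨m, rfl⟩
      exact ⟨hwq m, (D.s11_zero (h.mem (Sum.inr (0, m)))).mpr ⟨Sum.inr (0, m), rfl⟩⟩
  · exact fun n => D.deriv_s11_ne (Sum.inl (0, n))
  · exact fun m => D.deriv_s11_ne (Sum.inr (0, m))
  · have hr := h.r_ne
    refine D.isResidueConstant (fun k => ?_) fun k => ?_
    · have hk := h.ne_zero k
      have hq := h.q_ne
      have e : D.κ₀ k = A (hat q₀ (eta q₀ z w k)) * eta q₀ z w k / (I * qm) := by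
        change resCoef q₀ qm z w A 0 0 k = _
        rw [resCoef]
        simp [alphaVec, theta]
        rfl
      rw [e]
      change A (hat q₀ (eta q₀ z w k)) =
        A (hat q₀ (eta q₀ z w k)) * eta q₀ z w k / (I * qm) * hat q₀ (eta q₀ z w k) / (I * qm)
      have e2 : A (hat q₀ (eta q₀ z w k)) * eta q₀ z w k / (I * qm) * hat q₀ (eta q₀ z w k) /
          (I * qm) = A (hat q₀ (eta q₀ z w k)) * (-((q₀ : ℂ) ^ 2 / (I ^ 2 * (qm : ℂ) ^ 2))) := by
        rw [show hat q₀ (eta q₀ z w k) = -((q₀ : ℂ) ^ 2 / eta q₀ z w k) from rfl]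
        field_simp
      rw [e2, h.sqC, I_sq]
      field_simp
    · exact (hA _ (Or.inl ⟨k, rfl⟩)).2.2.2

/-- The residue constants at the points `η`. -/
def etaVal (q₀ : ℝ) (z : Fin N₁ → ℂ) (w : Fin N₂ → ℝ) (a : Fin N₁ → ℂ) (c : Fin N₂ → ℝ) :
    PoleIdx N₁ N₂ → ℂ
  | Sum.inl (j, n) => ![a n, -conj (a n), -((q₀ : ℂ) ^ 2 / conj (z n) ^ 2 * conj (a n)),
      (q₀ : ℂ) ^ 2 / z n ^ 2 * a n] j
  | Sum.inr (j, m) => ![I * (c m : ℂ), -((q₀ : ℂ) ^ 2 / (w m : ℂ) ^ 2 * (I * c m))] j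

/-- The residue constants at the points `η̂`. -/
def etaHatVal (q₀ : ℝ) (z : Fin N₁ → ℂ) (w : Fin N₂ → ℝ) (a : Fin N₁ → ℂ) (c : Fin N₂ → ℝ)
    (k : PoleIdx N₁ N₂) : ℂ := (q₀ : ℂ) ^ 2 / eta q₀ z w k ^ 2 * etaVal q₀ z w a c k

theorem etaVal_conj (q₀ : ℝ) (z : Fin N₁ → ℂ) (w : Fin N₂ → ℝ) (a : Fin N₁ → ℂ) (c : Fin N₂ → ℝ)
    (k : PoleIdx N₁ N₂) : etaVal q₀ z w a c k = -conj (etaVal q₀ z w a c (sigIdx k)) := by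
  rcases k with ⟨j, n⟩ | ⟨j, m⟩
  · fin_cases j <;> simp [etaVal, sigIdx]
  · fin_cases j <;> simp [etaVal, sigIdx]

theorem etaVal_inv (hq : q₀ ≠ 0) (hz : ∀ n, z n ≠ 0) (hw : ∀ m, w m ≠ 0) (a : Fin N₁ → ℂ)
    (c : Fin N₂ → ℝ) (k : PoleIdx N₁ N₂) :
    etaVal q₀ z w a c (tauIdx k) = (q₀ : ℂ) ^ 2 / eta q₀ z w k ^ 2 * etaVal q₀ z w a c k := by
  have hq' : (q₀ : ℂ) ≠ 0 := by exact_mod_cast hq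
  rcases k with ⟨j, n⟩ | ⟨j, m⟩
  · have h1 := hz n
    have h2 : conj (z n) ≠ 0 := (map_ne_zero _).mpr h1
    fin_cases j <;> simp [etaVal, eta, tauIdx] <;> field_simp
  · have h1 : (w m : ℂ) ≠ 0 := by exact_mod_cast hw m
    fin_cases j
    · simp [etaVal, eta, tauIdx, mul_pow, I_sq, div_neg]
    · simp [etaVal, eta, tauIdx, mul_pow, I_sq, div_pow]
      field_simp

/-- An admissible `A` is determined by the symmetric constants at the points `η`. -/
theorem isAdmissible_of_eta (h : PoleSys q₀ qm (eta q₀ z w) sigIdx tauIdx)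
    (h0 : ∀ k, A (eta q₀ z w k) ≠ 0)
    (hconj : ∀ k, A (eta q₀ z w k) = -conj (A (eta q₀ z w (sigIdx k))))
    (hhat : ∀ k, A (hat q₀ (eta q₀ z w k)) = (q₀ : ℂ) ^ 2 / eta q₀ z w k ^ 2 * A (eta q₀ z w k))
    (hinv : ∀ k, A (eta q₀ z w (tauIdx k)) =
      (q₀ : ℂ) ^ 2 / eta q₀ z w k ^ 2 * A (eta q₀ z w k)) : IsAdmissible q₀ z w A := by
  have hq := h.q_ne
  have hτ : ∀ k, A (hat q₀ (eta q₀ z w (tauIdx k))) = A (eta q₀ z w k) := fun k => by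
    have := h.ne_zero k
    rw [hhat, hinv, h.eta_inv]
    field_simp
  have hhconj : ∀ k, A (hat q₀ (eta q₀ z w k)) = -conj (A (hat q₀ (eta q₀ z w (sigIdx k)))) :=
    fun k => by
      have e : eta q₀ z w (sigIdx k) ^ 2 = conj (eta q₀ z w k) ^ 2 := by rw [h.eta_conj, neg_sq]
      rw [hhat, hhat, e, hconj k]
      simp
  rintro ζ (⟨k, rfl⟩ | ⟨k, rfl⟩)
  · have hk := h.ne_zero k
    refine ⟨h0 k, ?_, ?_, ?_⟩
    · rw [h.conj_eta, hτ]; exact hconj k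
    · rw [← h.eta_conj]; exact hconj k
    · change _ = _ * A (hat q₀ (eta q₀ z w k))
      rw [hhat]
      field_simp
  · change A (hat q₀ (eta q₀ z w k)) ≠ 0 ∧ A (hat q₀ (eta q₀ z w k)) =
      -conj (A (conj (hat q₀ (eta q₀ z w k)))) ∧ A (hat q₀ (eta q₀ z w k)) =
      -conj (A (-conj (hat q₀ (eta q₀ z w k)))) ∧ A (hat q₀ (eta q₀ z w k)) =
      hat q₀ (eta q₀ z w k) ^ 2 / (q₀ : ℂ) ^ 2 * A (hat q₀ (hat q₀ (eta q₀ z w k)))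
    have hk := h.ne_zero k
    refine ⟨?_, ?_, ?_, ?_⟩
    · rw [hhat]
      exact mul_ne_zero (div_ne_zero (pow_ne_zero 2 hq) (pow_ne_zero 2 hk)) (h0 k)
    · rw [h.conj_hat, ← hτ, h.inv_inv]; exact hhconj k
    · rw [← h.hat_conj]; exact hhconj k
    · rw [h.hat_hat hk, hhat, hat]
      field_simp

/-- The points `η` and `η̂` are pairwise distinct, so values may be prescribed on each symmetry
orbit from one representative. Only on the imaginary axis does the symmetry `η ↦ -η*` fix a point;
it forces `A[iw_m]` to be imaginary, hence the real parameter `c m`. -/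
theorem exists_admissible (h : PoleSys q₀ qm (eta q₀ z w) sigIdx tauIdx)
    (hz : ∀ n, z n ≠ 0) (hw : ∀ m, w m ≠ 0) {a : Fin N₁ → ℂ} {c : Fin N₂ → ℝ}
    (ha : ∀ n, a n ≠ 0) (hc : ∀ m, c m ≠ 0) :
    ∃ A : ℂ → ℂ, (∀ n, A (z n) = a n) ∧ (∀ m, A (I * (w m : ℂ)) = I * (c m : ℂ)) ∧
      IsAdmissible q₀ z w A := by
  have hq := h.q_ne
  set A : ℂ → ℂ := Function.extend (eta q₀ z w) (etaVal q₀ z w a c)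
    (Function.extend (fun k => hat q₀ (eta q₀ z w k)) (etaHatVal q₀ z w a c) 0) with hA
  have e1 : ∀ k, A (eta q₀ z w k) = etaVal q₀ z w a c k := fun k => h.inj.extend_apply _ _ k
  have e2 : ∀ k, A (hat q₀ (eta q₀ z w k)) = etaHatVal q₀ z w a c k := fun k => by
    rw [hA, Function.extend_apply']
    · exact h.hat_inj.extend_apply _ _ k
    · rintro ⟨j, hj⟩
      exact h.ne_hat j k hj
  have hv0 : ∀ k, etaVal q₀ z w a c k ≠ 0 := by
    rintro (⟨j, n⟩ | ⟨j, m⟩)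
    · have h1 := hz n
      have h2 : conj (z n) ≠ 0 := (map_ne_zero _).mpr h1
      have h3 := ha n
      have h4 : conj (a n) ≠ 0 := (map_ne_zero _).mpr h3
      fin_cases j
      · exact h3
      · exact neg_ne_zero.mpr h4
      · exact neg_ne_zero.mpr (mul_ne_zero (div_ne_zero (pow_ne_zero 2 hq) (pow_ne_zero 2 h2)) h4)
      · exact mul_ne_zero (div_ne_zero (pow_ne_zero 2 hq) (pow_ne_zero 2 h1)) h3
    · have h1 : (w m : ℂ) ≠ 0 := by exact_mod_cast hw m
      have h2 : I * (c m : ℂ) ≠ 0 := mul_ne_zero I_ne_zero (by exact_mod_cast hc m)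
      fin_cases j
      · exact h2
      · exact neg_ne_zero.mpr (mul_ne_zero (div_ne_zero (pow_ne_zero 2 hq) (pow_ne_zero 2 h1)) h2)
  have hconj := etaVal_conj q₀ z w a c
  have hinv := etaVal_inv (z := z) (w := w) h.pos.ne' hz hw a c
  refine ⟨A, fun n => e1 (Sum.inl (0, n)), fun m => e1 (Sum.inr (0, m)),
    isAdmissible_of_eta h (fun k => ?_) (fun k => ?_) (fun k => ?_) fun k => ?_⟩
  · rw [e1]; exact hv0 k
  · rw [e1, e1]; exact hconj k
  · rw [e1, e2, etaHatVal]
  · rw [e1, e1]; exact hinv k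

end existence

/-! ### Uniqueness, symmetries and non-vanishing of the Jost function. -/

namespace JostLeft

variable {q₀ r : ℝ} {u : ℝ → ℝ} {m m' : ℂ → ℝ → ℂ × ℂ}

/-- The Jost function is determined by the potential. -/
theorem unique (hm : JostLeft q₀ r u m) (hm' : JostLeft q₀ r u m') {z : ℂ}
    (hz : z ∈ closedPlus q₀) (x : ℝ) : m z x = m' z x := by
  have hδ : 0 < ‖z‖ := norm_pos_iff.mpr hz.1
  have hmem : z ∈ closedPlus q₀ ∩ {w | ‖z‖ ≤ ‖w‖} := ⟨hz, le_refl ‖z‖⟩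
  exact tendsto_nhds_unique ((hm.tendstoUniformlyOn_volIter hδ x).tendsto_at hmem)
    ((hm'.tendstoUniformlyOn_volIter hδ x).tendsto_at hmem)

/-- Reality of the potential. -/
theorem conj_symm (hm : JostLeft q₀ r u m) :
    JostLeft q₀ r u fun z x => (conj (m (-conj z) x).1, conj (m (-conj z) x).2) where
  pos := hm.pos
  sq := hm.sq
  smooth := hm.smooth
  integrable := hm.integrable
  deriv1 z hz h x := by
    have hz' : -conj z ≠ 0 := by simpa using hz
    have h' : 0 ≤ (lam q₀ (-conj z)).im := by simpa [lam_neg, lam_conj] using h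
    refine (hm.deriv1 _ hz' h' x).star.congr_deriv ?_
    simp
  deriv2 z hz h x := by
    have hz' : -conj z ≠ 0 := by simpa using hz
    have h' : 0 ≤ (lam q₀ (-conj z)).im := by simpa [lam_neg, lam_conj] using h
    refine (hm.deriv2 _ hz' h' x).star.congr_deriv ?_
    simp [div_neg]
  lim z hz h := by
    have hz' : -conj z ≠ 0 := by simpa using hz
    have h' : 0 ≤ (lam q₀ (-conj z)).im := by simpa [lam_neg, lam_conj] using h
    have := hm.lim _ hz' h'
    have h1 := (continuous_conj.tendsto _).comp ((continuous_fst.tendsto _).comp this)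
    have h2 := (continuous_conj.tendsto _).comp ((continuous_snd.tendsto _).comp this)
    simpa [div_neg, neg_div, Function.comp_def] using h1.prodMk_nhds h2

theorem eq_conj (hm : JostLeft q₀ r u m) {z : ℂ} (hz : z ∈ closedPlus q₀) (x : ℝ) :
    (m z x).1 = conj (m (-conj z) x).1 ∧ (m z x).2 = conj (m (-conj z) x).2 := by
  have := hm.unique hm.conj_symm hz x
  exact ⟨congrArg Prod.fst this, congrArg Prod.snd this⟩

/-- The symmetry `z → q₀² / z`. -/
theorem inv_symm (hm : JostLeft q₀ r u m) :
    JostLeft q₀ r u fun z x => (I * r / z * (m ((q₀ : ℂ) ^ 2 / z) x).2,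
      -(I * r / z * (m ((q₀ : ℂ) ^ 2 / z) x).1)) where
  pos := hm.pos
  sq := hm.sq
  smooth := hm.smooth
  integrable := hm.integrable
  deriv1 z hz h x := by
    have hq : (q₀ : ℂ) ≠ 0 := by exact_mod_cast hm.pos.ne'
    have hz' : (q₀ : ℂ) ^ 2 / z ≠ 0 := by positivity
    have h' : 0 ≤ (lam q₀ ((q₀ : ℂ) ^ 2 / z)).im := by rwa [lam_sq_div hm.pos.ne' hz]
    refine ((hm.deriv2 _ hz' h' x).const_mul (I * r / z)).congr_deriv ?_
    field_simp
    ring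
  deriv2 z hz h x := by
    have hq : (q₀ : ℂ) ≠ 0 := by exact_mod_cast hm.pos.ne'
    have hz' : (q₀ : ℂ) ^ 2 / z ≠ 0 := by positivity
    have h' : 0 ≤ (lam q₀ ((q₀ : ℂ) ^ 2 / z)).im := by rwa [lam_sq_div hm.pos.ne' hz]
    refine ((hm.deriv1 _ hz' h' x).const_mul (I * r / z)).fun_neg.congr_deriv ?_
    field_simp
    ring
  lim z hz h := by
    have hq : (q₀ : ℂ) ≠ 0 := by exact_mod_cast hm.pos.ne'
    have hr : (r : ℂ) ^ 2 = (q₀ : ℂ) ^ 2 := by exact_mod_cast hm.sq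
    have hz' : (q₀ : ℂ) ^ 2 / z ≠ 0 := by positivity
    have h' : 0 ≤ (lam q₀ ((q₀ : ℂ) ^ 2 / z)).im := by rwa [lam_sq_div hm.pos.ne' hz]
    have := hm.lim _ hz' h'
    have h1 := ((continuous_snd.tendsto _).comp this).const_mul (I * r / z)
    have h2 := (((continuous_fst.tendsto _).comp this).const_mul (I * r / z)).neg
    have e : -(I * r / z * (I * r / ((q₀ : ℂ) ^ 2 / z))) = 1 := by
      field_simp
      rw [hr, I_sq]
      field_simp
    simpa [Function.comp_def, e] using h1.prodMk_nhds h2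

theorem eq_inv (hm : JostLeft q₀ r u m) {z : ℂ} (hz : z ∈ closedPlus q₀) (x : ℝ) :
    (m z x).1 = I * r / z * (m ((q₀ : ℂ) ^ 2 / z) x).2 ∧
      (m z x).2 = -(I * r / z * (m ((q₀ : ℂ) ^ 2 / z) x).1) := by
  have := hm.unique hm.inv_symm hz x
  exact ⟨congrArg Prod.fst this, congrArg Prod.snd this⟩

/-- A Jost function has no zeros. -/
theorem ne_zero (hm : JostLeft q₀ r u m) {z : ℂ} (hz : z ∈ closedPlus q₀) (x : ℝ) :
    m z x ≠ 0 := by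
  intro h0
  -- Uniqueness for the linear differential equation propagates the zero to the left, against the
  -- limit `1` of the second component at `-∞`.
  have key : ∀ y ≤ x, m z y = 0 := by
    intro y hy
    obtain ⟨M, hM⟩ := (isCompact_Icc (a := y) (b := x)).exists_bound_of_continuousOn
      hm.smooth.continuous.continuousOn
    set c : ℂ := I * ((q₀ : ℂ) ^ 2 / z) with hc
    set v : ℝ → ℂ × ℂ → ℂ × ℂ := fun s p => (I * z * p.1 + u s * p.2, -u s * p.1 + c * p.2)
    have hd : ∀ s, HasDerivAt (m z) (v s (m z s)) s := fun s =>
      (hm.deriv1 z hz.1 hz.2 s).prodMk (hm.deriv2 z hz.1 hz.2 s)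
    have hv0 : ∀ s, v s 0 = 0 := fun s => by simp [v]
    have hL : ∀ s ∈ Set.Ioc y x, LipschitzOnWith (Real.toNNReal (‖z‖ + |M| + ‖c‖)) (v s)
        Set.univ := by
      intro s hs
      refine LipschitzOnWith.of_dist_le_mul fun p _ p' _ => ?_
      rw [Real.coe_toNNReal _ (by positivity), dist_eq_norm, dist_eq_norm]
      have hu : ‖(u s : ℂ)‖ ≤ |M| := by
        rw [norm_real]
        exact (hM s ⟨hs.1.le, hs.2⟩).trans (le_abs_self M)
      have e : v s p - v s p' = (I * z * (p - p').1 + u s * (p - p').2,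
          -u s * (p - p').1 + c * (p - p').2) := by
        ext <;> simp [v] <;> ring
      rw [e]
      set d := p - p'
      have h1 := norm_fst_le d
      have h2 := norm_snd_le d
      have hd0 := norm_nonneg d
      rw [Prod.norm_def]
      refine max_le ((norm_add_le _ _).trans ?_) ((norm_add_le _ _).trans ?_)
      · rw [norm_mul, norm_mul, norm_mul, norm_I, one_mul]
        have := mul_le_mul_of_nonneg_left h1 (norm_nonneg z)
        have := mul_le_mul hu h2 (norm_nonneg _) (abs_nonneg M)
        nlinarith [mul_nonneg (norm_nonneg c) hd0]
      · rw [norm_mul, norm_mul, norm_neg]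
        have := mul_le_mul_of_nonneg_left h2 (norm_nonneg c)
        have := mul_le_mul hu h1 (norm_nonneg _) (abs_nonneg M)
        nlinarith [mul_nonneg (norm_nonneg z) hd0]
    have := ODE_solution_unique_of_mem_Icc_left (v := v) (s := fun _ => Set.univ) (a := y) (b := x)
      (f := m z) (g := fun _ => 0) hL
      (fun s _ => (hd s).continuousAt.continuousWithinAt) (fun s _ => (hd s).hasDerivWithinAt)
      (fun _ _ => Set.mem_univ _) continuousOn_const
      (fun s _ => by simpa [hv0] using hasDerivWithinAt_const s (Set.Iic s) (0 : ℂ × ℂ))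
      (fun _ _ => Set.mem_univ _) h0
    exact this ⟨le_rfl, hy⟩
  have hl := hm.lim z hz.1 hz.2
  have h2 : Tendsto (m z) atBot (𝓝 0) :=
    tendsto_const_nhds.congr' (by filter_upwards [eventually_le_atBot x] with y hy
                                  exact (key y hy).symm)
  simpa using congrArg Prod.snd (tendsto_nhds_unique hl h2)

end JostLeft

/-! ### Two-sided functions in the uniformization plane -/

/-- The closed region `D₋ ∪ Σ`. -/
def closedMinus (q₀ : ℝ) : Set ℂ := {z | z ≠ 0 ∧ (lam q₀ z).im ≤ 0}

theorem mem_contSpec₀_iff {q₀ : ℝ} {z : ℂ} :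
    z ∈ contSpec₀ q₀ ↔ z ∈ contSpec q₀ ∧ z ^ 2 ≠ -(q₀ : ℂ) ^ 2 := by
  refine and_congr_right fun _ => ?_
  have : z ^ 2 = -(q₀ : ℂ) ^ 2 ↔ z = I * q₀ ∨ z = -(I * q₀) := by
    rw [← sq_eq_sq_iff_eq_or_eq_neg, mul_pow, I_sq, neg_one_mul]
  rw [Ne, this]
  simp

theorem gammaF_ne_zero_of_sq {q₀ : ℝ} {z : ℂ} (hz : z ≠ 0) (h : z ^ 2 ≠ -(q₀ : ℂ) ^ 2) :
    gammaF q₀ z ≠ 0 :=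
  gammaF_ne_zero hz (fun h' => h (by rw [h', mul_pow, I_sq, neg_one_mul]))
    fun h' => h (by rw [h', neg_sq, mul_pow, I_sq, neg_one_mul])

theorem DPlus_subset_closedPlus (q₀ : ℝ) : DPlus q₀ ⊆ closedPlus q₀ := fun _ h => ⟨h.1, h.2.le⟩

theorem DMinus_subset_closedMinus (q₀ : ℝ) : DMinus q₀ ⊆ closedMinus q₀ := fun _ h => ⟨h.1, h.2.le⟩

section hat

variable {q₀ : ℝ} (hq : 0 < q₀) {z : ℂ}

include hq

theorem hat_ne_zero (hz : z ≠ 0) : hat q₀ z ≠ 0 := neg_div_ne_zero hq.ne' hz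

theorem hat_hat (hz : z ≠ 0) : hat q₀ (hat q₀ z) = z := by
  have : (q₀ : ℂ) ≠ 0 := by exact_mod_cast hq.ne'
  unfold hat; field_simp

theorem hat_mem_closedPlus (hz : z ∈ closedMinus q₀) : hat q₀ z ∈ closedPlus q₀ :=
  ⟨hat_ne_zero hq hz.1, by rw [im_lam_hat hq.ne' hz.1]; linarith [hz.2]⟩

theorem hat_mem_closedMinus (hz : z ∈ closedPlus q₀) : hat q₀ z ∈ closedMinus q₀ :=
  ⟨hat_ne_zero hq hz.1, by rw [im_lam_hat hq.ne' hz.1]; linarith [hz.2]⟩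

theorem hat_mem_DPlus (hz : z ∈ DMinus q₀) : hat q₀ z ∈ DPlus q₀ :=
  ⟨hat_ne_zero hq hz.1, by rw [im_lam_hat hq.ne' hz.1]; linarith [hz.2]⟩

theorem hat_mem_contSpec (hz : z ∈ contSpec q₀) : hat q₀ z ∈ contSpec q₀ := by
  rw [mem_contSpec_iff hq] at hz ⊢
  exact ⟨hat_ne_zero hq hz.1, by rw [im_lam_hat hq.ne' hz.1, hz.2, neg_zero]⟩

theorem hat_sq_ne (hz : z ≠ 0) (h : z ^ 2 ≠ -(q₀ : ℂ) ^ 2) : hat q₀ z ^ 2 ≠ -(q₀ : ℂ) ^ 2 := by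
  have : (q₀ : ℂ) ≠ 0 := by exact_mod_cast hq.ne'
  intro h'
  apply h
  unfold hat at h'
  field_simp at h'
  linear_combination h'

theorem hat_mem_contSpec₀ (hz : z ∈ contSpec₀ q₀) : hat q₀ z ∈ contSpec₀ q₀ := by
  rw [mem_contSpec₀_iff] at hz ⊢
  exact ⟨hat_mem_contSpec hq hz.1, hat_sq_ne hq hz.1.1 hz.2⟩

theorem gammaF_hat (hz : z ≠ 0) : gammaF q₀ (hat q₀ z) = z ^ 2 / (q₀ : ℂ) ^ 2 * gammaF q₀ z := by
  have : (q₀ : ℂ) ≠ 0 := by exact_mod_cast hq.ne'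
  unfold gammaF hat
  field_simp
  ring

theorem mem_closedPlus_of_mem_contSpec (hz : z ∈ contSpec q₀) : z ∈ closedPlus q₀ :=
  ⟨hz.1, ((mem_contSpec_iff hq).mp hz).2.ge⟩

theorem mem_closedMinus_of_mem_contSpec (hz : z ∈ contSpec q₀) : z ∈ closedMinus q₀ :=
  ⟨hz.1, ((mem_contSpec_iff hq).mp hz).2.le⟩

theorem mem_contSpec_of_mem_of_mem (h1 : z ∈ closedPlus q₀) (h2 : z ∈ closedMinus q₀) :
    z ∈ contSpec q₀ := (mem_contSpec_iff hq).mpr ⟨h1.1, le_antisymm h2.2 h1.2⟩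

omit hq in
theorem differentiableAt_hat (hz : z ≠ 0) : DifferentiableAt ℂ (hat q₀) z :=
  ((differentiableAt_const _).div differentiableAt_id hz).neg

theorem tendsto_hat (hz : z ∈ closedMinus q₀) :
    Tendsto (hat q₀) (𝓝[closedMinus q₀] z) (𝓝[closedPlus q₀] (hat q₀ z)) :=
  (differentiableAt_hat hz.1).continuousAt.continuousWithinAt.tendsto_nhdsWithin
    fun _ h => hat_mem_closedPlus hq h

theorem _root_.ContinuousOn.comp_hat {E : Type*} [TopologicalSpace E] {f : ℂ → E}
    (hf : ContinuousOn f (closedPlus q₀)) (hz : z ∈ closedMinus q₀) :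
    ContinuousWithinAt (fun w => f (hat q₀ w)) (closedMinus q₀) z :=
  (hf _ (hat_mem_closedPlus hq hz)).tendsto.comp (tendsto_hat hq hz)

end hat

/-- A function that is continuous on both sides of `Σ` is continuous. -/
theorem continuousAt_of_sides {q₀ : ℝ} (hq : 0 < q₀) {F f g : ℂ → ℂ} {z : ℂ} (hz : z ∈ contSpec q₀)
    (hf : ContinuousWithinAt f (closedPlus q₀) z) (hg : ContinuousWithinAt g (closedMinus q₀) z)
    (hFf : F =ᶠ[𝓝[closedPlus q₀] z] f) (hFg : F =ᶠ[𝓝[closedMinus q₀] z] g) :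
    ContinuousAt F z := by
  have h1 := hf.congr_of_eventuallyEq hFf
    (hFf.self_of_nhdsWithin (mem_closedPlus_of_mem_contSpec hq hz))
  have h2 := hg.congr_of_eventuallyEq hFg
    (hFg.self_of_nhdsWithin (mem_closedMinus_of_mem_contSpec hq hz))
  refine (h1.union h2).continuousAt ?_
  filter_upwards [isOpen_ne.mem_nhds hz.1] with w hw
  rcases le_total 0 (lam q₀ w).im with h | h
  · exact Or.inl ⟨hw, h⟩
  · exact Or.inr ⟨hw, h⟩

/-! ### The points `±i q₀` -/

section branch

variable {q₀ : ℝ} (hq : 0 < q₀) {z₀ : ℂ} (hz : z₀ ^ 2 = -(q₀ : ℂ) ^ 2)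

include hq hz

theorem branch_ne_zero : z₀ ≠ 0 := by
  have : (q₀ : ℂ) ≠ 0 := by exact_mod_cast hq.ne'
  rintro rfl
  exact pow_ne_zero 2 this (by linear_combination hz)

theorem branch_im_ne_zero : z₀.im ≠ 0 := by
  intro h
  have h1 := congrArg re hz
  rw [sq, mul_re, h, ← ofReal_pow, neg_re, ofReal_re] at h1
  nlinarith

theorem norm_branch : ‖z₀‖ = q₀ := by
  have h1 := congrArg norm hz
  rw [norm_pow, norm_neg, norm_pow, norm_real, Real.norm_eq_abs, abs_of_pos hq,
    pow_left_inj₀ (norm_nonneg _) hq.le two_ne_zero] at h1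
  exact h1

theorem branch_mem : z₀ ∈ contSpec q₀ := ⟨branch_ne_zero hq hz, Or.inr (norm_branch hq hz)⟩

theorem hat_branch : hat q₀ z₀ = z₀ := by
  have := branch_ne_zero hq hz
  unfold hat
  field_simp
  linear_combination -hz

/-- On the ray `z₀ s` one has `Im λ = Im z₀ (s - 1/s)/2`. The choice `s = 1 - y Im z₀` makes this
negative for both signs of `Im z₀`. -/
theorem frequently_mem_DMinus : ∃ᶠ z in 𝓝 z₀, z ∈ DMinus q₀ := by
  have h0 := branch_ne_zero hq hz
  set b := z₀.im with hb
  have hb0 : b ≠ 0 := branch_im_ne_zero hq hz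
  have ht : Tendsto (fun y : ℝ => z₀ * ((1 - b * y : ℝ) : ℂ)) (𝓝[>] 0) (𝓝 z₀) := by
    have : Continuous fun y : ℝ => z₀ * ((1 - b * y : ℝ) : ℂ) := by fun_prop
    refine tendsto_nhdsWithin_of_tendsto_nhds ?_
    simpa using this.tendsto 0
  refine ht.frequently (Eventually.frequently ?_)
  have h1 : ∀ᶠ y : ℝ in 𝓝[>] 0, b * y < 1 := by
    refine (nhdsWithin_le_nhds (a := (0 : ℝ))) ?_
    have : Continuous fun y : ℝ => b * y := by fun_prop
    exact (this.tendsto 0).eventually_lt_const (by simp)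
  filter_upwards [h1, self_mem_nhdsWithin] with y hy hy0
  have hy0 : 0 < y := hy0
  set s := 1 - b * y with hs
  have hs0 : 0 < s := by linarith
  have hsC : (s : ℂ) ≠ 0 := by exact_mod_cast hs0.ne'
  refine ⟨mul_ne_zero h0 hsC, ?_⟩
  have e : lam q₀ (z₀ * s) = z₀ * (((s - 1 / s) / 2 : ℝ) : ℂ) := by
    unfold lam
    push_cast
    field_simp
    linear_combination hz
  rw [e, im_mul_ofReal, ← hb]
  have : b * ((s - 1 / s) / 2) = -(b ^ 2 * y * (2 - b * y)) / (2 * s) := by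
    field_simp
    rw [hs]; ring
  rw [this]
  apply div_neg_of_neg_of_pos _ (by positivity)
  have : 0 < b ^ 2 * y * (2 - b * y) := by
    have : 0 < 2 - b * y := by linarith
    positivity
  linarith

/-- The unimodular numbers `(1 + iy)/(1 - iy)` move `z₀` along the circle. The approach within `Σ⁰`
serves to extend identities to `±iq₀` and to test for poles there. -/
theorem frequently_mem_contSpec₀ : ∃ᶠ z in 𝓝[≠] z₀, z ∈ contSpec₀ q₀ := by
  have h0 := branch_ne_zero hq hz
  have hd : ∀ y : ℝ, (1 - I * (y : ℂ)) ≠ 0 := fun y h => by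
    simpa using congrArg re h
  have ht : Tendsto (fun y : ℝ => z₀ * ((1 + I * y) / (1 - I * y))) (𝓝[≠] 0) (𝓝[≠] z₀) := by
    rw [tendsto_nhdsWithin_iff]
    constructor
    · have : Continuous fun y : ℝ => z₀ * ((1 + I * (y : ℂ)) / (1 - I * y)) :=
        continuous_const.mul ((by fun_prop : Continuous fun y : ℝ => 1 + I * (y : ℂ)).div
          (by fun_prop) hd)
      refine tendsto_nhdsWithin_of_tendsto_nhds ?_
      simpa using this.tendsto 0
    · filter_upwards [self_mem_nhdsWithin] with y hy h
      have hy : (y : ℂ) ≠ 0 := by exact_mod_cast hy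
      have h1 : (1 + I * (y : ℂ)) / (1 - I * y) = 1 := by
        have : z₀ * ((1 + I * (y : ℂ)) / (1 - I * y)) = z₀ * 1 := by simpa using h
        exact mul_left_cancel₀ h0 this
      rw [div_eq_one_iff_eq (hd y)] at h1
      have : 2 * I * (y : ℂ) = 0 := by linear_combination h1
      simp [hy] at this
  have hc : ∃ᶠ z in 𝓝[≠] z₀, z ∈ contSpec q₀ := by
    refine ht.frequently (Eventually.frequently (Eventually.of_forall fun y => ⟨?_, Or.inr ?_⟩))
    · refine mul_ne_zero h0 (div_ne_zero (fun h => ?_) (hd y))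
      simpa using congrArg re h
    · have : ‖1 + I * (y : ℂ)‖ = ‖1 - I * (y : ℂ)‖ := by
        rw [← Complex.norm_conj]
        simp [sub_eq_add_neg]
      rw [norm_mul, norm_div, this, div_self (norm_ne_zero_iff.mpr (hd y)), mul_one,
        norm_branch hq hz]
  have h2 : ∀ᶠ z in 𝓝[≠] z₀, z ≠ -z₀ :=
    nhdsWithin_le_nhds (isOpen_ne.mem_nhds fun h => h0 (by linear_combination h / 2))
  refine (hc.and_eventually (h2.and self_mem_nhdsWithin)).mono fun z hz' => ?_
  rw [mem_contSpec₀_iff]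
  refine ⟨hz'.1, ?_⟩
  rw [← hz]
  intro h
  rcases sq_eq_sq_iff_eq_or_eq_neg.mp h with h | h
  · exact hz'.2.2 h
  · exact hz'.2.1 h

/-- If two pairs of functions `a`, `p` on `D₊ ∪ Σ` are related by parallelity of `a(z)` and
`p(ẑ)` on `Σ`, then their Wronskian has at most a zero of finite order at `±i q₀`. -/
theorem wronskian_factor {a₁ a₂ p₁ p₂ : ℂ → ℂ}
    (ca₁ : ContinuousOn a₁ (closedPlus q₀)) (ca₂ : ContinuousOn a₂ (closedPlus q₀))
    (cp₁ : ContinuousOn p₁ (closedPlus q₀)) (cp₂ : ContinuousOn p₂ (closedPlus q₀))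
    (da₁ : DifferentiableOn ℂ a₁ (DPlus q₀)) (da₂ : DifferentiableOn ℂ a₂ (DPlus q₀))
    (dp₁ : DifferentiableOn ℂ p₁ (DPlus q₀)) (dp₂ : DifferentiableOn ℂ p₂ (DPlus q₀))
    (hpar : ∀ z ∈ contSpec q₀, p₁ (hat q₀ z) * a₂ z = p₂ (hat q₀ z) * a₁ z)
    (ha : a₁ z₀ ≠ 0) (hp : p₁ z₀ ≠ 0) :
    ∃ E h : ℂ → ℂ, AnalyticAt ℂ E z₀ ∧ ContinuousWithinAt h (closedMinus q₀) z₀ ∧ h z₀ ≠ 0 ∧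
      ∀ᶠ z in 𝓝[closedMinus q₀] z₀,
        p₁ (hat q₀ z) * a₂ (hat q₀ z) - p₂ (hat q₀ z) * a₁ (hat q₀ z) = h z * E z := by
  have h0 := branch_ne_zero hq hz
  have hmem := branch_mem hq hz
  have hplus := mem_closedPlus_of_mem_contSpec hq hmem
  have hminus := mem_closedMinus_of_mem_contSpec hq hmem
  have hhat := hat_branch hq hz
  have hchat : ContinuousAt (hat q₀) z₀ := (differentiableAt_hat h0).continuousAt
  have htp : Tendsto (hat q₀) (𝓝[closedMinus q₀] z₀) (𝓝[closedPlus q₀] z₀) := by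
    simpa [hhat] using tendsto_hat hq hminus
  -- neighborhoods where the denominators do not vanish
  have ea : ∀ᶠ z in 𝓝[closedPlus q₀] z₀, a₁ z ≠ 0 := (ca₁ z₀ hplus).eventually_ne ha
  have ep : ∀ᶠ z in 𝓝[closedMinus q₀] z₀, p₁ (hat q₀ z) ≠ 0 :=
    htp.eventually ((cp₁ z₀ hplus).eventually_ne hp)
  classical
  -- The slope of `a(z)` on `D₊` and that of `p(ẑ)` on `D₋`. Parallelity makes them agree on `Σ`, so
  -- `R` is holomorphic near `z₀` although neither column is known to extend across `Σ`.
  set R : ℂ → ℂ := fun z => if 0 ≤ (lam q₀ z).im then a₂ z / a₁ z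
    else p₂ (hat q₀ z) / p₁ (hat q₀ z) with hR
  have Rp : ∀ z ∈ closedPlus q₀, R z = a₂ z / a₁ z := fun z hz => if_pos hz.2
  have eb : ∀ᶠ z in 𝓝 z₀, z ≠ 0 ∧ (z ∈ closedPlus q₀ → a₁ z ≠ 0) ∧
      (z ∈ closedMinus q₀ → p₁ (hat q₀ z) ≠ 0) := by
    filter_upwards [isOpen_ne.mem_nhds h0, eventually_nhdsWithin_iff.mp ea,
      eventually_nhdsWithin_iff.mp ep] with z h1 h2 h3 using ⟨h1, h2, h3⟩
  have Rm : ∀ᶠ z in 𝓝 z₀, z ∈ closedMinus q₀ → R z = p₂ (hat q₀ z) / p₁ (hat q₀ z) := by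
    filter_upwards [eb] with z h hzm
    by_cases hp : 0 ≤ (lam q₀ z).im
    · have hzp : z ∈ closedPlus q₀ := ⟨hzm.1, hp⟩
      rw [Rp z hzp, div_eq_div_iff (h.2.1 hzp) (h.2.2 hzm)]
      linear_combination hpar z (mem_contSpec_of_mem_of_mem hq hzp hzm)
    · simp [hR, hp]
  have hdp : ∀ᶠ z in 𝓝 z₀, 0 < (lam q₀ z).im → DifferentiableAt ℂ R z := by
    filter_upwards [eb] with z h hp
    have hzD : z ∈ DPlus q₀ := ⟨h.1, hp⟩
    have hn := (isOpen_DPlus q₀).mem_nhds hzD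
    refine (((da₂ z hzD).differentiableAt hn).div ((da₁ z hzD).differentiableAt hn)
      (h.2.1 ⟨h.1, hp.le⟩)).congr_of_eventuallyEq ?_
    filter_upwards [hn] with w hw using Rp w (DPlus_subset_closedPlus q₀ hw)
  have hdm : ∀ᶠ z in 𝓝 z₀, (lam q₀ z).im < 0 → DifferentiableAt ℂ R z := by
    filter_upwards [eb] with z h hm
    have hzD : z ∈ DMinus q₀ := ⟨h.1, hm⟩
    have hD := hat_mem_DPlus hq hzD
    have hn := (isOpen_DPlus q₀).mem_nhds hD
    have hh := differentiableAt_hat (q₀ := q₀) h.1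
    refine ((((dp₂ _ hD).differentiableAt hn).comp z hh).div
      (((dp₁ _ hD).differentiableAt hn).comp z hh) (h.2.2 ⟨h.1, hm.le⟩)).congr_of_eventuallyEq ?_
    filter_upwards [(isOpen_DMinus q₀).mem_nhds hzD] with w hw
    simp [hR, not_le.mpr hw.2]
  have hcR : ∀ᶠ z in 𝓝 z₀, ContinuousAt R z := by
    filter_upwards [eb, hdp, hdm, Rm.eventually_nhds] with z h h1 h2 h3
    rcases lt_trichotomy (lam q₀ z).im 0 with hlt | heq | hgt
    · exact (h2 hlt).continuousAt
    · have hzs : z ∈ contSpec q₀ := (mem_contSpec_iff hq).mpr ⟨h.1, heq⟩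
      have hzp := mem_closedPlus_of_mem_contSpec hq hzs
      have hzm := mem_closedMinus_of_mem_contSpec hq hzs
      exact continuousAt_of_sides hq hzs ((ca₂ z hzp).div (ca₁ z hzp) (h.2.1 hzp))
        ((cp₂.comp_hat hq hzm).div (cp₁.comp_hat hq hzm) (h.2.2 hzm))
        (by filter_upwards [self_mem_nhdsWithin] with w hw using Rp w hw)
        (eventually_nhdsWithin_iff.mpr h3)
    · exact (h1 hgt).continuousAt
  have hq2 : z₀ ^ 2 ≠ (q₀ : ℂ) ^ 2 := by
    intro h
    have hqC : (q₀ : ℂ) ≠ 0 := by exact_mod_cast hq.ne'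
    exact pow_ne_zero 2 hqC (by linear_combination (hz - h) / 2)
  have hdR : ∀ᶠ z in 𝓝 z₀, DifferentiableAt ℂ R z := by
    have e2 : ∀ᶠ z in 𝓝 z₀, z ^ 2 ≠ (q₀ : ℂ) ^ 2 :=
      (by fun_prop : Continuous fun z : ℂ => z ^ 2).continuousAt.eventually_ne hq2
    filter_upwards [eb, e2, hcR.eventually_nhds, hdp.eventually_nhds, hdm.eventually_nhds] with
      z h h2 h3 h4 h5
    refine differentiableAt_of_continuousAt_off_contSpec h.1 h2 h3 ?_
    filter_upwards [h4, h5] with w h4 h5 hw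
    rcases lt_or_gt_of_ne hw with h | h
    · exact h5 h
    · exact h4 h
  have hRan : AnalyticAt ℂ R z₀ := analyticAt_iff_eventually_differentiableAt.mpr hdR
  have hhan : AnalyticAt ℂ (hat q₀) z₀ := by
    rw [analyticAt_iff_eventually_differentiableAt]
    filter_upwards [isOpen_ne.mem_nhds h0] with z hz using differentiableAt_hat hz
  -- On the `D₋` side `R(ẑ)` is the slope of `a(ẑ)` and `R(z)` the slope of `p(ẑ)`; their difference
  -- is the Wronskian divided by the product of the first components.
  refine ⟨fun z => R (hat q₀ z) - R z, fun z => p₁ (hat q₀ z) * a₁ (hat q₀ z),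
    (AnalyticAt.fun_comp (g := R) (by rwa [hhat]) hhan).fun_sub hRan,
    (cp₁.comp_hat hq hminus).mul (ca₁.comp_hat hq hminus), by
      simp only [hhat]; exact mul_ne_zero hp ha, ?_⟩
  filter_upwards [self_mem_nhdsWithin, nhdsWithin_le_nhds Rm, ep, htp.eventually ea] with
    z hzm h1 h2 h3
  rw [h1 hzm, Rp _ (hat_mem_closedPlus hq hzm)]
  field_simp

end branch

/-! ### The Riemann–Hilbert problem of a reflectionless potential -/

/-- The Wronskian of `p` and `a`, divided by `1 + q₀²/z²`. -/
def scat (q₀ : ℝ) (a p : ℂ → ℂ × ℂ) (z : ℂ) : ℂ :=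
  ((p z).1 * (a z).2 - (p z).2 * (a z).1) / gammaF q₀ z

/-- The spectral properties of the Jost functions `a = Φ₋₂ e^{iθ}`, `p = Φ₊₁ e^{-iθ}` of a
reflectionless potential at fixed `x, t`. -/
structure RHData {ι : Type*} (q₀ r r' : ℝ) (η : ι → ℂ) (κ : ι → ℂ) (a p : ℂ → ℂ × ℂ) : Prop where
  sq' : r' ^ 2 = q₀ ^ 2
  cont_a : ContinuousOn a (closedPlus q₀)
  cont_p : ContinuousOn p (closedPlus q₀)
  diff_a : DifferentiableOn ℂ a (DPlus q₀)
  diff_p : DifferentiableOn ℂ p (DPlus q₀)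
  lim_a : Tendsto a (cobounded ℂ ⊓ 𝓟 (closedPlus q₀)) (𝓝 (0, 1))
  lim_p : Tendsto p (cobounded ℂ ⊓ 𝓟 (closedPlus q₀)) (𝓝 (1, 0))
  ne_a : ∀ z ∈ closedPlus q₀, a z ≠ 0
  ne_p : ∀ z ∈ closedPlus q₀, p z ≠ 0
  inv_a : ∀ z ∈ closedPlus q₀, a z =
    (I * r / z * (a ((q₀ : ℂ) ^ 2 / z)).2, -(I * r / z * (a ((q₀ : ℂ) ^ 2 / z)).1))
  inv_p : ∀ z ∈ closedPlus q₀, p z =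
    (-(I * r' / z * (p ((q₀ : ℂ) ^ 2 / z)).2), I * r' / z * (p ((q₀ : ℂ) ^ 2 / z)).1)
  jump : ∀ z ∈ contSpec₀ q₀, scat q₀ a p (hat q₀ z) • a z = (I * r / z) • p (hat q₀ z)
  ne_s : ∀ z ∈ contSpec₀ q₀, scat q₀ a p z ≠ 0
  zeros : {z | z ∈ DPlus q₀ ∧ scat q₀ a p z = 0} = Set.range η
  deriv_ne : ∀ k, deriv (scat q₀ a p) (η k) ≠ 0
  res : ∀ k, -(I * r) / (η k * deriv (scat q₀ a p) (η k)) * (p (η k)).1 = κ k * (a (η k)).1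

namespace RHData

variable {ι : Type*} {q₀ r r' : ℝ} {η κ : ι → ℂ} {σ τ : ι → ι} {a p : ℂ → ℂ × ℂ}
  (hS : PoleSys q₀ r η σ τ) (h : RHData q₀ r r' η κ a p)

include h

theorem continuousWithinAt_scat {z : ℂ} (hz : z ∈ closedPlus q₀) (hz2 : z ^ 2 ≠ -(q₀ : ℂ) ^ 2) :
    ContinuousWithinAt (scat q₀ a p) (closedPlus q₀) z := by
  have h1 := h.cont_a z hz
  have h2 := h.cont_p z hz
  have h3 : ContinuousAt (gammaF q₀) z := by
    unfold gammaF
    have := pow_ne_zero 2 hz.1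
    fun_prop (disch := assumption)
  exact ((h2.fst.mul h1.snd).sub (h2.snd.mul h1.fst)).div h3.continuousWithinAt
    (gammaF_ne_zero_of_sq hz.1 hz2)

theorem differentiableAt_fst_a {z : ℂ} (hz : z ∈ DPlus q₀) :
    DifferentiableAt ℂ (fun w => (a w).1) z :=
  ((h.diff_a z hz).differentiableAt ((isOpen_DPlus q₀).mem_nhds hz)).fst

theorem differentiableAt_fst_p {z : ℂ} (hz : z ∈ DPlus q₀) :
    DifferentiableAt ℂ (fun w => (p w).1) z :=
  ((h.diff_p z hz).differentiableAt ((isOpen_DPlus q₀).mem_nhds hz)).fst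

theorem tendsto_scat :
    Tendsto (scat q₀ a p) (cobounded ℂ ⊓ 𝓟 (closedPlus q₀)) (𝓝 1) := by
  have hγ : Tendsto (gammaF q₀) (cobounded ℂ) (𝓝 1) := by
    have h1 : Tendsto (fun z : ℂ => (z⁻¹) ^ 2) (cobounded ℂ) (𝓝 (0 ^ 2)) :=
      tendsto_inv₀_cobounded.pow 2
    have h2 := (h1.const_mul ((q₀ : ℂ) ^ 2)).const_add 1
    have e : gammaF q₀ = fun z => 1 + (q₀ : ℂ) ^ 2 * (z⁻¹) ^ 2 := by
      funext z
      rw [gammaF, div_eq_mul_inv, inv_pow]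
    rw [e]
    simpa using h2
  have ha1 := (continuous_fst.tendsto _).comp h.lim_a
  have ha2 := (continuous_snd.tendsto _).comp h.lim_a
  have hp1 := (continuous_fst.tendsto _).comp h.lim_p
  have hp2 := (continuous_snd.tendsto _).comp h.lim_p
  have := ((hp1.mul ha2).sub (hp2.mul ha1)).div (hγ.mono_left inf_le_left) one_ne_zero
  simp only [Function.comp_apply, one_mul, zero_mul, sub_zero, div_one] at this
  exact this

theorem scat_inv (hq : 0 < q₀) (hr : r ^ 2 = q₀ ^ 2) {z : ℂ} (hz : z ∈ closedPlus q₀)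
    (hz2 : z ^ 2 ≠ -(q₀ : ℂ) ^ 2) :
    scat q₀ a p ((q₀ : ℂ) ^ 2 / z) = r * r' / (q₀ : ℂ) ^ 2 * scat q₀ a p z := by
  have hqC : (q₀ : ℂ) ≠ 0 := by exact_mod_cast hq.ne'
  have hrC : (r : ℂ) ^ 2 = (q₀ : ℂ) ^ 2 := by exact_mod_cast hr
  have hrC' : (r' : ℂ) ^ 2 = (q₀ : ℂ) ^ 2 := by exact_mod_cast h.sq'
  have hz0 := hz.1
  have hγ := gammaF_ne_zero_of_sq hz0 hz2
  have hγ' : gammaF q₀ ((q₀ : ℂ) ^ 2 / z) = z ^ 2 / (q₀ : ℂ) ^ 2 * gammaF q₀ z := by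
    unfold gammaF
    field_simp
    ring
  unfold scat
  rw [hγ', h.inv_a z hz, h.inv_p z hz]
  simp only
  set A := a ((q₀ : ℂ) ^ 2 / z)
  set P := p ((q₀ : ℂ) ^ 2 / z)
  field_simp
  ring_nf
  rw [hrC, hrC', I_sq]
  ring

/-- The first entry of the second column of the solution of the Riemann–Hilbert problem. -/
def glue (q₀ r : ℝ) (a p : ℂ → ℂ × ℂ) (z : ℂ) : ℂ :=
  open Classical in if 0 ≤ (lam q₀ z).im then (a z).1
    else I * r / z * (p (hat q₀ z)).1 / scat q₀ a p (hat q₀ z)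

omit h in
theorem glue_of_plus {z : ℂ} (hz : z ∈ closedPlus q₀) : glue q₀ r a p z = (a z).1 := if_pos hz.2

/-- On `Σ⁰` both branches of the definition are available, and they agree by the jump relation; this
is the only place where vanishing reflection enters the gluing away from `±iq₀`. -/
theorem glue_of_minus (hq : 0 < q₀) {z : ℂ} (hz : z ∈ closedMinus q₀)
    (hz2 : z ^ 2 ≠ -(q₀ : ℂ) ^ 2) :
    glue q₀ r a p z = I * r / z * (p (hat q₀ z)).1 / scat q₀ a p (hat q₀ z) := by
  by_cases h0 : 0 ≤ (lam q₀ z).im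
  · have hs : z ∈ contSpec q₀ := mem_contSpec_of_mem_of_mem hq ⟨hz.1, h0⟩ hz
    have hs0 : z ∈ contSpec₀ q₀ := mem_contSpec₀_iff.mpr ⟨hs, hz2⟩
    have h1 := congrArg Prod.fst (h.jump z hs0)
    simp only [Prod.smul_fst, smul_eq_mul] at h1
    rw [glue_of_plus ⟨hz.1, h0⟩, eq_div_iff (h.ne_s _ (hat_mem_contSpec₀ hq hs0)), mul_comm]
    exact h1
  · simp [glue, h0]

include hS

theorem scat_ne {z : ℂ} (hz : z ∈ closedPlus q₀) (hz2 : z ^ 2 ≠ -(q₀ : ℂ) ^ 2)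
    (hη : ∀ k, z ≠ η k) : scat q₀ a p z ≠ 0 := by
  rcases hz.2.lt_or_eq with h1 | h1
  · intro h0
    have : z ∈ {z | z ∈ DPlus q₀ ∧ scat q₀ a p z = 0} := ⟨⟨hz.1, h1⟩, h0⟩
    rw [h.zeros] at this
    obtain ⟨k, hk⟩ := this
    exact hη k hk.symm
  · exact h.ne_s z (mem_contSpec₀_iff.mpr ⟨(mem_contSpec_iff hS.pos).mpr ⟨hz.1, h1.symm⟩, hz2⟩)

omit h in
theorem hat_ne_eta {z : ℂ} (hz : z ≠ 0) (hη : ∀ k, z ≠ hat q₀ (η k)) (k : ι) : hat q₀ z ≠ η k :=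
  fun h' => hη k (by rw [← h', hat_hat hS.pos hz])

theorem differentiableAt_glue_of_im {z : ℂ} (hz : (lam q₀ z).im ≠ 0) (hz0 : z ≠ 0)
    (hη : ∀ k, z ≠ hat q₀ (η k)) : DifferentiableAt ℂ (glue q₀ r a p) z := by
  have hq := hS.pos
  rcases lt_or_gt_of_ne hz with hlt | hgt
  · have hzD : z ∈ DMinus q₀ := ⟨hz0, hlt⟩
    have hD := hat_mem_DPlus hq hzD
    have hγ := gammaF_ne_zero_of_im hq hD.1 hD.2.ne'
    have hn := (isOpen_DPlus q₀).mem_nhds hD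
    have hh := differentiableAt_hat (q₀ := q₀) hz0
    have d1 : DifferentiableAt ℂ (fun w => p (hat q₀ w)) z :=
      ((h.diff_p _ hD).differentiableAt hn).comp z hh
    have d2 : DifferentiableAt ℂ (fun w => a (hat q₀ w)) z :=
      ((h.diff_a _ hD).differentiableAt hn).comp z hh
    have d3 : DifferentiableAt ℂ (fun w => gammaF q₀ (hat q₀ w)) z := by
      have : DifferentiableAt ℂ (gammaF q₀) (hat q₀ z) := by
        unfold gammaF
        have := pow_ne_zero 2 hD.1
        fun_prop (disch := assumption)
      exact this.comp z hh
    have hs := h.scat_ne hS (DPlus_subset_closedPlus q₀ hD)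
      (fun h' => hD.2.ne' ((mem_contSpec_iff hq).mp (branch_mem hq h')).2) (hat_ne_eta hS hz0 hη)
    have d4 : DifferentiableAt ℂ (fun w => scat q₀ a p (hat q₀ w)) z :=
      ((d1.fst.mul d2.snd).sub (d1.snd.mul d2.fst)).div d3 hγ
    have d5 : DifferentiableAt ℂ (fun w : ℂ => I * r / w) z := by fun_prop (disch := assumption)
    refine ((d5.mul d1.fst).div d4 hs).congr_of_eventuallyEq ?_
    filter_upwards [(isOpen_DMinus q₀).mem_nhds hzD] with w hw
    simp [glue, not_le.mpr hw.2]
  · have hzD : z ∈ DPlus q₀ := ⟨hz0, hgt⟩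
    refine (h.differentiableAt_fst_a hzD).congr_of_eventuallyEq ?_
    filter_upwards [(isOpen_DPlus q₀).mem_nhds hzD] with w hw
      using glue_of_plus (DPlus_subset_closedPlus q₀ hw)

theorem continuousAt_glue {z : ℂ} (hz : z ≠ 0) (hz2 : z ^ 2 ≠ -(q₀ : ℂ) ^ 2)
    (hη : ∀ k, z ≠ hat q₀ (η k)) : ContinuousAt (glue q₀ r a p) z := by
  have hq := hS.pos
  by_cases h0 : (lam q₀ z).im = 0
  · have hs : z ∈ contSpec q₀ := (mem_contSpec_iff hq).mpr ⟨hz, h0⟩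
    have hp := mem_closedPlus_of_mem_contSpec hq hs
    have hm := mem_closedMinus_of_mem_contSpec hq hs
    have hhp := hat_mem_closedPlus hq hm
    have hh2 := hat_sq_ne hq hz hz2
    have c1 : ContinuousWithinAt (fun w => scat q₀ a p (hat q₀ w)) (closedMinus q₀) z :=
      (h.continuousWithinAt_scat hhp hh2).tendsto.comp (tendsto_hat hq hm)
    have c2 := (h.cont_p.comp_hat hq hm).fst
    have c3 : ContinuousAt (fun w : ℂ => I * r / w) z := by fun_prop (disch := assumption)
    refine continuousAt_of_sides hq hs (h.cont_a z hp).fst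
      ((c3.continuousWithinAt.mul c2).div c1 (h.scat_ne hS hhp hh2 (hat_ne_eta hS hz hη)))
      (by filter_upwards [self_mem_nhdsWithin] with w hw using glue_of_plus hw) ?_
    have e : ∀ᶠ w in 𝓝[closedMinus q₀] z, w ^ 2 ≠ -(q₀ : ℂ) ^ 2 := nhdsWithin_le_nhds
      ((by fun_prop : Continuous fun z : ℂ => z ^ 2).continuousAt.eventually_ne hz2)
    filter_upwards [self_mem_nhdsWithin, e] with w hw hw2 using h.glue_of_minus hq hw hw2
  · exact (h.differentiableAt_glue_of_im hS h0 hz hη).continuousAt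

omit h hS in
theorem eventually_ne_hat [Finite ι] {z : ℂ} (hη : ∀ k, z ≠ hat q₀ (η k)) :
    ∀ᶠ w in 𝓝 z, ∀ k, w ≠ hat q₀ (η k) :=
  eventually_all.mpr fun k => isOpen_ne.mem_nhds (hη k)

/-- Continuity across `Σ` and holomorphy off it are upgraded by Morera's theorem in the coordinate
`λ`; this excludes `±q₀`, the critical points of `λ`. -/
theorem differentiableAt_glue [Finite ι] {z : ℂ} (hz : z ≠ 0) (hz1 : z ^ 2 ≠ (q₀ : ℂ) ^ 2)
    (hz2 : z ^ 2 ≠ -(q₀ : ℂ) ^ 2) (hη : ∀ k, z ≠ hat q₀ (η k)) :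
    DifferentiableAt ℂ (glue q₀ r a p) z := by
  have e : ∀ᶠ w in 𝓝 z, w ^ 2 ≠ -(q₀ : ℂ) ^ 2 :=
    (by fun_prop : Continuous fun z : ℂ => z ^ 2).continuousAt.eventually_ne hz2
  refine differentiableAt_of_continuousAt_off_contSpec hz hz1 ?_ ?_
  · filter_upwards [e, isOpen_ne.mem_nhds hz, eventually_ne_hat hη] with w h1 h2 h3
      using h.continuousAt_glue hS h2 h1 h3
  · filter_upwards [isOpen_ne.mem_nhds hz, eventually_ne_hat hη] with w h2 h3 h4
      using h.differentiableAt_glue_of_im hS h4 h2 h3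

end RHData

/-! ### Isolated singularities of the glued function. -/

namespace RHData

variable {ι : Type*} {q₀ r r' : ℝ} {η κ : ι → ℂ} {σ τ : ι → ι} {a p : ℂ → ℂ × ℂ}
  (hS : PoleSys q₀ r η σ τ) (h : RHData q₀ r r' η κ a p)

include h hS

/-- The jump relation gives parallelity on `Σ⁰`; at `±iq₀` it persists by continuity of the columns
themselves, which do not contain the division by `γ_f`. -/
theorem parallel {z : ℂ} (hz : z ∈ contSpec q₀) :
    (p (hat q₀ z)).1 * (a z).2 = (p (hat q₀ z)).2 * (a z).1 := by
  have hq := hS.pos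
  have key : ∀ w ∈ contSpec₀ q₀, (p (hat q₀ w)).1 * (a w).2 = (p (hat q₀ w)).2 * (a w).1 := by
    intro w hw
    have hj := h.jump w hw
    have h1 := congrArg Prod.fst hj
    have h2 := congrArg Prod.snd hj
    simp only [Prod.smul_fst, Prod.smul_snd, smul_eq_mul] at h1 h2
    have h3 : I * r / w ≠ 0 := div_ne_zero (mul_ne_zero I_ne_zero hS.r_ne) hw.1.1
    apply mul_left_cancel₀ h3
    linear_combination (a w).1 * h2 - (a w).2 * h1
  by_cases hz2 : z ^ 2 = -(q₀ : ℂ) ^ 2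
  · have hp := mem_closedPlus_of_mem_contSpec hq hz
    have hm := mem_closedMinus_of_mem_contSpec hq hz
    have hsub : contSpec₀ q₀ ⊆ closedPlus q₀ := fun w hw => mem_closedPlus_of_mem_contSpec hq hw.1
    have hsub' : contSpec₀ q₀ ⊆ closedMinus q₀ := fun w hw => mem_closedMinus_of_mem_contSpec hq hw.1
    have ca := (h.cont_a z hp).mono hsub
    have cp := (h.cont_p.comp_hat hq hm).mono hsub'
    have : (𝓝[contSpec₀ q₀] z).NeBot :=
      mem_closure_iff_nhdsWithin_neBot.mp (mem_closure_iff_frequently.mpr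
        ((frequently_mem_contSpec₀ hq hz2).filter_mono nhdsWithin_le_nhds))
    refine tendsto_nhds_unique (cp.fst.mul ca.snd) ((cp.snd.mul ca.fst).congr' ?_)
    filter_upwards [self_mem_nhdsWithin] with w hw using (key w hw).symm
  · exact key z (mem_contSpec₀_iff.mpr ⟨hz, hz2⟩)

/-- At `±iq₀` the two columns are non-zero and parallel, so some component is non-zero in both. If
only the second one is, the roles of the components are exchanged, which changes the sign of the
Wronskian. -/
theorem exists_wronskian_factor {z₀ : ℂ} (hz : z₀ ^ 2 = -(q₀ : ℂ) ^ 2) :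
    ∃ E g : ℂ → ℂ, AnalyticAt ℂ E z₀ ∧ ContinuousWithinAt g (closedMinus q₀) z₀ ∧ g z₀ ≠ 0 ∧
      ∀ᶠ z in 𝓝[closedMinus q₀] z₀, (p (hat q₀ z)).1 * (a (hat q₀ z)).2 -
        (p (hat q₀ z)).2 * (a (hat q₀ z)).1 = g z * E z := by
  have hq := hS.pos
  have hmem := branch_mem hq hz
  have hplus := mem_closedPlus_of_mem_contSpec hq hmem
  have hpar := h.parallel hS hmem
  rw [hat_branch hq hz] at hpar
  have na := h.ne_a z₀ hplus
  have np := h.ne_p z₀ hplus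
  have h1 : (a z₀).1 ≠ 0 ∧ (p z₀).1 ≠ 0 ∨ (a z₀).2 ≠ 0 ∧ (p z₀).2 ≠ 0 := by
    by_contra! hc
    by_cases ha : (a z₀).1 = 0
    · have ha2 : (a z₀).2 ≠ 0 := fun h2 => na (Prod.ext ha h2)
      have hp2 := hc.2 ha2
      have hp1 : (p z₀).1 = 0 := by
        rw [hp2, zero_mul] at hpar
        exact (mul_eq_zero.mp hpar).resolve_right ha2
      exact np (Prod.ext hp1 hp2)
    · have hp1 := hc.1 ha
      have hp2 : (p z₀).2 = 0 := by
        rw [hp1, zero_mul] at hpar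
        exact (mul_eq_zero.mp hpar.symm).resolve_right ha
      exact np (Prod.ext hp1 hp2)
  rcases h1 with ⟨ha, hp⟩ | ⟨ha, hp⟩
  · exact wronskian_factor hq hz (a₁ := fun z => (a z).1) (a₂ := fun z => (a z).2)
      (p₁ := fun z => (p z).1) (p₂ := fun z => (p z).2) h.cont_a.fst h.cont_a.snd h.cont_p.fst
      h.cont_p.snd h.diff_a.fst h.diff_a.snd h.diff_p.fst h.diff_p.snd
      (fun z hz => h.parallel hS hz) ha hp
  · obtain ⟨E, g, hE, hg, hg0, he⟩ := wronskian_factor hq hz (a₁ := fun z => (a z).2)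
      (a₂ := fun z => (a z).1)
      (p₁ := fun z => (p z).2) (p₂ := fun z => (p z).1) h.cont_a.snd h.cont_a.fst h.cont_p.snd
      h.cont_p.fst h.diff_a.snd h.diff_a.fst h.diff_p.snd h.diff_p.fst
      (fun z hz => (h.parallel hS hz).symm) ha hp
    refine ⟨E, fun z => -g z, hE, hg.neg, neg_ne_zero.mpr hg0, ?_⟩
    filter_upwards [he] with z hz
    linear_combination -hz

/-- The glued function has removable singularities at `±i q₀`. -/
theorem tendsto_glue_branch [Finite ι] {z₀ : ℂ} (hz : z₀ ^ 2 = -(q₀ : ℂ) ^ 2) :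
    Tendsto (fun z => (z - z₀) * glue q₀ r a p z) (𝓝[≠] z₀) (𝓝 0) := by
  have hq := hS.pos
  have hqC : (q₀ : ℂ) ≠ 0 := by exact_mod_cast hq.ne'
  have h0 := branch_ne_zero hq hz
  have hmem := branch_mem hq hz
  have hplus := mem_closedPlus_of_mem_contSpec hq hmem
  have hminus := mem_closedMinus_of_mem_contSpec hq hmem
  obtain ⟨E, g, hE, hg, hg0, hW⟩ := h.exists_wronskian_factor hS hz
  set F := glue q₀ r a p with hF
  have him := ((mem_contSpec_iff hq).mp hmem).2
  have hη : ∀ k, z₀ ≠ hat q₀ (η k) := fun k hk => (hS.hat_mem k).2.ne (hk ▸ him)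
  have e1 : ∀ᶠ w in 𝓝 z₀, w ^ 2 ≠ (q₀ : ℂ) ^ 2 := by
    refine (by fun_prop : Continuous fun z : ℂ => z ^ 2).continuousAt.eventually_ne ?_
    rw [hz]
    intro h'
    exact pow_ne_zero 2 hqC (by linear_combination -h' / 2)
  have e2 : ∀ᶠ w in 𝓝 z₀, w ≠ z₀ → w ^ 2 ≠ -(q₀ : ℂ) ^ 2 := by
    have : z₀ ≠ -z₀ := fun h' => h0 (by linear_combination h' / 2)
    filter_upwards [isOpen_ne.mem_nhds this] with w hw hw2 h'
    rw [← hz] at h'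
    rcases sq_eq_sq_iff_eq_or_eq_neg.mp h' with h' | h'
    · exact hw2 h'
    · exact hw h'
  -- nonvanishing of the Wronskian near the branch point
  have e3 : ∀ᶠ w in 𝓝[closedMinus q₀] z₀, w ≠ z₀ → scat q₀ a p (hat q₀ w) ≠ 0 := by
    filter_upwards [self_mem_nhdsWithin, nhdsWithin_le_nhds e2,
      nhdsWithin_le_nhds (eventually_ne_hat hη)] with w h1 h2 h3 h4
    exact h.scat_ne hS (hat_mem_closedPlus hq h1) (hat_sq_ne hq h1.1 (h2 h4))
      (hat_ne_eta hS h1.1 h3)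
  have e4 : ∀ᶠ w in 𝓝[closedMinus q₀] z₀, w ≠ z₀ → E w ≠ 0 := by
    filter_upwards [e3, hW] with w h1 h2 h3 h4
    apply h1 h3
    rw [scat, h2, h4, mul_zero, zero_div]
  -- If the analytic function `E` vanished near `z₀`, so would the Wronskian at points of `D₋` close
  -- to `z₀`, where it is known to be non-zero.
  have hE0 : ∀ᶠ w in 𝓝[≠] z₀, E w ≠ 0 := by
    refine hE.eventually_eq_zero_or_eventually_ne_zero.resolve_left fun hc => ?_
    obtain ⟨w, hw, h1, h2⟩ := ((frequently_mem_DMinus hq hz).and_eventually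
      (hc.and (eventually_nhdsWithin_iff.mp e4))).exists
    refine h2 (DMinus_subset_closedMinus q₀ hw) (fun h' => hw.2.ne (h' ▸ him)) h1
  -- `K = (z - z₀) F E` is analytic
  set K : ℂ → ℂ := fun z => (z - z₀) * F z * E z with hK
  have hKc : ContinuousAt K z₀ := by
    have cγ : ContinuousAt (fun w => gammaF q₀ (hat q₀ w)) z₀ := by
      refine ContinuousAt.comp (g := gammaF q₀) ?_ (differentiableAt_hat h0).continuousAt
      have := pow_ne_zero 2 (hat_ne_zero hq h0)
      unfold gammaF
      fun_prop (disch := assumption)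
    have c3 : ContinuousAt (fun w : ℂ => I * r / w) z₀ := by fun_prop (disch := assumption)
    have c4 : ContinuousAt (fun w : ℂ => w - z₀) z₀ := by fun_prop
    -- On the `D₋` side the division by the Wronskian `g E` is undone by `E` up to the non-vanishing
    -- `g`. The factor `z - z₀` settles the point `z₀` itself, where the formula for the glued
    -- function is not available.
    refine continuousAt_of_sides hq hmem
      (f := fun z => (z - z₀) * (a z).1 * E z)
      (g := fun z => (z - z₀) * (I * r / z * (p (hat q₀ z)).1 * gammaF q₀ (hat q₀ z) / g z))
      ((c4.continuousWithinAt.mul (h.cont_a z₀ hplus).fst).mul hE.continuousAt.continuousWithinAt)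
      (c4.continuousWithinAt.mul (((c3.continuousWithinAt.mul (h.cont_p.comp_hat hq hminus).fst).mul
        cγ.continuousWithinAt).div hg hg0)) ?_ ?_
    · filter_upwards [self_mem_nhdsWithin] with w hw
      simp only [hK, hF]
      rw [glue_of_plus hw]
    · filter_upwards [self_mem_nhdsWithin, nhdsWithin_le_nhds e2, e3, e4, hW,
        hg.eventually_ne hg0] with w h1 h2 h3 h4 h5 h6
      by_cases hw : w = z₀
      · simp [hK, hw]
      · have h7 := h3 hw
        have h8 := h4 hw
        simp only [hK, hF]
        rw [h.glue_of_minus hq h1 (h2 hw)]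
        have h9 := gammaF_ne_zero_of_sq (hat_ne_zero hq h1.1) (hat_sq_ne hq h1.1 (h2 hw))
        rw [scat, h5]
        have := h1.1
        field_simp
  have hdF : ∀ᶠ w in 𝓝[≠] z₀, DifferentiableAt ℂ F w := by
    filter_upwards [self_mem_nhdsWithin, nhdsWithin_le_nhds e1, nhdsWithin_le_nhds e2,
      nhdsWithin_le_nhds (eventually_ne_hat hη), nhdsWithin_le_nhds (isOpen_ne.mem_nhds h0)] with
      w h1 h2 h3 h4 h5 using h.differentiableAt_glue hS h5 h2 (h3 h1) h4
  have hKan : AnalyticAt ℂ K z₀ := by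
    refine analyticAt_of_differentiable_on_punctured_nhds_of_continuousAt ?_ hKc
    filter_upwards [hdF, nhdsWithin_le_nhds hE.eventually_analyticAt] with w h1 h2
    exact ((by fun_prop : DifferentiableAt ℂ (fun w => w - z₀) w).mul h1).mul h2.differentiableAt
  have hFm : MeromorphicAt F z₀ := by
    have hid : AnalyticAt ℂ (fun z => z - z₀) z₀ := analyticAt_id.sub analyticAt_const
    refine (hKan.meromorphicAt.div (hid.mul hE).meromorphicAt).congr ?_
    filter_upwards [self_mem_nhdsWithin, hE0] with w h1 h2
    have : w - z₀ ≠ 0 := sub_ne_zero.mpr h1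
    simp only [hK, Pi.div_apply, Pi.mul_apply]
    field_simp
  -- `F` is bounded on the `D₊` side
  have hord : 0 ≤ meromorphicOrderAt F z₀ := by
    by_contra! hneg
    have h1 := tendsto_norm_cobounded_atTop.comp (tendsto_cobounded_of_meromorphicOrderAt_neg hneg)
    have h2 : ∀ᶠ w in 𝓝[closedPlus q₀] z₀, ‖(a w).1‖ < ‖(a z₀).1‖ + 1 :=
      (h.cont_a z₀ hplus).fst.norm.eventually_lt continuousWithinAt_const (lt_add_one _)
    -- On `Σ⁰` the glued function is the first entry of `a`, which is bounded near `z₀`; a pole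
    -- would make it unbounded along every approach.
    obtain ⟨w, hw, h3, h4⟩ := ((frequently_mem_contSpec₀ hq hz).and_eventually
      ((h1.eventually_ge_atTop (‖(a z₀).1‖ + 1)).and
        (nhdsWithin_le_nhds (eventually_nhdsWithin_iff.mp h2)))).exists
    have hwp := mem_closedPlus_of_mem_contSpec hq hw.1
    have h5 := h4 hwp
    simp only [Function.comp_apply, hF] at h3
    rw [glue_of_plus hwp] at h3
    linarith
  obtain ⟨c, hc⟩ := tendsto_nhds_of_meromorphicOrderAt_nonneg hFm hord
  have hid : Tendsto (fun z => z - z₀) (𝓝[≠] z₀) (𝓝 0) :=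
    tendsto_nhdsWithin_of_tendsto_nhds (by
      simpa using (by fun_prop : Continuous fun z : ℂ => z - z₀).tendsto z₀)
  simpa using hid.mul hc

/-- The residue of the glued function at `η̂`. -/
theorem tendsto_glue_hat (k : ι) :
    Tendsto (fun z => (z - hat q₀ (η k)) * glue q₀ r a p z) (𝓝[≠] (hat q₀ (η k)))
      (𝓝 (κ k * (a (η k)).1)) := by
  have hq := hS.pos
  have hqC := hS.q_ne
  have hη0 := hS.ne_zero k
  have hηD := hS.mem k
  set e := η k with he
  have hD : hat q₀ e ∈ DMinus q₀ := hS.hat_mem k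
  have hs0 : scat q₀ a p e = 0 := by
    have : e ∈ {z | z ∈ DPlus q₀ ∧ scat q₀ a p z = 0} := by
      rw [h.zeros]; exact ⟨k, rfl⟩
    exact this.2
  have hds : HasDerivAt (scat q₀ a p) (deriv (scat q₀ a p) e) e := by
    exact (differentiableAt_of_deriv_ne_zero (h.deriv_ne k)).hasDerivAt
  set s' := deriv (scat q₀ a p) e with hs'
  have hs'0 : s' ≠ 0 := h.deriv_ne k
  have hhd : HasDerivAt (hat q₀) ((q₀ : ℂ) ^ 2 / hat q₀ e ^ 2) (hat q₀ e) := by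
    have := ((hasDerivAt_inv hD.1).const_mul ((q₀ : ℂ) ^ 2)).fun_neg
    refine (this.congr_deriv ?_)
    field_simp
  have hcomp : HasDerivAt (fun z => scat q₀ a p (hat q₀ z))
      (s' * ((q₀ : ℂ) ^ 2 / hat q₀ e ^ 2)) (hat q₀ e) := by
    refine HasDerivAt.comp (h₂ := scat q₀ a p) _ ?_ hhd
    rwa [hat_hat hq hη0]
  -- The zero of the denominator is simple, so `z - η̂_k` divided by it converges to the inverse of
  -- its derivative.
  have hsl := hcomp.tendsto_slope
  have hL : s' * ((q₀ : ℂ) ^ 2 / hat q₀ e ^ 2) ≠ 0 :=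
    mul_ne_zero hs'0 (div_ne_zero (pow_ne_zero 2 hqC) (pow_ne_zero 2 hD.1))
  have hp : Tendsto (fun z => I * r / z * (p (hat q₀ z)).1) (𝓝[≠] (hat q₀ e))
      (𝓝 (I * r / hat q₀ e * (p e).1)) := by
    refine tendsto_nhdsWithin_of_tendsto_nhds ?_
    have h1 : ContinuousAt (fun z : ℂ => I * r / z) (hat q₀ e) := by
      have := hD.1
      fun_prop (disch := assumption)
    have h2 : ContinuousAt (fun z => (p (hat q₀ z)).1) (hat q₀ e) := by
      refine ContinuousAt.comp (g := fun w => (p w).1) ?_ hhd.continuousAt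
      rw [hat_hat hq hη0]
      exact (h.differentiableAt_fst_p hηD).continuousAt
    have := (h1.mul h2).tendsto
    simp only [Pi.mul_apply, hat_hat hq hη0] at this
    exact this
  have hres := h.res k
  rw [← he, ← hs'] at hres
  have e1 : I * r / hat q₀ e * (p e).1 / (s' * ((q₀ : ℂ) ^ 2 / hat q₀ e ^ 2)) =
      κ k * (a e).1 := by
    rw [← hres]
    unfold hat
    field_simp
  rw [← e1]
  refine (hp.div hsl hL).congr' ?_
  filter_upwards [self_mem_nhdsWithin,
    nhdsWithin_le_nhds ((isOpen_DMinus q₀).mem_nhds hD)] with w hw hwD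
  have hw' : w - hat q₀ e ≠ 0 := sub_ne_zero.mpr hw
  simp only [Pi.div_apply, slope_def_field, hat_hat hq hη0, hs0, sub_zero]
  rw [glue, if_neg (not_le.mpr hwD.2)]
  field_simp

omit h hS in
theorem tendsto_of_sides {E : Type*} {f : ℂ → E} {l : Filter ℂ} {l' : Filter E}
    (h0 : ∀ᶠ z in l, z ≠ 0) (h1 : Tendsto f (l ⊓ 𝓟 (closedPlus q₀)) l')
    (h2 : Tendsto f (l ⊓ 𝓟 (DMinus q₀)) l') : Tendsto f l l' := by
  refine (h1.sup h2).mono_left ?_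
  rw [← inf_sup_left, sup_principal, le_inf_iff]
  refine ⟨le_rfl, ?_⟩
  rw [le_principal_iff]
  filter_upwards [h0] with z hz
  rcases le_or_gt 0 (lam q₀ z).im with h | h
  · exact Or.inl ⟨hz, h⟩
  · exact Or.inr ⟨hz, h⟩

omit h hS in
theorem tendsto_sq_div (hq : 0 < q₀) :
    Tendsto (fun z : ℂ => (q₀ : ℂ) ^ 2 / z) (𝓝[≠] 0) (cobounded ℂ) := by
  have hqC : (q₀ : ℂ) ≠ 0 := by exact_mod_cast hq.ne'
  have h1 : Tendsto (fun z : ℂ => z / (q₀ : ℂ) ^ 2) (𝓝[≠] 0) (𝓝[≠] 0) := by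
    rw [tendsto_nhdsWithin_iff]
    constructor
    · refine tendsto_nhdsWithin_of_tendsto_nhds ?_
      simpa using (by fun_prop : Continuous fun z : ℂ => z / (q₀ : ℂ) ^ 2).tendsto 0
    · filter_upwards [self_mem_nhdsWithin] with z hz
        using div_ne_zero hz (pow_ne_zero 2 hqC)
  refine (tendsto_inv₀_nhdsNE_zero.comp h1).congr fun z => ?_
  simp

/-- Near `0` the columns are reached from infinity: by the symmetry `z ↦ q₀²/z` on `D₊`, and through
`ẑ → ∞` on `D₋`, where `p₁` and the scattering coefficient both tend to `1`. -/
theorem tendsto_mul_glue_zero :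
    Tendsto (fun z => z * glue q₀ r a p z) (𝓝[≠] 0) (𝓝 (I * r)) := by
  have hq := hS.pos
  refine tendsto_of_sides (q₀ := q₀) self_mem_nhdsWithin ?_ ?_
  · have ht : Tendsto (fun z : ℂ => (q₀ : ℂ) ^ 2 / z) (𝓝[≠] 0 ⊓ 𝓟 (closedPlus q₀))
        (cobounded ℂ ⊓ 𝓟 (closedPlus q₀)) := by
      refine tendsto_inf.mpr ⟨(tendsto_sq_div hq).mono_left inf_le_left, ?_⟩
      rw [tendsto_principal]
      filter_upwards [mem_inf_of_right (mem_principal_self _)] with z hz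
      exact ⟨div_ne_zero (pow_ne_zero 2 hS.q_ne) hz.1, by rw [lam_sq_div hq.ne' hz.1]; exact hz.2⟩
    have := ((continuous_snd.tendsto _).comp (h.lim_a.comp ht)).const_mul (I * r)
    simp only [mul_one, Function.comp_apply] at this
    refine this.congr' ?_
    filter_upwards [mem_inf_of_right (mem_principal_self _)] with z hz
    have := hz.1
    rw [glue_of_plus hz, h.inv_a z hz]
    field_simp
  · have ht : Tendsto (hat q₀) (𝓝[≠] 0 ⊓ 𝓟 (DMinus q₀)) (cobounded ℂ ⊓ 𝓟 (closedPlus q₀)) := by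
      refine tendsto_inf.mpr ⟨?_, ?_⟩
      · exact (tendsto_neg_cobounded.comp (tendsto_sq_div hq)).mono_left inf_le_left
      · rw [tendsto_principal]
        filter_upwards [mem_inf_of_right (mem_principal_self _)] with z hz
        exact hat_mem_closedPlus hq (DMinus_subset_closedMinus q₀ hz)
    have := (((continuous_fst.tendsto _).comp (h.lim_p.comp ht)).const_mul (I * r)).div
      (h.tendsto_scat.comp ht) one_ne_zero
    simp only [mul_one, div_one] at this
    refine this.congr' ?_
    filter_upwards [mem_inf_of_right (mem_principal_self _)] with z hz
    have := hz.1
    simp only [glue, not_le.mpr hz.2, if_false, Pi.div_apply, Function.comp_apply]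
    field_simp

/-- On `D₋` the argument `ẑ` tends to `0`, where no limit is given. The symmetry of `p` moves it to
`q₀²/ẑ = -z`, which tends to infinity in `D₊`, and the second entry of `p` tends to `0` there. -/
theorem tendsto_glue_cobounded : Tendsto (glue q₀ r a p) (cobounded ℂ) (𝓝 0) := by
  have hq := hS.pos
  refine tendsto_of_sides (q₀ := q₀) (eventually_cobounded_ne 0) ?_ ?_
  · refine ((continuous_fst.tendsto _).comp h.lim_a).congr' ?_
    filter_upwards [mem_inf_of_right (mem_principal_self _)] with z hz
      using (glue_of_plus hz).symm
  · have ht : Tendsto (fun z : ℂ => -z) (cobounded ℂ ⊓ 𝓟 (DMinus q₀))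
        (cobounded ℂ ⊓ 𝓟 (closedPlus q₀)) := by
      refine tendsto_inf.mpr ⟨tendsto_neg_cobounded.mono_left inf_le_left, ?_⟩
      rw [tendsto_principal]
      filter_upwards [mem_inf_of_right (mem_principal_self _)] with z hz
      exact ⟨neg_ne_zero.mpr hz.1, by rw [lam_neg, neg_im]; linarith [hz.2]⟩
    have := (((continuous_snd.tendsto _).comp (h.lim_p.comp ht)).neg).div
      (h.tendsto_scat.comp ht) one_ne_zero
    simp only [neg_zero, div_one] at this
    refine this.congr' ?_
    filter_upwards [mem_inf_of_right (mem_principal_self _)] with z hz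
    have hz0 := hz.1
    have hqC := hS.q_ne
    have hr := hS.r_ne
    have hr' : (r' : ℂ) ≠ 0 := by
      have : r' ≠ 0 := fun h0 => by
        have := h.sq'
        rw [h0] at this
        have : 0 < q₀ ^ 2 := by positivity
        linarith
      exact_mod_cast this
    have hmD : -z ∈ DPlus q₀ := ⟨neg_ne_zero.mpr hz0, by rw [lam_neg, neg_im]; linarith [hz.2]⟩
    have hmp := DPlus_subset_closedPlus q₀ hmD
    have hz2 : (-z) ^ 2 ≠ -(q₀ : ℂ) ^ 2 :=
      fun h' => hmD.2.ne' ((mem_contSpec_iff hq).mp (branch_mem hq h')).2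
    have e1 := h.scat_inv hq hS.sq hmp hz2
    rw [div_neg] at e1
    have e2 := congrArg Prod.fst (h.inv_p _ (hat_mem_closedPlus hq (DMinus_subset_closedMinus q₀ hz)))
    have e3 : (q₀ : ℂ) ^ 2 / hat q₀ z = -z := by
      unfold hat; field_simp
    simp only at e2
    rw [e3] at e2
    simp only [glue, not_le.mpr hz.2, if_false, Pi.div_apply, Function.comp_apply]
    rw [e2, hat, e1]
    by_cases hs : scat q₀ a p (-z) = 0
    · simp [hs]
    · field_simp
      rw [I_sq]
      ring

omit h hS in
theorem tendsto_sub_mul_of_continuousAt {f : ℂ → ℂ} {s : ℂ} (hf : ContinuousAt f s) :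
    Tendsto (fun z => (z - s) * f z) (𝓝[≠] s) (𝓝 0) := by
  refine tendsto_nhdsWithin_of_tendsto_nhds ?_
  have h1 : Tendsto (fun z => z - s) (𝓝 s) (𝓝 0) := by
    simpa using (by fun_prop : Continuous fun z : ℂ => z - s).tendsto s
  simpa using h1.mul hf.tendsto

/-- The solution of the Riemann–Hilbert problem in partial fractions. -/
theorem fst_eq [Fintype ι] {z : ℂ} (hz : z ∈ DPlus q₀) :
    (a z).1 = I * r / z + pfrac q₀ η (fun k => κ k * (a (η k)).1) z := by
  classical
  have hq := hS.pos
  have hqC := hS.q_ne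
  set c : ι → ℂ := fun k => κ k * (a (η k)).1 with hc
  set G : ℂ → ℂ := fun z => glue q₀ r a p z - I * r / z - pfrac q₀ η c z with hG
  -- The exceptional points are the pole `0`, the critical points `±q₀` of `λ`, the zeros `±iq₀` of
  -- `γ_f`, and the `η̂_k`.
  set S : Finset ℂ := {0, (q₀ : ℂ), -(q₀ : ℂ), I * q₀, -(I * q₀)} ∪
    Finset.univ.image (fun k => hat q₀ (η k)) with hSdef
  have hmem : ∀ w, w ∉ S ↔ w ≠ 0 ∧ w ^ 2 ≠ (q₀ : ℂ) ^ 2 ∧ w ^ 2 ≠ -(q₀ : ℂ) ^ 2 ∧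
      ∀ k, w ≠ hat q₀ (η k) := by
    intro w
    have e1 : w ^ 2 = -(q₀ : ℂ) ^ 2 ↔ w = I * q₀ ∨ w = -(I * q₀) := by
      rw [← sq_eq_sq_iff_eq_or_eq_neg, mul_pow, I_sq, neg_one_mul]
    have e2 : w ^ 2 = (q₀ : ℂ) ^ 2 ↔ w = q₀ ∨ w = -q₀ := sq_eq_sq_iff_eq_or_eq_neg
    rw [Ne, Ne, Ne, e1, e2, hSdef]
    simp only [Finset.mem_union, Finset.mem_insert, Finset.mem_singleton, Finset.mem_image,
      Finset.mem_univ, true_and, not_or, not_exists, ne_comm]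
    tauto
  have cI : ∀ w : ℂ, w ≠ 0 → ContinuousAt (fun w : ℂ => I * r / w) w := fun w hw => by
    fun_prop (disch := assumption)
  have hne : ∀ w : ℂ, (lam q₀ w).im = 0 → ∀ k, w ≠ hat q₀ (η k) := fun w hw k hk =>
    (hS.hat_mem k).2.ne (hk ▸ hw)
  have hlim : ∀ s ∈ S, Tendsto (fun w => (w - s) * G w) (𝓝[≠] s) (𝓝 0) := by
    have split : ∀ s w : ℂ, (w - s) * G w = (w - s) * glue q₀ r a p w - (w - s) * (I * r / w) -
        (w - s) * pfrac q₀ η c w := fun s w => by rw [hG]; ring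
    intro s hs
    simp only [split]
    by_cases h0 : s = 0
    · have hp : ContinuousAt (pfrac q₀ η c) s := PoleSys.continuousAt_pfrac c fun k hk =>
        hS.hat_ne_zero k (by rw [← hk, h0])
      have h1 := h.tendsto_mul_glue_zero hS
      have h2 : Tendsto (fun w => (w - s) * (I * r / w)) (𝓝[≠] s) (𝓝 (I * r)) := by
        refine tendsto_const_nhds.congr' ?_
        filter_upwards [self_mem_nhdsWithin] with w hw
        have : w ≠ 0 := by rw [← h0]; exact hw
        rw [h0]; field_simp; ring
      have h3 := tendsto_sub_mul_of_continuousAt hp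
      subst h0
      simp only [sub_zero] at h2 h3 ⊢
      simpa only [sub_self, sub_zero] using (h1.sub h2).sub h3
    by_cases hh : ∃ k, s = hat q₀ (η k)
    · obtain ⟨k, rfl⟩ := hh
      have h1 := h.tendsto_glue_hat hS k
      have h2 := tendsto_sub_mul_of_continuousAt (cI _ h0)
      have h3 := hS.tendsto_mul_pfrac c k
      simpa [hc] using (h1.sub h2).sub h3
    · push Not at hh
      have h2 := tendsto_sub_mul_of_continuousAt (cI _ h0)
      have h3 := tendsto_sub_mul_of_continuousAt (PoleSys.continuousAt_pfrac c hh)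
      have h1 : Tendsto (fun w => (w - s) * glue q₀ r a p w) (𝓝[≠] s) (𝓝 0) := by
        by_cases hb : s ^ 2 = -(q₀ : ℂ) ^ 2
        · exact h.tendsto_glue_branch hS hb
        · exact tendsto_sub_mul_of_continuousAt (h.continuousAt_glue hS h0 hb hh)
      simpa using (h1.sub h2).sub h3
  have hdiff : DifferentiableOn ℂ G (↑S : Set ℂ)ᶜ := by
    intro w hw
    have hw' := (hmem w).mp (by simpa using hw)
    have d1 := h.differentiableAt_glue hS hw'.1 hw'.2.1 hw'.2.2.1 hw'.2.2.2
    have d2 : DifferentiableAt ℂ (fun w : ℂ => I * r / w) w := by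
      have := hw'.1
      fun_prop (disch := assumption)
    have d3 : DifferentiableWithinAt ℂ (pfrac q₀ η c) (↑S : Set ℂ)ᶜ w :=
      PoleSys.differentiableOn_pfrac q₀ η c
        (fun w hw => ((hmem w).mp (by simpa using hw)).2.2.2) w hw
    exact (d1.sub d2).differentiableWithinAt.sub d3
  have hinf : Tendsto G (cocompact ℂ) (𝓝 0) := by
    rw [← Metric.cobounded_eq_cocompact]
    have h2 : Tendsto (fun w : ℂ => I * r / w) (cobounded ℂ) (𝓝 0) := by
      simpa [div_eq_mul_inv] using tendsto_inv₀_cobounded.const_mul (I * (r : ℂ))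
    have h3 : Tendsto (pfrac q₀ η c) (cobounded ℂ) (𝓝 0) := tendsto_cobounded_sum_div_sub _ _
    simpa using ((h.tendsto_glue_cobounded hS).sub h2).sub h3
  have hzS : z ∉ S := by
    rw [hmem]
    refine ⟨hz.1, fun h2 => ?_, fun h2 => ?_, fun k hk => ?_⟩
    · have hn : ‖z‖ = q₀ := by
        have h1 := congrArg norm h2
        rw [norm_pow, norm_pow, norm_real, Real.norm_eq_abs, abs_of_pos hq,
          pow_left_inj₀ (norm_nonneg _) hq.le two_ne_zero] at h1
        exact h1
      exact hz.2.ne' ((mem_contSpec_iff hq).mp ⟨hz.1, Or.inr hn⟩).2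
    · exact hz.2.ne' ((mem_contSpec_iff hq).mp (branch_mem hq h2)).2
    · have := (hS.hat_mem k).2
      rw [← hk] at this
      exact lt_asymm this hz.2
  have := eq_of_removable_of_tendsto S G 0 hdiff hlim hinf z hzS
  simp only [hG] at this
  rw [glue_of_plus (DPlus_subset_closedPlus q₀ hz)] at this
  linear_combination this

end RHData

/-! ### The analytic columns of the Jost solutions -/

/-- `a = Φ₋₂` and `p = Φ₊₁`, the columns of the Jost solutions that are analytic in `D₊`. -/
structure JostCols (q₀ r r' : ℝ) (q : ℝ → ℝ → ℝ) (a p : ℂ → ℝ → ℝ → Fin 2 → ℂ) : Prop where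
  pos : 0 < q₀
  sq : r ^ 2 = q₀ ^ 2
  sq' : r' ^ 2 = q₀ ^ 2
  smooth : ∀ t, ContDiff ℝ 1 fun x => q x t
  integrable : ∀ t, IntegrableOn (fun x => (1 + |x|) * (q x t - r)) (Set.Iic 0)
  integrable' : ∀ t, IntegrableOn (fun x => (1 + |x|) * (q x t - r')) (Set.Ici 0)
  lax_a : ∀ z ∈ closedPlus q₀, SolvesLax q₀ q z (a z)
  lax_p : ∀ z ∈ closedPlus q₀, SolvesLax q₀ q z (p z)
  lim_a : ∀ z ∈ closedPlus q₀, ∀ t i,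
    Tendsto (fun x => a z x t i * exp (I * theta q₀ x t z)) atBot (𝓝 (bgMat r z i 1))
  lim_p : ∀ z ∈ closedPlus q₀, ∀ t i,
    Tendsto (fun x => p z x t i * exp (-(I * theta q₀ x t z))) atTop (𝓝 (bgMat r' z i 0))

/-- The Wronskian of two solutions of the Lax pair is constant. -/
theorem SolvesLax.wrv_eq {q₀ : ℝ} {q : ℝ → ℝ → ℝ} {z : ℂ} {φ ψ : ℝ → ℝ → Fin 2 → ℂ}
    (h1 : SolvesLax q₀ q z φ) (h2 : SolvesLax q₀ q z ψ) (x t : ℝ) :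
    wrv (φ x t) (ψ x t) = wrv (φ 0 0) (ψ 0 0) := by
  rw [solvesLax_iff] at h1 h2
  have dx : ∀ x t, HasDerivAt (fun x => wrv (φ x t) (ψ x t)) 0 x := fun x t => by
    obtain ⟨⟨a1, a2⟩, -⟩ := h1 x t
    obtain ⟨⟨b1, b2⟩, -⟩ := h2 x t
    refine ((a1.fun_mul b2).fun_sub (a2.fun_mul b1)).congr_deriv ?_
    ring
  have dt : ∀ x t, HasDerivAt (fun t => wrv (φ x t) (ψ x t)) 0 t := fun x t => by
    obtain ⟨-, a1, a2⟩ := h1 x t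
    obtain ⟨-, b1, b2⟩ := h2 x t
    refine ((a1.fun_mul b2).fun_sub (a2.fun_mul b1)).congr_deriv ?_
    ring
  rw [is_const_of_deriv_eq_zero (fun x => (dx x t).differentiableAt) (fun x => (dx x t).deriv) x 0]
  exact is_const_of_deriv_eq_zero (fun t => (dt 0 t).differentiableAt) (fun t => (dt 0 t).deriv) t 0

namespace JostCols

variable {q₀ r r' : ℝ} {q : ℝ → ℝ → ℝ} {a p a' p' : ℂ → ℝ → ℝ → Fin 2 → ℂ}

/-- `Φ₋₂ e^{iθ}`. -/
def left (q₀ : ℝ) (a : ℂ → ℝ → ℝ → Fin 2 → ℂ) (t : ℝ) (z : ℂ) (x : ℝ) : ℂ × ℂ :=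
  (a z x t 0 * exp (I * theta q₀ x t z), a z x t 1 * exp (I * theta q₀ x t z))

/-- `Φ₊₁ e^{-iθ}` after the reflection `x → -x`. -/
def right (q₀ : ℝ) (p : ℂ → ℝ → ℝ → Fin 2 → ℂ) (t : ℝ) (z : ℂ) (x : ℝ) : ℂ × ℂ :=
  (p z (-x) t 1 * exp (-(I * theta q₀ (-x) t z)), p z (-x) t 0 * exp (-(I * theta q₀ (-x) t z)))

theorem jostLeft (h : JostCols q₀ r r' q a p) (t : ℝ) :
    JostLeft q₀ r (fun x => q x t) (left q₀ a t) where
  pos := h.pos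
  sq := h.sq
  smooth := h.smooth t
  integrable := h.integrable t
  deriv1 z hz hi x := by
    have e := ((hasDerivAt_theta_fst q₀ x t z).const_mul I).cexp
    have hl : lam q₀ z = z - kk q₀ z := by rw [lam, kk]; ring
    refine ((solvesLax_iff.mp (h.lax_a z ⟨hz, hi⟩) x t).1.1.mul e).congr_deriv ?_
    rw [hl, left]; ring
  deriv2 z hz hi x := by
    have e := ((hasDerivAt_theta_fst q₀ x t z).const_mul I).cexp
    have hl : lam q₀ z = (q₀ : ℂ) ^ 2 / z + kk q₀ z := by rw [lam, kk]; ring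
    refine ((solvesLax_iff.mp (h.lax_a z ⟨hz, hi⟩) x t).1.2.mul e).congr_deriv ?_
    rw [hl, left]; ring
  lim z hz hi := by
    have h0 := h.lim_a z ⟨hz, hi⟩ t 0
    have h1 := h.lim_a z ⟨hz, hi⟩ t 1
    simp only [bgMat, Matrix.of_apply, Matrix.cons_val_zero, Matrix.cons_val_one] at h0 h1
    exact h0.prodMk_nhds h1

/-- The reflection `x ↦ -x` with exchanged components maps the Lax equation for `q` to that for
`q(-x)` and `+∞` to `-∞`. So the analysis at `-∞` covers both columns. -/
theorem jostRight (h : JostCols q₀ r r' q a p) (t : ℝ) :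
    JostLeft q₀ r' (fun x => q (-x) t) (right q₀ p t) where
  pos := h.pos
  sq := h.sq'
  smooth := (h.smooth t).comp contDiff_neg
  integrable := by
    have := IntegrableOn.comp_neg_Iic (c := 0) (f := fun x => (1 + |x|) * (q x t - r'))
      (by simpa using h.integrable' t)
    simpa using this
  deriv1 z hz hi x := by
    have e := ((hasDerivAt_theta_fst q₀ (-x) t z).const_mul I).fun_neg.cexp
    have hl : lam q₀ z = z - kk q₀ z := by rw [lam, kk]; ring
    have hd := (solvesLax_iff.mp (h.lax_p z ⟨hz, hi⟩) (-x) t).1.2.fun_mul e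
    refine (hd.scomp x (hasDerivAt_neg x)).congr_deriv ?_
    rw [hl, right, neg_one_smul]; ring
  deriv2 z hz hi x := by
    have e := ((hasDerivAt_theta_fst q₀ (-x) t z).const_mul I).fun_neg.cexp
    have hl : lam q₀ z = (q₀ : ℂ) ^ 2 / z + kk q₀ z := by rw [lam, kk]; ring
    have hd := (solvesLax_iff.mp (h.lax_p z ⟨hz, hi⟩) (-x) t).1.1.fun_mul e
    refine (hd.scomp x (hasDerivAt_neg x)).congr_deriv ?_
    rw [hl, right, neg_one_smul]; ring
  lim z hz hi := by
    have h0 := (h.lim_p z ⟨hz, hi⟩ t 0).comp tendsto_neg_atBot_atTop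
    have h1 := (h.lim_p z ⟨hz, hi⟩ t 1).comp tendsto_neg_atBot_atTop
    simp only [bgMat, Matrix.of_apply, Matrix.cons_val_zero, Matrix.cons_val_one] at h0 h1
    exact h1.prodMk_nhds h0

theorem unique_a (h : JostCols q₀ r r' q a p) (h' : JostCols q₀ r r' q a' p') {z : ℂ}
    (hz : z ∈ closedPlus q₀) (x t : ℝ) (i : Fin 2) : a z x t i = a' z x t i := by
  have := (h.jostLeft t).unique (h'.jostLeft t) hz x
  have h1 := congrArg Prod.fst this
  have h2 := congrArg Prod.snd this
  simp only [left] at h1 h2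
  fin_cases i
  · exact mul_right_cancel₀ (exp_ne_zero _) h1
  · exact mul_right_cancel₀ (exp_ne_zero _) h2

theorem unique_p (h : JostCols q₀ r r' q a p) (h' : JostCols q₀ r r' q a' p') {z : ℂ}
    (hz : z ∈ closedPlus q₀) (x t : ℝ) (i : Fin 2) : p z x t i = p' z x t i := by
  have := (h.jostRight t).unique (h'.jostRight t) hz (-x)
  have h1 := congrArg Prod.fst this
  have h2 := congrArg Prod.snd this
  simp only [right, neg_neg] at h1 h2
  fin_cases i
  · exact mul_right_cancel₀ (exp_ne_zero _) h2
  · exact mul_right_cancel₀ (exp_ne_zero _) h1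

variable (h : JostCols q₀ r r' q a p)

include h

omit h in
theorem neg_conj_mem {z : ℂ} (hz : z ∈ closedPlus q₀) : -conj z ∈ closedPlus q₀ :=
  ⟨by simpa using hz.1, by simpa [lam_neg, lam_conj] using hz.2⟩

theorem inv_mem {z : ℂ} (hz : z ∈ closedPlus q₀) : (q₀ : ℂ) ^ 2 / z ∈ closedPlus q₀ := by
  have : (q₀ : ℂ) ≠ 0 := by exact_mod_cast h.pos.ne'
  exact ⟨div_ne_zero (pow_ne_zero 2 this) hz.1, by rw [lam_sq_div h.pos.ne' hz.1]; exact hz.2⟩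

theorem conj_a {z : ℂ} (hz : z ∈ closedPlus q₀) (x t : ℝ) (i : Fin 2) :
    a (-conj z) x t i = conj (a z x t i) := by
  have h1 := (h.jostLeft t).eq_conj (neg_conj_mem hz) x
  simp only [left, map_neg, Complex.conj_conj, neg_neg, map_mul, ← exp_conj, conj_I, theta_neg, theta_conj,
    neg_mul, mul_neg] at h1
  fin_cases i
  · exact mul_right_cancel₀ (exp_ne_zero _) h1.1
  · exact mul_right_cancel₀ (exp_ne_zero _) h1.2

theorem conj_p {z : ℂ} (hz : z ∈ closedPlus q₀) (x t : ℝ) (i : Fin 2) :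
    p (-conj z) x t i = conj (p z x t i) := by
  have h1 := (h.jostRight t).eq_conj (neg_conj_mem hz) (-x)
  simp only [right, map_neg, Complex.conj_conj, neg_neg, map_mul, ← exp_conj, conj_I, theta_neg, theta_conj,
    neg_mul, mul_neg] at h1
  fin_cases i
  · exact mul_right_cancel₀ (exp_ne_zero _) h1.2
  · exact mul_right_cancel₀ (exp_ne_zero _) h1.1

theorem theta_inv (x t : ℝ) {z : ℂ} (hz : z ≠ 0) :
    theta q₀ x t ((q₀ : ℂ) ^ 2 / z) = theta q₀ x t z := by
  have := theta_hat h.pos.ne' x t hz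
  rw [hat, theta_neg] at this
  exact neg_injective this

theorem inv_a {z : ℂ} (hz : z ∈ closedPlus q₀) (x t : ℝ) :
    a z x t 0 = I * r / z * a ((q₀ : ℂ) ^ 2 / z) x t 1 ∧
      a z x t 1 = -(I * r / z * a ((q₀ : ℂ) ^ 2 / z) x t 0) := by
  have h1 := (h.jostLeft t).eq_inv hz x
  simp only [left, h.theta_inv x t hz.1] at h1
  have he := exp_ne_zero (I * theta q₀ x t z)
  constructor
  · apply mul_right_cancel₀ he
    linear_combination h1.1
  · apply mul_right_cancel₀ he
    linear_combination h1.2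

theorem inv_p {z : ℂ} (hz : z ∈ closedPlus q₀) (x t : ℝ) :
    p z x t 0 = -(I * r' / z * p ((q₀ : ℂ) ^ 2 / z) x t 1) ∧
      p z x t 1 = I * r' / z * p ((q₀ : ℂ) ^ 2 / z) x t 0 := by
  have h1 := (h.jostRight t).eq_inv hz (-x)
  simp only [right, neg_neg, h.theta_inv x t hz.1] at h1
  have he := exp_ne_zero (-(I * theta q₀ x t z))
  constructor
  · apply mul_right_cancel₀ he
    linear_combination h1.2
  · apply mul_right_cancel₀ he
    linear_combination h1.1

theorem a_ne {z : ℂ} (hz : z ∈ closedPlus q₀) (x t : ℝ) : a z x t ≠ 0 := fun h0 =>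
  (h.jostLeft t).ne_zero hz x (by simp [left, h0])

theorem p_ne {z : ℂ} (hz : z ∈ closedPlus q₀) (x t : ℝ) : p z x t ≠ 0 := fun h0 =>
  (h.jostRight t).ne_zero hz (-x) (by simp [right, h0])

/-- The determinant of `Φ₋` on `Σ`. -/
theorem det_left {z : ℂ} (hz : z ∈ contSpec q₀) (x t : ℝ) :
    I * r / z * wrv (a (hat q₀ z) x t) (a z x t) = gammaF q₀ z := by
  have hq := h.pos
  have hqC : (q₀ : ℂ) ≠ 0 := by exact_mod_cast hq.ne'
  have hrC : (r : ℂ) ^ 2 = (q₀ : ℂ) ^ 2 := by exact_mod_cast h.sq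
  have hz0 := hz.1
  have hp := mem_closedPlus_of_mem_contSpec hq hz
  have hp' := mem_closedPlus_of_mem_contSpec hq (hat_mem_contSpec hq hz)
  have hk : kk q₀ (hat q₀ z) = kk q₀ z := kk_neg_div hq.ne' hz0
  have hconst := (solvesLax_congr_kk hk (h.lax_a _ hp')).wrv_eq (h.lax_a z hp)
  have hlim : Tendsto (fun y => wrv (a (hat q₀ z) y t) (a z y t)) atBot
      (𝓝 (I * r / hat q₀ z * 1 - 1 * (I * r / z))) := by
    have l0 := h.lim_a z hp t 0
    have l1 := h.lim_a z hp t 1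
    have k0 := h.lim_a _ hp' t 0
    have k1 := h.lim_a _ hp' t 1
    simp only [bgMat, Matrix.of_apply, Matrix.cons_val_zero, Matrix.cons_val_one] at l0 l1 k0 k1
    refine ((k0.mul l1).sub (k1.mul l0)).congr fun y => ?_
    rw [theta_hat hq.ne' y t hz0, wrv, mul_neg, exp_neg]
    have := exp_ne_zero (I * theta q₀ y t z)
    field_simp
  have h1 : wrv (a (hat q₀ z) x t) (a z x t) = I * r / hat q₀ z * 1 - 1 * (I * r / z) := by
    refine tendsto_nhds_unique (tendsto_const_nhds.congr fun y => ?_) hlim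
    rw [hconst x t, hconst y t]
  rw [h1, gammaF, hat]
  field_simp
  ring_nf
  rw [I_sq, hrC]
  ring

end JostCols

/-- `s₁₁` in terms of the analytic columns. -/
def wronskCoef (q₀ : ℝ) (a p : ℂ → ℝ → ℝ → Fin 2 → ℂ) (z : ℂ) : ℂ :=
  wrv (p z 0 0) (a z 0 0) / gammaF q₀ z

/-! ### Symmetries of `s₁₁` and of the norming constants, and passage to the Riemann–Hilbert
problem. -/

namespace JostCols

variable {q₀ r r' : ℝ} {q : ℝ → ℝ → ℝ} {a p : ℂ → ℝ → ℝ → Fin 2 → ℂ}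
  (h : JostCols q₀ r r' q a p)

include h

theorem q_ne : (q₀ : ℂ) ≠ 0 := by exact_mod_cast h.pos.ne'

theorem sqC : (r : ℂ) ^ 2 = (q₀ : ℂ) ^ 2 := by exact_mod_cast h.sq

theorem sqC' : (r' : ℂ) ^ 2 = (q₀ : ℂ) ^ 2 := by exact_mod_cast h.sq'

theorem r_ne : (r : ℂ) ≠ 0 := by
  have := h.sqC
  intro h0
  rw [h0] at this
  exact pow_ne_zero 2 h.q_ne (by simpa using this.symm)

theorem r_ne' : (r' : ℂ) ≠ 0 := by
  have := h.sqC'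
  intro h0
  rw [h0] at this
  exact pow_ne_zero 2 h.q_ne (by simpa using this.symm)

theorem wronskCoef_conj {z : ℂ} (hz : z ∈ closedPlus q₀) :
    wronskCoef q₀ a p (-conj z) = conj (wronskCoef q₀ a p z) := by
  have hγ : gammaF q₀ (-conj z) = conj (gammaF q₀ z) := by simp [gammaF]
  simp only [wronskCoef, wrv, hγ, h.conj_a hz, h.conj_p hz, map_div₀, map_sub, map_mul]

/-- The factor is `±1`. Its sign cannot be fixed here, since `q₊ = q₋` is known only at the end. -/
theorem wronskCoef_inv {z : ℂ} (hz : z ∈ DPlus q₀) :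
    wronskCoef q₀ a p ((q₀ : ℂ) ^ 2 / z) = r * r' / (q₀ : ℂ) ^ 2 * wronskCoef q₀ a p z := by
  have hqC := h.q_ne
  have hz0 := hz.1
  have hγ := gammaF_ne_zero_of_im h.pos hz0 hz.2.ne'
  have hγ' : gammaF q₀ ((q₀ : ℂ) ^ 2 / z) = z ^ 2 / (q₀ : ℂ) ^ 2 * gammaF q₀ z := by
    unfold gammaF
    field_simp
    ring
  have hp := DPlus_subset_closedPlus q₀ hz
  unfold wronskCoef wrv
  rw [hγ', (h.inv_a hp 0 0).1, (h.inv_a hp 0 0).2, (h.inv_p hp 0 0).1, (h.inv_p hp 0 0).2]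
  set A := a ((q₀ : ℂ) ^ 2 / z) 0 0
  set P := p ((q₀ : ℂ) ^ 2 / z) 0 0
  field_simp
  ring_nf
  rw [h.sqC, h.sqC', I_sq]
  ring

theorem differentiableAt_wronskCoef {z : ℂ} (hz : z ∈ DPlus q₀) :
    DifferentiableAt ℂ (wronskCoef q₀ a p) z := by
  have hγ := gammaF_ne_zero_of_im h.pos hz.1 hz.2.ne'
  have hn := (isOpen_DPlus q₀).mem_nhds hz
  have d1 := ((h.jostLeft 0).differentiableOn_spectral 0 z hz).differentiableAt hn
  have d2 := ((h.jostRight 0).differentiableOn_spectral 0 z hz).differentiableAt hn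
  have d3 : DifferentiableAt ℂ (gammaF q₀) z := by
    unfold gammaF
    have := pow_ne_zero 2 hz.1
    fun_prop (disch := assumption)
  have := ((d2.snd.fun_mul d1.snd).fun_sub (d2.fst.fun_mul d1.fst)).fun_div d3 hγ
  refine this.congr_of_eventuallyEq (Eventually.of_forall fun w => ?_)
  simp [wronskCoef, wrv, left, right, theta]

theorem deriv_wronskCoef_conj {z : ℂ} (hz : z ∈ DPlus q₀) :
    deriv (wronskCoef q₀ a p) (-conj z) = -conj (deriv (wronskCoef q₀ a p) z) := by
  have hd := (h.differentiableAt_wronskCoef hz).hasDerivAt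
  have hz' : -conj z ∈ DPlus q₀ :=
    ⟨by simpa using hz.1, by simpa [lam_neg, lam_conj] using hz.2⟩
  have h1 := hd.conj_conj
  have h2 : HasDerivAt (fun w => conj (wronskCoef q₀ a p (conj (-w))))
      (conj (deriv (wronskCoef q₀ a p) z) * (-1)) (-conj z) := by
    refine HasDerivAt.comp (h₂ := conj ∘ wronskCoef q₀ a p ∘ conj) (-conj z) ?_ (hasDerivAt_neg _)
    simpa using h1
  rw [mul_neg_one] at h2
  rw [← h2.deriv]
  refine EventuallyEq.deriv_eq ?_
  filter_upwards [(isOpen_DPlus q₀).mem_nhds hz'] with w hw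
  have := h.wronskCoef_conj (DPlus_subset_closedPlus q₀ hw)
  rw [map_neg, this, Complex.conj_conj]

theorem deriv_wronskCoef_inv {z : ℂ} (hz : z ∈ DPlus q₀) :
    r * r' / (q₀ : ℂ) ^ 2 * deriv (wronskCoef q₀ a p) z =
      -((q₀ : ℂ) ^ 2 / z ^ 2) * deriv (wronskCoef q₀ a p) ((q₀ : ℂ) ^ 2 / z) := by
  have hz0 := hz.1
  have hz' : (q₀ : ℂ) ^ 2 / z ∈ DPlus q₀ :=
    ⟨div_ne_zero (pow_ne_zero 2 h.q_ne) hz0, by rw [lam_sq_div h.pos.ne' hz0]; exact hz.2⟩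
  have hd := (h.differentiableAt_wronskCoef hz').hasDerivAt
  have hi : HasDerivAt (fun w : ℂ => (q₀ : ℂ) ^ 2 / w) (-((q₀ : ℂ) ^ 2 / z ^ 2)) z := by
    have := (hasDerivAt_inv hz0).const_mul ((q₀ : ℂ) ^ 2)
    refine this.congr_deriv ?_
    field_simp
  have h2 := HasDerivAt.comp (h₂ := wronskCoef q₀ a p) z hd hi
  rw [mul_comm (-((q₀ : ℂ) ^ 2 / z ^ 2)), ← h2.deriv]
  have h3 := ((h.differentiableAt_wronskCoef hz).hasDerivAt.const_mul
    (r * r' / (q₀ : ℂ) ^ 2)).deriv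
  rw [← h3]
  refine EventuallyEq.deriv_eq ?_
  filter_upwards [(isOpen_DPlus q₀).mem_nhds hz] with w hw using (h.wronskCoef_inv hw).symm

/-- The proportionality constant at `-z*`. -/
theorem norming_conj {z b b' : ℂ} (hz : z ∈ closedPlus q₀)
    (hb : ∀ x t i, p z x t i = b * a z x t i)
    (hb' : ∀ x t i, p (-conj z) x t i = b' * a (-conj z) x t i) : b' = conj b := by
  obtain ⟨i, hi⟩ := Function.ne_iff.mp (h.a_ne hz 0 0)
  have h1 := hb' 0 0 i
  rw [h.conj_a hz, h.conj_p hz, hb, map_mul] at h1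
  exact (mul_right_cancel₀ ((map_ne_zero _).mpr hi) h1).symm

/-- The proportionality constant at `q₀²/z`. -/
theorem norming_inv {z b b' : ℂ} (hz : z ∈ closedPlus q₀)
    (hb : ∀ x t i, p z x t i = b * a z x t i)
    (hb' : ∀ x t i, p ((q₀ : ℂ) ^ 2 / z) x t i = b' * a ((q₀ : ℂ) ^ 2 / z) x t i) :
    r * b = -(r' * b') := by
  have hz0 := hz.1
  have hI := I_ne_zero
  have ha := h.inv_a hz 0 0
  have hp := h.inv_p hz 0 0
  have h0 := hb 0 0 0
  have h1 := hb 0 0 1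
  rw [hp.1, ha.1, hb'] at h0
  rw [hp.2, ha.2, hb'] at h1
  obtain ⟨i, hi⟩ := Function.ne_iff.mp (h.a_ne (h.inv_mem hz) 0 0)
  have hi : a ((q₀ : ℂ) ^ 2 / z) 0 0 i ≠ 0 := hi
  field_simp at h0 h1
  fin_cases i
  · apply mul_right_cancel₀ hi
    change r * b * a ((q₀ : ℂ) ^ 2 / z) 0 0 0 = _ * a ((q₀ : ℂ) ^ 2 / z) 0 0 0
    linear_combination h1
  · apply mul_right_cancel₀ hi
    change r * b * a ((q₀ : ℂ) ^ 2 / z) 0 0 1 = _ * a ((q₀ : ℂ) ^ 2 / z) 0 0 1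
    linear_combination -h0

/-- The Riemann–Hilbert problem for the analytic columns. -/
theorem rhData {ι : Type*} {η : ι → ℂ}
    (hjump : ∀ z ∈ contSpec₀ q₀, wrv (p (hat q₀ z) 0 0) (a z 0 0) = 0)
    (hne : ∀ z ∈ contSpec₀ q₀, wronskCoef q₀ a p z ≠ 0)
    (hzeros : {z | z ∈ DPlus q₀ ∧ wronskCoef q₀ a p z = 0} = Set.range η)
    (hder : ∀ k, deriv (wronskCoef q₀ a p) (η k) ≠ 0) (b : ι → ℂ)
    (hb : ∀ k x t i, p (η k) x t i = b k * a (η k) x t i) (x t : ℝ) :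
    RHData q₀ r r' η
      (fun k => (q₀ : ℂ) ^ 2 / η k ^ 2 * (b k / deriv (wronskCoef q₀ a p) (η k)) *
        exp (2 * I * theta q₀ x t (hat q₀ (η k))) * η k / (I * r))
      (fun z => left q₀ a t z x) (fun z => (right q₀ p t z (-x)).swap) := by
  have hq := h.pos
  have hmem : ∀ k, η k ∈ DPlus q₀ := fun k => by
    have : η k ∈ {z | z ∈ DPlus q₀ ∧ wronskCoef q₀ a p z = 0} := by rw [hzeros]; exact ⟨k, rfl⟩
    exact this.1
  -- The phases of the two columns are opposite and the Wronskian of two Lax solutions is constant,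
  -- so the coefficient does not depend on `(x,t)`.
  have hscat : ∀ z ∈ closedPlus q₀, scat q₀ (fun z => left q₀ a t z x)
      (fun z => (right q₀ p t z (-x)).swap) z = wronskCoef q₀ a p z := by
    intro z hz
    rw [wronskCoef, ← (h.lax_p z hz).wrv_eq (h.lax_a z hz) x t, scat]
    simp only [left, right, Prod.fst_swap, Prod.snd_swap, neg_neg, wrv, exp_neg]
    have := exp_ne_zero (I * theta q₀ x t z)
    congr 1
    field_simp
  have hderiv : ∀ k, deriv (scat q₀ (fun z => left q₀ a t z x)
      (fun z => (right q₀ p t z (-x)).swap)) (η k) = deriv (wronskCoef q₀ a p) (η k) := fun k => by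
    refine EventuallyEq.deriv_eq ?_
    filter_upwards [(isOpen_DPlus q₀).mem_nhds (hmem k)] with w hw
      using hscat w (DPlus_subset_closedPlus q₀ hw)
  have hL := h.jostLeft t
  have hR := h.jostRight t
  refine
    { sq' := h.sq'
      cont_a := hL.continuousOn_spectral x
      cont_p := continuous_swap.comp_continuousOn (hR.continuousOn_spectral (-x))
      diff_a := hL.differentiableOn_spectral x
      diff_p := (hR.differentiableOn_spectral (-x)).snd.prodMk
        (hR.differentiableOn_spectral (-x)).fst
      lim_a := hL.tendsto_cobounded x
      lim_p := (continuous_swap.tendsto ((0, 1) : ℂ × ℂ)).comp (hR.tendsto_cobounded (-x))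
      ne_a := fun z hz => hL.ne_zero hz x
      ne_p := fun z hz h0 => hR.ne_zero hz (-x) (Prod.swap_injective h0)
      inv_a := fun z hz => Prod.ext (hL.eq_inv hz x).1 (hL.eq_inv hz x).2
      inv_p := fun z hz => Prod.ext (hR.eq_inv hz (-x)).2 (hR.eq_inv hz (-x)).1
      jump := ?_
      ne_s := fun z hz => by
        rw [hscat z (mem_closedPlus_of_mem_contSpec hq hz.1)]; exact hne z hz
      zeros := ?_
      deriv_ne := fun k => by rw [hderiv]; exact hder k
      res := ?_ }
  · intro z hz
    have hz0 := hz.1.1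
    have hI := I_ne_zero
    have hr := h.r_ne
    have hqC := h.q_ne
    have hzh := hat_mem_contSpec₀ hq hz
    have hp := mem_closedPlus_of_mem_contSpec hq hz.1
    have hp' := mem_closedPlus_of_mem_contSpec hq hzh.1
    have hγ := gammaF_ne_zero_of_sq hzh.1.1 (mem_contSpec₀_iff.mp hzh).2
    have hdet := h.det_left hzh.1 x t
    rw [hat_hat hq hz0] at hdet
    have hk : kk q₀ (hat q₀ z) = kk q₀ z := kk_neg_div hq.ne' hz0
    have hj := (solvesLax_congr_kk hk (h.lax_p _ hp')).wrv_eq (h.lax_a z hp) x t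
    rw [hjump z hz] at hj
    have e : scat q₀ (fun z => left q₀ a t z x) (fun z => (right q₀ p t z (-x)).swap) (hat q₀ z) =
        wrv (p (hat q₀ z) x t) (a (hat q₀ z) x t) / gammaF q₀ (hat q₀ z) := by
      rw [hscat _ hp', wronskCoef, (h.lax_p _ hp').wrv_eq (h.lax_a _ hp') x t]
    have hc : I * r / z * (I * r / hat q₀ z) = 1 := by
      unfold hat
      field_simp
      rw [I_sq, h.sqC]
      ring
    have key : ∀ i, wrv (p (hat q₀ z) x t) (a (hat q₀ z) x t) / gammaF q₀ (hat q₀ z) * a z x t i =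
        I * r / z * p (hat q₀ z) x t i := by
      intro i
      rw [div_mul_eq_mul_div, div_eq_iff hγ]
      rw [← hdet]
      -- The linear relation between three vectors of the plane; by `hj` its third coefficient, the
      -- Wronskian of `p(ẑ)` and `a(z)`, is zero.
      have hid : wrv (p (hat q₀ z) x t) (a (hat q₀ z) x t) * a z x t i =
          wrv (a z x t) (a (hat q₀ z) x t) * p (hat q₀ z) x t i := by
        unfold wrv at hj ⊢
        fin_cases i
        · simp only [Fin.zero_eta]
          linear_combination a (hat q₀ z) x t 0 * hj
        · simp only [Fin.mk_one]
          linear_combination a (hat q₀ z) x t 1 * hj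
      rw [hid]
      linear_combination -(wrv (a z x t) (a (hat q₀ z) x t) * p (hat q₀ z) x t i) * hc
    rw [e]
    have e2 := theta_hat hq.ne' x t hz0
    refine Prod.ext ?_ ?_
    · simp only [left, right, Prod.smul_fst, Prod.fst_swap, smul_eq_mul, neg_neg, e2, mul_neg]
      linear_combination exp (I * theta q₀ x t z) * key 0
    · simp only [left, right, Prod.smul_snd, Prod.snd_swap, smul_eq_mul, neg_neg, e2, mul_neg]
      linear_combination exp (I * theta q₀ x t z) * key 1
  · rw [← hzeros]
    ext z
    refine and_congr_right fun hz => ?_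
    rw [hscat z (DPlus_subset_closedPlus q₀ hz)]
  · intro k
    have hz0 := (hmem k).1
    have hI := I_ne_zero
    have hr := h.r_ne
    have hd := hder k
    rw [hderiv, theta_hat hq.ne' x t hz0]
    simp only [left, right, Prod.fst_swap, neg_neg, hb]
    have e : exp (2 * I * -theta q₀ x t (η k)) * exp (I * theta q₀ x t (η k)) =
        exp (-(I * theta q₀ x t (η k))) := by
      rw [← exp_add]; congr 1; ring
    rw [← e]
    field_simp
    rw [← h.sqC, I_sq]
    ring

end JostCols

/-! ### The two pairs of columns of a Jost solution. -/

variable {q₀ qm qp : ℝ} {q : ℝ → ℝ → ℝ} {Φm Φp : ℝ → ℝ → ℂ → Matrix (Fin 2) (Fin 2) ℂ}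

theorem jostCols_of_isJost (hq : 0 < q₀) (hm : qm ^ 2 = q₀ ^ 2) (hp : qp ^ 2 = q₀ ^ 2)
    (hs : IsFocusingSolution q) (hbv : HasBoundaryValues q qm qp) (hJ : IsJost q₀ q qm qp Φm Φp) :
    JostCols q₀ qm qp q (fun z x t i => Φm x t z i 1) (fun z x t i => Φp x t z i 0) where
  pos := hq
  sq := hm
  sq' := hp
  smooth t := (hs.1 t).of_le (by norm_num)
  integrable t := (hbv t).2.2.1
  integrable' t := (hbv t).2.2.2
  lax_a z hz := (hJ.1 z hz.1 hz.2).2.1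
  lax_p z hz := (hJ.1 z hz.1 hz.2).1
  lim_a z hz t i := ((hJ.1 z hz.1 hz.2).2.2 t i).2
  lim_p z hz t i := ((hJ.1 z hz.1 hz.2).2.2 t i).1

/-- The columns on `D₋ ∪ Σ`, transported to `D₊ ∪ Σ` by `z → -q₀²/z`. -/
theorem jostCols_hat_of_isJost (hq : 0 < q₀) (hm : qm ^ 2 = q₀ ^ 2) (hp : qp ^ 2 = q₀ ^ 2)
    (hs : IsFocusingSolution q) (hbv : HasBoundaryValues q qm qp) (hJ : IsJost q₀ q qm qp Φm Φp) :
    JostCols q₀ qm qp q (fun z x t i => I * qm / z * Φm x t (hat q₀ z) i 0)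
      (fun z x t i => I * qp / z * Φp x t (hat q₀ z) i 1) := by
  have hJ2 : ∀ z ∈ closedPlus q₀, _ := fun z hz =>
    hJ.2 (hat q₀ z) (hat_ne_zero hq hz.1) (hat_mem_closedMinus hq hz).2
  have hk : ∀ z ∈ closedPlus q₀, kk q₀ (hat q₀ z) = kk q₀ z := fun z hz => kk_neg_div hq.ne' hz.1
  have hqC : (q₀ : ℂ) ≠ 0 := by exact_mod_cast hq.ne'
  have hc : ∀ r : ℝ, r ^ 2 = q₀ ^ 2 → ∀ z ∈ closedPlus q₀,
      I * (r : ℂ) / z * (I * r / hat q₀ z) = 1 := fun r hr z hz => by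
    have hrC : (r : ℂ) ^ 2 = (q₀ : ℂ) ^ 2 := by exact_mod_cast hr
    have := hz.1
    unfold hat
    field_simp
    rw [I_sq, hrC]
    ring
  refine
    { pos := hq
      sq := hm
      sq' := hp
      smooth := fun t => (hs.1 t).of_le (by norm_num)
      integrable := fun t => (hbv t).2.2.1
      integrable' := fun t => (hbv t).2.2.2
      lax_a := fun z hz => (solvesLax_congr_kk (hk z hz) (hJ2 z hz).1).const_mul _
      lax_p := fun z hz => (solvesLax_congr_kk (hk z hz) (hJ2 z hz).2.1).const_mul _
      lim_a := fun z hz t i => ?_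
      lim_p := fun z hz t i => ?_ }
  · have h1 := ((hJ2 z hz).2.2 t i).1.const_mul (I * qm / z)
    have e : I * qm / z * bgMat qm (hat q₀ z) i 0 = bgMat qm z i 1 := by
      fin_cases i
      · simp [bgMat]
      · simpa [bgMat] using hc qm hm z hz
    rw [e] at h1
    refine h1.congr fun x => ?_
    rw [theta_hat hq.ne' x t hz.1, mul_neg, neg_neg, mul_assoc]
  · have h1 := ((hJ2 z hz).2.2 t i).2.const_mul (I * qp / z)
    have e : I * qp / z * bgMat qp (hat q₀ z) i 1 = bgMat qp z i 0 := by
      fin_cases i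
      · simpa [bgMat] using hc qp hp z hz
      · simp [bgMat]
    rw [e] at h1
    refine h1.congr fun x => ?_
    rw [theta_hat hq.ne' x t hz.1, mul_neg, mul_assoc]

section symmetries

variable {N₁ N₂ : ℕ} {z : Fin N₁ → ℂ} {w : Fin N₂ → ℝ}

/-- A property of the points `η` that is preserved by the symmetries `η ↦ -η*`, `η ↦ q₀²/η`. -/
theorem eta_induction {C : PoleIdx N₁ N₂ → Prop} (h0 : ∀ n, C (Sum.inl (0, n)))
    (h1 : ∀ m, C (Sum.inr (0, m))) (hσ : ∀ k, C k → C (sigIdx k)) (hτ : ∀ k, C k → C (tauIdx k))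
    (k : PoleIdx N₁ N₂) : C k := by
  rcases k with ⟨j, n⟩ | ⟨j, m⟩
  · fin_cases j
    · exact h0 n
    · exact hσ _ (h0 n)
    · exact hτ _ (hσ _ (h0 n))
    · exact hτ _ (h0 n)
  · fin_cases j
    · exact h1 m
    · exact hτ _ (h1 m)

/-- The symmetries determine all zeros in `D₊` from those in the first quadrant and on the
imaginary axis. -/
theorem zeros_eq_range_eta (hS : PoleSys q₀ qm (eta q₀ z w) sigIdx tauIdx) {C : ℂ → Prop}
    (hconj : ∀ ζ ∈ DPlus q₀, C ζ → C (-conj ζ))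
    (hinv : ∀ ζ ∈ DPlus q₀, C ζ → C ((q₀ : ℂ) ^ 2 / ζ))
    (h1 : {ζ : ℂ | ζ ∈ DPlus q₀ ∧ 0 < ζ.re ∧ 0 < ζ.im ∧ C ζ} = Set.range z)
    (h2 : {v : ℝ | q₀ < v ∧ C (I * (v : ℂ))} = Set.range w) :
    {ζ | ζ ∈ DPlus q₀ ∧ C ζ} = Set.range (eta q₀ z w) := by
  have hq := hS.pos
  have upper : ∀ ζ ∈ DPlus q₀, 0 < ζ.im → C ζ → ζ ∈ Set.range (eta q₀ z w) := by
    intro ζ hζ him hC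
    rcases lt_trichotomy ζ.re 0 with hre | hre | hre
    · have : -conj ζ ∈ Set.range z := by
        rw [← h1]
        exact ⟨⟨by simpa using hζ.1, by simpa [lam_neg, lam_conj] using hζ.2⟩, by simpa using hre,
          by simpa using him, hconj ζ hζ hC⟩
      obtain ⟨n, hn⟩ := this
      refine ⟨Sum.inl (1, n), ?_⟩
      change -conj (z n) = ζ
      rw [hn]; simp
    · have e : ζ = I * (ζ.im : ℂ) := by
        apply Complex.ext <;> simp [hre]
      have hn : normSq ζ = ζ.im ^ 2 := by rw [normSq_apply, hre]; ring
      have h3 := hζ.2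
      rw [im_lam, hn] at h3
      have h4 : 0 < 1 - q₀ ^ 2 / ζ.im ^ 2 := by
        by_contra! hc
        have := mul_nonpos_of_nonneg_of_nonpos him.le hc
        linarith
      have h5 : q₀ ^ 2 < ζ.im ^ 2 := by
        rwa [sub_pos, div_lt_one (by positivity)] at h4
      have h6 : q₀ < ζ.im := lt_of_pow_lt_pow_left₀ 2 him.le h5
      have : ζ.im ∈ Set.range w := by
        rw [← h2]
        exact ⟨h6, by rwa [← e]⟩
      obtain ⟨m, hm⟩ := this
      refine ⟨Sum.inr (0, m), ?_⟩
      change I * (w m : ℂ) = ζ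
      rw [hm, ← e]
    · have : ζ ∈ Set.range z := by
        rw [← h1]
        exact ⟨hζ, hre, him, hC⟩
      obtain ⟨n, hn⟩ := this
      exact ⟨Sum.inl (0, n), hn⟩
  ext ζ
  constructor
  · rintro ⟨hζ, hC⟩
    have him : ζ.im ≠ 0 := fun h0 => by
      have := hζ.2
      rw [im_lam, h0, zero_mul, zero_div] at this
      exact lt_irrefl _ this
    rcases him.lt_or_gt with hlt | hgt
    · have hζ' : (q₀ : ℂ) ^ 2 / ζ ∈ DPlus q₀ :=
        ⟨div_ne_zero (pow_ne_zero 2 hS.q_ne) hζ.1, by rw [lam_sq_div hq.ne' hζ.1]; exact hζ.2⟩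
      have him' : 0 < ((q₀ : ℂ) ^ 2 / ζ).im := by
        rw [← ofReal_pow, div_eq_mul_inv, im_ofReal_mul, inv_im]
        have := normSq_pos.mpr hζ.1
        have : 0 < -ζ.im := neg_pos.mpr hlt
        positivity
      obtain ⟨k, hk⟩ := upper _ hζ' him' (hinv ζ hζ hC)
      refine ⟨tauIdx k, ?_⟩
      have := hS.q_ne
      have := hζ.1
      rw [hS.eta_inv, hk]
      field_simp
    · exact upper ζ hζ hgt hC
  · rintro ⟨k, rfl⟩
    refine ⟨hS.mem k, ?_⟩
    refine eta_induction (C := fun k => C (eta q₀ z w k)) (fun n => ?_) (fun m => ?_)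
      (fun k hk => ?_) (fun k hk => ?_) k
    · have : z n ∈ {ζ : ℂ | ζ ∈ DPlus q₀ ∧ 0 < ζ.re ∧ 0 < ζ.im ∧ C ζ} := by rw [h1]; exact ⟨n, rfl⟩
      exact this.2.2.2
    · have : w m ∈ {v : ℝ | q₀ < v ∧ C (I * (v : ℂ))} := by rw [h2]; exact ⟨m, rfl⟩
      exact this.2
    · rw [hS.eta_conj]; exact hconj _ (hS.mem k) hk
    · rw [hS.eta_inv]; exact hinv _ (hS.mem k) hk

end symmetries

/-- `s₂₂(z) = (q₊/q₋) s₁₁(-q₀²/z)`. -/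
theorem s22_eq_wronskCoef (h : JostCols q₀ qm qp q (fun z x t i => Φm x t z i 1)
      (fun z x t i => Φp x t z i 0))
    (h' : JostCols q₀ qm qp q (fun z x t i => I * qm / z * Φm x t (hat q₀ z) i 0)
      (fun z x t i => I * qp / z * Φp x t (hat q₀ z) i 1)) {z : ℂ} (hz : z ∈ DMinus q₀) :
    s22 q₀ Φm Φp z = qm * qp / (q₀ : ℂ) ^ 2 * s11 q₀ Φm Φp (hat q₀ z) := by
  have hq := h.pos
  have hqC := h.q_ne
  have hI := I_ne_zero
  have hz0 := hz.1
  have hD := hat_mem_DPlus hq hz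
  have hc := DPlus_subset_closedPlus q₀ hD
  have ea := fun i => h.unique_a h' hc 0 0 i
  have ep := fun i => h.unique_p h' hc 0 0 i
  simp only [hat_hat hq hz0] at ea ep
  have hγ := gammaF_ne_zero_of_im hq hz0 hz.2.ne
  unfold s22 s11 wr
  rw [ea, ea, ep, ep, gammaF_hat hq hz0]
  unfold hat
  field_simp
  ring_nf
  rw [h.sqC, h.sqC', I_sq]
  field_simp
  ring

/-! ### Identification of a reflectionless potential. -/

section main

variable {N₁ N₂ : ℕ} {z : Fin N₁ → ℂ} {w : Fin N₂ → ℝ} {A : ℂ → ℂ}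

/-- The symmetries of the columns pass to `s₁₁`, to its derivatives at the zeros and to the norming
constants, and division gives `(*)`. The unknown sign `q₋q₊/q₀²` enters numerator and denominator
alike and cancels. -/
theorem symmetric_of_reflectionless (hS : PoleSys q₀ qm (eta q₀ z w) sigIdx tauIdx)
    (hp : qp ^ 2 = q₀ ^ 2) (h : IsReflectionlessPotential q₀ qm qp z w A q) :
    IsAdmissible q₀ z w A ∧ ∃ a p : ℂ → ℝ → ℝ → Fin 2 → ℂ, JostCols q₀ qm qp q a p ∧
      ∀ x t, RHData q₀ qm qp (eta q₀ z w) (resCoef q₀ qm z w A x t)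
        (fun z => JostCols.left q₀ a t z x) (fun z => (JostCols.right q₀ p t z (-x)).swap) := by
  obtain ⟨hs, hbv, Φm, Φp, hJ, hne, hrefl, hz1, hz2, hd1, hd2, hR1, hR2⟩ := h
  have hq := hS.pos
  have hqC := hS.q_ne
  have hC := jostCols_of_isJost hq hS.sq hp hs hbv hJ
  have hC' := jostCols_hat_of_isJost hq hS.sq hp hs hbv hJ
  set a : ℂ → ℝ → ℝ → Fin 2 → ℂ := fun z x t i => Φm x t z i 1 with ha
  set p : ℂ → ℝ → ℝ → Fin 2 → ℂ := fun z x t i => Φp x t z i 0 with hpdef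
  have hs11 : s11 q₀ Φm Φp = wronskCoef q₀ a p := rfl
  rw [hs11] at hz1 hz2 hd1 hd2 hR1
  have hr := hC.r_ne
  have hr' := hC.r_ne'
  have hε : (qm : ℂ) * qp / (q₀ : ℂ) ^ 2 ≠ 0 :=
    div_ne_zero (mul_ne_zero hr hr') (pow_ne_zero 2 hqC)
  have hzeros : {ζ | ζ ∈ DPlus q₀ ∧ wronskCoef q₀ a p ζ = 0} = Set.range (eta q₀ z w) := by
    refine zeros_eq_range_eta hS (C := fun ζ => wronskCoef q₀ a p ζ = 0) (fun ζ hζ h0 => ?_)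
      (fun ζ hζ h0 => ?_) hz1 hz2
    · rw [hC.wronskCoef_conj (DPlus_subset_closedPlus q₀ hζ), h0, map_zero]
    · rw [hC.wronskCoef_inv hζ, h0, mul_zero]
  have hzero : ∀ k, wronskCoef q₀ a p (eta q₀ z w k) = 0 := fun k => by
    have : eta q₀ z w k ∈ {ζ | ζ ∈ DPlus q₀ ∧ wronskCoef q₀ a p ζ = 0} := by
      rw [hzeros]; exact ⟨k, rfl⟩
    exact this.2
  set s' : PoleIdx N₁ N₂ → ℂ := fun k => deriv (wronskCoef q₀ a p) (eta q₀ z w k) with hs'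
  have hsσ : ∀ k, s' (sigIdx k) = -conj (s' k) := fun k => by
    simp only [hs']
    rw [hS.eta_conj, hC.deriv_wronskCoef_conj (hS.mem k)]
  have hsτ : ∀ k, qm * qp / (q₀ : ℂ) ^ 2 * s' k =
      -((q₀ : ℂ) ^ 2 / eta q₀ z w k ^ 2) * s' (tauIdx k) := fun k => by
    simp only [hs']
    rw [hS.eta_inv, hC.deriv_wronskCoef_inv (hS.mem k)]
  have hs0 : ∀ k, s' k ≠ 0 := by
    refine eta_induction hd1 hd2 (fun k hk => ?_) fun k hk => ?_
    · rw [hsσ]; exact neg_ne_zero.mpr ((map_ne_zero _).mpr hk)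
    · intro h0
      have := hsτ k
      rw [h0, mul_zero] at this
      exact mul_ne_zero hε hk this
  have hb : ∀ k, ∃ b : ℂ, (∀ x t i, p (eta q₀ z w k) x t i = b * a (eta q₀ z w k) x t i) ∧
      A (eta q₀ z w k) = b / s' k := fun k => hR1 _ (hS.mem k) (hzero k)
  choose b hba hbA using hb
  have hcp : ∀ k, eta q₀ z w k ∈ closedPlus q₀ := fun k => DPlus_subset_closedPlus q₀ (hS.mem k)
  have hb0 : ∀ k, b k ≠ 0 := fun k h0 => by
    refine hC.p_ne (hcp k) 0 0 (funext fun i => ?_)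
    rw [hba, h0, zero_mul]; rfl
  have hbσ : ∀ k, b (sigIdx k) = conj (b k) := fun k => by
    refine hC.norming_conj (hcp k) (hba k) ?_
    have := hba (sigIdx k)
    rwa [hS.eta_conj] at this
  have hbτ : ∀ k, qm * b k = -(qp * b (tauIdx k)) := fun k => by
    refine hC.norming_inv (hcp k) (hba k) ?_
    have := hba (tauIdx k)
    rwa [hS.eta_inv] at this
  have hhat : ∀ k, A (hat q₀ (eta q₀ z w k)) =
      (q₀ : ℂ) ^ 2 / eta q₀ z w k ^ 2 * A (eta q₀ z w k) := by
    intro k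
    have hk := hS.ne_zero k
    have hmem := hS.hat_mem k
    have hh := hat_hat hq hk
    obtain ⟨b', hb', hA'⟩ := hR2 _ hmem (by
      rw [s22_eq_wronskCoef hC hC' hmem, hh, hs11, hzero k, mul_zero])
    have hder : deriv (s22 q₀ Φm Φp) (hat q₀ (eta q₀ z w k)) =
        qm * qp / (q₀ : ℂ) ^ 2 * (s' k * (eta q₀ z w k ^ 2 / (q₀ : ℂ) ^ 2)) := by
      have hd : HasDerivAt (hat q₀) (eta q₀ z w k ^ 2 / (q₀ : ℂ) ^ 2) (hat q₀ (eta q₀ z w k)) := by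
        have := ((hasDerivAt_inv hmem.1).const_mul ((q₀ : ℂ) ^ 2)).fun_neg
        refine this.congr_deriv ?_
        unfold hat
        field_simp
      have hw := (hC.differentiableAt_wronskCoef (hS.mem k)).hasDerivAt
      have hcomp : HasDerivAt (fun ζ => wronskCoef q₀ a p (hat q₀ ζ))
          (s' k * (eta q₀ z w k ^ 2 / (q₀ : ℂ) ^ 2)) (hat q₀ (eta q₀ z w k)) := by
        refine HasDerivAt.comp (h₂ := wronskCoef q₀ a p) _ ?_ hd
        rw [hh]; exact hw
      rw [← (hcomp.const_mul (qm * qp / (q₀ : ℂ) ^ 2)).deriv]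
      refine EventuallyEq.deriv_eq ?_
      filter_upwards [(isOpen_DMinus q₀).mem_nhds hmem] with ζ hζ
      exact s22_eq_wronskCoef hC hC' hζ
    -- The columns on `D₋`, transported by `z ↦ ẑ` and renormalized, satisfy the conditions of those
    -- on `D₊` and hence coincide with them; so the norming constants at `η_k` and `η̂_k` differ
    -- only by `q₊/q₋`.
    have hbb : qm * b k = qp * b' := by
      obtain ⟨i, hi⟩ := Function.ne_iff.mp (hC.a_ne (hcp k) 0 0)
      have e1 := hC.unique_a hC' (hcp k) 0 0 i
      have e2 := hC.unique_p hC' (hcp k) 0 0 i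
      have e3 := hb' 0 0 i
      have e4 := hba k 0 0 i
      have hi : a (eta q₀ z w k) 0 0 i ≠ 0 := hi
      rw [e3] at e2
      apply mul_right_cancel₀ hi
      rw [mul_assoc, ← e4]
      change qm * p (eta q₀ z w k) 0 0 i = _
      rw [e2, e1]
      field_simp
    have hsk := hs0 k
    rw [hA', hder, hbA]
    have : b' = qm * b k / qp := by rw [hbb]; field_simp
    rw [this]
    field_simp
    linear_combination -(b k) * hC.sqC'
  have hA : IsAdmissible q₀ z w A := by
    refine isAdmissible_of_eta hS (fun k => ?_) (fun k => ?_) hhat fun k => ?_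
    · rw [hbA]; exact div_ne_zero (hb0 k) (hs0 k)
    · rw [hbA, hbA, hbσ, hsσ]
      simp [div_neg]
    · have hk := hS.ne_zero k
      have h1 := hs0 k
      have h2 := hs0 (tauIdx k)
      rw [hbA, hbA]
      have e1 := hsτ k
      have e2 := hbτ k
      have e3 : b k = -(qp * b (tauIdx k)) / qm := by rw [← e2]; field_simp
      have e4 : s' k = -((q₀ : ℂ) ^ 2 / eta q₀ z w k ^ 2) * s' (tauIdx k) /
          (qm * qp / (q₀ : ℂ) ^ 2) := by rw [← e1]; field_simp
      rw [e3, e4]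
      field_simp
      linear_combination -(b (tauIdx k)) * hC.sqC'
  refine ⟨hA, a, p, hC, fun x t => ?_⟩
  convert hC.rhData (fun ζ hζ => ?_) (fun ζ hζ => (hne ζ hζ).1) hzeros hs0 b hba x t using 1
  · funext k
    rw [resCoef, alphaVec]
    change A (hat q₀ (eta q₀ z w k)) * exp (2 * I * theta q₀ x t (hat q₀ (eta q₀ z w k))) * _ / _ = _
    rw [hhat, hbA]
  · have h12 : s12 q₀ Φm Φp ζ = 0 :=
      (div_eq_zero_iff.mp (hrefl ζ hζ).2).resolve_right (hne ζ hζ).2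
    have hζ0 := hζ.1.1
    have hγ := gammaF_ne_zero_of_sq hζ0 (mem_contSpec₀_iff.mp hζ).2
    have h3 := (div_eq_zero_iff.mp h12).resolve_right hγ
    have hm := mem_closedPlus_of_mem_contSpec hq (hat_mem_contSpec hq hζ.1)
    have e := fun i => hC.unique_p hC' hm 0 0 i
    simp only [hat_hat hq hζ0] at e
    rw [wrv, e, e]
    unfold wr at h3
    linear_combination (I * qp / hat q₀ ζ) * h3

/-- The partial fractions of `RHData.fst_eq`, evaluated at the poles, are the linear system of the
constructed solution with the same `A`. So the first entry of the Jost column is `D.f` throughout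
`D₊`, and the potential can be recovered from its `x`-derivative. -/
theorem eq_q_of_reflectionless (hS : PoleSys q₀ qm (eta q₀ z w) sigIdx tauIdx)
    (hp : qp ^ 2 = q₀ ^ 2) (h : IsReflectionlessPotential q₀ qm qp z w A q) :
    ∃ hA : IsAdmissible q₀ z w A, q = (ratData hS hA).q := by
  obtain ⟨hA, a, p, hC, hRH⟩ := symmetric_of_reflectionless hS hp h
  refine ⟨hA, ?_⟩
  set D := ratData hS hA with hD
  have hq := hS.pos
  have hf : ∀ ζ ∈ DPlus q₀, ∀ x t, (JostCols.left q₀ a t ζ x).1 = D.f ζ x t := by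
    intro ζ hζ x t
    have hfst := fun ζ (hζ : ζ ∈ DPlus q₀) => (hRH x t).fst_eq hS hζ
    have hv : ∀ k, (JostCols.left q₀ a t (eta q₀ z w k) x).1 = D.v x t k := by
      refine D.eq_v (u := fun k => (JostCols.left q₀ a t (eta q₀ z w k) x).1) fun k => ?_
      rw [hD, ratData_κ]
      exact hfst _ (hS.mem k)
    rw [hfst ζ hζ]
    simp only [hv]
    rw [← ratData_κ hS hA]
    rfl
  funext x t
  have key : ∀ ζ ∈ DPlus q₀, (q x t : ℂ) * (JostCols.left q₀ a t ζ x).2 = D.qc x t * D.g ζ x t := by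
    intro ζ hζ
    have hζ0 := hζ.1
    have h1 := (hC.jostLeft t).deriv1 ζ hζ0 hζ.2.le x
    have h2 : HasDerivAt (fun x => D.f ζ x t) (dx (D.f ζ) x t) x :=
      (D.smooth_f ζ).hasDerivAt_dx x t
    have h3 := h1.unique (h2.congr_of_eventuallyEq (Eventually.of_forall fun y => hf ζ hζ y t))
    rw [D.dx_f_eq hζ0 (fun n => hS.ne_hat_of_nonneg hζ.2.le n) x t, hf ζ hζ] at h3
    linear_combination h3
  have : (cobounded ℂ ⊓ 𝓟 (DPlus q₀)).NeBot := by
    have ht : Tendsto (fun v : ℝ => I * (v : ℂ)) atTop (cobounded ℂ ⊓ 𝓟 (DPlus q₀)) := by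
      refine tendsto_inf.mpr ⟨?_, ?_⟩
      · rw [← tendsto_norm_atTop_iff_cobounded]
        simpa using tendsto_abs_atTop_atTop
      · rw [tendsto_principal]
        filter_upwards [eventually_gt_atTop q₀] with v hv
        have hv0 := hq.trans hv
        exact ⟨mul_ne_zero I_ne_zero (by exact_mod_cast hv0.ne'),
          im_lam_pos hq (by simpa using hv0) (by simpa [abs_of_pos hv0] using hv)⟩
    exact ht.neBot
  have hle : cobounded ℂ ⊓ 𝓟 (DPlus q₀) ≤ cobounded ℂ ⊓ 𝓟 (closedPlus q₀) :=
    inf_le_inf_left _ (principal_mono.mpr (DPlus_subset_closedPlus q₀))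
  have l1 := ((continuous_snd.tendsto _).comp (((hC.jostLeft t).tendsto_cobounded x).mono_left
    hle)).const_mul (q x t : ℂ)
  have l2 := ((D.tendsto_g x t).mono_left (inf_le_left (b := 𝓟 (DPlus q₀)))).const_mul (D.qc x t)
  have h3 := tendsto_nhds_unique l1 (l2.congr' ?_)
  · rw [mul_one, mul_one, ← D.ofReal_q] at h3
    exact_mod_cast h3
  · filter_upwards [mem_inf_of_right (mem_principal_self _)] with ζ hζ using (key ζ hζ).symm

/-- The given potential is now the constructed one, whose limits at both ends are `q₋`; uniqueness
of the limit at `+∞` gives `q₊ = q₋`. -/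
theorem reflectionless_unique (hS : PoleSys q₀ qm (eta q₀ z w) sigIdx tauIdx) (hp : |qp| = q₀)
    (h : IsReflectionlessPotential q₀ qm qp z w A q) :
    qp = qm ∧ IsAdmissible q₀ z w A ∧
      ∀ x t : ℝ, (gMat q₀ qm z w A x t).det ≠ 0 ∧
        (q x t : ℂ) = qm + (borderedMat q₀ qm z w A x t).det / (gMat q₀ qm z w A x t).det * I := by
  obtain ⟨hA, rfl⟩ := eq_q_of_reflectionless hS (by rw [← hp, sq_abs]) h
  exact ⟨tendsto_nhds_unique (h.2.1 0).2.1 ((ratData hS hA).hasBoundaryValues 0).2.1, hA,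
    fun x t => ⟨det_gMat_ne_zero hS hA x t, determinant_formula_ratData hS hA x t⟩⟩

end main

end

end MKdV

theorem mainTheorem1 (q₀ qm : ℝ) (hq₀ : 0 < q₀) (hqm : |qm| = q₀) (N₁ N₂ : ℕ)
    (z : Fin N₁ → ℂ) (w : Fin N₂ → ℝ)
    (hz : Function.Injective z) (hzre : ∀ n, 0 < (z n).re) (hzim : ∀ n, 0 < (z n).im)
    (hznorm : ∀ n, q₀ < ‖z n‖) (hw : Function.Injective w) (hwq : ∀ m, q₀ < w m) :
    (∀ (qp : ℝ) (A : ℂ → ℂ) (q : ℝ → ℝ → ℝ), |qp| = q₀ →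
      MKdV.IsReflectionlessPotential q₀ qm qp z w A q →
        qp = qm ∧ MKdV.IsAdmissible q₀ z w A ∧
        ∀ x t : ℝ, (MKdV.gMat q₀ qm z w A x t).det ≠ 0 ∧
          (q x t : ℂ) = qm + (MKdV.borderedMat q₀ qm z w A x t).det /
            (MKdV.gMat q₀ qm z w A x t).det * Complex.I) ∧
    (∀ (a : Fin N₁ → ℂ) (c : Fin N₂ → ℝ), (∀ n, a n ≠ 0) → (∀ m, c m ≠ 0) →
      ∃ (A : ℂ → ℂ) (q : ℝ → ℝ → ℝ),
        (∀ n, A (z n) = a n) ∧ (∀ m, A (Complex.I * (w m : ℂ)) = Complex.I * (c m : ℂ)) ∧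
        MKdV.IsAdmissible q₀ z w A ∧
        (∀ x t : ℝ, (MKdV.gMat q₀ qm z w A x t).det ≠ 0 ∧
          (q x t : ℂ) = qm + (MKdV.borderedMat q₀ qm z w A x t).det /
            (MKdV.gMat q₀ qm z w A x t).det * Complex.I) ∧
        MKdV.IsReflectionlessPotential q₀ qm qm z w A q) := by
  have hP := MKdV.poleSys_eta hq₀ hqm hz hw hzre hzim hznorm hwq
  refine ⟨fun qp A q hqp h => ?_, fun a c ha hc => ?_⟩
  · exact MKdV.reflectionless_unique hP hqp h
  · obtain ⟨A, h1, h2, hA⟩ := MKdV.exists_admissible hP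
      (fun n h => by simpa [h] using hzre n) (fun m => (hq₀.trans (hwq m)).ne') ha hc
    exact ⟨A, (MKdV.ratData hP hA).q, h1, h2, hA, fun x t =>
      ⟨MKdV.det_gMat_ne_zero hP hA x t, MKdV.determinant_formula_ratData hP hA x t⟩,
      MKdV.isReflectionlessPotential_ratData hP hA hzre hzim hwq⟩
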